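/- All manifolds are smooth, finite dimensional, Hausdorff and second countable; vector bundles are real and smooth. \textbf{Setting.} Let $(W,E;A,M)$ be a VB-algebroid: a double vector bundle with rows $W\to E$, $p:A\to M$ and columns $q_W:W\to A$, $q:E\to M$, whose rows are Lie algebroids with anchors $\tilde\rho:W\to TE$ and $\rho:A\to TM$, such that $(q_W,q)$ is a morphism of Lie algebroids, $(\tilde\rho,\rho)$ is a morphism of vector bundles from $W\to A$ to $TE\to TM$, and the bracket of $\Gamma(W,E)$ (sections of $W\to E$) satisfies $[\Gamma_\ell,\Gamma_\ell]\subset\Gamma_\ell$, $[\Gamma_\ell,\Gamma_c]\subset\Gamma_c$, $[\Gamma_c,\Gamma_c]=0$. Here $\Gamma_\ell$ is the space of linear sections (those that are vector bundle morphisms from $E\to M$ to $W\to A$ over some section of $A$), and $\Gamma_c$ is the space of core sections $\widehat\chi_e=0_{W,E}(e)+_{W,A}\chi_{q(e)}$ with $\chi\in\Gamma(C)$, where $C=\ker(W\to E)\cap\ker(W\to A)\to M$ is the core. \textbf{Derivations.} A derivation $\Delta$ of a vector bundle $V\to N$ is an $\mathbb R$-linear operator on $\Gamma(V)$ together with a vector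 field $\sigma(\Delta)$ on $N$, its symbol, such that $\Delta(fs)=\sigma(\Delta)(f)\,s+f\Delta s$ (if $V$ has positive rank, the symbol is determined by the operator). It corresponds to the linear vector field $X_\Delta$ on $V$ that projects to $\sigma(\Delta)$ and satisfies $\langle\varphi,\Delta s\rangle=\sigma(\Delta)\langle\varphi,s\rangle-\langle X_\Delta(\varphi),s\rangle$ for all $\varphi\in\Gamma(V^*)$, regarded also as fibrewise linear functions on $V$, and all $s\in\Gamma(V)$. A vector field $X$ on $W$ is an \emph{infinitesimal automorphism} of $(W,E;A,M)$ if its (local) flow consists of VB-algebroid automorphisms, i.e. each flow map $\phi_t$ is an isomorphism between the restrictions of $(W,E;A,M)$ to open subsets of $M$. A derivation of $W\to A$ is an \emph{IM derivation} if the corresponding linear vector field on $W$ is an infinitesimal automorphism of $(W,E;A,M)$. \textbf{Fat algebroid, core-anchor and representations.} The fat algebroid $\widehat A\to M$ is the Lie algebroid with $\Gamma(\widehat A)=\Gamma_\ell$, with the restricted bracket and the anchor $\rho\circ\pi$, where $\pi:\widehat A\to A$ is the projection. It contains $\mathrm{Hom}(E,C)$: $\Phi$ is identified with the linear section $e\mapsto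 0_{W,E}(e)+_{W,A}\Phi(e)$. The core-anchor $\alpha:C\to E$, the side representation $\psi^s$ of $\widehat A$ on $E$ and the core representation $\psi^c$ of $\widehat A$ on $C$ are given by $$q^*\langle\varphi,\alpha\chi\rangle=\tilde\rho(\widehat\chi)(\varphi),\qquad \langle\varphi,\psi^s_{\tilde a}e\rangle=\rho(\pi\tilde a)\langle\varphi,e\rangle-\langle\tilde\rho(\tilde a)(\varphi),e\rangle,\qquad \widehat{\psi^c_{\tilde a}\chi}=[\tilde a,\widehat\chi]$$ for all $\varphi\in\Gamma(E^*)$ (regarded also as fibrewise linear functions on $E$), $e\in\Gamma(E)$, $\chi\in\Gamma(C)$ and $\tilde a\in\Gamma(\widehat A)$. \textbf{Theorem.} For every VB-algebroid $(W,E;A,M)$ there are one-to-one correspondences between (1) infinitesimal automorphisms $X_W$ of $(W,E;A,M)$; (2) IM derivations of $W\to A$; (3) triples $(\delta_{\widehat A},\delta_E,\delta_C)$ consisting of a derivation $\delta_{\widehat A}$ of the Lie algebroid $\widehat A$ (a derivation of the vector bundle $\widehat A$ with $\delta_{\widehat A}[\tilde a,\tilde b]=[\delta_{\widehat A}\tilde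 a,\tilde b]+[\tilde a,\delta_{\widehat A}\tilde b]$), a derivation $\delta_E$ of $E$ and a derivation $\delta_C$ of $C$, such that $$\sigma(\delta_{\widehat A})=\sigma(\delta_E)=\sigma(\delta_C),\qquad \delta_{\widehat A}(\Phi)=\delta_C\circ\Phi-\Phi\circ\delta_E,\qquad \alpha\circ\delta_C=\delta_E\circ\alpha,$$ $$[\delta_E,\psi^s_{\tilde a}]=\psi^s_{\delta_{\widehat A}\tilde a},\qquad [\delta_C,\psi^c_{\tilde a}]=\psi^c_{\delta_{\widehat A}\tilde a}$$ for all vector bundle morphisms $\Phi:E\to C$ over the identity of $M$ and all $\tilde a\in\Gamma(\widehat A)$. The bijection from (1) to (2) maps $X_W$ to the corresponding derivation of $W\to A$. The bijection from (1) to (3) is given as follows: if $\Delta_{W,E}$ is the derivation of $W\to E$ corresponding to $X_W$, then $\delta_{\widehat A}\tilde a=\Delta_{W,E}\tilde a$ for $\tilde a\in\Gamma_\ell$, $\widehat{\delta_C\chi}=\Delta_{W,E}\widehat\chi$ for $\chi\in\Gamma(C)$, and $\delta_E$ is the derivation of $E$ corresponding to the projection of $X_W$ to $E$, which is the symbol of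 $\Delta_{W,E}$. -/

import Mathlib

open Set
open scoped Manifold ContDiff Topology

noncomputable section

/-! ### Vector fields on manifolds and their flows -/

section VectorFields

variable (VN : Type*) [NormedAddCommGroup VN] [NormedSpace ℝ VN]
  (N : Type*) [TopologicalSpace N] [ChartedSpace VN N] [IsManifold 𝓘(ℝ, VN) ∞ N]

/-- Smooth real functions on `N`. -/
abbrev SmoothFun := C^∞⟮𝓘(ℝ, VN), N; ℝ⟯

/-- Smooth vector fields on `N`. -/
abbrev VField := ContMDiffSection 𝓘(ℝ, VN) VN ∞ (TangentSpace 𝓘(ℝ, VN) : N → Type _)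

variable {VN N}

/-- The derivative `X(f)` of a smooth function along a smooth vector field. -/
def VField.deriv (X : VField VN N) (f : SmoothFun VN N) : SmoothFun VN N :=
  ⟨fun x => mfderiv 𝓘(ℝ, VN) 𝓘(ℝ, ℝ) f x (X x), by
    have h1 : ContMDiff 𝓘(ℝ, VN) 𝓘(ℝ, VN).tangent ∞
        (fun x => (⟨x, X x⟩ : TangentBundle 𝓘(ℝ, VN) N)) := X.contMDiff
    have h2 := (f.contMDiff.contMDiff_tangentMap (m := ∞) (by simp)).comp h1
    exact (contMDiff_snd_tangentBundle_modelSpace ℝ 𝓘(ℝ, ℝ)).comp h2⟩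

/-- `X.FlowsTo t x y`: the integral curve of `X` starting at `x` is defined up to time `t`
and is at `y` at time `t`, i.e. `x` lies in the domain of the time `t` flow `φ_t` of `X` and
`φ_t x = y`. -/
def VField.FlowsTo (X : VField VN N) (t : ℝ) (x y : N) : Prop :=
  ∃ (γ : ℝ → N) (a b : ℝ), (0 : ℝ) ∈ Ioo a b ∧ t ∈ Ioo a b ∧
    IsMIntegralCurveOn (I := 𝓘(ℝ, VN)) γ (fun z => X z) (Ioo a b) ∧ γ 0 = x ∧ γ t = y

end VectorFields

/-! ### Smooth vector bundles -/

section VectorBundles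

/-- A smooth real vector bundle structure `V → N` on the manifold `V`.  (A total space of a double
vector bundle carries two such structures, so the total space is kept as a plain manifold.)
`add v w` is meaningful only for `v`, `w` in the same fibre. -/
structure VBundle (VV : Type*) [NormedAddCommGroup VV] [NormedSpace ℝ VV]
    (V : Type*) [TopologicalSpace V] [ChartedSpace VV V]
    (VN : Type*) [NormedAddCommGroup VN] [NormedSpace ℝ VN]
    (N : Type*) [TopologicalSpace N] [ChartedSpace VN N] where
  proj : V → N
  zero : N → V
  add : V → V → V
  smul : ℝ → V → V
  rank : ℕ
  proj_zero : ∀ x, proj (zero x) = x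
  proj_add : ∀ v w, proj v = proj w → proj (add v w) = proj v
  proj_smul : ∀ r v, proj (smul r v) = proj v
  /-- Around every point there is a smooth fibrewise linear local trivialization. -/
  locallyTrivial : ∀ x : N, ∃ (U : Set N)
    (e : OpenPartialHomeomorph V (N × EuclideanSpace ℝ (Fin rank))),
    IsOpen U ∧ x ∈ U ∧ e.source = proj ⁻¹' U ∧ e.target = U ×ˢ univ ∧
    ContMDiffOn 𝓘(ℝ, VV) (𝓘(ℝ, VN).prod 𝓘(ℝ, EuclideanSpace ℝ (Fin rank))) ∞ e e.source ∧
    ContMDiffOn (𝓘(ℝ, VN).prod 𝓘(ℝ, EuclideanSpace ℝ (Fin rank))) 𝓘(ℝ, VV) ∞ e.symm e.target ∧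
    (∀ v, proj v ∈ U → (e v).1 = proj v) ∧
    (∀ y ∈ U, (e (zero y)).2 = 0) ∧
    (∀ v w, proj v ∈ U → proj v = proj w → (e (add v w)).2 = (e v).2 + (e w).2) ∧
    (∀ r v, proj v ∈ U → (e (smul r v)).2 = r • (e v).2)

variable {VV : Type*} [NormedAddCommGroup VV] [NormedSpace ℝ VV]
  {V : Type*} [TopologicalSpace V] [ChartedSpace VV V]
  {VN : Type*} [NormedAddCommGroup VN] [NormedSpace ℝ VN]
  {N : Type*} [TopologicalSpace N] [ChartedSpace VN N]
  {VX : Type*} [NormedAddCommGroup VX] [NormedSpace ℝ VX]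
  {X : Type*} [TopologicalSpace X] [ChartedSpace VX X]

namespace VBundle

variable (B : VBundle VV V VN N)

/-- Two points of one fibre agree as soon as their coordinates in some chosen linear fibre
coordinate (available on that fibre) agree. -/
lemma exists_fibreCoord (x : N) : ∃ c : V → EuclideanSpace ℝ (Fin B.rank),
    (∀ v w, B.proj v = x → B.proj w = x → c v = c w → v = w) ∧ c (B.zero x) = 0 ∧
    (∀ v w, B.proj v = x → B.proj w = x → c (B.add v w) = c v + c w) ∧
    (∀ r v, B.proj v = x → c (B.smul r v) = r • c v) := by
  obtain ⟨U, e, -, hx, hs, -, -, -, h1, h0, ha, hm⟩ := B.locallyTrivial x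
  refine ⟨fun v => (e v).2, ?_, h0 x hx, ?_, ?_⟩
  · intro v w hv hw h
    have hvU : B.proj v ∈ U := hv ▸ hx
    have hwU : B.proj w ∈ U := hw ▸ hx
    apply e.injOn (by rw [hs]; exact hvU) (by rw [hs]; exact hwU)
    exact Prod.ext (by rw [h1 v hvU, h1 w hwU, hv, hw]) h
  · intro v w hv hw
    exact ha v w (hv ▸ hx) (hv.trans hw.symm)
  · intro r v hv
    exact hm r v (hv ▸ hx)

lemma zero_smul' (v : V) : B.smul 0 v = B.zero (B.proj v) := by
  obtain ⟨c, hi, h0, -, hm⟩ := B.exists_fibreCoord (B.proj v)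
  exact hi _ _ (B.proj_smul _ _) (B.proj_zero _) (by rw [hm _ _ rfl, h0, zero_smul])

lemma smul_zero' (r : ℝ) (x : N) : B.smul r (B.zero x) = B.zero x := by
  obtain ⟨c, hi, h0, -, hm⟩ := B.exists_fibreCoord x
  have hx := B.proj_zero x
  exact hi _ _ ((B.proj_smul _ _).trans hx) hx (by rw [hm _ _ hx, h0, smul_zero])

lemma add_zero' (v : V) : B.add v (B.zero (B.proj v)) = v := by
  obtain ⟨c, hi, h0, ha, -⟩ := B.exists_fibreCoord (B.proj v)
  have hz := B.proj_zero (B.proj v)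
  exact hi _ _ (B.proj_add _ _ hz.symm) rfl (by rw [ha _ _ rfl hz, h0, add_zero])

lemma contMDiff_proj : ContMDiff 𝓘(ℝ, VV) 𝓘(ℝ, VN) ∞ B.proj := by
  intro v
  obtain ⟨U, e, hU, hx, hs, -, hsm, -, h1, -⟩ := B.locallyTrivial (B.proj v)
  have hv : v ∈ e.source := by rw [hs]; exact hx
  have hn : e.source ∈ 𝓝 v := e.open_source.mem_nhds hv
  have h := contMDiffAt_fst.comp v (hsm.contMDiffAt hn)
  refine h.congr_of_eventuallyEq ?_
  filter_upwards [hn] with w hw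
  rw [hs] at hw
  exact (h1 w hw).symm

/-- A map into a vector bundle is smooth as soon as, near every point, its base point and its fibre
coordinate in a local trivialization are smooth. -/
lemma contMDiff_of_coord {g : X → V} {h : X → N}
    (hg : ∀ x, B.proj (g x) = h x) (hh : ContMDiff 𝓘(ℝ, VX) 𝓘(ℝ, VN) ∞ h)
    (key : ∀ x (U : Set N) (e : OpenPartialHomeomorph V (N × EuclideanSpace ℝ (Fin B.rank))),
      IsOpen U → h x ∈ U → e.source = B.proj ⁻¹' U →
      ContMDiffOn 𝓘(ℝ, VV) (𝓘(ℝ, VN).prod 𝓘(ℝ, EuclideanSpace ℝ (Fin B.rank))) ∞ e e.source →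
      (∀ y ∈ U, (e (B.zero y)).2 = 0) →
      (∀ v w, B.proj v ∈ U → B.proj v = B.proj w → (e (B.add v w)).2 = (e v).2 + (e w).2) →
      (∀ r v, B.proj v ∈ U → (e (B.smul r v)).2 = r • (e v).2) →
      ContMDiffAt 𝓘(ℝ, VX) 𝓘(ℝ, EuclideanSpace ℝ (Fin B.rank)) ∞ (fun y => (e (g y)).2) x) :
    ContMDiff 𝓘(ℝ, VX) 𝓘(ℝ, VV) ∞ g := by
  intro x
  obtain ⟨U, e, hU, hx, hs, ht, hsm, hsy, h1, h0, ha, hm⟩ := B.locallyTrivial (h x)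
  have hk := key x U e hU hx hs hsm h0 ha hm
  have hgx : e (g x) ∈ e.target := e.map_source (by rw [hs]; show B.proj (g x) ∈ U; rwa [hg])
  have hpair : ContMDiffAt 𝓘(ℝ, VX) (𝓘(ℝ, VN).prod 𝓘(ℝ, EuclideanSpace ℝ (Fin B.rank))) ∞
      (fun y => (h y, (e (g y)).2)) x := (hh x).prodMk hk
  have hpt : (h x, (e (g x)).2) = e (g x) :=
    Prod.ext (by rw [h1 (g x) (by rwa [hg]), hg]) rfl
  have hsx : ContMDiffAt (𝓘(ℝ, VN).prod 𝓘(ℝ, EuclideanSpace ℝ (Fin B.rank))) 𝓘(ℝ, VV) ∞ e.symm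
      (h x, (e (g x)).2) :=
    hsy.contMDiffAt (by rw [hpt]; exact e.open_target.mem_nhds hgx)
  refine (hsx.comp x hpair).congr_of_eventuallyEq ?_
  filter_upwards [hh.continuous.continuousAt.preimage_mem_nhds (hU.mem_nhds hx)] with y hy
  have hyU : B.proj (g y) ∈ U := by rw [hg]; exact hy
  have : (h y, (e (g y)).2) = e (g y) := Prod.ext (by rw [h1 (g y) hyU, hg]) rfl
  show g y = e.symm (h y, (e (g y)).2)
  rw [this, e.left_inv (by rw [hs]; exact hyU)]

lemma contMDiffAt_coord {g : X → V} {h : X → N} {x : X} {U : Set N}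
    {e : OpenPartialHomeomorph V (N × EuclideanSpace ℝ (Fin B.rank))}
    (hg : ∀ x, B.proj (g x) = h x) (hgs : ContMDiff 𝓘(ℝ, VX) 𝓘(ℝ, VV) ∞ g) (hx : h x ∈ U)
    (hs : e.source = B.proj ⁻¹' U)
    (hsm : ContMDiffOn 𝓘(ℝ, VV) (𝓘(ℝ, VN).prod 𝓘(ℝ, EuclideanSpace ℝ (Fin B.rank))) ∞
      e e.source) :
    ContMDiffAt 𝓘(ℝ, VX) 𝓘(ℝ, EuclideanSpace ℝ (Fin B.rank)) ∞ (fun y => (e (g y)).2) x := by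
  have hgx : g x ∈ e.source := by rw [hs]; show B.proj (g x) ∈ U; rwa [hg]
  exact contMDiffAt_snd.comp x
    ((hsm.contMDiffAt (e.open_source.mem_nhds hgx)).comp x (hgs x))

lemma contMDiff_zero_comp {h : X → N} (hh : ContMDiff 𝓘(ℝ, VX) 𝓘(ℝ, VN) ∞ h) :
    ContMDiff 𝓘(ℝ, VX) 𝓘(ℝ, VV) ∞ (fun x => B.zero (h x)) := by
  refine B.contMDiff_of_coord (h := h) (fun x => B.proj_zero _) hh ?_
  intro x U e hU hx _ _ h0 _ _
  refine (contMDiffAt_const (c := (0 : EuclideanSpace ℝ (Fin B.rank)))).congr_of_eventuallyEq ?_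
  filter_upwards [hh.continuous.continuousAt.preimage_mem_nhds (hU.mem_nhds hx)] with y hy
  exact h0 _ hy

lemma contMDiff_add_comp {f g : X → V} (hf : ContMDiff 𝓘(ℝ, VX) 𝓘(ℝ, VV) ∞ f)
    (hg : ContMDiff 𝓘(ℝ, VX) 𝓘(ℝ, VV) ∞ g) (hfg : ∀ x, B.proj (f x) = B.proj (g x)) :
    ContMDiff 𝓘(ℝ, VX) 𝓘(ℝ, VV) ∞ (fun x => B.add (f x) (g x)) := by
  have hh : ContMDiff 𝓘(ℝ, VX) 𝓘(ℝ, VN) ∞ (fun x => B.proj (f x)) := B.contMDiff_proj.comp hf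
  refine B.contMDiff_of_coord (h := fun x => B.proj (f x))
    (fun x => B.proj_add _ _ (hfg x)) hh ?_
  intro x U e hU hx hs hsm _ ha _
  have h1 := B.contMDiffAt_coord (fun _ => rfl) hf hx hs hsm
  have h2 := B.contMDiffAt_coord (h := fun x => B.proj (f x))
    (fun x => (hfg x).symm) hg hx hs hsm
  refine (h1.add h2).congr_of_eventuallyEq ?_
  filter_upwards [hh.continuous.continuousAt.preimage_mem_nhds (hU.mem_nhds hx)] with y hy
  exact ha _ _ hy (hfg y)

lemma contMDiff_smul_comp {r : X → ℝ} {g : X → V} (hr : ContMDiff 𝓘(ℝ, VX) 𝓘(ℝ, ℝ) ∞ r)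
    (hg : ContMDiff 𝓘(ℝ, VX) 𝓘(ℝ, VV) ∞ g) :
    ContMDiff 𝓘(ℝ, VX) 𝓘(ℝ, VV) ∞ (fun x => B.smul (r x) (g x)) := by
  have hh : ContMDiff 𝓘(ℝ, VX) 𝓘(ℝ, VN) ∞ (fun x => B.proj (g x)) := B.contMDiff_proj.comp hg
  refine B.contMDiff_of_coord (h := fun x => B.proj (g x)) (fun x => B.proj_smul _ _) hh ?_
  intro x U e hU hx hs hsm _ _ hm
  have h2 := B.contMDiffAt_coord (fun _ => rfl) hg hx hs hsm
  refine ((hr x).smul h2).congr_of_eventuallyEq ?_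
  filter_upwards [hh.continuous.continuousAt.preimage_mem_nhds (hU.mem_nhds hx)] with y hy
  exact hm _ _ hy

/-- Smooth sections of `V → N` along a smooth map `h : X → N`, i.e. smooth sections of the pull-back
bundle `h^* V → X`. -/
structure SecAlong (h : C^∞⟮𝓘(ℝ, VX), X; 𝓘(ℝ, VN), N⟯) where
  toFun : X → V
  contMDiff' : ContMDiff 𝓘(ℝ, VX) 𝓘(ℝ, VV) ∞ toFun
  proj' : ∀ x, B.proj (toFun x) = h x

/-- The smooth sections `Γ(V)` of the vector bundle `V → N`. -/
abbrev Sec := B.SecAlong (ContMDiffMap.id : C^∞⟮𝓘(ℝ, VN), N; 𝓘(ℝ, VN), N⟯)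

namespace SecAlong

variable {B} {h : C^∞⟮𝓘(ℝ, VX), X; 𝓘(ℝ, VN), N⟯}

instance : CoeFun (B.SecAlong h) (fun _ => X → V) := ⟨SecAlong.toFun⟩

lemma contMDiff (s : B.SecAlong h) : ContMDiff 𝓘(ℝ, VX) 𝓘(ℝ, VV) ∞ s := s.contMDiff'

lemma proj_apply (s : B.SecAlong h) (x : X) : B.proj (s x) = h x := s.proj' x

@[ext] lemma ext {s t : B.SecAlong h} (hst : ∀ x, s x = t x) : s = t := by
  cases s; cases t; congr; exact funext hst

instance : Zero (B.SecAlong h) :=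
  ⟨⟨fun x => B.zero (h x), B.contMDiff_zero_comp h.contMDiff, fun _ => B.proj_zero _⟩⟩

instance : Add (B.SecAlong h) :=
  ⟨fun s t => ⟨fun x => B.add (s x) (t x),
    B.contMDiff_add_comp s.contMDiff t.contMDiff
      (fun x => (s.proj_apply x).trans (t.proj_apply x).symm),
    fun x => (B.proj_add _ _ ((s.proj_apply x).trans (t.proj_apply x).symm)).trans
      (s.proj_apply x)⟩⟩

instance : SMul (SmoothFun VX X) (B.SecAlong h) :=
  ⟨fun f s => ⟨fun x => B.smul (f x) (s x), B.contMDiff_smul_comp f.contMDiff s.contMDiff,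
    fun x => (B.proj_smul _ _).trans (s.proj_apply x)⟩⟩

instance : Neg (B.SecAlong h) := ⟨fun s => (-1 : SmoothFun VX X) • s⟩

lemma zero_apply (x : X) : (0 : B.SecAlong h) x = B.zero (h x) := rfl
lemma add_apply (s t : B.SecAlong h) (x : X) : (s + t) x = B.add (s x) (t x) := rfl
lemma smul_apply (f : SmoothFun VX X) (s : B.SecAlong h) (x : X) :
    (f • s) x = B.smul (f x) (s x) := rfl

/-- Identities between sections can be checked in linear fibre coordinates. -/
lemma ext_coord {s t : B.SecAlong h}
    (key : ∀ x (c : V → EuclideanSpace ℝ (Fin B.rank)), c ((0 : B.SecAlong h) x) = 0 →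
      (∀ s t : B.SecAlong h, c ((s + t) x) = c (s x) + c (t x)) →
      (∀ (f : SmoothFun VX X) (s : B.SecAlong h), c ((f • s) x) = f x • c (s x)) →
      c (s x) = c (t x)) : s = t := by
  ext x
  obtain ⟨c, hi, h0, ha, hm⟩ := B.exists_fibreCoord (h x)
  exact hi _ _ (s.proj_apply x) (t.proj_apply x)
    (key x c h0 (fun s t => ha _ _ (s.proj_apply x) (t.proj_apply x))
      (fun f s => hm _ _ (s.proj_apply x)))

instance : AddCommGroup (B.SecAlong h) where
  add_assoc s t u := ext_coord fun x c h0 ha hm => by simp only [ha, add_assoc]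
  zero_add s := ext_coord fun x c h0 ha hm => by simp only [ha, h0, zero_add]
  add_zero s := ext_coord fun x c h0 ha hm => by simp only [ha, h0, add_zero]
  add_comm s t := ext_coord fun x c h0 ha hm => by simp only [ha, add_comm]
  neg_add_cancel s := ext_coord fun x c h0 ha hm => by
    have : c ((-s) x) = (-1 : SmoothFun VX X) x • c (s x) := hm _ _
    rw [ha, this, h0]
    have h1 : (-1 : SmoothFun VX X) x = -1 := rfl
    rw [h1]; simp
  nsmul := nsmulRec
  zsmul := zsmulRec

/-- Sections form a module over the smooth functions. -/
instance : Module (SmoothFun VX X) (B.SecAlong h) where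
  one_smul s := ext_coord fun x c h0 ha hm => by
    rw [hm]; exact one_smul ℝ _
  mul_smul f g s := ext_coord fun x c h0 ha hm => by
    rw [hm, hm, hm]; exact mul_smul (f x) (g x) _
  smul_zero f := ext_coord fun x c h0 ha hm => by rw [hm, h0, smul_zero]
  smul_add f s t := ext_coord fun x c h0 ha hm => by rw [hm, ha, ha, hm, hm, smul_add]
  add_smul f g s := ext_coord fun x c h0 ha hm => by
    rw [hm, ha, hm, hm]; exact add_smul (f x) (g x) _
  zero_smul s := ext_coord fun x c h0 ha hm => by
    rw [hm, h0]; exact zero_smul ℝ _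

end SecAlong

/-- Fibrewise linear smooth functions on `V`, i.e. smooth sections of the dual bundle. -/
def IsFibreLinear (φ : SmoothFun VV V) : Prop :=
  (∀ v w, B.proj v = B.proj w → φ (B.add v w) = φ v + φ w) ∧ ∀ r v, φ (B.smul r v) = r * φ v

/-- `(F, f)` is a morphism of vector bundles from the restriction of `V → N` to the open set `S`
to the vector bundle `V' → N'`. -/
structure IsMorphismOn {VV' : Type*} [NormedAddCommGroup VV'] [NormedSpace ℝ VV']
    {V' : Type*} [TopologicalSpace V'] [ChartedSpace VV' V']
    {VN' : Type*} [NormedAddCommGroup VN'] [NormedSpace ℝ VN']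
    {N' : Type*} [TopologicalSpace N'] [ChartedSpace VN' N']
    (B' : VBundle VV' V' VN' N') (S : Set N) (F : V → V') (f : N → N') : Prop where
  smooth_total : ContMDiffOn 𝓘(ℝ, VV) 𝓘(ℝ, VV') ∞ F (B.proj ⁻¹' S)
  smooth_base : ContMDiffOn 𝓘(ℝ, VN) 𝓘(ℝ, VN') ∞ f S
  proj : ∀ v, B.proj v ∈ S → B'.proj (F v) = f (B.proj v)
  map_add : ∀ v w, B.proj v ∈ S → B.proj v = B.proj w → F (B.add v w) = B'.add (F v) (F w)
  map_smul : ∀ r v, B.proj v ∈ S → F (B.smul r v) = B'.smul r (F v)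

end VBundle

/-! ### Derivations -/

/-- A derivation with base `N` of a `C^∞(N)`-module of sections `Γ`: an `ℝ`-linear operator
satisfying the Leibniz rule for some vector field, its symbol.  The symbol is determined by the
operator if the bundle has positive rank; recording it makes derivations of a rank zero bundle the
sections of its gauge algebroid `TN`. -/
structure Der (VN : Type*) [NormedAddCommGroup VN] [NormedSpace ℝ VN]
    (N : Type*) [TopologicalSpace N] [ChartedSpace VN N] [IsManifold 𝓘(ℝ, VN) ∞ N]
    (Γ : Type*) [AddCommGroup Γ] [Module (SmoothFun VN N) Γ] where
  toFun : Γ → Γ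
  symbol : VField VN N
  map_add : ∀ s t, toFun (s + t) = toFun s + toFun t
  map_const_smul : ∀ (r : ℝ) s,
    toFun (algebraMap ℝ (SmoothFun VN N) r • s) = algebraMap ℝ (SmoothFun VN N) r • toFun s
  leibniz : ∀ (f : SmoothFun VN N) s, toFun (f • s) = symbol.deriv f • s + f • toFun s

instance {VN : Type*} [NormedAddCommGroup VN] [NormedSpace ℝ VN]
    {N : Type*} [TopologicalSpace N] [ChartedSpace VN N] [IsManifold 𝓘(ℝ, VN) ∞ N]
    {Γ : Type*} [AddCommGroup Γ] [Module (SmoothFun VN N) Γ] :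
    CoeFun (Der VN N Γ) (fun _ => Γ → Γ) := ⟨Der.toFun⟩

namespace VBundle

variable [IsManifold 𝓘(ℝ, VV) ∞ V] [IsManifold 𝓘(ℝ, VN) ∞ N] (B : VBundle VV V VN N)

/-- The pairing `⟨φ, s⟩` of a smooth function on `V` (of interest for fibrewise linear ones) with a
section. -/
def pairing (φ : SmoothFun VV V) (s : B.Sec) : SmoothFun VN N :=
  ⟨fun x => φ (s x), φ.contMDiff.comp s.contMDiff⟩

/-- For a linear vector field `Z` on `V` over the vector field `Y` on `N`, this says that `t` is the
image of `s` under the associated derivation: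
`⟨φ, t⟩ = Y ⟨φ, s⟩ - ⟨Z φ, s⟩` for all fibrewise linear functions `φ`. -/
def IsDerivOf (Z : VField VV V) (Y : VField VN N) (s t : B.Sec) : Prop :=
  ∀ φ : SmoothFun VV V, B.IsFibreLinear φ → ∀ x : N,
    φ (t x) = Y.deriv (B.pairing φ s) x - Z.deriv φ (s x)

/-- The derivation `Δ` of `V → N` and the vector field `Z` on `V` correspond to each other:
`Z` is an infinitesimal automorphism of the vector bundle projecting to the symbol of `Δ`, and
`⟨φ, Δ s⟩ = σ(Δ) ⟨φ, s⟩ - ⟨Z φ, s⟩`. -/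
def Corresponds (Z : VField VV V) (Δ : Der VN N B.Sec) : Prop :=
  (∀ φ, B.IsFibreLinear φ → B.IsFibreLinear (Z.deriv φ)) ∧
  (∀ v, mfderiv 𝓘(ℝ, VV) 𝓘(ℝ, VN) B.proj v (Z v) = Δ.symbol (B.proj v)) ∧
  ∀ s, B.IsDerivOf Z Δ.symbol s (Δ s)

end VBundle

/-! ### Lie algebroids -/

/-- An anchor: a vector bundle morphism from `V → N` to the tangent bundle `TN → N` over the
identity.  The anchor of `v` is `anchor (proj v) v`; the value `anchor x v` is meaningful only for
`x = proj v`. -/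
structure AnchorMap [IsManifold 𝓘(ℝ, VN) ∞ N] (B : VBundle VV V VN N) where
  anchor : (x : N) → V → TangentSpace 𝓘(ℝ, VN) x
  anchor_smooth : ContMDiff 𝓘(ℝ, VV) 𝓘(ℝ, VN).tangent ∞
    (fun v => (⟨B.proj v, anchor (B.proj v) v⟩ : TangentBundle 𝓘(ℝ, VN) N))
  anchor_add : ∀ x v w, B.proj v = x → B.proj w = x →
    anchor x (B.add v w) = anchor x v + anchor x w
  anchor_smul : ∀ x r v, B.proj v = x → anchor x (B.smul r v) = r • anchor x v

/-- The vector field `ρ(s)` on `N` obtained from a section `s`. -/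
def AnchorMap.field [IsManifold 𝓘(ℝ, VN) ∞ N] {B : VBundle VV V VN N} (L : AnchorMap B)
    (s : B.Sec) : VField VN N :=
  ⟨fun x => L.anchor x (s x), by
    have h := L.anchor_smooth.comp s.contMDiff
    refine h.congr fun x => ?_
    have hx : B.proj (s x) = x := s.proj_apply x
    show (⟨x, L.anchor x (s x)⟩ : TangentBundle 𝓘(ℝ, VN) N) =
      ⟨B.proj (s x), L.anchor (B.proj (s x)) (s x)⟩
    rw [hx]⟩

/-- A Lie algebroid structure on the vector bundle `V → N`: an anchor and a Lie bracket on sections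
satisfying the Leibniz rule. -/
structure LieAlgebroid [IsManifold 𝓘(ℝ, VN) ∞ N] (B : VBundle VV V VN N) extends AnchorMap B where
  bracket : B.Sec → B.Sec → B.Sec
  bracket_add_left : ∀ s s' t, bracket (s + s') t = bracket s t + bracket s' t
  bracket_add_right : ∀ s t t', bracket s (t + t') = bracket s t + bracket s t'
  bracket_self : ∀ s, bracket s s = 0
  jacobi : ∀ s t u,
    bracket s (bracket t u) = bracket (bracket s t) u + bracket t (bracket s u)
  /-- The Leibniz rule; for constant `f` it gives the homogeneity of the bracket. -/
  leibniz : ∀ s (f : SmoothFun VN N) t,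
    bracket s (f • t) = (toAnchorMap.field s).deriv f • t + f • bracket s t
  anchor_bracket : ∀ s t x, toAnchorMap.field (bracket s t) x =
    VectorField.mlieBracket 𝓘(ℝ, VN) (toAnchorMap.field s) (toAnchorMap.field t) x

namespace LieAlgebroid

variable [IsManifold 𝓘(ℝ, VN) ∞ N] {B : VBundle VV V VN N} (L : LieAlgebroid B)

/-- `(F, f)` is a morphism of Lie algebroids from the restriction of `V → N` to the open set `S` to
`V → N`, for `f` a diffeomorphism from `S` onto an open set and `F` a fibrewise isomorphism: a
vector bundle morphism that intertwines the anchors and the brackets of (locally) related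
sections. -/
structure IsMorphismOn (S : Set N) (F : V → V) (f : N → N) : Prop where
  vb : B.IsMorphismOn B S F f
  anchor : ∀ v, B.proj v ∈ S →
    mfderiv 𝓘(ℝ, VN) 𝓘(ℝ, VN) f (B.proj v) (L.anchor (B.proj v) v) = L.anchor (f (B.proj v)) (F v)
  bracket : ∀ (O : Set N), IsOpen O → O ⊆ S → ∀ s₁ s₂ t₁ t₂ : B.Sec,
    (∀ x ∈ O, F (s₁ x) = t₁ (f x)) → (∀ x ∈ O, F (s₂ x) = t₂ (f x)) →
    ∀ x ∈ O, F (L.bracket s₁ s₂ x) = L.bracket t₁ t₂ (f x)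

end LieAlgebroid

end VectorBundles

/-! ### Double vector bundles -/

section Double

/-- A double vector bundle `(W, E; A, M)`: the sides are vector bundles `W → E`, `A → M` (rows) and
`W → A`, `E → M` (columns), and the projection and the structure maps of the columns are vector
bundle morphisms for the rows. -/
structure DoubleVB (VW : Type*) [NormedAddCommGroup VW] [NormedSpace ℝ VW]
    (W : Type*) [TopologicalSpace W] [ChartedSpace VW W]
    (VE : Type*) [NormedAddCommGroup VE] [NormedSpace ℝ VE]
    (E : Type*) [TopologicalSpace E] [ChartedSpace VE E]
    (VA : Type*) [NormedAddCommGroup VA] [NormedSpace ℝ VA]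
    (A : Type*) [TopologicalSpace A] [ChartedSpace VA A]
    (VM : Type*) [NormedAddCommGroup VM] [NormedSpace ℝ VM]
    (M : Type*) [TopologicalSpace M] [ChartedSpace VM M] where
  overE : VBundle VW W VE E
  overA : VBundle VW W VA A
  bE : VBundle VE E VM M
  bA : VBundle VA A VM M
  /-- The projection `W → A` is a vector bundle morphism over `E → M`. -/
  projA_morphism : overE.IsMorphismOn bA univ overA.proj bE.proj
  /-- The projection `W → E` is a vector bundle morphism over `A → M`. -/
  projE_morphism : overA.IsMorphismOn bE univ overE.proj bA.proj
  /-- The two additions of `W` satisfy the interchange law. -/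
  interchange : ∀ w₁ w₂ w₃ w₄, overE.proj w₁ = overE.proj w₂ → overE.proj w₃ = overE.proj w₄ →
    overA.proj w₁ = overA.proj w₃ → overA.proj w₂ = overA.proj w₄ →
    overA.add (overE.add w₁ w₂) (overE.add w₃ w₄) = overE.add (overA.add w₁ w₃) (overA.add w₂ w₄)
  smulE_addA : ∀ r w w', overA.proj w = overA.proj w' →
    overE.smul r (overA.add w w') = overA.add (overE.smul r w) (overE.smul r w')
  smulA_addE : ∀ r w w', overE.proj w = overE.proj w' →
    overA.smul r (overE.add w w') = overE.add (overA.smul r w) (overA.smul r w')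
  smul_comm : ∀ r r' w, overE.smul r (overA.smul r' w) = overA.smul r' (overE.smul r w)

variable {VW : Type*} [NormedAddCommGroup VW] [NormedSpace ℝ VW]
  {W : Type*} [TopologicalSpace W] [ChartedSpace VW W]
  {VE : Type*} [NormedAddCommGroup VE] [NormedSpace ℝ VE]
  {E : Type*} [TopologicalSpace E] [ChartedSpace VE E]
  {VA : Type*} [NormedAddCommGroup VA] [NormedSpace ℝ VA]
  {A : Type*} [TopologicalSpace A] [ChartedSpace VA A]
  {VM : Type*} [NormedAddCommGroup VM] [NormedSpace ℝ VM]
  {M : Type*} [TopologicalSpace M] [ChartedSpace VM M]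

namespace DoubleVB

variable (D : DoubleVB VW W VE E VA A VM M)

/-- The projection `W → M`. -/
def base (w : W) : M := D.bE.proj (D.overE.proj w)

/-- The zero section `M → E`, as a smooth map. -/
def zeroE : C^∞⟮𝓘(ℝ, VM), M; 𝓘(ℝ, VE), E⟯ :=
  ⟨D.bE.zero, D.bE.contMDiff_zero_comp contMDiff_id⟩

/-- The zero vector of `W → E` over `e` projects to a zero vector of `A`. -/
lemma projA_zeroE (e : E) : D.overA.proj (D.overE.zero e) = D.bA.zero (D.bE.proj e) := by
  have hz := D.overE.smul_zero' 0 e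
  rw [← hz, D.projA_morphism.map_smul _ _ (mem_univ _), D.bA.zero_smul',
    D.projA_morphism.proj _ (mem_univ _), D.overE.proj_zero]

/-- The sections `Γ(C)` of the core `C = ker (W → E) ∩ ker (W → A)`: smooth maps `χ : M → W` with
`χ x` projecting to the zero vectors of `E` and of `A` over `x`.  (On the core the operations of
`W → E` and of `W → A` agree.) -/
def CoreSec : Submodule (SmoothFun VM M) (D.overE.SecAlong D.zeroE) where
  carrier := {χ | ∀ x, D.overA.proj (χ x) = D.bA.zero x}
  zero_mem' := by
    intro x
    show D.overA.proj (D.overE.zero (D.bE.zero x)) = D.bA.zero x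
    rw [D.projA_zeroE, D.bE.proj_zero]
  add_mem' := by
    intro s t hs ht x
    show D.overA.proj (D.overE.add (s x) (t x)) = D.bA.zero x
    rw [D.projA_morphism.map_add _ _ (mem_univ _)
      ((s.proj_apply x).trans (t.proj_apply x).symm), hs x, ht x]
    have h := D.bA.add_zero' (D.bA.zero x)
    rwa [D.bA.proj_zero] at h
  smul_mem' := by
    intro f s hs x
    show D.overA.proj (D.overE.smul (f x) (s x)) = D.bA.zero x
    rw [D.projA_morphism.map_smul _ _ (mem_univ _), hs x, D.bA.smul_zero']

/-- The section `e ↦ 0_{W,E}(e) +_{W,A} k(e)` of `W → E` attached to a smooth map `k` from `E` to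
the core over the identity of `M`. -/
def shift (k : E → W) (hk : ContMDiff 𝓘(ℝ, VE) 𝓘(ℝ, VW) ∞ k)
    (hkE : ∀ e, D.overE.proj (k e) = D.bE.zero (D.bE.proj e))
    (hkA : ∀ e, D.overA.proj (k e) = D.bA.zero (D.bE.proj e)) : D.overE.Sec where
  toFun e := D.overA.add (D.overE.zero e) (k e)
  contMDiff' := D.overA.contMDiff_add_comp (D.overE.contMDiff_zero_comp contMDiff_id) hk
    (fun e => (D.projA_zeroE e).trans (hkA e).symm)
  proj' := by
    intro e
    rw [D.projE_morphism.map_add _ _ (mem_univ _) ((D.projA_zeroE e).trans (hkA e).symm), hkE,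
      D.overE.proj_zero]
    exact D.bE.add_zero' e

/-- The core section `χ̂ = (e ↦ 0_{W,E}(e) +_{W,A} χ(q e))` of `W → E` given by `χ ∈ Γ(C)`. -/
def hat (χ : D.CoreSec) : D.overE.Sec :=
  D.shift (fun e => χ.1 (D.bE.proj e)) (χ.1.contMDiff.comp D.bE.contMDiff_proj)
    (fun _ => χ.1.proj_apply _) (fun _ => χ.2 _)

/-- The linear section `s` of `W → E` covers the section `a` of `A → M`: `(s, a)` is a vector bundle
morphism from `E → M` to `W → A`. -/
def IsLinearOver (s : D.overE.Sec) (a : D.bA.Sec) : Prop :=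
  D.bE.IsMorphismOn D.overA univ s a

variable {D}

lemma IsLinearOver.projA {s : D.overE.Sec} {a : D.bA.Sec} (h : D.IsLinearOver s a) (e : E) :
    D.overA.proj (s e) = a (D.bE.proj e) := h.proj e (mem_univ _)

lemma IsLinearOver.zero : D.IsLinearOver 0 0 where
  smooth_total := (0 : D.overE.Sec).contMDiff.contMDiffOn
  smooth_base := (0 : D.bA.Sec).contMDiff.contMDiffOn
  proj e _ := D.projA_zeroE e
  map_add e e' _ he := by
    show D.overE.zero (D.bE.add e e') = D.overA.add (D.overE.zero e) (D.overE.zero e')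
    have hA : D.overA.proj (D.overE.zero e) = D.overA.proj (D.overE.zero e') := by
      rw [D.projA_zeroE, D.projA_zeroE, he]
    have h := D.smulE_addA 0 _ _ hA
    rwa [D.overE.zero_smul', D.overE.smul_zero', D.overE.smul_zero',
      D.projE_morphism.map_add _ _ (mem_univ _) hA, D.overE.proj_zero, D.overE.proj_zero] at h
  map_smul r e _ := by
    show D.overE.zero (D.bE.smul r e) = D.overA.smul r (D.overE.zero e)
    have h := D.smul_comm 0 r (D.overE.zero e)
    rwa [D.overE.zero_smul', D.overE.smul_zero',
      D.projE_morphism.map_smul _ _ (mem_univ _), D.overE.proj_zero] at h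

lemma IsLinearOver.add {s t : D.overE.Sec} {a b : D.bA.Sec} (hs : D.IsLinearOver s a)
    (ht : D.IsLinearOver t b) : D.IsLinearOver (s + t) (a + b) where
  smooth_total := (s + t).contMDiff.contMDiffOn
  smooth_base := (a + b).contMDiff.contMDiffOn
  proj e _ := by
    show D.overA.proj (D.overE.add (s e) (t e)) =
      D.bA.add (a (D.bE.proj e)) (b (D.bE.proj e))
    rw [D.projA_morphism.map_add _ _ (mem_univ _)
      ((s.proj_apply e).trans (t.proj_apply e).symm), hs.projA, ht.projA]
  map_add e e' _ he := by
    show D.overE.add (s (D.bE.add e e')) (t (D.bE.add e e')) =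
      D.overA.add (D.overE.add (s e) (t e)) (D.overE.add (s e') (t e'))
    rw [hs.map_add _ _ (mem_univ _) he, ht.map_add _ _ (mem_univ _) he]
    refine (D.interchange _ _ _ _ ((s.proj_apply e).trans (t.proj_apply e).symm)
      ((s.proj_apply e').trans (t.proj_apply e').symm) ?_ ?_).symm
    · rw [hs.projA, hs.projA, he]
    · rw [ht.projA, ht.projA, he]
  map_smul r e _ := by
    show D.overE.add (s (D.bE.smul r e)) (t (D.bE.smul r e)) =
      D.overA.smul r (D.overE.add (s e) (t e))
    rw [hs.map_smul _ _ (mem_univ _), ht.map_smul _ _ (mem_univ _),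
      D.smulA_addE _ _ _ ((s.proj_apply e).trans (t.proj_apply e).symm)]

variable (D) in
/-- The pull-back `q^* f` of a function along `q : E → M`. -/
def pullE (f : SmoothFun VM M) : SmoothFun VE E :=
  ⟨fun e => f (D.bE.proj e), f.contMDiff.comp D.bE.contMDiff_proj⟩

lemma IsLinearOver.smul (f : SmoothFun VM M) {s : D.overE.Sec} {a : D.bA.Sec}
    (hs : D.IsLinearOver s a) : D.IsLinearOver (D.pullE f • s) (f • a) where
  smooth_total := (D.pullE f • s).contMDiff.contMDiffOn
  smooth_base := (f • a).contMDiff.contMDiffOn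
  proj e _ := by
    show D.overA.proj (D.overE.smul (f (D.bE.proj e)) (s e)) =
      D.bA.smul (f (D.bE.proj e)) (a (D.bE.proj e))
    rw [D.projA_morphism.map_smul _ _ (mem_univ _), hs.projA]
  map_add e e' _ he := by
    show D.overE.smul (f (D.bE.proj (D.bE.add e e'))) (s (D.bE.add e e')) =
      D.overA.add (D.overE.smul (f (D.bE.proj e)) (s e)) (D.overE.smul (f (D.bE.proj e')) (s e'))
    rw [D.bE.proj_add _ _ he, ← he, hs.map_add _ _ (mem_univ _) he]
    exact D.smulE_addA _ _ _ (by rw [hs.projA, hs.projA, he])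
  map_smul r e _ := by
    show D.overE.smul (f (D.bE.proj (D.bE.smul r e))) (s (D.bE.smul r e)) =
      D.overA.smul r (D.overE.smul (f (D.bE.proj e)) (s e))
    rw [D.bE.proj_smul, hs.map_smul _ _ (mem_univ _), D.smul_comm]

variable (D)

/-- The linear sections `Γ_ℓ(W, E)` of `W → E`.  This is the module `Γ(Â)` of sections of the vector
bundle `Â → M` whose fibre over `x` consists of the pairs of a point `a ∈ A_x` and a linear right
inverse `E_x → W_a` of `W_a → E_x`. -/
def LinSec : AddSubgroup D.overE.Sec where
  carrier := {s | ∃ a, D.IsLinearOver s a}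
  zero_mem' := ⟨0, IsLinearOver.zero⟩
  add_mem' := fun ⟨a, ha⟩ ⟨b, hb⟩ => ⟨a + b, ha.add hb⟩
  neg_mem' := fun ⟨a, ha⟩ => ⟨(-1 : SmoothFun VM M) • a, ha.smul (-1)⟩

/-- `Γ_ℓ(W, E)` is a `C^∞(M)`-module by `f • s = (q^* f) s`. -/
instance : Module (SmoothFun VM M) D.LinSec where
  smul f s := ⟨D.pullE f • s.1, s.2.elim fun a h => ⟨f • a, h.smul f⟩⟩
  one_smul s := Subtype.ext (one_smul (SmoothFun VE E) s.1)
  mul_smul f g s := Subtype.ext (mul_smul (D.pullE f) (D.pullE g) s.1)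
  smul_zero f := Subtype.ext (smul_zero (D.pullE f))
  smul_add f s t := Subtype.ext (smul_add (D.pullE f) s.1 t.1)
  add_smul f g s := Subtype.ext (add_smul (D.pullE f) (D.pullE g) s.1)
  zero_smul s := Subtype.ext (zero_smul (SmoothFun VE E) s.1)

/-- The projection `π : Γ(Â) → Γ(A)`: the section of `A` covered by a linear section. -/
def fatProj (s : D.LinSec) : D.bA.Sec := s.2.choose

lemma fatProj_spec (s : D.LinSec) : D.IsLinearOver s.1 (D.fatProj s) := s.2.choose_spec

/-- Sections of `Hom(E, C)`: vector bundle morphisms `Φ : E → C` over the identity of `M`.  (Linearity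
is written with the operations of `W → A`, which agree on the core with those of `W → E`.) -/
structure HomEC where
  toFun : E → W
  smooth : ContMDiff 𝓘(ℝ, VE) 𝓘(ℝ, VW) ∞ toFun
  projE : ∀ e, D.overE.proj (toFun e) = D.bE.zero (D.bE.proj e)
  projA : ∀ e, D.overA.proj (toFun e) = D.bA.zero (D.bE.proj e)
  map_add : ∀ e e', D.bE.proj e = D.bE.proj e' →
    toFun (D.bE.add e e') = D.overA.add (toFun e) (toFun e')
  map_smul : ∀ r e, toFun (D.bE.smul r e) = D.overA.smul r (toFun e)

variable {D}

/-- The section `Φ ∘ ε` of `C` for a section `ε` of `E`. -/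
def HomEC.apply (Φ : D.HomEC) (ε : D.bE.Sec) : D.CoreSec :=
  ⟨⟨fun x => Φ.toFun (ε x), Φ.smooth.comp ε.contMDiff, fun x => by
      rw [Φ.projE, ε.proj_apply]; rfl⟩,
    fun x => by
      show D.overA.proj (Φ.toFun (ε x)) = D.bA.zero x
      rw [Φ.projA, ε.proj_apply]; rfl⟩

/-- The inclusion `Hom(E, C) ⊂ Â`: the morphism `Φ` is regarded as the linear section
`e ↦ 0_{W,E}(e) +_{W,A} Φ(e)`, so that `φ ⊗ χ` becomes `φ χ̂`. -/
def HomEC.toLin (Φ : D.HomEC) : D.LinSec :=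
  ⟨D.shift Φ.toFun Φ.smooth Φ.projE Φ.projA, 0,
    { smooth_total := (D.shift Φ.toFun Φ.smooth Φ.projE Φ.projA).contMDiff.contMDiffOn
      smooth_base := (0 : D.bA.Sec).contMDiff.contMDiffOn
      proj := fun e _ =>
        (D.overA.proj_add _ _ ((D.projA_zeroE e).trans (Φ.projA e).symm)).trans (D.projA_zeroE e)
      map_add := fun e e' _ he => by
        show D.overA.add (D.overE.zero (D.bE.add e e')) (Φ.toFun (D.bE.add e e')) =
          D.overA.add (D.overA.add (D.overE.zero e) (Φ.toFun e))
            (D.overA.add (D.overE.zero e') (Φ.toFun e'))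
        have h0 : D.overE.zero (D.bE.add e e') =
            D.overA.add (D.overE.zero e) (D.overE.zero e') :=
          IsLinearOver.zero.map_add e e' (mem_univ _) he
        rw [h0, Φ.map_add e e' he]
        have p1 := D.projA_zeroE e
        have p2 : D.overA.proj (D.overE.zero e') = D.bA.zero (D.bE.proj e) := by
          rw [he]; exact D.projA_zeroE e'
        have p3 := Φ.projA e
        have p4 : D.overA.proj (Φ.toFun e') = D.bA.zero (D.bE.proj e) := by
          rw [he]; exact Φ.projA e'
        have q : ∀ v w, D.overA.proj v = D.bA.zero (D.bE.proj e) →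
            D.overA.proj w = D.bA.zero (D.bE.proj e) →
            D.overA.proj (D.overA.add v w) = D.bA.zero (D.bE.proj e) :=
          fun v w hv hw => (D.overA.proj_add _ _ (hv.trans hw.symm)).trans hv
        obtain ⟨c, hi, -, ha, -⟩ := D.overA.exists_fibreCoord (D.bA.zero (D.bE.proj e))
        refine hi _ _ (q _ _ (q _ _ p1 p2) (q _ _ p3 p4)) (q _ _ (q _ _ p1 p3) (q _ _ p2 p4)) ?_
        rw [ha _ _ (q _ _ p1 p2) (q _ _ p3 p4), ha _ _ p1 p2, ha _ _ p3 p4,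
          ha _ _ (q _ _ p1 p3) (q _ _ p2 p4), ha _ _ p1 p3, ha _ _ p2 p4]
        abel
      map_smul := fun r e _ => by
        show D.overA.add (D.overE.zero (D.bE.smul r e)) (Φ.toFun (D.bE.smul r e)) =
          D.overA.smul r (D.overA.add (D.overE.zero e) (Φ.toFun e))
        have h0 : D.overE.zero (D.bE.smul r e) = D.overA.smul r (D.overE.zero e) :=
          IsLinearOver.zero.map_smul r e (mem_univ _)
        rw [h0, Φ.map_smul r e]
        have p1 := D.projA_zeroE e
        have p3 := Φ.projA e
        have q : ∀ v, D.overA.proj v = D.bA.zero (D.bE.proj e) →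
            D.overA.proj (D.overA.smul r v) = D.bA.zero (D.bE.proj e) :=
          fun v hv => (D.overA.proj_smul _ _).trans hv
        have p5 := (D.overA.proj_add _ _ (p1.trans p3.symm)).trans p1
        obtain ⟨c, hi, -, ha, hm⟩ := D.overA.exists_fibreCoord (D.bA.zero (D.bE.proj e))
        refine hi _ _ ((D.overA.proj_add _ _ ((q _ p1).trans (q _ p3).symm)).trans (q _ p1))
          (q _ p5) ?_
        rw [ha _ _ (q _ p1) (q _ p3), hm _ _ p1, hm _ _ p3, hm _ _ p5, ha _ _ p1 p3, smul_add] }⟩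

end DoubleVB

/-! ### VB-algebroids -/

/-- A VB-algebroid: a double vector bundle whose rows `W → E` and `A → M` are Lie algebroids, such
that the projection `W → A` is compatible with anchors and brackets, the anchor `W → TE` is a
morphism of vector bundles from `W → A` to `TE → TM`, and the bracket of `W → E` satisfies the
linearity conditions. -/
structure VBAlgebroid (VW : Type*) [NormedAddCommGroup VW] [NormedSpace ℝ VW]
    (W : Type*) [TopologicalSpace W] [ChartedSpace VW W] [IsManifold 𝓘(ℝ, VW) ∞ W]
    (VE : Type*) [NormedAddCommGroup VE] [NormedSpace ℝ VE]
    (E : Type*) [TopologicalSpace E] [ChartedSpace VE E] [IsManifold 𝓘(ℝ, VE) ∞ E]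
    (VA : Type*) [NormedAddCommGroup VA] [NormedSpace ℝ VA]
    (A : Type*) [TopologicalSpace A] [ChartedSpace VA A] [IsManifold 𝓘(ℝ, VA) ∞ A]
    (VM : Type*) [NormedAddCommGroup VM] [NormedSpace ℝ VM]
    (M : Type*) [TopologicalSpace M] [ChartedSpace VM M] [IsManifold 𝓘(ℝ, VM) ∞ M]
    extends DoubleVB VW W VE E VA A VM M where
  lieW : LieAlgebroid toDoubleVB.overE
  lieA : LieAlgebroid toDoubleVB.bA
  /-- `W → TE` covers `A → TM`. -/
  anchor_proj : ∀ w, mfderiv 𝓘(ℝ, VE) 𝓘(ℝ, VM) bE.proj (overE.proj w)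
      (lieW.anchor (overE.proj w) w) =
    lieA.anchor (bE.proj (overE.proj w)) (overA.proj w)
  /-- `W → TE` maps the addition of `W → A` to the addition of `TE → TM`.  The latter is the tangent
  map of the addition of `E`, i.e. the sum of the velocities of two curves `c`, `c'` over the same
  curve in `M` is the velocity of `c + c'`. -/
  anchor_addA : ∀ w w' (c c' : ℝ → E), overA.proj w = overA.proj w' →
    ContMDiff 𝓘(ℝ, ℝ) 𝓘(ℝ, VE) ∞ c → ContMDiff 𝓘(ℝ, ℝ) 𝓘(ℝ, VE) ∞ c' →
    (∀ t, bE.proj (c t) = bE.proj (c' t)) → c 0 = overE.proj w → c' 0 = overE.proj w' →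
    mfderiv 𝓘(ℝ, ℝ) 𝓘(ℝ, VE) c 0 (1 : ℝ) = lieW.anchor (c 0) w →
    mfderiv 𝓘(ℝ, ℝ) 𝓘(ℝ, VE) c' 0 (1 : ℝ) = lieW.anchor (c' 0) w' →
    mfderiv 𝓘(ℝ, ℝ) 𝓘(ℝ, VE) (fun t => bE.add (c t) (c' t)) 0 (1 : ℝ) =
      lieW.anchor (bE.add (c 0) (c' 0)) (overA.add w w')
  /-- `W → TE` maps the scalar multiplication of `W → A` to the one of `TE → TM`, the tangent map of
  the scalar multiplication of `E`. -/
  anchor_smulA : ∀ r w, mfderiv 𝓘(ℝ, VE) 𝓘(ℝ, VE) (bE.smul r) (overE.proj w)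
      (lieW.anchor (overE.proj w) w) =
    lieW.anchor (bE.smul r (overE.proj w)) (overA.smul r w)
  /-- The bracket of linear sections is linear, and `W → A` intertwines the brackets. -/
  bracket_lin_lin : ∀ s t a b, toDoubleVB.IsLinearOver s a → toDoubleVB.IsLinearOver t b →
    toDoubleVB.IsLinearOver (lieW.bracket s t) (lieA.bracket a b)
  /-- The bracket of a linear section and a core section is a core section. -/
  bracket_lin_core : ∀ s ∈ toDoubleVB.LinSec, ∀ χ : toDoubleVB.CoreSec,
    ∃ χ' : toDoubleVB.CoreSec, lieW.bracket s (toDoubleVB.hat χ) = toDoubleVB.hat χ'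
  /-- Core sections commute. -/
  bracket_core_core : ∀ χ χ' : toDoubleVB.CoreSec,
    lieW.bracket (toDoubleVB.hat χ) (toDoubleVB.hat χ') = 0

namespace VBAlgebroid

variable [IsManifold 𝓘(ℝ, VW) ∞ W] [IsManifold 𝓘(ℝ, VE) ∞ E] [IsManifold 𝓘(ℝ, VA) ∞ A]
  [IsManifold 𝓘(ℝ, VM) ∞ M] (D : VBAlgebroid VW W VE E VA A VM M)

/-- `(FW, FE; FA, F)` is a morphism of VB-algebroids from the restriction of `(W, E; A, M)` to the
open set `U ⊆ M` to `(W, E; A, M)`, for `F` a diffeomorphism from `U` onto an open set and the other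
maps isomorphisms on fibres: Lie algebroid morphisms for the rows and vector bundle morphisms for
the columns. -/
structure IsMorphismOn (U : Set M) (FW : W → W) (FE : E → E) (FA : A → A) (F : M → M) : Prop where
  rowW : D.lieW.IsMorphismOn (D.bE.proj ⁻¹' U) FW FE
  rowA : D.lieA.IsMorphismOn U FA F
  columnW : D.overA.IsMorphismOn D.overA (D.bA.proj ⁻¹' U) FW FA
  columnE : D.bE.IsMorphismOn D.bE U FE F

/-- `X` generates a flow of VB-algebroid automorphisms: for every time `t`, the domain of the time
`t` flow `φ_t` of `X` is the restriction of `W` to an open subset `U` of `M` and `φ_t` is a morphism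
of VB-algebroids there.  (`X` need not be complete; `φ_t` is inverse to `φ_{-t}`, for which the same
is required, so `φ_t` is an isomorphism between the restrictions to two open subsets of `M`.) -/
def IsInfAut (X : VField VW W) : Prop :=
  ∀ t : ℝ, ∃ (U : Set M) (FW : W → W) (FE : E → E) (FA : A → A) (F : M → M), IsOpen U ∧
    (∀ w, (∃ w', X.FlowsTo t w w') ↔ D.base w ∈ U) ∧
    (∀ w, D.base w ∈ U → X.FlowsTo t w (FW w)) ∧
    D.IsMorphismOn U FW FE FA F

/-- The infinitesimal automorphisms of the VB-algebroid. -/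
def InfAut : Type _ := {X : VField VW W // D.IsInfAut X}

/-- The IM derivations of `W → A`: those whose corresponding linear vector field on `W` is an
infinitesimal automorphism of the VB-algebroid. -/
def IMDer : Type _ :=
  {Δ : Der VA A D.overA.Sec // ∃ X : VField VW W, D.overA.Corresponds X Δ ∧ D.IsInfAut X}

/-- The bracket of the fat algebroid `Â`, the restriction of the bracket of `W → E`. -/
def fatBracket (s t : D.LinSec) : D.LinSec :=
  ⟨D.lieW.bracket s.1 t.1, _, D.bracket_lin_lin _ _ _ _ (D.fatProj_spec s) (D.fatProj_spec t)⟩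

/-- The anchor `ρ ∘ π` of the fat algebroid `Â`. -/
def fatAnchor (s : D.LinSec) : VField VM M := D.lieA.field (D.fatProj s)

/-- The core representation: the section `ψ^c_s χ` of `C` with `(ψ^c_s χ)^ = [s, χ̂]`. -/
def coreRep (s : D.LinSec) (χ : D.CoreSec) : D.CoreSec :=
  (D.bracket_lin_core s.1 s.2 χ).choose

/-- The core-anchor `α : C → E` on sections: `α χ` is the section of `E` with
`⟨α χ, φ⟩ = ρ̃(χ̂)(φ)` for all fibrewise linear functions `φ` on `E`. -/
def coreAnchor (χ : D.CoreSec) : D.bE.Sec :=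
  Classical.epsilon fun ε : D.bE.Sec => ∀ φ : SmoothFun VE E, D.bE.IsFibreLinear φ →
    ∀ e, (D.lieW.field (D.hat χ)).deriv φ e = φ (ε (D.bE.proj e))

/-- The side representation: `ψ^s_s ε` is the section of `E` with
`⟨φ, ψ^s_s ε⟩ = ρ(π s) ⟨φ, ε⟩ - ⟨ρ̃(s)(φ), ε⟩` for all fibrewise linear functions `φ` on `E`. -/
def sideRep (s : D.LinSec) (ε : D.bE.Sec) : D.bE.Sec :=
  Classical.epsilon (D.bE.IsDerivOf (D.lieW.field s.1) (D.fatAnchor s) ε)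

/-- The triples `(δ_Â, δ_E, δ_C)`. -/
structure Triple where
  dA : Der VM M D.LinSec
  dE : Der VM M D.bE.Sec
  dC : Der VM M D.CoreSec
  /-- `δ_Â` is a derivation of the Lie algebroid `Â`. -/
  bracket : ∀ s t, dA (D.fatBracket s t) = D.fatBracket (dA s) t + D.fatBracket s (dA t)
  symbol_E : dA.symbol = dE.symbol
  symbol_C : dE.symbol = dC.symbol
  /-- `δ_Â Φ = δ_C ∘ Φ - Φ ∘ δ_E`. -/
  hom : ∀ Φ : D.HomEC, ∃ Ψ : D.HomEC, dA Φ.toLin = Ψ.toLin ∧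
    ∀ ε, Ψ.apply ε = dC (Φ.apply ε) - Φ.apply (dE ε)
  core_anchor : ∀ χ, D.coreAnchor (dC χ) = dE (D.coreAnchor χ)
  side : ∀ s ε, dE (D.sideRep s ε) - D.sideRep s (dE ε) = D.sideRep (dA s) ε
  core : ∀ s χ, dC (D.coreRep s χ) - D.coreRep s (dC χ) = D.coreRep (dA s) χ

/-- The triple obtained from the infinitesimal automorphism `X`: with `Δ` the (horizontal)
derivation of `W → E` corresponding to `X`, the derivations `δ_Â` and `δ_C` are given by the action
of `Δ` on linear and on core sections, and `δ_E` is the derivation of `E` corresponding to the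
symbol of `Δ`, which is the projection of `X` to `E`. -/
def IsTripleOf (X : VField VW W) (T : D.Triple) : Prop :=
  ∃ Δ : Der VE E D.overE.Sec, D.overE.Corresponds X Δ ∧
    (∀ s : D.LinSec, Δ s.1 = (T.dA s).1) ∧
    D.bE.Corresponds Δ.symbol T.dE ∧
    ∀ χ : D.CoreSec, Δ (D.hat χ) = D.hat (T.dC χ)

end VBAlgebroid

end Double

end

/-!
# Infinitesimal automorphisms of VB-algebroids

A derivation of a vector bundle `V → N` is the same as a linear vector field on `V`, and the linear
vector fields are those that are invariant under scalar multiplication (`Corresponds.field_unique`,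
`Corresponds.der_unique`, `VBundle.exists_corresponds`, `VBundle.IsHomogeneous.exists_der`). Working
with homogeneity instead of additivity is possible because a smooth function that is homogeneous of
degree one on a vector space is linear. The flow of a linear vector field is defined on whole fibres,
since homogeneity moves any vector close to the zero section.

Let `X` be a linear vector field on the total space of a Lie algebroid, with derivation `Δ`. Its flow
preserves the anchor and the bracket if and only if `X` preserves the transpose of the anchor and `Δ`
is a derivation of the bracket (`LieAlgebroid.isMorphismOn_flow`, `LieAlgebroid.der_bracket_of_flow`).
The condition is sufficient: the failure of the time `t` flow to preserve the anchor, or the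
differential `dξ` of a fibrewise linear function, is tensorial and vanishes at `t = 0`; in a local
frame it solves a homogeneous linear differential equation, so it vanishes identically. Hence a vector
field `X` on `W` is an infinitesimal automorphism if and only if it is linear over `E` and over `A`
and its derivation `Δ` of `W → E` is compatible with the anchor and the bracket of `W → E`
(`VBAlgebroid.IsInfinitesimal`). The conditions for the other three sides of the double vector bundle
follow by projection.

The first correspondence is then the one between linear vector fields and derivations for `W → A`. For
the second one, sections of `W → E` are locally generated by linear and by core sections
(`DoubleVB.exists_generators`), and these are the sections of degree `0` and `-1` for the scalar
multiplications of `W → A`; thus a field that is linear over `A` preserves both classes, and its action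
on them, together with its projection to `E`, is a triple as in the statement
(`IsInfinitesimal.exists_isTripleOf`). The compatibility with `α` and `ψ^s` is the compatibility with
the anchor, evaluated on core sections and on linear sections. Conversely, a triple determines the
action of a derivation `Δ` of `W → E` on generators. The condition on `Hom(E, C)` is what makes this
consistent, as `φ χ̂` is a linear section for every fibrewise linear function `φ` on `E` and every
section `χ` of the core (`Triple.exists_der`). Since the failure of `Δ` to respect the anchor and the
bracket is tensorial, it is enough to test it on generators, where it vanishes by the equations for the
triple (`Triple.isInfinitesimal`). The only missing piece is the compatibility of `δ_Â` with the anchor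
of `Â`; it follows from the Leibniz rule for the bracket (`Triple.fatAnchor_der`).
-/

noncomputable section

set_option linter.unusedSectionVars false

/-! ### Smooth dependence of solutions of ordinary differential equations on initial values -/

section ODE

universe u

variable {K : Type*} [TopologicalSpace K] [CompactSpace K]
  {E F : Type u} [NormedAddCommGroup E] [NormedSpace ℝ E] [NormedAddCommGroup F] [NormedSpace ℝ F]

/-- Pointwise application `(A, h) ↦ (t ↦ A t (h t))` of continuous families of linear maps. -/
def ContinuousMap.pointwiseApply : C(K, E →L[ℝ] F) →L[ℝ] C(K, E) →L[ℝ] C(K, F) :=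
  LinearMap.mkContinuous₂
    (LinearMap.mk₂ ℝ (fun (A : C(K, E →L[ℝ] F)) (h : C(K, E)) =>
      (⟨fun t => A t (h t), A.continuous.clm_apply h.continuous⟩ : C(K, F)))
      (fun A B h => by ext t; simp) (fun c A h => by ext t; simp)
      (fun A h k => by ext t; simp) (fun c A h => by ext t; simp)) 1 (fun A h => by
        rw [one_mul, ContinuousMap.norm_le _ (by positivity)]
        intro t
        refine ((A t).le_opNorm _).trans ?_
        gcongr
        exacts [A.norm_coe_le_norm t, h.norm_coe_le_norm t])

/-- The superposition operator `u ↦ f ∘ u` on continuous functions. -/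
def superposition (K : Type*) [TopologicalSpace K] (f : E → F) (hf : Continuous f) (u : C(K, E)) :
    C(K, F) := ⟨fun t => f (u t), hf.comp u.continuous⟩

/-- The superposition operator is differentiable, because `f'` is uniformly continuous. -/
lemma hasFDerivAt_superposition {f : E → F} (hf : ContDiff ℝ ∞ f) (hc : HasCompactSupport f)
    (u : C(K, E)) :
    HasFDerivAt (superposition K f hf.continuous)
      (ContinuousMap.pointwiseApply
        (superposition K (fderiv ℝ f) (hf.continuous_fderiv (by simp)) u)) u := by
  have huc : UniformContinuous (fderiv ℝ f) :=
    (hc.fderiv (𝕜 := ℝ)).uniformContinuous_of_continuous (hf.continuous_fderiv (by simp))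
  rw [hasFDerivAt_iff_isLittleO_nhds_zero, Asymptotics.isLittleO_iff]
  intro ε hε
  obtain ⟨δ, hδ, hd⟩ := Metric.uniformContinuous_iff.1 huc ε hε
  filter_upwards [Metric.ball_mem_nhds (0 : C(K, E)) hδ] with h hh
  rw [mem_ball_zero_iff] at hh
  rw [ContinuousMap.norm_le _ (by positivity)]
  intro t
  have ht : ‖h t‖ < δ := (h.norm_coe_le_norm t).trans_lt hh
  have key := (convex_ball (u t) δ).norm_image_sub_le_of_norm_hasFDerivWithin_le'
    (f := f) (f' := fderiv ℝ f) (φ := fderiv ℝ f (u t)) (C := ε)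
    (fun x _ => ((hf.differentiable (by simp)) x).hasFDerivAt.hasFDerivWithinAt)
    (fun x hx => by
      have := hd hx
      rw [dist_eq_norm] at this
      exact this.le) (Metric.mem_ball_self hδ) (y := u t + h t) (by simpa [dist_eq_norm] using ht)
  rw [add_sub_cancel_left] at key
  calc ‖f (u t + h t) - f (u t) - fderiv ℝ f (u t) (h t)‖ ≤ ε * ‖h t‖ := key
    _ ≤ ε * ‖h‖ := by gcongr; exact h.norm_coe_le_norm t

/-- Iterated differentiability of the superposition operator, by induction over all target spaces:
its derivative is given by the superposition operator of `f'`. -/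
lemma contDiff_superposition_nat (n : ℕ) : ∀ {F : Type u} [NormedAddCommGroup F] [NormedSpace ℝ F]
    {f : E → F} (hf : ContDiff ℝ ∞ f), HasCompactSupport f →
    ContDiff ℝ n (superposition K f hf.continuous) := by
  induction n with
  | zero =>
    intro F _ _ f hf hc
    have hd : Differentiable ℝ (superposition K f hf.continuous) :=
      fun u => (hasFDerivAt_superposition hf hc u).differentiableAt
    exact contDiff_zero.2 hd.continuous
  | succ n ih =>
    intro F _ _ f hf hc
    have hd : Differentiable ℝ (superposition K f hf.continuous) :=
      fun u => (hasFDerivAt_superposition hf hc u).differentiableAt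
    refine (contDiff_succ_iff_fderiv (n := n)).2 ⟨hd, fun h => by simp at h, ?_⟩
    have h1 := ih (hf.fderiv_right (m := ∞) (by simp)) (hc.fderiv (𝕜 := ℝ))
    have h2 : fderiv ℝ (superposition K f hf.continuous) = fun u => ContinuousMap.pointwiseApply
        (superposition K (fderiv ℝ f) (hf.continuous_fderiv (by simp)) u) :=
      funext fun u => (hasFDerivAt_superposition hf hc u).fderiv
    rw [h2]
    exact ContinuousMap.pointwiseApply.contDiff.comp h1

lemma contDiff_superposition {f : E → F} (hf : ContDiff ℝ ∞ f) (hc : HasCompactSupport f) :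
    ContDiff ℝ ∞ (superposition K f hf.continuous) :=
  contDiff_infty.2 fun n => contDiff_superposition_nat n hf hc

variable [CompleteSpace F]

/-- The primitive `u ↦ (t ↦ ∫₀ᵗ u)` on `C([0, 1], F)`. -/
def primitive (F : Type*) [NormedAddCommGroup F] [NormedSpace ℝ F] [CompleteSpace F] :
    C(Icc (0 : ℝ) 1, F) →L[ℝ] C(Icc (0 : ℝ) 1, F) :=
  LinearMap.mkContinuous
    { toFun := fun u => ⟨fun t => ∫ r in (0 : ℝ)..t, IccExtend zero_le_one u r, by
        have h : Continuous fun t : ℝ => ∫ r in (0 : ℝ)..t, IccExtend zero_le_one u r :=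
          intervalIntegral.continuous_primitive
            (fun a b => (u.continuous.Icc_extend' (h := zero_le_one)).intervalIntegrable a b) 0
        exact h.comp continuous_subtype_val⟩
      map_add' := fun u v => by
        ext t
        have h1 := (u.continuous.Icc_extend' (h := zero_le_one' ℝ)).intervalIntegrable
          (μ := MeasureTheory.volume) 0 t
        have h2 := (v.continuous.Icc_extend' (h := zero_le_one' ℝ)).intervalIntegrable
          (μ := MeasureTheory.volume) 0 t
        exact intervalIntegral.integral_add h1 h2
      map_smul' := fun c u => by
        ext t
        exact intervalIntegral.integral_smul c _ } 1 (fun u => by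
    rw [one_mul, ContinuousMap.norm_le _ (norm_nonneg _)]
    intro t
    have h := intervalIntegral.norm_integral_le_of_norm_le_const (a := (0 : ℝ)) (b := t)
      (f := IccExtend zero_le_one u) (C := ‖u‖) (fun x _ => u.norm_coe_le_norm _)
    refine h.trans ?_
    rw [sub_zero, abs_of_nonneg t.2.1]
    exact mul_le_of_le_one_right (norm_nonneg _) t.2.2)

lemma primitive_apply (u : C(Icc (0 : ℝ) 1, F)) (t : Icc (0 : ℝ) 1) :
    primitive F u t = ∫ r in (0 : ℝ)..t, IccExtend zero_le_one u r := rfl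

/-- The solutions of `u' = s f(u)` on `[0, 1]` starting at `x` depend smoothly on `(s, x)` near
`(0, x₀)`: the inverse function theorem applies to `(s, u) ↦ (s, u - s ∫ f(u))`, whose derivative at
`s = 0` is a shear. -/
lemma exists_smooth_rescaled_solution {f : F → F} (hf : ContDiff ℝ ∞ f) (hc : HasCompactSupport f)
    (x₀ : F) : ∃ S : ℝ × F → C(Icc (0 : ℝ) 1, F),
      ∀ᶠ p in 𝓝 ((0 : ℝ), x₀), ContDiffAt ℝ ∞ S p ∧
        S p - p.1 • primitive F (superposition _ f hf.continuous (S p)) =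
        ContinuousMap.const _ p.2 := by
  -- the local inverse of `P`, applied to `(s, x)` with `x` a constant function, gives the solution
  let P : ℝ × C(Icc (0 : ℝ) 1, F) → ℝ × C(Icc (0 : ℝ) 1, F) := fun q =>
    (q.1, q.2 - q.1 • primitive F (superposition _ f hf.continuous q.2))
  have hP : ContDiff ℝ ∞ P := contDiff_fst.prodMk (contDiff_snd.sub (contDiff_fst.smul
    ((primitive F).contDiff.comp ((contDiff_superposition hf hc).comp contDiff_snd))))
  let c : F →L[ℝ] C(Icc (0 : ℝ) 1, F) := LinearMap.mkContinuous
    { toFun := fun x => ContinuousMap.const _ x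
      map_add' := fun x y => by ext; simp
      map_smul' := fun r x => by ext; simp } 1 (fun x => by
      rw [one_mul, ContinuousMap.norm_le _ (norm_nonneg _)]
      intro t; simp)
  let k := primitive F (superposition _ f hf.continuous (c x₀))
  let A : (ℝ × C(Icc (0 : ℝ) 1, F)) ≃L[ℝ] (ℝ × C(Icc (0 : ℝ) 1, F)) :=
    ContinuousLinearEquiv.equivOfInverse
      ((ContinuousLinearMap.fst ℝ ℝ _).prod (ContinuousLinearMap.snd ℝ ℝ _ -
        (ContinuousLinearMap.fst ℝ ℝ C(Icc (0 : ℝ) 1, F)).smulRight k))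
      ((ContinuousLinearMap.fst ℝ ℝ _).prod (ContinuousLinearMap.snd ℝ ℝ _ +
        (ContinuousLinearMap.fst ℝ ℝ C(Icc (0 : ℝ) 1, F)).smulRight k))
      (fun q => by ext <;> simp) (fun q => by ext <;> simp)
  have hA : HasFDerivAt P (A : _ →L[ℝ] _) ((0 : ℝ), c x₀) := by
    have hN : HasFDerivAt (fun q : ℝ × C(Icc (0 : ℝ) 1, F) =>
        primitive F (superposition _ f hf.continuous q.2))
        (fderiv ℝ (fun q : ℝ × C(Icc (0 : ℝ) 1, F) =>
          primitive F (superposition _ f hf.continuous q.2)) (0, c x₀)) (0, c x₀) :=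
      (((primitive F).contDiff.comp ((contDiff_superposition hf hc).comp
        contDiff_snd)).differentiable (n := ∞) (by simp) _).hasFDerivAt
    have h := (hasFDerivAt_fst (𝕜 := ℝ) (p := ((0 : ℝ), c x₀))).prodMk
      ((hasFDerivAt_snd (𝕜 := ℝ) (p := ((0 : ℝ), c x₀))).sub
        ((hasFDerivAt_fst (𝕜 := ℝ) (p := ((0 : ℝ), c x₀))).smul hN))
    refine h.congr_fderiv ?_
    ext q <;> simp [A, k]
  have hP0 : P ((0 : ℝ), c x₀) = (0, c x₀) := by simp [P]
  let e := hP.contDiffAt.toOpenPartialHomeomorph P hA (by simp)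
  have he : ∀ q, e q = P q := fun _ => rfl
  have hsrc : ((0 : ℝ), c x₀) ∈ e.source :=
    hP.contDiffAt.mem_toOpenPartialHomeomorph_source hA (by simp)
  have htgt : ((0 : ℝ), c x₀) ∈ e.target := by
    have := e.map_source hsrc
    rwa [he, hP0] at this
  have hsymm : e.symm (0, c x₀) = (0, c x₀) := by
    have := e.left_inv hsrc
    rwa [he, hP0] at this
  have hι : ContDiff ℝ ∞ (fun p : ℝ × F => (p.1, c p.2)) :=
    contDiff_fst.prodMk (c.contDiff.comp contDiff_snd)
  have hι0 : Filter.Tendsto (fun p : ℝ × F => (p.1, c p.2)) (𝓝 ((0 : ℝ), x₀))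
      (𝓝 ((0 : ℝ), c x₀)) := hι.continuous.continuousAt
  have hinv : ∀ᶠ y in 𝓝 ((0 : ℝ), c x₀), fderiv ℝ P (e.symm y) ∈
      range ((↑) : ((ℝ × C(Icc (0 : ℝ) 1, F)) ≃L[ℝ] (ℝ × C(Icc (0 : ℝ) 1, F))) → _) := by
    have h1 : ContinuousAt (fun y => fderiv ℝ P (e.symm y)) ((0 : ℝ), c x₀) :=
      (hP.continuous_fderiv (by simp)).continuousAt.comp (e.continuousAt_symm htgt)
    refine h1.preimage_mem_nhds (ContinuousLinearEquiv.isOpen.mem_nhds ?_)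
    rw [hsymm, hA.fderiv]
    exact mem_range_self A
  refine ⟨fun p => (e.symm (p.1, c p.2)).2, ?_⟩
  filter_upwards [hι0.eventually hinv, hι0.eventually (e.open_target.mem_nhds htgt)] with p hp hpt
  obtain ⟨A', hA'⟩ := hp
  have hr : P (e.symm (p.1, c p.2)) = (p.1, c p.2) := e.right_inv hpt
  constructor
  · have hd : HasFDerivAt e (A' : _ →L[ℝ] _) (e.symm (p.1, c p.2)) := by
      rw [hA']
      exact ((hP.differentiable (by simp)) _).hasFDerivAt
    exact contDiffAt_snd.comp _ (ContDiffAt.comp p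
      (e.contDiffAt_symm hpt hd hP.contDiffAt) hι.contDiffAt)
  · have h1 : (e.symm (p.1, c p.2)).1 = p.1 := congrArg Prod.fst hr
    have h2 := congrArg Prod.snd hr
    simp only [P, h1] at h2
    exact h2

/-- A smooth vector field on a finite dimensional vector space has, near every point, a local flow
that is jointly smooth in time and initial value. -/
theorem exists_smooth_local_flow [FiniteDimensional ℝ F] {v : F → F} {O : Set F} (hO : IsOpen O)
    (hv : ContDiffOn ℝ ∞ v O) {x₀ : F} (hx₀ : x₀ ∈ O) :
    ∃ (ε : ℝ) (Q : Set F) (Φ : ℝ × F → F), 0 < ε ∧ IsOpen Q ∧ x₀ ∈ Q ∧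
      ∀ x ∈ Q, Φ (0, x) = x ∧ ∀ t ∈ Ioo (-ε) ε, ContDiffAt ℝ ∞ Φ (t, x) ∧ Φ (t, x) ∈ O ∧
        HasDerivAt (fun t => Φ (t, x)) (v (Φ (t, x))) t := by
  -- `f` is the vector field cut off to a compact set, so that superposition is smooth
  obtain ⟨R, hR, hRO⟩ := Metric.isOpen_iff.1 hO x₀ hx₀
  let χ : ContDiffBump x₀ := ⟨R / 3, R / 2, by positivity, by linarith⟩
  let f : F → F := fun x => χ x • v x
  have hf : ContDiff ℝ ∞ f := by
    rw [contDiff_iff_contDiffAt]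
    intro x
    by_cases hx : x ∈ tsupport χ
    · rw [χ.tsupport_eq] at hx
      have : x ∈ O := hRO (Metric.closedBall_subset_ball (by simp [χ]; linarith) hx)
      exact χ.contDiff.contDiffAt.smul (hv.contDiffAt (hO.mem_nhds this))
    · have h0 : f =ᶠ[𝓝 x] fun _ => 0 := by
        filter_upwards [(isClosed_tsupport χ).isOpen_compl.mem_nhds hx] with y hy
        simp [f, image_eq_zero_of_notMem_tsupport hy]
      exact contDiffAt_const.congr_of_eventuallyEq h0
  have hc : HasCompactSupport f := χ.hasCompactSupport.smul_right
  obtain ⟨L, hL⟩ := hf.lipschitzWith_of_hasCompactSupport hc (by simp)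
  have hfv : ∀ x ∈ Metric.ball x₀ (R / 3), f x = v x := fun x hx => by
    simp [f, χ.one_of_mem_closedBall (Metric.ball_subset_closedBall hx)]
  obtain ⟨r, hr, ε₁, hε₁, hα⟩ := (hf.contDiffAt (x := x₀)).of_le (m := 1) (by simp)
    |>.exists_forall_mem_closedBall_exists_eq_forall_mem_Ioo_hasDerivAt 0
  obtain ⟨S, hS⟩ := exists_smooth_rescaled_solution hf hc x₀
  let one : Icc (0 : ℝ) 1 := ⟨1, by simp⟩
  let zro : Icc (0 : ℝ) 1 := ⟨0, by simp⟩
  let Φ : ℝ × F → F := fun p => S p one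
  let ev : C(Icc (0 : ℝ) 1, F) →L[ℝ] F := ContinuousMap.evalCLM ℝ one
  have hΦs : ∀ p, ContDiffAt ℝ ∞ S p → ContDiffAt ℝ ∞ Φ p := fun p hp =>
    ev.contDiff.contDiffAt.comp p hp
  have hΦ0 : Φ (0, x₀) = x₀ := by
    have h2 := hS.self_of_nhds.2
    rw [zero_smul, sub_zero] at h2
    simp [Φ, h2]
  have hnear : ∀ᶠ p in 𝓝 ((0 : ℝ), x₀), Φ p ∈ Metric.ball x₀ (R / 3) := by
    refine (hΦs _ hS.self_of_nhds.1).continuousAt.preimage_mem_nhds ?_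
    rw [hΦ0]
    exact Metric.ball_mem_nhds _ (by positivity)
  have hball : ∀ᶠ p in 𝓝 ((0 : ℝ), x₀), p.2 ∈ Metric.ball x₀ r :=
    continuous_snd.continuousAt.preimage_mem_nhds (Metric.ball_mem_nhds _ hr)
  obtain ⟨T, hT, Q, hQ, hTQ⟩ := mem_nhds_prod_iff.1 (hS.and (hnear.and hball))
  obtain ⟨Q', hQ', hQ'o, hxQ'⟩ := mem_nhds_iff.1 hQ
  obtain ⟨ε₂, hε₂, hTε⟩ := Metric.mem_nhds_iff.1 hT
  have key : ∀ x ∈ Q', ∀ s ∈ Ioo (-min ε₁ ε₂) (min ε₁ ε₂), s ∈ T := fun x _ s hs => by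
    refine hTε ?_
    rw [mem_ball_zero_iff, Real.norm_eq_abs]
    exact (abs_lt.2 hs).trans_le (min_le_right _ _)
  refine ⟨min ε₁ ε₂, Q', Φ, lt_min hε₁ hε₂, hQ'o, hxQ', fun x hx => ?_⟩
  have hε0 : (0 : ℝ) < min ε₁ ε₂ := lt_min hε₁ hε₂
  have hmem : ∀ s ∈ Ioo (-min ε₁ ε₂) (min ε₁ ε₂), _ := fun s hs =>
    hTQ (mk_mem_prod (key x hx s hs) (hQ' hx))
  obtain ⟨α, hα0, hαd⟩ := hα x (Metric.ball_subset_closedBall (hmem 0 ⟨by linarith, hε0⟩).2.2)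
  -- the rescaled solution is `t ↦ α (s t)`
  have hΦα : ∀ s ∈ Ioo (-min ε₁ ε₂) (min ε₁ ε₂), Φ (s, x) = α s := by
    intro s hs
    have hsol : S (s, x) - s • primitive F (superposition _ f hf.continuous (S (s, x))) =
        ContinuousMap.const _ x := (hmem s hs).1.2
    let N : C(Icc (0 : ℝ) 1, F) := superposition _ f hf.continuous (S (s, x))
    let w : ℝ → F := fun t => x + s • ∫ r in (0 : ℝ)..t, IccExtend zero_le_one N r
    have hw : ∀ t (ht : t ∈ Icc (0 : ℝ) 1), S (s, x) ⟨t, ht⟩ = w t := by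
      intro t ht
      have := congrArg (fun g : C(Icc (0 : ℝ) 1, F) => g ⟨t, ht⟩) hsol
      simp only [ContinuousMap.sub_apply, ContinuousMap.smul_apply, primitive_apply,
        ContinuousMap.const_apply] at this
      rw [sub_eq_iff_eq_add] at this
      exact this
    have hNc : Continuous (IccExtend (zero_le_one' ℝ) N) := N.continuous.Icc_extend'
    have hwd : ∀ t, HasDerivAt w (s • IccExtend zero_le_one N t) t := fun t =>
      ((intervalIntegral.integral_hasDerivAt_right (hNc.intervalIntegrable _ _)
        (hNc.stronglyMeasurableAtFilter _ _) hNc.continuousAt).const_smul s).const_add x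
    have hβd : ∀ t ∈ Icc (0 : ℝ) 1, HasDerivAt (fun t => α (s * t)) (s • f (α (s * t))) t := by
      intro t ht
      have hst : s * t ∈ Ioo (0 - ε₁) (0 + ε₁) := by
        have h1 : |s| < ε₁ := (abs_lt.2 hs).trans_le (min_le_left _ _)
        have h2 : |s * t| < ε₁ := by
          rw [abs_mul, abs_of_nonneg ht.1]
          exact (mul_le_of_le_one_right (abs_nonneg _) ht.2).trans_lt h1
        rw [zero_sub, zero_add]
        exact abs_lt.1 h2
      have := (hαd _ hst).scomp t ((hasDerivAt_id t).const_mul s)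
      simpa [Function.comp_def] using this
    have huniq := ODE_solution_unique (v := fun _ y => s • f y) (K := ‖s‖₊ * L) (a := 0) (b := 1)
      (f := w) (g := fun t => α (s * t))
      (fun _ => (lipschitzWith_smul s).comp hL)
      (fun t _ => (hwd t).continuousAt.continuousWithinAt)
      (fun t ht => by
        have h1 := (hwd t).hasDerivWithinAt (s := Ici t)
        rwa [IccExtend_of_mem _ _ (Ico_subset_Icc_self ht), show N ⟨t, Ico_subset_Icc_self ht⟩ =
          f (w t) from congrArg f (hw t _)] at h1)
      (fun t ht => (hβd t ht).continuousAt.continuousWithinAt)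
      (fun t ht => (hβd t (Ico_subset_Icc_self ht)).hasDerivWithinAt) (by simp [w, hα0])
    have h1 := huniq (right_mem_Icc.2 zero_le_one)
    simp only [mul_one] at h1
    rw [← h1]
    exact hw 1 _
  refine ⟨by rw [hΦα 0 ⟨by linarith, hε0⟩, hα0], fun t ht => ⟨hΦs _ (hmem t ht).1.1, ?_, ?_⟩⟩
  · exact hRO (Metric.ball_subset_ball (by linarith) (hmem t ht).2.1)
  · rw [← hfv _ (hmem t ht).2.1]
    have h1 : HasDerivAt α (f (α t)) t := hαd t
      ⟨by linarith [ht.1, min_le_left ε₁ ε₂], by linarith [ht.2, min_le_left ε₁ ε₂]⟩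
    rw [hΦα t ht]
    refine h1.congr_of_eventuallyEq ?_
    filter_upwards [isOpen_Ioo.mem_nhds ht] with s hs
    exact hΦα s hs

end ODE

/-! ### Calculus on manifolds with smooth functions as test objects -/

section Calculus

variable {VN : Type*} [NormedAddCommGroup VN] [NormedSpace ℝ VN]
  {N : Type*} [TopologicalSpace N] [ChartedSpace VN N]
  {VP : Type*} [NormedAddCommGroup VP] [NormedSpace ℝ VP]
  {P : Type*} [TopologicalSpace P] [ChartedSpace VP P]
  {G : Type*} [NormedAddCommGroup G] [NormedSpace ℝ G]

/-- The derivative of `g : N → G` at `x` in the direction `u`, as an element of `G`. -/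
def dirDeriv (g : N → G) (x : N) (u : TangentSpace 𝓘(ℝ, VN) x) : G :=
  mfderiv 𝓘(ℝ, VN) 𝓘(ℝ, G) g x u

lemma dirDeriv_congr {f g : N → G} {x : N} (h : f =ᶠ[𝓝 x] g) (u : TangentSpace 𝓘(ℝ, VN) x) :
    dirDeriv f x u = dirDeriv g x u := by
  unfold dirDeriv
  rw [h.mfderiv_eq]
  rfl

lemma dirDeriv_map_add (g : N → G) (x : N) (u w : TangentSpace 𝓘(ℝ, VN) x) :
    dirDeriv g x (u + w) = dirDeriv g x u + dirDeriv g x w := map_add _ _ _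

lemma dirDeriv_map_sub (g : N → G) (x : N) (u w : TangentSpace 𝓘(ℝ, VN) x) :
    dirDeriv g x (u - w) = dirDeriv g x u - dirDeriv g x w := map_sub _ _ _

lemma dirDeriv_map_smul (g : N → G) (x : N) (r : ℝ) (u : TangentSpace 𝓘(ℝ, VN) x) :
    dirDeriv g x (r • u) = r • dirDeriv g x u := map_smul _ _ _

lemma dirDeriv_map_zero (g : N → G) (x : N) :
    dirDeriv g x (0 : TangentSpace 𝓘(ℝ, VN) x) = 0 := map_zero _

lemma dirDeriv_const (c : G) (x : N) (u : TangentSpace 𝓘(ℝ, VN) x) :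
    dirDeriv (fun _ : N => c) x u = 0 := by
  unfold dirDeriv
  rw [mfderiv_const]
  rfl

lemma dirDeriv_add {f g : N → G} {x : N} (hf : MDifferentiableAt 𝓘(ℝ, VN) 𝓘(ℝ, G) f x)
    (hg : MDifferentiableAt 𝓘(ℝ, VN) 𝓘(ℝ, G) g x) (u : TangentSpace 𝓘(ℝ, VN) x) :
    dirDeriv (fun y => f y + g y) x u = dirDeriv f x u + dirDeriv g x u := by
  have h := (hf.hasMFDerivAt.add hg.hasMFDerivAt).mfderiv
  exact congrArg (fun A => A u) h

lemma dirDeriv_sub {f g : N → G} {x : N} (hf : MDifferentiableAt 𝓘(ℝ, VN) 𝓘(ℝ, G) f x)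
    (hg : MDifferentiableAt 𝓘(ℝ, VN) 𝓘(ℝ, G) g x) (u : TangentSpace 𝓘(ℝ, VN) x) :
    dirDeriv (fun y => f y - g y) x u = dirDeriv f x u - dirDeriv g x u := by
  have h := (hf.hasMFDerivAt.sub hg.hasMFDerivAt).mfderiv
  exact congrArg (fun A => A u) h

lemma dirDeriv_mul {f g : N → ℝ} {x : N} (hf : MDifferentiableAt 𝓘(ℝ, VN) 𝓘(ℝ, ℝ) f x)
    (hg : MDifferentiableAt 𝓘(ℝ, VN) 𝓘(ℝ, ℝ) g x) (u : TangentSpace 𝓘(ℝ, VN) x) :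
    dirDeriv (fun y => f y * g y) x u = dirDeriv f x u * g x + f x * dirDeriv g x u := by
  have h := (hf.hasMFDerivAt.mul hg.hasMFDerivAt).mfderiv
  refine (congrArg (fun A => A u) h).trans ?_
  show f x * dirDeriv g x u + g x * dirDeriv f x u = _
  ring

/-- The chain rule for a smooth map between manifolds. -/
lemma dirDeriv_comp {F : P → N} {g : N → G} {x : P}
    (hg : MDifferentiableAt 𝓘(ℝ, VN) 𝓘(ℝ, G) g (F x))
    (hF : MDifferentiableAt 𝓘(ℝ, VP) 𝓘(ℝ, VN) F x) (u : TangentSpace 𝓘(ℝ, VP) x) :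
    dirDeriv (fun y => g (F y)) x u = dirDeriv g (F x) (mfderiv 𝓘(ℝ, VP) 𝓘(ℝ, VN) F x u) := by
  have h := mfderiv_comp x hg hF
  exact congrArg (fun A => A u) h

/-- The chain rule for a smooth map into a vector space. -/
lemma dirDeriv_comp_fderiv {G' : Type*} [NormedAddCommGroup G'] [NormedSpace ℝ G']
    {F : P → G} {g : G → G'} {x : P} (hg : DifferentiableAt ℝ g (F x))
    (hF : MDifferentiableAt 𝓘(ℝ, VP) 𝓘(ℝ, G) F x) (u : TangentSpace 𝓘(ℝ, VP) x) :
    dirDeriv (fun y => g (F y)) x u = fderiv ℝ g (F x) (dirDeriv F x u) := by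
  have h := mfderiv_comp x hg.mdifferentiableAt hF
  rw [mfderiv_eq_fderiv] at h
  exact congrArg (fun A => A u) h

/-- Derivative of a function along a curve. -/
lemma hasDerivAt_comp_curve {g : N → G} {γ : ℝ → N} {t : ℝ} {u : TangentSpace 𝓘(ℝ, VN) (γ t)}
    (hg : MDifferentiableAt 𝓘(ℝ, VN) 𝓘(ℝ, G) g (γ t))
    (hγ : HasMFDerivAt 𝓘(ℝ, ℝ) 𝓘(ℝ, VN) γ t ((1 : ℝ →L[ℝ] ℝ).smulRight u)) :
    HasDerivAt (fun s => g (γ s)) (dirDeriv g (γ t) u) t := by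
  have h := (hg.hasMFDerivAt.comp t hγ).hasFDerivAt
  rw [hasDerivAt_iff_hasFDerivAt]
  refine h.congr_fderiv ?_
  ext
  show mfderiv 𝓘(ℝ, VN) 𝓘(ℝ, G) g (γ t) ((1 : ℝ) • u) = (1 : ℝ) • dirDeriv g (γ t) u
  rw [one_smul, one_smul]
  rfl

/-- A smooth function on an open set, multiplied by a cut-off function, is globally smooth. -/
lemma contMDiff_cutoff {ρ : N → ℝ} (hρ : ContMDiff 𝓘(ℝ, VN) 𝓘(ℝ, ℝ) ∞ ρ) {O : Set N}
    (hO : IsOpen O) (hs : tsupport ρ ⊆ O) {g : N → G}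
    (hg : ContMDiffOn 𝓘(ℝ, VN) 𝓘(ℝ, G) ∞ g O) :
    ContMDiff 𝓘(ℝ, VN) 𝓘(ℝ, G) ∞ (fun x => ρ x • g x) := by
  refine contMDiff_of_tsupport fun x hx => ?_
  have : x ∈ O := hs (tsupport_smul_subset_left _ _ hx)
  exact (hρ x).smul ((hg x this).contMDiffAt (hO.mem_nhds this))

section Bump

variable [FiniteDimensional ℝ VN] [T2Space N] [IsManifold 𝓘(ℝ, VN) ∞ N]

lemma exists_bump {x : N} {O : Set N} (hO : O ∈ 𝓝 x) :
    ∃ ρ : SmoothFun VN N, (∀ᶠ y in 𝓝 x, ρ y = 1) ∧ tsupport ρ ⊆ O := by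
  obtain ⟨f, -, hf⟩ := (SmoothBumpFunction.nhds_basis_tsupport (I := 𝓘(ℝ, VN)) x).mem_iff.1 hO
  exact ⟨⟨f, f.contMDiff⟩, f.eventuallyEq_one, hf⟩

/-- The chart at `x` extended to a smooth function on the whole manifold. -/
lemma exists_chartFun (x : N) : ∃ h : N → VN, ContMDiff 𝓘(ℝ, VN) 𝓘(ℝ, VN) ∞ h ∧
    h =ᶠ[𝓝 x] extChartAt 𝓘(ℝ, VN) x := by
  obtain ⟨ρ, h1, hs⟩ := exists_bump (VN := VN)
    ((chartAt VN x).open_source.mem_nhds (mem_chart_source VN x))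
  refine ⟨_, contMDiff_cutoff ρ.contMDiff (chartAt VN x).open_source hs
    (contMDiffOn_extChartAt (I := 𝓘(ℝ, VN)) (x := x)), ?_⟩
  filter_upwards [h1] with y hy
  rw [hy, one_smul]

/-- Tangent vectors are determined by their action on smooth functions. -/
lemma tangent_ext {x : N} {u w : TangentSpace 𝓘(ℝ, VN) x}
    (h : ∀ f : SmoothFun VN N, dirDeriv f x u = dirDeriv f x w) : u = w := by
  obtain ⟨c, hc, hcx⟩ := exists_chartFun (VN := VN) x
  have h1 : ∀ v : TangentSpace 𝓘(ℝ, VN) x, dirDeriv c x v = (v : VN) := fun v => by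
    rw [dirDeriv_congr hcx]
    unfold dirDeriv
    rw [mfderiv_extChartAt_self]
    rfl
  have h2 : dirDeriv c x u = dirDeriv c x w := by
    refine (SeparatingDual.eq_iff_forall_dual_eq (R := ℝ)).2 fun ℓ => ?_
    have h3 : ∀ v : TangentSpace 𝓘(ℝ, VN) x,
        dirDeriv (fun y => ℓ (c y)) x v = ℓ (dirDeriv c x v) := fun v => by
      rw [dirDeriv_comp_fderiv ℓ.differentiableAt ((hc x).mdifferentiableAt (by simp)), ℓ.fderiv]
    have h4 := h ⟨fun y => ℓ (c y), ℓ.contMDiff.comp hc⟩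
    exact (h3 u).symm.trans (h4.trans (h3 w))
  rwa [h1, h1] at h2

lemma VField.deriv_apply (X : VField VN N) (f : SmoothFun VN N) (x : N) :
    X.deriv f x = dirDeriv f x (X x) := rfl

lemma VField.ext_deriv {X Y : VField VN N} (h : ∀ f, X.deriv f = Y.deriv f) : X = Y :=
  ContMDiffSection.ext fun _ => tangent_ext fun f => congrArg (fun g : SmoothFun VN N => g _) (h f)

/-- A curve is differentiable with prescribed velocity if this holds for its representation in a
function that agrees near the curve with a chart. -/
lemma hasMFDerivAt_of_chartFun {γ : ℝ → N} {t : ℝ} {u : TangentSpace 𝓘(ℝ, VN) (γ t)} {x : N}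
    (hγ : ContinuousAt γ t) (hx : γ t ∈ (chartAt VN x).source)
    (hd : HasDerivAt (fun s => extChartAt 𝓘(ℝ, VN) x (γ s))
      (dirDeriv (extChartAt 𝓘(ℝ, VN) x) (γ t) u) t) :
    HasMFDerivAt 𝓘(ℝ, ℝ) 𝓘(ℝ, VN) γ t ((1 : ℝ →L[ℝ] ℝ).smulRight u) := by
  have hx' : γ t ∈ (extChartAt 𝓘(ℝ, VN) x).source := by rwa [extChartAt_source]
  have ht : extChartAt 𝓘(ℝ, VN) x (γ t) ∈ (extChartAt 𝓘(ℝ, VN) x).target :=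
    (extChartAt 𝓘(ℝ, VN) x).map_source hx'
  have hsm : ContMDiffAt 𝓘(ℝ, VN) 𝓘(ℝ, VN) ∞ (extChartAt 𝓘(ℝ, VN) x).symm
      (extChartAt 𝓘(ℝ, VN) x (γ t)) :=
    (contMDiffOn_extChartAt_symm x).contMDiffAt ((isOpen_extChartAt_target x).mem_nhds ht)
  have hcm : ContMDiffAt 𝓘(ℝ, VN) 𝓘(ℝ, VN) ∞ (extChartAt 𝓘(ℝ, VN) x) (γ t) :=
    contMDiffAt_extChartAt' hx
  have h1 := hsm.mdifferentiableAt (by simp)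
  have h2 := hcm.mdifferentiableAt (by simp)
  have hd' : HasMFDerivAt 𝓘(ℝ, ℝ) 𝓘(ℝ, VN) (fun s => extChartAt 𝓘(ℝ, VN) x (γ s)) t
      ((1 : ℝ →L[ℝ] ℝ).smulRight (dirDeriv (G := VN) (extChartAt 𝓘(ℝ, VN) x) (γ t) u)) :=
    hd.hasFDerivAt.hasMFDerivAt
  have h3 := (h1.hasMFDerivAt.comp t hd')
  have heq : γ =ᶠ[𝓝 t] (extChartAt 𝓘(ℝ, VN) x).symm ∘ fun s => extChartAt 𝓘(ℝ, VN) x (γ s) := by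
    filter_upwards [hγ.preimage_mem_nhds ((chartAt VN x).open_source.mem_nhds hx)] with s hs
    exact ((extChartAt 𝓘(ℝ, VN) x).left_inv (by rwa [extChartAt_source])).symm
  have hid : (extChartAt 𝓘(ℝ, VN) x).symm ∘ (extChartAt 𝓘(ℝ, VN) x) =ᶠ[𝓝 (γ t)] id := by
    filter_upwards [(chartAt VN x).open_source.mem_nhds hx] with y hy
    exact (extChartAt 𝓘(ℝ, VN) x).left_inv (by rwa [extChartAt_source])
  have h4 : mfderiv 𝓘(ℝ, VN) 𝓘(ℝ, VN) (extChartAt 𝓘(ℝ, VN) x).symm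
      (extChartAt 𝓘(ℝ, VN) x (γ t)) (mfderiv 𝓘(ℝ, VN) 𝓘(ℝ, VN) (extChartAt 𝓘(ℝ, VN) x) (γ t) u) =
      u := by
    have h5 := mfderiv_comp (γ t) h1 h2
    rw [hid.mfderiv_eq, mfderiv_id] at h5
    exact (congrArg (fun A => A u) h5).symm
  have h6 := h3.congr_of_eventuallyEq heq
  refine HasMFDerivAt.congr_mfderiv h6 ?_
  ext
  show mfderiv 𝓘(ℝ, VN) 𝓘(ℝ, VN) (extChartAt 𝓘(ℝ, VN) x).symm (extChartAt 𝓘(ℝ, VN) x (γ t))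
    ((1 : ℝ) • dirDeriv (extChartAt 𝓘(ℝ, VN) x) (γ t) u) = (1 : ℝ) • u
  rw [one_smul, one_smul]
  exact h4

/-- A family of tangent vectors that maps smooth functions to smooth functions is a smooth vector
field. -/
def VField.ofDirDeriv (X : ∀ x : N, TangentSpace 𝓘(ℝ, VN) x)
    (hX : ∀ f : SmoothFun VN N, ContMDiff 𝓘(ℝ, VN) 𝓘(ℝ, ℝ) ∞ fun x => dirDeriv f x (X x)) :
    VField VN N :=
  ⟨X, by
    intro x₀
    rw [Bundle.contMDiffAt_section]
    obtain ⟨c, hc, hcx⟩ := exists_chartFun (VN := VN) x₀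
    have h1 : ∀ ℓ : VN →L[ℝ] ℝ,
        ContMDiff 𝓘(ℝ, VN) 𝓘(ℝ, ℝ) ∞ fun x => ℓ (dirDeriv c x (X x)) := fun ℓ => by
      refine (hX ⟨fun y => ℓ (c y), ℓ.contMDiff.comp hc⟩).congr fun x => ?_
      show _ = dirDeriv (fun y => ℓ (c y)) x (X x)
      rw [dirDeriv_comp_fderiv ℓ.differentiableAt ((hc x).mdifferentiableAt (by simp)), ℓ.fderiv]
    have h2 : ContMDiff 𝓘(ℝ, VN) 𝓘(ℝ, VN) ∞ fun x => dirDeriv c x (X x) := by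
      let b := Module.finBasis ℝ VN
      have h3 : (fun x => dirDeriv c x (X x)) = fun x => ∑ i,
          (LinearMap.toContinuousLinearMap (b.coord i)) (dirDeriv c x (X x)) • b i := by
        funext x
        exact (b.sum_repr _).symm
      rw [h3]
      exact contMDiff_finsetSum fun i _ => (h1 _).smul contMDiff_const
    refine (h2 x₀).congr_of_eventuallyEq ?_
    filter_upwards [hcx.eventuallyEq_nhds, (chartAt VN x₀).open_source.mem_nhds
      (mem_chart_source VN x₀)] with x hx hxs
    rw [dirDeriv_congr hx]
    have h4 := (trivializationAt VN (TangentSpace 𝓘(ℝ, VN)) x₀).continuousLinearMapAt_apply_of_mem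
      ℝ (b := x) (by exact hxs) (X x)
    have h5 := TangentBundle.continuousLinearMapAt_trivializationAt (I := 𝓘(ℝ, VN)) hxs
    exact h4.symm.trans (congrArg (fun A => A (X x)) h5)⟩

lemma VField.contMDiff_dirDeriv (X : VField VN N) {g : N → G}
    (hg : ContMDiff 𝓘(ℝ, VN) 𝓘(ℝ, G) ∞ g) :
    ContMDiff 𝓘(ℝ, VN) 𝓘(ℝ, G) ∞ fun x => dirDeriv g x (X x) := by
  have h1 : ContMDiff 𝓘(ℝ, VN) 𝓘(ℝ, VN).tangent ∞
      (fun x => (⟨x, X x⟩ : TangentBundle 𝓘(ℝ, VN) N)) := X.contMDiff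
  have h2 := (hg.contMDiff_tangentMap (m := ∞) (by simp)).comp h1
  exact (contMDiff_snd_tangentBundle_modelSpace G 𝓘(ℝ, G)).comp h2

namespace VField

variable (X : VField VN N)

lemma _root_.SmoothFun.mdifferentiableAt (f : SmoothFun VN N) (x : N) :
    MDifferentiableAt 𝓘(ℝ, VN) 𝓘(ℝ, ℝ) f x := (f.contMDiff x).mdifferentiableAt (by simp)

lemma deriv_add (f g : SmoothFun VN N) : X.deriv (f + g) = X.deriv f + X.deriv g :=
  ContMDiffMap.ext fun x => dirDeriv_add (f.mdifferentiableAt x) (g.mdifferentiableAt x) (X x)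

lemma deriv_sub (f g : SmoothFun VN N) : X.deriv (f - g) = X.deriv f - X.deriv g :=
  ContMDiffMap.ext fun x => dirDeriv_sub (f.mdifferentiableAt x) (g.mdifferentiableAt x) (X x)

lemma deriv_mul (f g : SmoothFun VN N) :
    X.deriv (f * g) = X.deriv f * g + f * X.deriv g :=
  ContMDiffMap.ext fun x => dirDeriv_mul (f.mdifferentiableAt x) (g.mdifferentiableAt x) (X x)

lemma deriv_const (r : ℝ) : X.deriv (algebraMap ℝ (SmoothFun VN N) r) = 0 :=
  ContMDiffMap.ext fun x => dirDeriv_const r x (X x)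

lemma deriv_zero : X.deriv 0 = 0 := by
  have := X.deriv_const 0
  rwa [map_zero] at this

lemma deriv_sum {ι : Type*} (s : Finset ι) (f : ι → SmoothFun VN N) :
    X.deriv (∑ i ∈ s, f i) = ∑ i ∈ s, X.deriv (f i) := by
  classical
  induction s using Finset.induction_on with
  | empty => simp [deriv_zero]
  | insert a s ha ih => rw [Finset.sum_insert ha, Finset.sum_insert ha, deriv_add, ih]

lemma deriv_congr {f g : SmoothFun VN N} {x : N} (h : ∀ᶠ y in 𝓝 x, f y = g y) :
    X.deriv f x = X.deriv g x := dirDeriv_congr h (X x)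

end VField

end Bump

/-- Interchange of the derivative in a parameter with a directional derivative, in a vector space. -/
lemma hasDerivAt_fderiv_param {k : ℝ × VN → G} {τ : ℝ} {z : VN} (hk : ContDiffAt ℝ ∞ k (τ, z))
    (u : VN) : HasDerivAt (fun t => fderiv ℝ (fun z => k (t, z)) z u)
      (fderiv ℝ (fun z => deriv (fun t => k (t, z)) τ) z u) τ := by
  have h2 : ContDiffAt ℝ 2 k (τ, z) := by exact_mod_cast contDiffAt_infty.1 hk 2
  have hev : ∀ᶠ p in 𝓝 (τ, z), DifferentiableAt ℝ k p :=
    (h2.eventually (by simp)).mono fun p hp => hp.differentiableAt (by simp)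
  have hD : DifferentiableAt ℝ (fderiv ℝ k) (τ, z) :=
    (h2.fderiv_right (m := 1) (by norm_num)).differentiableAt (by simp)
  have e1 : ∀ᶠ t in 𝓝 τ, fderiv ℝ (fun z => k (t, z)) z u = fderiv ℝ k (t, z) (0, u) := by
    have : Filter.Tendsto (fun t : ℝ => (t, z)) (𝓝 τ) (𝓝 (τ, z)) :=
      (Continuous.prodMk_left z).continuousAt
    filter_upwards [this.eventually hev] with t ht
    have := (ht.hasFDerivAt.comp z (hasFDerivAt_prodMk_right t z)).fderiv
    exact congrArg (fun A => A u) this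
  have e2 : ∀ᶠ y in 𝓝 z, deriv (fun t => k (t, y)) τ = fderiv ℝ k (τ, y) (1, 0) := by
    have : Filter.Tendsto (fun y : VN => (τ, y)) (𝓝 z) (𝓝 (τ, z)) :=
      (Continuous.prodMk_right τ).continuousAt
    filter_upwards [this.eventually hev] with y hy
    have := (hy.hasFDerivAt.comp τ (hasFDerivAt_prodMk_left τ y)).hasDerivAt.deriv
    simpa [Function.comp_def] using this
  have d1 : HasDerivAt (fun t => fderiv ℝ k (t, z) (0, u))
      (fderiv ℝ (fderiv ℝ k) (τ, z) (1, 0) (0, u)) τ := by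
    have h := hD.hasFDerivAt.comp_hasDerivAt τ ((hasDerivAt_id τ).prodMk (hasDerivAt_const τ z))
    exact (ContinuousLinearMap.apply ℝ G ((0 : ℝ), u)).hasFDerivAt.comp_hasDerivAt τ h
  have d2 : fderiv ℝ (fun y => deriv (fun t => k (t, y)) τ) z u =
      fderiv ℝ (fderiv ℝ k) (τ, z) (0, u) (1, 0) := by
    have h3 : (fun y => deriv (fun t => k (t, y)) τ) =ᶠ[𝓝 z] fun y => fderiv ℝ k (τ, y) (1, 0) := e2
    rw [h3.fderiv_eq]
    have h := hD.hasFDerivAt.comp z (hasFDerivAt_prodMk_right τ z)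
    have h' := ((ContinuousLinearMap.apply ℝ G ((1 : ℝ), (0 : VN))).hasFDerivAt.comp z h).fderiv
    exact congrArg (fun A => A u) h'
  rw [d2, (h2.isSymmSndFDerivAt (by simp)).eq (0, u) (1, 0)]
  exact d1.congr_of_eventuallyEq e1

/-- Interchange of the derivative in a parameter with a directional derivative on a manifold. -/
lemma hasDerivAt_dirDeriv_param [IsManifold 𝓘(ℝ, VN) ∞ N] {K : ℝ × N → G} {τ : ℝ} {x : N}
    (hK : ContMDiffAt (𝓘(ℝ, ℝ).prod 𝓘(ℝ, VN)) 𝓘(ℝ, G) ∞ K (τ, x)) (u : TangentSpace 𝓘(ℝ, VN) x) :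
    HasDerivAt (fun t => dirDeriv (fun y => K (t, y)) x u)
      (dirDeriv (fun y => deriv (fun t => K (t, y)) τ) x u) τ := by
  let c := extChartAt 𝓘(ℝ, VN) x
  let k : ℝ × VN → G := fun p => K (p.1, c.symm p.2)
  have hcx : c.symm (c x) = x := extChartAt_to_inv x
  have hk : ContDiffAt ℝ ∞ k (τ, c x) := by
    have h1 : ContMDiffAt 𝓘(ℝ, VN) 𝓘(ℝ, VN) ∞ c.symm (c x) :=
      (contMDiffOn_extChartAt_symm x).contMDiffAt (extChartAt_target_mem_nhds x)
    have h2 : ContMDiffAt (𝓘(ℝ, ℝ).prod 𝓘(ℝ, VN)) (𝓘(ℝ, ℝ).prod 𝓘(ℝ, VN)) ∞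
        (fun p : ℝ × VN => (p.1, c.symm p.2)) (τ, c x) :=
      contMDiffAt_fst.prodMk (ContMDiffAt.comp (τ, c x) h1 contMDiffAt_snd)
    have h3 : ContMDiffAt (𝓘(ℝ, ℝ).prod 𝓘(ℝ, VN)) 𝓘(ℝ, G) ∞ k (τ, c x) := by
      refine ContMDiffAt.comp (τ, c x) ?_ h2
      rwa [show ((τ, c x) : ℝ × VN).2 = c x from rfl, hcx]
    rw [← modelWithCornersSelf_prod] at h3
    exact contMDiffAt_iff_contDiffAt.1 (chartedSpaceSelf_prod (H := ℝ) (H' := VN) ▸ h3)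
  have hKk : ∀ᶠ y in 𝓝 x, ∀ t, K (t, y) = k (t, c y) := by
    filter_upwards [extChartAt_source_mem_nhds (I := 𝓘(ℝ, VN)) x] with y hy t
    show K (t, y) = K (t, c.symm (c y))
    rw [c.left_inv hy]
  have hcd : MDifferentiableAt 𝓘(ℝ, VN) 𝓘(ℝ, VN) c x :=
    contMDiffAt_extChartAt.mdifferentiableAt (n := ∞) (by simp)
  have hcu : dirDeriv (G := VN) c x u = (u : VN) := by
    unfold dirDeriv
    rw [mfderiv_extChartAt_self]
    rfl
  have h2 : ContDiffAt ℝ 2 k (τ, c x) := by exact_mod_cast contDiffAt_infty.1 hk 2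
  have hev : ∀ᶠ p in 𝓝 (τ, c x), ContDiffAt ℝ 2 k p := h2.eventually (by simp)
  have hD : DifferentiableAt ℝ (fun y => deriv (fun t => k (t, y)) τ) (c x) := by
    have : Filter.Tendsto (fun y : VN => (τ, y)) (𝓝 (c x)) (𝓝 (τ, c x)) :=
      (Continuous.prodMk_right τ).continuousAt
    have e2 : (fun y => deriv (fun t => k (t, y)) τ) =ᶠ[𝓝 (c x)]
        fun y => fderiv ℝ k (τ, y) (1, 0) := by
      filter_upwards [this.eventually hev] with y hy
      have := ((hy.differentiableAt (by simp)).hasFDerivAt.comp τ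
        (hasFDerivAt_prodMk_left τ y)).hasDerivAt.deriv
      simpa [Function.comp_def] using this
    refine DifferentiableAt.congr_of_eventuallyEq ?_ e2
    have hd : DifferentiableAt ℝ (fderiv ℝ k) (τ, c x) :=
      (h2.fderiv_right (m := 1) (by norm_num)).differentiableAt (by simp)
    exact (hd.comp (c x) (hasFDerivAt_prodMk_right τ (c x)).differentiableAt).clm_apply
      (differentiableAt_const _)
  have key := hasDerivAt_fderiv_param hk (u : VN)
  have r1 : dirDeriv (fun y => deriv (fun t => K (t, y)) τ) x u =
      fderiv ℝ (fun z => deriv (fun t => k (t, z)) τ) (c x) u := by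
    have h3 : (fun y => deriv (fun t => K (t, y)) τ) =ᶠ[𝓝 x]
        fun y => deriv (fun t => k (t, c y)) τ := by
      filter_upwards [hKk] with y hy
      simp only [hy]
    rw [dirDeriv_congr h3]
    have := dirDeriv_comp_fderiv (g := fun z => deriv (fun t => k (t, z)) τ) hD hcd u
    rwa [hcu] at this
  have r2 : ∀ᶠ t in 𝓝 τ, dirDeriv (fun y => K (t, y)) x u =
      fderiv ℝ (fun z => k (t, z)) (c x) u := by
    have : Filter.Tendsto (fun t : ℝ => (t, c x)) (𝓝 τ) (𝓝 (τ, c x)) :=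
      (Continuous.prodMk_left _).continuousAt
    filter_upwards [this.eventually hev] with t ht
    have h3 : (fun y => K (t, y)) =ᶠ[𝓝 x] fun y => k (t, c y) := hKk.mono fun y hy => hy t
    have h4 : DifferentiableAt ℝ (fun z => k (t, z)) (c x) :=
      (ht.differentiableAt (by simp)).comp (c x) (hasFDerivAt_prodMk_right t (c x)).differentiableAt
    rw [dirDeriv_congr h3]
    have := dirDeriv_comp_fderiv (g := fun z => k (t, z)) h4 hcd u
    rwa [hcu] at this
  rw [r1]
  exact key.congr_of_eventuallyEq r2

end Calculus

/-! ### Flows of vector fields on manifolds -/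

section Flows

variable {VN : Type*} [NormedAddCommGroup VN] [NormedSpace ℝ VN] [FiniteDimensional ℝ VN]
  {N : Type*} [TopologicalSpace N] [ChartedSpace VN N] [IsManifold 𝓘(ℝ, VN) ∞ N] [T2Space N]
  {G : Type*} [NormedAddCommGroup G] [NormedSpace ℝ G]
  {VP : Type*} [NormedAddCommGroup VP] [NormedSpace ℝ VP] [FiniteDimensional ℝ VP]
  {P : Type*} [TopologicalSpace P] [ChartedSpace VP P] [IsManifold 𝓘(ℝ, VP) ∞ P] [T2Space P]

namespace VField

variable (X : VField VN N)

/-- The point `x` lies in the domain of the time `t` flow of `X`. -/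
def Defined (t : ℝ) (x : N) : Prop := ∃ y, X.FlowsTo t x y

open Classical in
/-- The flow `φ_t x` of `X`, with value `x` outside of its domain. -/
def flow (t : ℝ) (x : N) : N := if h : X.Defined t x then h.choose else x

lemma contMDiff_one : ContMDiff 𝓘(ℝ, VN) 𝓘(ℝ, VN).tangent 1
    (fun x => (⟨x, X x⟩ : TangentBundle 𝓘(ℝ, VN) N)) :=
  X.contMDiff.of_le (by norm_num)

variable {X}

lemma FlowsTo.unique {t : ℝ} {x y y' : N} (h : X.FlowsTo t x y) (h' : X.FlowsTo t x y') :
    y = y' := by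
  obtain ⟨γ, a, b, h0, ht, hγ, hx, rfl⟩ := h
  obtain ⟨γ', a', b', h0', ht', hγ', hx', rfl⟩ := h'
  have := isMIntegralCurveOn_Ioo_eqOn_of_contMDiff_boundaryless
    (a := max a a') (b := min b b') (t₀ := 0)
    ⟨max_lt h0.1 h0'.1, lt_min h0.2 h0'.2⟩ X.contMDiff_one
    (hγ.mono (Ioo_subset_Ioo (le_max_left ..) (min_le_left ..)))
    (hγ'.mono (Ioo_subset_Ioo (le_max_right ..) (min_le_right ..))) (hx.trans hx'.symm)
  exact this ⟨max_lt ht.1 ht'.1, lt_min ht.2 ht'.2⟩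

lemma FlowsTo.defined {t : ℝ} {x y : N} (h : X.FlowsTo t x y) : X.Defined t x := ⟨y, h⟩

lemma Defined.flowsTo {t : ℝ} {x : N} (h : X.Defined t x) : X.FlowsTo t x (X.flow t x) := by
  unfold flow
  rw [dif_pos h]
  exact h.choose_spec

lemma FlowsTo.flow_eq {t : ℝ} {x y : N} (h : X.FlowsTo t x y) : X.flow t x = y :=
  h.defined.flowsTo.unique h

lemma flowsTo_of_isMIntegralCurveOn {γ : ℝ → N} {a b t : ℝ} (h0 : (0 : ℝ) ∈ Ioo a b)
    (hγ : IsMIntegralCurveOn (I := 𝓘(ℝ, VN)) γ (fun z => X z) (Ioo a b)) (ht : t ∈ Ioo a b) :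
    X.FlowsTo t (γ 0) (γ t) := ⟨γ, a, b, h0, ht, hγ, rfl, rfl⟩

/-- Concatenation of integral curves. -/
lemma FlowsTo.trans {s t : ℝ} {x y z : N} (h : X.FlowsTo s x y) (h' : X.FlowsTo t y z) :
    X.FlowsTo (s + t) x z := by
  obtain ⟨γ, a, b, h0, hs, hγ, hx, hy⟩ := h
  obtain ⟨γ', a', b', h0', ht, hγ', hy', hz⟩ := h'
  have h1 := hγ'.comp_add (-s)
  have hset : {t | t + -s ∈ Ioo a' b'} = Ioo (a' + s) (b' + s) := by
    ext r
    simp only [mem_ofPred_eq, mem_Ioo]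
    constructor <;> rintro ⟨h1, h2⟩ <;> constructor <;> linarith
  rw [hset] at h1
  have hs' : s ∈ Ioo a b ∩ Ioo (a' + s) (b' + s) :=
    ⟨hs, by linarith [h0'.1], by linarith [h0'.2]⟩
  have heq : γ s = (γ' ∘ (· + -s)) s := by simp [hy, hy']
  have h2 := isMIntegralCurveOn_piecewise X.contMDiff_one hγ h1 hs' heq
  have h3 := eqOn_piecewise_of_isMIntegralCurveOn_Ioo X.contMDiff_one hγ h1 hs' heq
  rw [Ioo_union_Ioo' (hs'.2.1.trans hs.2) (hs.1.trans hs'.2.2)] at h2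
  have hst : s + t ∈ Ioo (a' + s) (b' + s) := ⟨by linarith [ht.1], by linarith [ht.2]⟩
  refine ⟨_, _, _, ⟨min_lt_of_left_lt h0.1, lt_max_of_lt_left h0.2⟩,
    ⟨min_lt_of_right_lt hst.1, lt_max_of_lt_right hst.2⟩, h2, ?_, ?_⟩
  · rw [piecewise, if_pos h0, hx]
  · rw [h3 hst]
    simp [hz]

lemma FlowsTo.symm {t : ℝ} {x y : N} (h : X.FlowsTo t x y) : X.FlowsTo (-t) y x := by
  obtain ⟨γ, a, b, h0, ht, hγ, hx, hy⟩ := h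
  have h1 := hγ.comp_add t
  have hset : {r | r + t ∈ Ioo a b} = Ioo (a - t) (b - t) := by
    ext r
    simp only [mem_ofPred_eq, mem_Ioo]
    constructor <;> rintro ⟨h1, h2⟩ <;> constructor <;> linarith
  rw [hset] at h1
  exact ⟨_, _, _, ⟨by linarith [ht.1], by linarith [ht.2]⟩,
    ⟨by linarith [h0.1], by linarith [h0.2]⟩, h1, by simp [hy], by simp [hx]⟩

/-- The integral curve through a point of the domain of the time `t` flow is `s ↦ φ_s x` near times
between `0` and `t`. -/
lemma Defined.exists_Ioo {t : ℝ} {x : N} (h : X.Defined t x) : ∃ a b : ℝ, (0 : ℝ) ∈ Ioo a b ∧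
    t ∈ Ioo a b ∧ (∀ s ∈ Ioo a b, X.Defined s x) ∧
    IsMIntegralCurveOn (I := 𝓘(ℝ, VN)) (fun s => X.flow s x) (fun z => X z) (Ioo a b) := by
  obtain ⟨y, γ, a, b, h0, ht, hγ, rfl, rfl⟩ := h
  have h1 : ∀ s ∈ Ioo a b, X.FlowsTo s (γ 0) (γ s) := fun s hs =>
    flowsTo_of_isMIntegralCurveOn h0 hγ hs
  refine ⟨a, b, h0, ht, fun s hs => (h1 s hs).defined, fun s hs => ?_⟩
  have h2 : X.flow s (γ 0) = γ s := (h1 s hs).flow_eq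
  have h3 : HasMFDerivWithinAt 𝓘(ℝ, ℝ) 𝓘(ℝ, VN) γ (Ioo a b) s
    ((1 : ℝ →L[ℝ] ℝ).smulRight (X (γ s))) := hγ s hs
  rw [← h2] at h3
  refine HasMFDerivWithinAt.congr_of_eventuallyEq h3 ?_ h2
  filter_upwards [self_mem_nhdsWithin] with r hr using (h1 r hr).flow_eq

lemma Defined.hasMFDerivAt {t : ℝ} {x : N} (h : X.Defined t x) :
    HasMFDerivAt 𝓘(ℝ, ℝ) 𝓘(ℝ, VN) (fun s => X.flow s x) t
      ((1 : ℝ →L[ℝ] ℝ).smulRight (X (X.flow t x))) := by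
  obtain ⟨a, b, -, ht, -, hγ⟩ := h.exists_Ioo
  exact (hγ t ht).hasMFDerivAt (isOpen_Ioo.mem_nhds ht)

lemma Defined.eventually {t : ℝ} {x : N} (h : X.Defined t x) : ∀ᶠ s in 𝓝 t, X.Defined s x := by
  obtain ⟨a, b, -, ht, hd, -⟩ := h.exists_Ioo
  filter_upwards [isOpen_Ioo.mem_nhds ht] with s hs using hd s hs

/-- Derivative of a function along the flow. -/
lemma Defined.hasDerivAt {t : ℝ} {x : N} (h : X.Defined t x) {g : N → G}
    (hg : MDifferentiableAt 𝓘(ℝ, VN) 𝓘(ℝ, G) g (X.flow t x)) :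
    HasDerivAt (fun s => g (X.flow s x)) (dirDeriv g (X.flow t x) (X (X.flow t x))) t :=
  hasDerivAt_comp_curve (γ := fun s => X.flow s x) hg h.hasMFDerivAt

/-- Near every point the flow is defined for a uniform time and jointly smooth. -/
lemma exists_local_flow (X : VField VN N) (x₀ : N) : ∃ (ε : ℝ) (Q : Set N), 0 < ε ∧ IsOpen Q ∧
    x₀ ∈ Q ∧ ∀ x ∈ Q, ∀ t ∈ Ioo (-ε) ε, X.Defined t x ∧
      ContMDiffAt (𝓘(ℝ, ℝ).prod 𝓘(ℝ, VN)) 𝓘(ℝ, VN) ∞ (fun p : ℝ × N => X.flow p.1 p.2) (t, x) := by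
  obtain ⟨g, hg, hgx⟩ := exists_chartFun (VN := VN) x₀
  obtain ⟨B, hBg, hB, hxB⟩ := mem_nhds_iff.1 (Filter.inter_mem hgx
    ((chartAt VN x₀).open_source.mem_nhds (mem_chart_source VN x₀)))
  let c := extChartAt 𝓘(ℝ, VN) x₀
  have hcsrc : ∀ y ∈ B, y ∈ c.source := fun y hy => by
    rw [extChartAt_source]; exact (hBg hy).2
  have hgc : ∀ y ∈ B, g =ᶠ[𝓝 y] c := fun y hy => by
    filter_upwards [hB.mem_nhds hy] with z hz using (hBg hz).1
  let O : Set VN := c.target ∩ c.symm ⁻¹' B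
  have hO : IsOpen O :=
    (continuousOn_extChartAt_symm x₀).isOpen_inter_preimage (isOpen_extChartAt_target x₀) hB
  -- the vector field in the chart
  let v : VN → VN := fun z => dirDeriv g (c.symm z) (X (c.symm z))
  have hv : ContDiffOn ℝ ∞ v O := by
    rw [← contMDiffOn_iff_contDiffOn]
    exact (X.contMDiff_dirDeriv hg).comp_contMDiffOn
      ((contMDiffOn_extChartAt_symm x₀).mono inter_subset_left)
  have hcO : ∀ y ∈ B, c y ∈ O := fun y hy =>
    ⟨c.map_source (hcsrc y hy), by
      show c.symm (c y) ∈ B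
      rwa [c.left_inv (hcsrc y hy)]⟩
  obtain ⟨ε, Q, Φ, hε, hQ, hxQ, hΦ⟩ := exists_smooth_local_flow hO hv (hcO x₀ hxB)
  have hcsm : ∀ z ∈ O, ContMDiffAt 𝓘(ℝ, VN) 𝓘(ℝ, VN) ∞ c.symm z := fun z hz =>
    (contMDiffOn_extChartAt_symm x₀).contMDiffAt ((isOpen_extChartAt_target x₀).mem_nhds hz.1)
  have hQ' : IsOpen (B ∩ c ⁻¹' Q) :=
    ((continuousOn_extChartAt x₀).mono hcsrc).isOpen_inter_preimage hB hQ
  have h0 : (0 : ℝ) ∈ Ioo (-ε) ε := ⟨by linarith, hε⟩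
  have key : ∀ x ∈ B ∩ c ⁻¹' Q, ∀ t ∈ Ioo (-ε) ε, X.FlowsTo t x (c.symm (Φ (t, c x))) := by
    rintro x ⟨hxB, hxQ⟩ t ht
    refine ⟨fun s => c.symm (Φ (s, c x)), -ε, ε, h0, ht, fun s hs => ?_, ?_, rfl⟩
    · obtain ⟨h1, h2, h3⟩ := (hΦ (c x) hxQ).2 s hs
      refine HasMFDerivAt.hasMFDerivWithinAt ?_
      have hcont : ContinuousAt (fun s => c.symm (Φ (s, c x))) s :=
        ContinuousAt.comp (f := fun s => Φ (s, c x)) (hcsm _ h2).continuousAt h3.continuousAt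
      refine hasMFDerivAt_of_chartFun (x := x₀) hcont (hBg h2.2).2 ?_
      have h4 : (fun r => extChartAt 𝓘(ℝ, VN) x₀ (c.symm (Φ (r, c x)))) =ᶠ[𝓝 s]
          fun r => Φ (r, c x) := by
        filter_upwards [h3.continuousAt.preimage_mem_nhds
          ((isOpen_extChartAt_target x₀).mem_nhds h2.1)] with r hr
        exact c.right_inv hr
      rw [← dirDeriv_congr (hgc _ h2.2)]
      exact h3.congr_of_eventuallyEq h4
    · show c.symm (Φ (0, c x)) = x
      rw [(hΦ (c x) hxQ).1, c.left_inv (hcsrc x hxB)]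
  refine ⟨ε, B ∩ c ⁻¹' Q, hε, hQ', ⟨hxB, hxQ⟩, fun x hx t ht => ⟨(key x hx t ht).defined, ?_⟩⟩
  have h1 : (fun p : ℝ × N => X.flow p.1 p.2) =ᶠ[𝓝 (t, x)] fun p => c.symm (Φ (p.1, c p.2)) := by
    filter_upwards [(isOpen_Ioo.prod hQ').mem_nhds (mk_mem_prod ht hx)] with p hp
    exact (key p.2 hp.2 p.1 hp.1).flow_eq
  refine ContMDiffAt.congr_of_eventuallyEq ?_ h1
  obtain ⟨h2, h3, -⟩ := (hΦ (c x) hx.2).2 t ht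
  have h4 : ContMDiffAt (𝓘(ℝ, ℝ).prod 𝓘(ℝ, VN)) 𝓘(ℝ, VN) ∞ (fun p : ℝ × N => c p.2) (t, x) :=
    ContMDiffAt.comp (t, x) (contMDiffAt_extChartAt' (hBg hx.1).2) contMDiffAt_snd
  have h5 : ContMDiffAt (𝓘(ℝ, ℝ).prod 𝓘(ℝ, VN)) 𝓘(ℝ, ℝ × VN) ∞ (fun p : ℝ × N => (p.1, c p.2))
      (t, x) := contMDiffAt_fst.prodMk_space h4
  exact ContMDiffAt.comp (t, x) (hcsm _ h3) (ContMDiffAt.comp (t, x) h2.contMDiffAt h5)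

lemma defined_zero (X : VField VN N) (x : N) : X.Defined 0 x := by
  obtain ⟨ε, Q, hε, -, hx, h⟩ := X.exists_local_flow x
  exact (h x hx 0 ⟨by linarith, hε⟩).1

lemma flow_zero (X : VField VN N) (x : N) : X.flow 0 x = x := by
  obtain ⟨-, γ, a, b, h0, -, hγ, hx, -⟩ := X.defined_zero x
  exact FlowsTo.flow_eq ⟨γ, a, b, h0, h0, hγ, hx, hx⟩

end VField

/-- A property of times that is locally constant along a connected set propagates. -/
lemma IsPreconnected.propagate {s : Set ℝ} (hs : IsPreconnected s) {p : ℝ → Prop}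
    (h : ∀ τ ∈ s, ∃ O ∈ 𝓝 τ, ∀ t₁ ∈ O, ∀ t₂ ∈ O, p t₁ → p t₂) {t₁ t₂ : ℝ} (h₁ : t₁ ∈ s)
    (h₂ : t₂ ∈ s) (hp : p t₁) : p t₂ := by
  refine hs.induction₂' (fun a b => p a → p b) (fun τ hτ => ?_)
    (fun _ _ _ _ _ _ h h' => h' ∘ h) h₁ h₂ hp
  obtain ⟨O, hO, hp⟩ := h τ hτ
  filter_upwards [mem_nhdsWithin_of_mem_nhds hO] with y hy
  exact ⟨hp _ (mem_of_mem_nhds hO) _ hy, hp _ hy _ (mem_of_mem_nhds hO)⟩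

namespace VField

variable {X : VField VN N}

/-- The domain of the flow is open and the flow is jointly smooth there. -/
theorem Defined.eventually_contMDiffAt {t : ℝ} {x : N} (h : X.Defined t x) :
    ∀ᶠ p in 𝓝 (t, x), X.Defined p.1 p.2 ∧
      ContMDiffAt (𝓘(ℝ, ℝ).prod 𝓘(ℝ, VN)) 𝓘(ℝ, VN) ∞ (fun p : ℝ × N => X.flow p.1 p.2) p := by
  obtain ⟨a, b, h0, ht, hd, hγ⟩ := h.exists_Ioo
  -- propagate along the integral curve by composing with the local flow near `φ_τ x`
  refine isPreconnected_Ioo.propagate (s := Ioo a b) (p := fun τ => ∀ᶠ p in 𝓝 (τ, x),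
    X.Defined p.1 p.2 ∧ ContMDiffAt (𝓘(ℝ, ℝ).prod 𝓘(ℝ, VN)) 𝓘(ℝ, VN) ∞
      (fun p : ℝ × N => X.flow p.1 p.2) p) (fun τ hτ => ?_) h0 ht ?_
  · obtain ⟨ε, Q, hε, hQ, hxQ, hloc⟩ := X.exists_local_flow (X.flow τ x)
    have hcont : ContinuousAt (fun s => X.flow s x) τ := (hd τ hτ).hasMFDerivAt.continuousAt
    refine ⟨_, Filter.inter_mem (Metric.ball_mem_nhds τ (half_pos hε))
      (hcont.preimage_mem_nhds (hQ.mem_nhds hxQ)), fun t₁ h₁ t₂ h₂ hp => ?_⟩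
    have hδ : t₂ - t₁ ∈ Ioo (-ε) ε := by
      have h3 := h₁.1
      have h4 := h₂.1
      rw [Metric.mem_ball, Real.dist_eq, abs_lt] at h3 h4
      exact ⟨by linarith [h3.2, h4.1], by linarith [h3.1, h4.2]⟩
    have hshift : Filter.Tendsto (fun p : ℝ × N => (p.1 - (t₂ - t₁), p.2)) (𝓝 (t₂, x))
        (𝓝 (t₁, x)) := by
      have : Continuous fun p : ℝ × N => (p.1 - (t₂ - t₁), p.2) := by fun_prop
      have h3 := this.continuousAt (x := (t₂, x))
      simpa [ContinuousAt] using h3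
    have hQ1 : ∀ᶠ p in 𝓝 (t₁, x), X.flow p.1 p.2 ∈ Q :=
      hp.self_of_nhds.2.continuousAt.preimage_mem_nhds (hQ.mem_nhds h₁.2)
    have hall : ∀ᶠ p in 𝓝 (t₂, x), X.FlowsTo p.1 p.2
        (X.flow (t₂ - t₁) (X.flow (p.1 - (t₂ - t₁)) p.2)) := by
      filter_upwards [hshift.eventually (hp.and hQ1)] with p hp'
      have h3 := hp'.1.1.flowsTo.trans (hloc _ hp'.2 _ hδ).1.flowsTo
      simpa using h3
    filter_upwards [hshift.eventually (hp.and hQ1), hall, hall.eventually_nhds] with p hp' hp2 hp3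
    refine ⟨hp2.defined, ?_⟩
    have h4 : (fun p : ℝ × N => X.flow p.1 p.2) =ᶠ[𝓝 p]
        fun p => X.flow (t₂ - t₁) (X.flow (p.1 - (t₂ - t₁)) p.2) :=
      hp3.mono fun q hq => hq.flow_eq
    refine ContMDiffAt.congr_of_eventuallyEq ?_ h4
    have h5 : ContMDiffAt (𝓘(ℝ, ℝ).prod 𝓘(ℝ, VN)) (𝓘(ℝ, ℝ).prod 𝓘(ℝ, VN)) ∞
        (fun p : ℝ × N => (p.1 - (t₂ - t₁), p.2)) p :=
      (contMDiffAt_fst.sub contMDiffAt_const).prodMk contMDiffAt_snd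
    have h6 := ContMDiffAt.comp p hp'.1.2 h5
    have h7 : ContMDiffAt (𝓘(ℝ, ℝ).prod 𝓘(ℝ, VN)) (𝓘(ℝ, ℝ).prod 𝓘(ℝ, VN)) ∞
        (fun p : ℝ × N => (t₂ - t₁, X.flow (p.1 - (t₂ - t₁)) p.2)) p :=
      contMDiffAt_const.prodMk h6
    exact ContMDiffAt.comp p (hloc _ hp'.2 _ hδ).2 h7
  · obtain ⟨ε, Q, hε, hQ, hxQ, hloc⟩ := X.exists_local_flow x
    filter_upwards [(isOpen_Ioo.prod hQ).mem_nhds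
      (mk_mem_prod (⟨by linarith, hε⟩ : (0 : ℝ) ∈ Ioo (-ε) ε) hxQ)] with p hp
    exact hloc p.2 hp.2 p.1 hp.1

lemma Defined.contMDiffAt {t : ℝ} {x : N} (h : X.Defined t x) :
    ContMDiffAt (𝓘(ℝ, ℝ).prod 𝓘(ℝ, VN)) 𝓘(ℝ, VN) ∞ (fun p : ℝ × N => X.flow p.1 p.2) (t, x) :=
  h.eventually_contMDiffAt.self_of_nhds.2

lemma Defined.contMDiffAt_flow {t : ℝ} {x : N} (h : X.Defined t x) :
    ContMDiffAt 𝓘(ℝ, VN) 𝓘(ℝ, VN) ∞ (X.flow t) x :=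
  ContMDiffAt.comp x h.contMDiffAt (contMDiffAt_const.prodMk contMDiffAt_id)

lemma isOpen_defined (X : VField VN N) (t : ℝ) : IsOpen {x | X.Defined t x} := by
  rw [isOpen_iff_mem_nhds]
  intro x hx
  have h1 : Filter.Tendsto (fun y : N => (t, y)) (𝓝 x) (𝓝 (t, x)) :=
    (Continuous.prodMk_right t).continuousAt
  filter_upwards [h1.eventually hx.eventually_contMDiffAt] with y hy using hy.1

/-- Related vector fields have related flows. -/
lemma FlowsTo.map {Y : VField VP P} {F : N → P} (hF : ContMDiff 𝓘(ℝ, VN) 𝓘(ℝ, VP) ∞ F)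
    (hXY : ∀ x, mfderiv 𝓘(ℝ, VN) 𝓘(ℝ, VP) F x (X x) = Y (F x)) {t : ℝ} {x y : N}
    (h : X.FlowsTo t x y) : Y.FlowsTo t (F x) (F y) := by
  obtain ⟨γ, a, b, h0, ht, hγ, rfl, rfl⟩ := h
  refine ⟨fun s => F (γ s), a, b, h0, ht, fun s hs => ?_, rfl, rfl⟩
  have h1 := (((hF (γ s)).mdifferentiableAt (by simp)).hasMFDerivAt.comp_hasMFDerivWithinAt s
    (hγ s hs))
  refine HasMFDerivWithinAt.congr_mfderiv h1 ?_
  ext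
  show mfderiv 𝓘(ℝ, VN) 𝓘(ℝ, VP) F (γ s) ((1 : ℝ) • X (γ s)) = (1 : ℝ) • Y (F (γ s))
  rw [one_smul, one_smul]
  exact hXY _

end VField

end Flows

/-! ### Vector bundles: frames, fibrewise linear functions, homogeneity -/

namespace VBundle

variable {VV : Type*} [NormedAddCommGroup VV] [NormedSpace ℝ VV]
  {V : Type*} [TopologicalSpace V] [ChartedSpace VV V]
  {VN : Type*} [NormedAddCommGroup VN] [NormedSpace ℝ VN]
  {N : Type*} [TopologicalSpace N] [ChartedSpace VN N]
  {VX : Type*} [NormedAddCommGroup VX] [NormedSpace ℝ VX]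
  {X : Type*} [TopologicalSpace X] [ChartedSpace VX X]
  (B : VBundle VV V VN N)

lemma smul_smul' (r s : ℝ) (v : V) : B.smul r (B.smul s v) = B.smul (r * s) v := by
  obtain ⟨c, hi, -, -, hm⟩ := B.exists_fibreCoord (B.proj v)
  refine hi _ _ ((B.proj_smul _ _).trans (B.proj_smul _ _)) (B.proj_smul _ _) ?_
  rw [hm _ _ (B.proj_smul _ _), hm _ _ rfl, hm _ _ rfl, smul_smul]

lemma one_smul' (v : V) : B.smul 1 v = v := by
  obtain ⟨c, hi, -, -, hm⟩ := B.exists_fibreCoord (B.proj v)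
  exact hi _ _ (B.proj_smul _ _) rfl (by rw [hm _ _ rfl, one_smul])

lemma contMDiff_smul (r : ℝ) : ContMDiff 𝓘(ℝ, VV) 𝓘(ℝ, VV) ∞ (B.smul r) :=
  B.contMDiff_smul_comp (r := fun _ => r) contMDiff_const contMDiff_id

lemma contMDiff_zero : ContMDiff 𝓘(ℝ, VN) 𝓘(ℝ, VV) ∞ B.zero :=
  B.contMDiff_zero_comp contMDiff_id

/-- The curve `r ↦ r v` is smooth. -/
lemma contMDiff_smul_curve (v : V) : ContMDiff 𝓘(ℝ, ℝ) 𝓘(ℝ, VV) ∞ fun r : ℝ => B.smul r v :=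
  B.contMDiff_smul_comp (r := fun r : ℝ => r) contMDiff_id contMDiff_const

/-- The pull-back of a function on the base to the total space. -/
def pull (f : SmoothFun VN N) : SmoothFun VV V :=
  ⟨fun v => f (B.proj v), f.contMDiff.comp B.contMDiff_proj⟩

lemma pull_apply (f : SmoothFun VN N) (v : V) : B.pull f v = f (B.proj v) := rfl

section FibreLinear

variable {B} {φ ψ : SmoothFun VV V}

lemma IsFibreLinear.add (hφ : B.IsFibreLinear φ) (hψ : B.IsFibreLinear ψ) :
    B.IsFibreLinear (φ + ψ) := by
  refine ⟨fun v w h => ?_, fun r v => ?_⟩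
  · show φ _ + ψ _ = φ v + ψ v + (φ w + ψ w)
    rw [hφ.1 v w h, hψ.1 v w h]; ring
  · show φ _ + ψ _ = r * (φ v + ψ v)
    rw [hφ.2, hψ.2]; ring

lemma IsFibreLinear.pull_mul (f : SmoothFun VN N) (hφ : B.IsFibreLinear φ) :
    B.IsFibreLinear (B.pull f * φ) := by
  refine ⟨fun v w h => ?_, fun r v => ?_⟩
  · show f _ * φ _ = f _ * φ v + f _ * φ w
    rw [hφ.1 v w h, B.proj_add _ _ h, h]; ring
  · show f _ * φ _ = r * (f _ * φ v)
    rw [hφ.2, B.proj_smul]; ring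

variable (B) in
lemma isFibreLinear_zero : B.IsFibreLinear (0 : SmoothFun VV V) := by
  refine ⟨fun v w h => ?_, fun r v => ?_⟩
  · show (0 : ℝ) = 0 + 0
    ring
  · show (0 : ℝ) = r * 0
    ring

lemma IsFibreLinear.neg (hφ : B.IsFibreLinear φ) : B.IsFibreLinear (-φ) := by
  refine ⟨fun v w h => ?_, fun r v => ?_⟩
  · show -φ _ = -φ v + -φ w
    rw [hφ.1 v w h]; ring
  · show -φ _ = r * -φ v
    rw [hφ.2]; ring

lemma IsFibreLinear.sub (hφ : B.IsFibreLinear φ) (hψ : B.IsFibreLinear ψ) :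
    B.IsFibreLinear (φ - ψ) := by
  rw [sub_eq_add_neg]; exact hφ.add hψ.neg

lemma IsFibreLinear.sum {ι : Type*} (s : Finset ι) {φ : ι → SmoothFun VV V}
    (h : ∀ i ∈ s, B.IsFibreLinear (φ i)) : B.IsFibreLinear (∑ i ∈ s, φ i) := by
  classical
  induction s using Finset.induction_on with
  | empty => simpa using B.isFibreLinear_zero
  | insert a s ha ih =>
    rw [Finset.sum_insert ha]
    exact (h a (Finset.mem_insert_self a s)).add
      (ih fun i hi => h i (Finset.mem_insert_of_mem hi))

lemma IsFibreLinear.apply_zero (hφ : B.IsFibreLinear φ) (x : N) : φ (B.zero x) = 0 := by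
  have := hφ.2 0 (B.zero x)
  rwa [B.smul_zero', zero_mul] at this

section Along

variable {h : C^∞⟮𝓘(ℝ, VX), X; 𝓘(ℝ, VN), N⟯}

lemma IsFibreLinear.sec_add (hφ : B.IsFibreLinear φ) (s t : B.SecAlong h) (x : X) :
    φ ((s + t) x) = φ (s x) + φ (t x) :=
  hφ.1 _ _ ((s.proj_apply x).trans (t.proj_apply x).symm)

lemma IsFibreLinear.sec_smul (hφ : B.IsFibreLinear φ) (f : SmoothFun VX X) (s : B.SecAlong h)
    (x : X) : φ ((f • s) x) = f x * φ (s x) := hφ.2 _ _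

lemma IsFibreLinear.sec_zero (hφ : B.IsFibreLinear φ) (x : X) :
    φ ((0 : B.SecAlong h) x) = 0 := hφ.apply_zero _

lemma IsFibreLinear.sec_neg (hφ : B.IsFibreLinear φ) (s : B.SecAlong h) (x : X) :
    φ ((-s) x) = -φ (s x) := by
  have := hφ.sec_add (-s) s x
  rw [neg_add_cancel, hφ.sec_zero] at this
  linarith

lemma IsFibreLinear.sec_sub (hφ : B.IsFibreLinear φ) (s t : B.SecAlong h) (x : X) :
    φ ((s - t) x) = φ (s x) - φ (t x) := by
  rw [sub_eq_add_neg, hφ.sec_add, hφ.sec_neg]; ring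

lemma IsFibreLinear.sec_sum (hφ : B.IsFibreLinear φ) {ι : Type*} (I : Finset ι)
    (s : ι → B.SecAlong h) (x : X) : φ ((∑ i ∈ I, s i) x) = ∑ i ∈ I, φ (s i x) := by
  classical
  induction I using Finset.induction_on with
  | empty => simpa using hφ.sec_zero x
  | insert a s ha ih => rw [Finset.sum_insert ha, Finset.sum_insert ha, hφ.sec_add, ih]

end Along

end FibreLinear

section Frames

variable [FiniteDimensional ℝ VN] [T2Space N] [IsManifold 𝓘(ℝ, VN) ∞ N]
  [IsManifold 𝓘(ℝ, VV) ∞ V]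

/-- Near `x₀`, a local frame, cut off to global sections `s j`, and the dual frame, cut off to
global fibrewise linear functions `φ j`; moreover a local diffeomorphism `H` from the model space of
the base times the model fibre whose inverse is given by a chart of the base and the `φ j`. -/
lemma exists_frame (x₀ : N) : ∃ (ρ : SmoothFun VN N)
    (φ : Fin B.rank → SmoothFun VV V) (s : Fin B.rank → B.Sec)
    (h : N → VN) (H : VN × EuclideanSpace ℝ (Fin B.rank) → V),
    (∀ᶠ y in 𝓝 x₀, ρ y = 1) ∧ (∀ j, B.IsFibreLinear (φ j)) ∧
    (∀ ψ : SmoothFun VV V, B.IsFibreLinear ψ → ∀ v,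
      ∑ j, φ j v * ψ (s j (B.proj v)) = ρ (B.proj v) * ψ v) ∧
    (∀ v w, B.proj v = x₀ → B.proj w = x₀ → (∀ j, φ j v = φ j w) → v = w) ∧
    ContMDiff 𝓘(ℝ, VN) 𝓘(ℝ, VN) ∞ h ∧
    ∀ v₀, B.proj v₀ = x₀ → ∀ᶠ v in 𝓝 v₀,
      H (h (B.proj v), WithLp.toLp 2 fun j => φ j v) = v ∧
      ContMDiffAt 𝓘(ℝ, VN × EuclideanSpace ℝ (Fin B.rank)) 𝓘(ℝ, VV) ∞ H
        (h (B.proj v), WithLp.toLp 2 fun j => φ j v) := by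
  classical
  obtain ⟨U, e, hU, hx, hs, ht, hsm, hsy, h1, h0, ha, hm⟩ := B.locallyTrivial x₀
  obtain ⟨θ, hθ1, hθs⟩ := exists_bump (VN := VN) (hU.mem_nhds hx)
  obtain ⟨c, hc, hcx⟩ := exists_chartFun (VN := VN) x₀
  have hsrc : ∀ v, B.proj v ∈ U → v ∈ e.source := fun v hv => by rw [hs]; exact hv
  have htgt : ∀ x ∈ U, ∀ u, (x, u) ∈ e.target := fun x hx u => by rw [ht]; exact ⟨hx, mem_univ _⟩
  have hpe : ∀ x ∈ U, ∀ u, B.proj (e.symm (x, u)) = x := fun x hx u => by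
    have h2 := e.map_target (htgt x hx u)
    rw [hs] at h2
    rw [← h1 _ h2, e.right_inv (htgt x hx u)]
  have he2 : ∀ x ∈ U, ∀ u, (e (e.symm (x, u))).2 = u := fun x hx u => by
    rw [e.right_inv (htgt x hx u)]
  have hinj : ∀ v w, B.proj v ∈ U → B.proj v = B.proj w → (e v).2 = (e w).2 → v = w :=
    fun v w hv hvw h => e.injOn (hsrc v hv) (hsrc w (hvw ▸ hv))
      (Prod.ext (by rw [h1 v hv, h1 w (hvw ▸ hv), hvw]) h)
  have hev : ∀ v, B.proj v ∈ U → e.symm (B.proj v, (e v).2) = v := fun v hv => by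
    rw [← h1 v hv]; exact e.left_inv (hsrc v hv)
  -- the cut-off coordinates
  have hφsm : ∀ j, ContMDiff 𝓘(ℝ, VV) 𝓘(ℝ, ℝ) ∞ fun v => θ (B.proj v) • (e v).2 j := by
    intro j
    refine contMDiff_cutoff (O := B.proj ⁻¹' U) (θ.contMDiff.comp B.contMDiff_proj)
      (hU.preimage B.contMDiff_proj.continuous) ?_ ?_
    · refine (closure_minimal ?_ ((isClosed_tsupport θ).preimage B.contMDiff_proj.continuous)).trans
        (preimage_mono hθs)
      exact fun v hv => subset_tsupport _ hv
    · rw [← hs]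
      intro v hv
      have h2 := (hsm v hv).snd
      exact ((contDiff_piLp_apply (p := 2) (i := j) (𝕜 := ℝ)
        (E := fun _ : Fin B.rank => ℝ)).contMDiff.contMDiffAt).comp_contMDiffWithinAt
        v h2
  let φ : Fin B.rank → SmoothFun VV V := fun j => ⟨_, hφsm j⟩
  have hφ : ∀ j v, φ j v = θ (B.proj v) * (e v).2 j := fun _ _ => rfl
  -- the cut-off frame
  let σ : Fin B.rank → N → V := fun j x =>
    if x ∈ U then e.symm (x, θ x • EuclideanSpace.single j 1) else B.zero x
  have hz : ∀ x ∈ U, e.symm (x, 0) = B.zero x := fun x hx => by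
    refine hinj _ _ (by rwa [hpe x hx]) (by rw [hpe x hx, B.proj_zero]) ?_
    rw [he2 x hx, h0 x hx]
  have hσp : ∀ j x, B.proj (σ j x) = x := fun j x => by
    by_cases hx : x ∈ U
    · simp only [σ, if_pos hx, hpe x hx]
    · simp only [σ, if_neg hx, B.proj_zero]
  have hσsm : ∀ j, ContMDiff 𝓘(ℝ, VN) 𝓘(ℝ, VV) ∞ (σ j) := by
    intro j x
    by_cases hx : x ∈ tsupport θ
    · have hxU := hθs hx
      have h2 : ContMDiffAt 𝓘(ℝ, VN) (𝓘(ℝ, VN).prod 𝓘(ℝ, EuclideanSpace ℝ (Fin B.rank))) ∞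
          (fun x => (x, θ x • (EuclideanSpace.single j 1 : EuclideanSpace ℝ (Fin B.rank)))) x :=
        contMDiffAt_id.prodMk ((θ.contMDiff x).smul contMDiffAt_const)
      have h3 := ContMDiffAt.comp x
        (hsy.contMDiffAt (e.open_target.mem_nhds (htgt x hxU _))) h2
      refine h3.congr_of_eventuallyEq ?_
      filter_upwards [hU.mem_nhds hxU] with y hy
      simp only [σ, if_pos hy, Function.comp_def]
    · refine (B.contMDiff_zero x).congr_of_eventuallyEq ?_
      filter_upwards [(isClosed_tsupport θ).isOpen_compl.mem_nhds hx] with y hy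
      by_cases hyU : y ∈ U
      · simp only [σ, if_pos hyU, image_eq_zero_of_notMem_tsupport hy, zero_smul, hz y hyU]
      · simp only [σ, if_neg hyU]
  let s : Fin B.rank → B.Sec := fun j => ⟨σ j, hσsm j, hσp j⟩
  refine ⟨θ * θ, φ, s, c, fun p => e.symm ((extChartAt 𝓘(ℝ, VN) x₀).symm p.1, p.2), ?_, ?_, ?_, ?_,
    hc, ?_⟩
  · filter_upwards [hθ1] with y hy
    show θ y * θ y = 1
    rw [hy, one_mul]
  · intro j
    refine ⟨fun v w hvw => ?_, fun r v => ?_⟩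
    · rw [hφ, hφ, hφ, B.proj_add _ _ hvw, ← hvw]
      by_cases hv : B.proj v ∈ U
      · rw [ha v w hv hvw, PiLp.add_apply]; ring
      · rw [image_eq_zero_of_notMem_tsupport (fun h => hv (hθs h))]; ring
    · rw [hφ, hφ, B.proj_smul]
      by_cases hv : B.proj v ∈ U
      · rw [hm r v hv, PiLp.smul_apply, smul_eq_mul]; ring
      · rw [image_eq_zero_of_notMem_tsupport (fun h => hv (hθs h))]; ring
  · intro ψ hψ v
    show _ = θ (B.proj v) * θ (B.proj v) * ψ v
    by_cases hv : B.proj v ∈ U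
    · let L : EuclideanSpace ℝ (Fin B.rank) →ₗ[ℝ] ℝ :=
        { toFun := fun u => ψ (e.symm (B.proj v, u))
          map_add' := fun u w => by
            rw [← hψ.1 _ _ (by rw [hpe _ hv, hpe _ hv])]
            congr 1
            refine hinj _ _ (by rwa [hpe _ hv]) ?_ ?_
            · rw [hpe _ hv, B.proj_add _ _ (by rw [hpe _ hv, hpe _ hv]), hpe _ hv]
            · rw [he2 _ hv, ha _ _ (by rwa [hpe _ hv]) (by rw [hpe _ hv, hpe _ hv]), he2 _ hv,
                he2 _ hv]
          map_smul' := fun r u => by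
            rw [RingHom.id_apply, smul_eq_mul, ← hψ.2]
            congr 1
            refine hinj _ _ (by rwa [hpe _ hv]) ?_ ?_
            · rw [hpe _ hv, B.proj_smul, hpe _ hv]
            · rw [he2 _ hv, hm _ _ (by rwa [hpe _ hv]), he2 _ hv] }
      have hL : ∀ u, ψ (e.symm (B.proj v, u)) = L u := fun _ => rfl
      have h2 : ∀ j, ψ (s j (B.proj v)) = θ (B.proj v) * L (EuclideanSpace.single j 1) := fun j => by
        show ψ (σ j (B.proj v)) = _
        simp only [σ, if_pos hv]
        rw [hL, map_smul, smul_eq_mul]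
      have h3 : ψ v = ∑ j, (e v).2 j * L (EuclideanSpace.single j 1) := by
        conv_lhs => rw [← hev v hv, hL, ← (EuclideanSpace.basisFun (Fin B.rank) ℝ).sum_repr (e v).2]
        simp [map_sum]
      rw [h3, Finset.mul_sum]
      refine Finset.sum_congr rfl fun j _ => ?_
      rw [h2, hφ]; ring
    · have h2 : θ (B.proj v) = 0 := image_eq_zero_of_notMem_tsupport (fun h => hv (hθs h))
      simp [hφ, h2]
  · intro v w hv hw hvw
    refine hinj v w (hv ▸ hx) (hv.trans hw.symm) ?_
    ext j
    have := hvw j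
    rwa [hφ, hφ, hv, hw, hθ1.self_of_nhds, one_mul, one_mul] at this
  · intro v₀ hv₀
    have hcont : Filter.Tendsto B.proj (𝓝 v₀) (𝓝 x₀) := by
      rw [← hv₀]; exact B.contMDiff_proj.continuous.continuousAt
    filter_upwards [hcont.eventually hθ1, hcont.eventually hcx,
      hcont.eventually (hU.mem_nhds hx), hcont.eventually
        ((chartAt VN x₀).open_source.mem_nhds (mem_chart_source VN x₀))] with v h2 h3 h4 h5
    have h6 : (WithLp.toLp 2 fun j => φ j v : EuclideanSpace ℝ (Fin B.rank)) = (e v).2 := by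
      ext j
      show φ j v = _
      rw [hφ, h2, one_mul]
    have h5' : B.proj v ∈ (extChartAt 𝓘(ℝ, VN) x₀).source := by rwa [extChartAt_source]
    have h7 : (extChartAt 𝓘(ℝ, VN) x₀).symm (c (B.proj v)) = B.proj v := by
      rw [h3, (extChartAt 𝓘(ℝ, VN) x₀).left_inv h5']
    refine ⟨?_, ?_⟩
    · show e.symm ((extChartAt 𝓘(ℝ, VN) x₀).symm (c (B.proj v)), _) = v
      rw [h6, h7, hev v h4]
    · rw [h6]
      have h8 : ContMDiffAt 𝓘(ℝ, VN) 𝓘(ℝ, VN) ∞ (extChartAt 𝓘(ℝ, VN) x₀).symm (c (B.proj v)) := by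
        refine (contMDiffOn_extChartAt_symm x₀).contMDiffAt
          ((isOpen_extChartAt_target x₀).mem_nhds ?_)
        rw [h3]
        exact (extChartAt 𝓘(ℝ, VN) x₀).map_source h5'
      have h9 : ContMDiffAt 𝓘(ℝ, VN × EuclideanSpace ℝ (Fin B.rank))
          (𝓘(ℝ, VN).prod 𝓘(ℝ, EuclideanSpace ℝ (Fin B.rank))) ∞
          (fun p : VN × EuclideanSpace ℝ (Fin B.rank) =>
            ((extChartAt 𝓘(ℝ, VN) x₀).symm p.1, p.2)) (c (B.proj v), (e v).2) :=
        (ContMDiffAt.comp (c (B.proj v), (e v).2) h8 contDiff_fst.contMDiff.contMDiffAt).prodMk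
          contDiff_snd.contMDiff.contMDiffAt
      refine ContMDiffAt.comp (c (B.proj v), (e v).2) ?_ h9
      rw [show ((c (B.proj v), (e v).2) : VN × EuclideanSpace ℝ (Fin B.rank)).1 = c (B.proj v)
        from rfl, h7]
      exact hsy.contMDiffAt (e.open_target.mem_nhds (htgt _ h4 _))

end Frames

end VBundle

/-! ### Tensorial functionals of sections and of fibrewise linear functions -/

lemma SmoothFun.sum_apply {VN : Type*} [NormedAddCommGroup VN] [NormedSpace ℝ VN]
    {N : Type*} [TopologicalSpace N] [ChartedSpace VN N] {ι : Type*} (I : Finset ι)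
    (f : ι → SmoothFun VN N) (x : N) : (∑ i ∈ I, f i) x = ∑ i ∈ I, f i x := by
  classical
  induction I using Finset.induction_on with
  | empty => rfl
  | insert a I ha ih =>
    rw [Finset.sum_insert ha, Finset.sum_insert ha, ← ih]; rfl

section

variable {VN : Type*} [NormedAddCommGroup VN] [NormedSpace ℝ VN]
  {N : Type*} [TopologicalSpace N] [ChartedSpace VN N] (f g : SmoothFun VN N) (x : N)

lemma SmoothFun.add_apply : (f + g) x = f x + g x := rfl
lemma SmoothFun.sub_apply : (f - g) x = f x - g x := rfl
lemma SmoothFun.mul_apply : (f * g) x = f x * g x := rfl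
lemma SmoothFun.const_apply (r : ℝ) : algebraMap ℝ (SmoothFun VN N) r x = r := rfl

end

namespace VBundle

variable {VV : Type*} [NormedAddCommGroup VV] [NormedSpace ℝ VV]
  {V : Type*} [TopologicalSpace V] [ChartedSpace VV V] [IsManifold 𝓘(ℝ, VV) ∞ V]
  {VN : Type*} [NormedAddCommGroup VN] [NormedSpace ℝ VN]
  {N : Type*} [TopologicalSpace N] [ChartedSpace VN N] [IsManifold 𝓘(ℝ, VN) ∞ N]
  {VX : Type*} [NormedAddCommGroup VX] [NormedSpace ℝ VX]
  {X : Type*} [TopologicalSpace X] [ChartedSpace VX X]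
  [FiniteDimensional ℝ VN] [T2Space N]
  (B : VBundle VV V VN N)

/-- The fibrewise linear functions separate the points of a fibre. -/
lemma ext_fibreLinear {v w : V} (h : B.proj v = B.proj w)
    (hφ : ∀ φ, B.IsFibreLinear φ → φ v = φ w) : v = w := by
  obtain ⟨ρ, φ, s, c, H, -, h1, -, h2, -⟩ := B.exists_frame (B.proj w)
  exact h2 v w h rfl fun j => hφ _ (h1 j)

lemma SecAlong.ext_fibreLinear {B : VBundle VV V VN N} {h : C^∞⟮𝓘(ℝ, VX), X; 𝓘(ℝ, VN), N⟯}
    {s t : B.SecAlong h} (hst : ∀ φ, B.IsFibreLinear φ → ∀ x, φ (s x) = φ (t x)) : s = t :=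
  SecAlong.ext fun x => B.ext_fibreLinear ((s.proj_apply x).trans (t.proj_apply x).symm)
    fun φ hφ => hst φ hφ x

lemma pairing_apply (φ : SmoothFun VV V) (s : B.Sec) (x : N) : B.pairing φ s x = φ (s x) := rfl

/-- Near every point a section is a combination of finitely many fixed sections with coefficients
given by fixed fibrewise linear functions. -/
lemma exists_dual_pair (x₀ : N) : ∃ (n : ℕ) (ρ : SmoothFun VN N) (φ : Fin n → SmoothFun VV V)
    (s : Fin n → B.Sec), (∀ᶠ y in 𝓝 x₀, ρ y = 1) ∧ (∀ j, B.IsFibreLinear (φ j)) ∧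
    (∀ ψ, B.IsFibreLinear ψ → ∑ j, B.pull (B.pairing ψ (s j)) * φ j = B.pull ρ * ψ) ∧
    ∀ t : B.Sec, ∑ j, B.pairing (φ j) t • s j = ρ • t := by
  obtain ⟨ρ, φ, s, c, H, h0, h1, h2, -⟩ := B.exists_frame x₀
  refine ⟨B.rank, ρ, φ, s, h0, h1, fun ψ hψ => ContMDiffMap.ext fun v => ?_, fun t => ?_⟩
  · refine Eq.trans ?_ (h2 ψ hψ v)
    rw [SmoothFun.sum_apply]
    refine Finset.sum_congr rfl fun j _ => ?_
    exact mul_comm _ _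
  · refine SecAlong.ext_fibreLinear fun ψ hψ x => ?_
    rw [hψ.sec_sum, hψ.sec_smul]
    have := h2 ψ hψ (t x)
    rw [t.proj_apply] at this
    refine Eq.trans (Finset.sum_congr rfl fun j _ => ?_) this
    rw [hψ.sec_smul]; rfl

/-- Every vector is a value of a section. -/
lemma exists_sec_eq (v : V) : ∃ s : B.Sec, s (B.proj v) = v := by
  obtain ⟨n, ρ, φ, s, h0, h1, h2, -⟩ := B.exists_dual_pair (B.proj v)
  refine ⟨∑ j, algebraMap ℝ (SmoothFun VN N) (φ j v) • s j,
    B.ext_fibreLinear (SecAlong.proj_apply _ _) fun ψ hψ => ?_⟩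
  rw [hψ.sec_sum]
  have := congrArg (fun f : SmoothFun VV V => f v) (h2 ψ hψ)
  rw [SmoothFun.sum_apply] at this
  refine Eq.trans (Finset.sum_congr rfl fun j _ => ?_) (this.trans ?_)
  · rw [hψ.sec_smul]; exact mul_comm _ _
  · show ρ _ * ψ v = _
    rw [h0.self_of_nhds, one_mul]

/-- A quantity depending tensorially on fibrewise linear functions is locally determined by its
values on a frame. -/
lemma tensorial_eq_sum {T : SmoothFun VV V → ℝ} {x : N}
    (hadd : ∀ φ ψ, B.IsFibreLinear φ → B.IsFibreLinear ψ → T (φ + ψ) = T φ + T ψ)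
    (hmul : ∀ f φ, B.IsFibreLinear φ → T (B.pull f * φ) = f x * T φ)
    {n : ℕ} {ρ : SmoothFun VN N} {φ : Fin n → SmoothFun VV V} {s : Fin n → B.Sec}
    (hφ : ∀ j, B.IsFibreLinear (φ j))
    (h : ∀ ψ, B.IsFibreLinear ψ → ∑ j, B.pull (B.pairing ψ (s j)) * φ j = B.pull ρ * ψ)
    {ψ : SmoothFun VV V} (hψ : B.IsFibreLinear ψ) :
    ρ x * T ψ = ∑ j, ψ (s j x) * T (φ j) := by
  have hsum : ∀ (I : Finset (Fin n)) (χ : Fin n → SmoothFun VV V), (∀ j, B.IsFibreLinear (χ j)) →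
      T (∑ j ∈ I, χ j) = ∑ j ∈ I, T (χ j) := by
    intro I χ hχ
    classical
    induction I using Finset.induction_on with
    | empty =>
      have := hmul 0 0 B.isFibreLinear_zero
      rw [mul_zero] at this
      rw [Finset.sum_empty, Finset.sum_empty, this]
      exact zero_mul _
    | insert a I ha ih =>
      rw [Finset.sum_insert ha, Finset.sum_insert ha,
        hadd _ _ (hχ a) (IsFibreLinear.sum I fun j _ => hχ j), ih]
  rw [← hmul ρ ψ hψ, ← h ψ hψ, hsum _ _ fun j => (hφ j).pull_mul _]
  exact Finset.sum_congr rfl fun j _ => hmul _ _ (hφ j)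

/-- A quantity depending tensorially on sections depends only on the value at the point. -/
lemma tensorial_sec_congr {G : Type*} [AddCommGroup G] [Module ℝ G] {T : B.Sec → G} {x : N}
    (hadd : ∀ s t, T (s + t) = T s + T t)
    (hmul : ∀ (f : SmoothFun VN N) s, T (f • s) = f x • T s) {s t : B.Sec} (h : s x = t x) : T s = T t := by
  obtain ⟨n, ρ, φ, σ, h0, h1, -, h2⟩ := B.exists_dual_pair x
  have h00 : T 0 = 0 := by
    have := hadd 0 0
    rw [add_zero] at this
    simpa using this
  have key : ∀ s, T s = ∑ j, φ j (s x) • T (σ j) := fun s => by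
    have e1 : ρ x • T s = _ := (hmul ρ s).symm
    rw [h0.self_of_nhds, one_smul] at e1
    rw [e1, ← h2 s]
    have hsum : ∀ (I : Finset (Fin n)) (χ : Fin n → B.Sec),
        T (∑ j ∈ I, χ j) = ∑ j ∈ I, T (χ j) := by
      intro I χ
      classical
      induction I using Finset.induction_on with
      | empty => simpa using h00
      | insert a I ha ih => rw [Finset.sum_insert ha, Finset.sum_insert ha, hadd, ih]
    rw [hsum]
    exact Finset.sum_congr rfl fun j _ => hmul _ _
  rw [key s, key t, h]

/-- The double dual: a `C^∞(N)`-linear functional on the fibrewise linear functions with values in the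
functions on `X` is the pairing with a section along the given map `X → N`. -/
lemma exists_secAlong_of_dual (h : C^∞⟮𝓘(ℝ, VX), X; 𝓘(ℝ, VN), N⟯) {T : SmoothFun VV V → X → ℝ}
    (hsm : ∀ φ, B.IsFibreLinear φ → ContMDiff 𝓘(ℝ, VX) 𝓘(ℝ, ℝ) ∞ (T φ))
    (hadd : ∀ φ ψ, B.IsFibreLinear φ → B.IsFibreLinear ψ → ∀ x, T (φ + ψ) x = T φ x + T ψ x)
    (hmul : ∀ f φ, B.IsFibreLinear φ → ∀ x, T (B.pull f * φ) x = f (h x) * T φ x) :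
    ∃ t : B.SecAlong h, ∀ φ, B.IsFibreLinear φ → ∀ x, φ (t x) = T φ x := by
  have key : ∀ x₀, ∃ t : B.SecAlong h, ∀ᶠ x in 𝓝 x₀, ∀ φ, B.IsFibreLinear φ → φ (t x) = T φ x := by
    intro x₀
    obtain ⟨n, ρ, φ, σ, h0, h1, h2, -⟩ := B.exists_dual_pair (h x₀)
    let τ : Fin n → SmoothFun VX X := fun j => ⟨T (φ j), hsm _ (h1 j)⟩
    let σ' : Fin n → B.SecAlong h := fun j =>
      ⟨fun x => σ j (h x), (σ j).contMDiff.comp h.contMDiff, fun x => (σ j).proj_apply (h x)⟩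
    refine ⟨∑ j, τ j • σ' j, ?_⟩
    filter_upwards [h.contMDiff.continuous.continuousAt.eventually h0] with x hx ψ hψ
    have e1 := B.tensorial_eq_sum (T := fun φ => T φ x) (fun φ ψ hφ hψ => hadd φ ψ hφ hψ x)
      (fun f φ hφ => hmul f φ hφ x) h1 h2 hψ
    rw [hx, one_mul] at e1
    rw [e1, hψ.sec_sum]
    refine Finset.sum_congr rfl fun j _ => ?_
    rw [hψ.sec_smul]
    exact mul_comm _ _
  choose t ht using key
  refine ⟨⟨fun x => t x x, fun x₀ => ?_, fun x => (t x).proj_apply x⟩, fun φ hφ x =>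
    (ht x).self_of_nhds φ hφ⟩
  refine ((t x₀).contMDiff x₀).congr_of_eventuallyEq ?_
  filter_upwards [ht x₀] with x hx
  exact B.ext_fibreLinear (((t x).proj_apply x).trans ((t x₀).proj_apply x).symm) fun φ hφ => by
    rw [hx φ hφ, (ht x).self_of_nhds φ hφ]

lemma exists_sec_of_dual {T : SmoothFun VV V → N → ℝ}
    (hsm : ∀ φ, B.IsFibreLinear φ → ContMDiff 𝓘(ℝ, VN) 𝓘(ℝ, ℝ) ∞ (T φ))
    (hadd : ∀ φ ψ, B.IsFibreLinear φ → B.IsFibreLinear ψ → ∀ x, T (φ + ψ) x = T φ x + T ψ x)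
    (hmul : ∀ f φ, B.IsFibreLinear φ → ∀ x, T (B.pull f * φ) x = f x * T φ x) :
    ∃ t : B.Sec, ∀ φ, B.IsFibreLinear φ → ∀ x, φ (t x) = T φ x :=
  B.exists_secAlong_of_dual _ hsm hadd hmul

/-! ### Homogeneous maps are linear -/

/-- A function on a fibre that is homogeneous of degree one and differentiable at the origin is its
own derivative at the origin, hence additive. -/
lemma additive_of_homogeneous {f : V → ℝ} {x : N}
    (hf : MDifferentiableAt 𝓘(ℝ, VV) 𝓘(ℝ, ℝ) f (B.zero x))
    (hr : ∀ r v, B.proj v = x → f (B.smul r v) = r * f v) {v w : V} (hv : B.proj v = x)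
    (hw : B.proj w = x) : f (B.add v w) = f v + f w := by
  obtain ⟨U, e, hU, hx, hs, ht, hsm, hsy, h1, h0, ha, hm⟩ := B.locallyTrivial x
  have htgt : ∀ u, (x, u) ∈ e.target := fun u => by rw [ht]; exact ⟨hx, mem_univ _⟩
  have hpe : ∀ u, B.proj (e.symm (x, u)) = x := fun u => by
    have h2 := e.map_target (htgt u)
    rw [hs] at h2
    rw [← h1 _ h2, e.right_inv (htgt u)]
  have hev : ∀ v, B.proj v = x → e.symm (x, (e v).2) = v := fun v hv => by
    have h3 : B.proj v ∈ U := hv ▸ hx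
    rw [← hv, ← h1 v h3]
    exact e.left_inv (by rw [hs]; exact h3)
  have hz : e.symm (x, 0) = B.zero x := by
    rw [← h0 x hx]; exact hev _ (B.proj_zero x)
  have hg : DifferentiableAt ℝ (fun u => f (e.symm (x, u))) 0 := by
    rw [← mdifferentiableAt_iff_differentiableAt]
    have h2 : ContMDiffAt 𝓘(ℝ, EuclideanSpace ℝ (Fin B.rank))
        (𝓘(ℝ, VN).prod 𝓘(ℝ, EuclideanSpace ℝ (Fin B.rank))) ∞ (fun u => (x, u))
        (0 : EuclideanSpace ℝ (Fin B.rank)) := contMDiffAt_const.prodMk contMDiffAt_id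
    have h3 := (ContMDiffAt.comp (0 : EuclideanSpace ℝ (Fin B.rank))
      (hsy.contMDiffAt (e.open_target.mem_nhds (htgt 0))) h2).mdifferentiableAt (by simp)
    refine MDifferentiableAt.comp (0 : EuclideanSpace ℝ (Fin B.rank)) (g := f) ?_ h3
    show MDifferentiableAt 𝓘(ℝ, VV) 𝓘(ℝ, ℝ) f (e.symm (x, 0))
    rw [hz]; exact hf
  have hlin : ∀ u, f (e.symm (x, u)) = fderiv ℝ (fun u => f (e.symm (x, u))) 0 u := by
    intro u
    have h4 : ∀ r : ℝ, f (e.symm (x, r • u)) = r * f (e.symm (x, u)) := fun r => by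
      rw [← hr r _ (hpe u)]
      congr 1
      have h3 : B.proj (e.symm (x, u)) ∈ U := by rw [hpe]; exact hx
      rw [← hev (B.smul r (e.symm (x, u))) ((B.proj_smul _ _).trans (hpe u)), hm _ _ h3,
        e.right_inv (htgt u)]
    have h5 : HasDerivAt (fun r : ℝ => f (e.symm (x, r • u)))
        (fderiv ℝ (fun u => f (e.symm (x, u))) 0 u) 0 := by
      have h6 : HasDerivAt (fun r : ℝ => r • u) u 0 := by
        simpa using (hasDerivAt_id (0 : ℝ)).smul_const u
      have h7 : HasFDerivAt (fun u => f (e.symm (x, u)))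
          (fderiv ℝ (fun u => f (e.symm (x, u))) 0) ((0 : ℝ) • u) := by
        rw [zero_smul]; exact hg.hasFDerivAt
      exact h7.comp_hasDerivAt 0 h6
    have h8 : HasDerivAt (fun r : ℝ => f (e.symm (x, r • u))) (f (e.symm (x, u))) 0 := by
      simp_rw [h4]
      simpa using (hasDerivAt_id (0 : ℝ)).mul_const (f (e.symm (x, u)))
    exact h8.unique h5
  have hvU : B.proj v ∈ U := hv ▸ hx
  rw [← hev v hv, ← hev w hw, ← hev (B.add _ _) ((B.proj_add _ _ (by rw [hpe, hpe])).trans (hpe _)),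
    ha _ _ (by rw [hpe]; exact hx) (by rw [hpe, hpe]), e.right_inv (htgt _), e.right_inv (htgt _)]
  rw [hlin, hlin (e v).2, hlin (e w).2, map_add]

lemma isFibreLinear_of_homogeneous {φ : SmoothFun VV V} (h : ∀ r v, φ (B.smul r v) = r * φ v) :
    B.IsFibreLinear φ :=
  ⟨fun v w hvw => B.additive_of_homogeneous (x := B.proj w) ((φ.contMDiff _).mdifferentiableAt (by simp))
    (fun r v _ => h r v) hvw rfl, h⟩

/-- A smooth map between vector bundles that commutes with scalar multiplication is a morphism. -/
lemma isMorphismOn_of_homogeneous {VV' : Type*} [NormedAddCommGroup VV'] [NormedSpace ℝ VV']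
    {V' : Type*} [TopologicalSpace V'] [ChartedSpace VV' V'] [IsManifold 𝓘(ℝ, VV') ∞ V']
    {VN' : Type*} [NormedAddCommGroup VN'] [NormedSpace ℝ VN'] [FiniteDimensional ℝ VN']
    {N' : Type*} [TopologicalSpace N'] [ChartedSpace VN' N'] [IsManifold 𝓘(ℝ, VN') ∞ N']
    [T2Space N'] (B' : VBundle VV' V' VN' N') {S : Set N} (hS : IsOpen S) {F : V → V'} {f : N → N'}
    (hF : ContMDiffOn 𝓘(ℝ, VV) 𝓘(ℝ, VV') ∞ F (B.proj ⁻¹' S))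
    (hr : ∀ r v, B.proj v ∈ S → F (B.smul r v) = B'.smul r (F v))
    (hf : ∀ x ∈ S, B'.proj (F (B.zero x)) = f x) : B.IsMorphismOn B' S F f := by
  have hp : ∀ v, B.proj v ∈ S → B'.proj (F v) = f (B.proj v) := fun v hv => by
    rw [← hf _ hv, ← B.zero_smul', hr _ _ hv, B'.proj_smul]
  refine ⟨hF, ?_, hp, fun v w hv hvw => ?_, hr⟩
  · have h1 : ContMDiffOn 𝓘(ℝ, VN) 𝓘(ℝ, VN') ∞ (fun x => B'.proj (F (B.zero x))) S :=
      B'.contMDiff_proj.comp_contMDiffOn (hF.comp B.contMDiff_zero.contMDiffOn fun x hx => by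
        show B.proj (B.zero x) ∈ S
        rwa [B.proj_zero])
    exact h1.congr fun x hx => (hf x hx).symm
  · have hw : B.proj w ∈ S := hvw ▸ hv
    have e1 : B'.proj (F v) = B'.proj (F w) := by rw [hp v hv, hp w hw, hvw]
    refine B'.ext_fibreLinear ?_ fun ψ hψ => ?_
    · rw [hp _ (by rwa [B.proj_add _ _ hvw]), B'.proj_add _ _ e1, hp v hv, B.proj_add _ _ hvw]
    · rw [hψ.1 _ _ e1]
      refine B.additive_of_homogeneous (f := fun v => ψ (F v)) (x := B.proj w) ?_
        (fun r v' hv' => ?_) hvw rfl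
      · have h2 : B.zero (B.proj w) ∈ B.proj ⁻¹' S := by
          show B.proj (B.zero _) ∈ S
          rwa [B.proj_zero]
        exact MDifferentiableAt.comp (B.zero (B.proj w)) ((ψ.contMDiff _).mdifferentiableAt (by simp))
          ((hF.contMDiffAt ((hS.preimage B.contMDiff_proj.continuous).mem_nhds
            h2)).mdifferentiableAt (by simp))
      · show ψ (F (B.smul r v')) = r * ψ (F v')
        rw [hr _ _ (by rwa [hv']), hψ.2]

/-! ### Tangent vectors of the total space -/

/-- Near any point of the total space, functions are smooth functions of the base point and of
finitely many fibrewise linear functions. -/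
lemma exists_adapted (v₀ : V) : ∃ (n : ℕ) (φ : Fin n → SmoothFun VV V) (h : N → VN),
    (∀ j, B.IsFibreLinear (φ j)) ∧ ContMDiff 𝓘(ℝ, VN) 𝓘(ℝ, VN) ∞ h ∧
    ∀ f : SmoothFun VV V, ∃ k : VN × EuclideanSpace ℝ (Fin n) → ℝ, ∀ᶠ v in 𝓝 v₀,
      k (h (B.proj v), WithLp.toLp 2 fun j => φ j v) = f v ∧
      ContDiffAt ℝ ∞ k (h (B.proj v), WithLp.toLp 2 fun j => φ j v) := by
  obtain ⟨ρ, φ, s, h, H, -, h1, -, -, h2, h3⟩ := B.exists_frame (B.proj v₀)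
  refine ⟨B.rank, φ, h, h1, h2, fun f => ⟨fun p => f (H p), ?_⟩⟩
  filter_upwards [h3 v₀ rfl] with v hv
  refine ⟨by rw [hv.1], ?_⟩
  rw [← contMDiffAt_iff_contDiffAt]
  exact (f.contMDiff _).comp _ hv.2

/-- The derivative of a function in adapted coordinates. -/
lemma dirDeriv_adapted {n : ℕ} (φ : Fin n → SmoothFun VV V) {h : N → VN}
    (hh : ContMDiff 𝓘(ℝ, VN) 𝓘(ℝ, VN) ∞ h) {f : SmoothFun VV V}
    {k : VN × EuclideanSpace ℝ (Fin n) → ℝ} {v : V}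
    (hk : ∀ᶠ v in 𝓝 v, k (h (B.proj v), WithLp.toLp 2 fun j => φ j v) = f v)
    (hd : ContDiffAt ℝ ∞ k (h (B.proj v), WithLp.toLp 2 fun j => φ j v))
    (u : TangentSpace 𝓘(ℝ, VV) v) :
    dirDeriv f v u = fderiv ℝ k (h (B.proj v), WithLp.toLp 2 fun j => φ j v)
      (dirDeriv h (B.proj v) (mfderiv 𝓘(ℝ, VV) 𝓘(ℝ, VN) B.proj v u),
        WithLp.toLp 2 fun j => dirDeriv (φ j) v u) := by
  have hg1 : ContMDiff 𝓘(ℝ, VV) 𝓘(ℝ, VN) ∞ fun v => h (B.proj v) := hh.comp B.contMDiff_proj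
  have hg2 : ContMDiff 𝓘(ℝ, VV) 𝓘(ℝ, EuclideanSpace ℝ (Fin n)) ∞
      fun v => (WithLp.toLp 2 fun j => φ j v : EuclideanSpace ℝ (Fin n)) :=
    (PiLp.contDiff_toLp (p := 2)).contMDiff.comp (contMDiff_pi_space.2 fun j => (φ j).contMDiff)
  have hg := hg1.prodMk_space hg2
  have hgd : MDifferentiableAt 𝓘(ℝ, VV) 𝓘(ℝ, VN × EuclideanSpace ℝ (Fin n))
      (fun v => (h (B.proj v), (WithLp.toLp 2 fun j => φ j v : EuclideanSpace ℝ (Fin n)))) v :=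
    (hg v).mdifferentiableAt (by simp)
  rw [← dirDeriv_congr hk u]
  have e0 := dirDeriv_comp_fderiv (g := k)
    (F := fun v => (h (B.proj v), (WithLp.toLp 2 fun j => φ j v : EuclideanSpace ℝ (Fin n))))
    (hd.differentiableAt (by simp)) hgd u
  refine e0.trans ?_
  congr 1
  refine Prod.ext ?_ ?_
  · have e1 := dirDeriv_comp_fderiv (g := fun p : VN × EuclideanSpace ℝ (Fin n) => p.1)
      differentiableAt_fst hgd u
    have e3 : fderiv ℝ (fun p : VN × EuclideanSpace ℝ (Fin n) => p.1)
      (h (B.proj v), (WithLp.toLp 2 fun j => φ j v : EuclideanSpace ℝ (Fin n))) =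
        ContinuousLinearMap.fst ℝ _ _ := fderiv_fst
    rw [e3] at e1
    refine Eq.trans e1.symm ?_
    exact dirDeriv_comp ((hh _).mdifferentiableAt (by simp))
      ((B.contMDiff_proj v).mdifferentiableAt (by simp)) u
  · ext j
    let L : VN × EuclideanSpace ℝ (Fin n) →L[ℝ] ℝ :=
      (EuclideanSpace.proj j).comp (ContinuousLinearMap.snd ℝ _ _)
    have e1 := dirDeriv_comp_fderiv (g := L) L.differentiableAt hgd u
    rw [ContinuousLinearMap.fderiv] at e1
    exact e1.symm

/-- A tangent vector of the total space is determined by its projection and its action on fibrewise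
linear functions. -/
lemma tangent_ext [FiniteDimensional ℝ VV] [T2Space V] {v : V} {u w : TangentSpace 𝓘(ℝ, VV) v}
    (hp : mfderiv 𝓘(ℝ, VV) 𝓘(ℝ, VN) B.proj v u = mfderiv 𝓘(ℝ, VV) 𝓘(ℝ, VN) B.proj v w)
    (hφ : ∀ φ : SmoothFun VV V, B.IsFibreLinear φ → dirDeriv φ v u = dirDeriv φ v w) : u = w := by
  obtain ⟨n, φ, h, h1, h2, h3⟩ := B.exists_adapted v
  refine _root_.tangent_ext fun f => ?_
  obtain ⟨k, hk⟩ := h3 f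
  rw [B.dirDeriv_adapted φ h2 (hk.mono fun _ h => h.1) hk.self_of_nhds.2,
    B.dirDeriv_adapted φ h2 (hk.mono fun _ h => h.1) hk.self_of_nhds.2, hp]
  simp_rw [hφ _ (h1 _)]

/-- A family of tangent vectors of the total space is a smooth vector field if it projects to a
smooth vector field and acts smoothly on fibrewise linear functions. -/
lemma exists_vfield [FiniteDimensional ℝ VV] [T2Space V] {Z : ∀ v : V, TangentSpace 𝓘(ℝ, VV) v}
    {Y : VField VN N} (hY : ∀ v, mfderiv 𝓘(ℝ, VV) 𝓘(ℝ, VN) B.proj v (Z v) = Y (B.proj v))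
    (hφ : ∀ φ : SmoothFun VV V, B.IsFibreLinear φ →
      ContMDiff 𝓘(ℝ, VV) 𝓘(ℝ, ℝ) ∞ fun v => dirDeriv φ v (Z v)) :
    ∃ Z' : VField VV V, ∀ v, Z' v = Z v := by
  refine ⟨VField.ofDirDeriv Z fun f v₀ => ?_, fun _ => rfl⟩
  obtain ⟨n, φ, h, h1, h2, h3⟩ := B.exists_adapted v₀
  obtain ⟨k, hk⟩ := h3 f
  have hg1 : ContMDiff 𝓘(ℝ, VV) 𝓘(ℝ, VN) ∞ fun v => h (B.proj v) := h2.comp B.contMDiff_proj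
  have hg2 : ContMDiff 𝓘(ℝ, VV) 𝓘(ℝ, EuclideanSpace ℝ (Fin n)) ∞
      fun v => (WithLp.toLp 2 fun j => φ j v : EuclideanSpace ℝ (Fin n)) :=
    (PiLp.contDiff_toLp (p := 2)).contMDiff.comp (contMDiff_pi_space.2 fun j => (φ j).contMDiff)
  have hg := hg1.prodMk_space hg2
  have hd1 : ContMDiff 𝓘(ℝ, VV) 𝓘(ℝ, VN) ∞ fun v => dirDeriv h (B.proj v) (Y (B.proj v)) :=
    (Y.contMDiff_dirDeriv h2).comp B.contMDiff_proj
  have hd2 : ContMDiff 𝓘(ℝ, VV) 𝓘(ℝ, EuclideanSpace ℝ (Fin n)) ∞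
      fun v => (WithLp.toLp 2 fun j => dirDeriv (φ j) v (Z v) : EuclideanSpace ℝ (Fin n)) :=
    (PiLp.contDiff_toLp (p := 2)).contMDiff.comp (contMDiff_pi_space.2 fun j => hφ _ (h1 j))
  have hd := hd1.prodMk_space hd2
  have hkd : ContMDiffAt 𝓘(ℝ, VV) 𝓘(ℝ, VN × EuclideanSpace ℝ (Fin n) →L[ℝ] ℝ) ∞
      (fun v => fderiv ℝ k (h (B.proj v), WithLp.toLp 2 fun j => φ j v)) v₀ :=
    ContMDiffAt.comp v₀ (g := fderiv ℝ k)
      (hk.self_of_nhds.2.fderiv_right (m := ∞) (by simp)).contMDiffAt (hg v₀)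
  refine (hkd.clm_apply (hd v₀)).congr_of_eventuallyEq ?_
  filter_upwards [hk.eventually_nhds] with v hv
  rw [B.dirDeriv_adapted φ h2 (hv.mono fun _ h => h.1) hv.self_of_nhds.2, hY]

end VBundle

/-! ### Linear vector fields and derivations -/

namespace VBundle

variable {VV : Type*} [NormedAddCommGroup VV] [NormedSpace ℝ VV]
  {V : Type*} [TopologicalSpace V] [ChartedSpace VV V] [IsManifold 𝓘(ℝ, VV) ∞ V]
  {VN : Type*} [NormedAddCommGroup VN] [NormedSpace ℝ VN]
  {N : Type*} [TopologicalSpace N] [ChartedSpace VN N] [IsManifold 𝓘(ℝ, VN) ∞ N]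
  [FiniteDimensional ℝ VV] [T2Space V] [FiniteDimensional ℝ VN] [T2Space N]
  {B : VBundle VV V VN N}

/-- The vector field `Z` on the total space is invariant under all scalar multiplications. -/
def IsHomogeneous (B : VBundle VV V VN N) (Z : VField VV V) : Prop :=
  ∀ r v, mfderiv 𝓘(ℝ, VV) 𝓘(ℝ, VV) (B.smul r) v (Z v) = Z (B.smul r v)

lemma mdifferentiableAt_smul (B : VBundle VV V VN N) (r : ℝ) (v : V) :
    MDifferentiableAt 𝓘(ℝ, VV) 𝓘(ℝ, VV) (B.smul r) v :=
  (B.contMDiff_smul r v).mdifferentiableAt (by simp)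

lemma mdifferentiableAt_proj (B : VBundle VV V VN N) (v : V) :
    MDifferentiableAt 𝓘(ℝ, VV) 𝓘(ℝ, VN) B.proj v :=
  (B.contMDiff_proj v).mdifferentiableAt (by simp)

lemma SecAlong.mdifferentiableAt (s : B.Sec) (x : N) : MDifferentiableAt 𝓘(ℝ, VN) 𝓘(ℝ, VV) s x :=
  (s.contMDiff x).mdifferentiableAt (by simp)

section Unique

variable {Z Z' : VField VV V} {Δ Δ' : Der VN N B.Sec}

lemma Corresponds.deriv_eq (h : B.Corresponds Z Δ) {φ : SmoothFun VV V} (hφ : B.IsFibreLinear φ)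
    (s : B.Sec) (x : N) :
    Z.deriv φ (s x) = Δ.symbol.deriv (B.pairing φ s) x - φ (Δ s x) := by
  have := h.2.2 s φ hφ x
  linarith

/-- The derivation determines the linear vector field. -/
lemma Corresponds.field_unique (h : B.Corresponds Z Δ) (h' : B.Corresponds Z' Δ) : Z = Z' := by
  refine ContMDiffSection.ext fun v => B.tangent_ext ((h.2.1 v).trans (h'.2.1 v).symm) fun φ hφ => ?_
  obtain ⟨s, hs⟩ := B.exists_sec_eq v
  have e1 := h.deriv_eq hφ s (B.proj v)
  have e2 := h'.deriv_eq hφ s (B.proj v)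
  rw [hs] at e1 e2
  exact e1.trans e2.symm

lemma _root_.Der.ext' {Γ : Type*} [AddCommGroup Γ] [Module (SmoothFun VN N) Γ] {Δ Δ' : Der VN N Γ}
    (h1 : ∀ s, Δ s = Δ' s) (h2 : Δ.symbol = Δ'.symbol) : Δ = Δ' := by
  cases Δ; cases Δ'
  obtain rfl : _ = _ := h2
  congr
  exact funext h1

/-- The linear vector field determines the derivation. -/
lemma Corresponds.der_unique (h : B.Corresponds Z Δ) (h' : B.Corresponds Z Δ') : Δ = Δ' := by
  have hs : Δ.symbol = Δ'.symbol := by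
    refine ContMDiffSection.ext fun x => ?_
    have e1 := h.2.1 (B.zero x)
    have e2 := h'.2.1 (B.zero x)
    rw [B.proj_zero] at e1 e2
    exact e1.symm.trans e2
  refine Der.ext' (fun s => SecAlong.ext_fibreLinear fun φ hφ x => ?_) hs
  rw [h.2.2 s φ hφ x, h'.2.2 s φ hφ x, hs]

/-- A linear vector field is invariant under scalar multiplication. -/
lemma Corresponds.isHomogeneous (h : B.Corresponds Z Δ) : B.IsHomogeneous Z := by
  intro r v
  refine B.tangent_ext ?_ fun φ hφ => ?_
  · refine Eq.trans ?_ (h.2.1 _).symm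
    have e1 := mfderiv_comp v (B.mdifferentiableAt_proj (B.smul r v)) (B.mdifferentiableAt_smul r v)
    have e2 : B.proj ∘ B.smul r = B.proj := funext fun v => B.proj_smul r v
    rw [e2] at e1
    have e3 := h.2.1 v
    rw [e1] at e3
    rw [B.proj_smul]
    exact e3
  · rw [← dirDeriv_comp (φ.mdifferentiableAt _) (B.mdifferentiableAt_smul r v)]
    have e2 : (fun y => φ (B.smul r y)) = fun y => algebraMap ℝ (SmoothFun VV V) r y * φ y :=
      funext fun y => hφ.2 r y
    rw [e2, dirDeriv_mul ((algebraMap ℝ (SmoothFun VV V) r).mdifferentiableAt v)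
      (φ.mdifferentiableAt v)]
    have e3 : dirDeriv (algebraMap ℝ (SmoothFun VV V) r) v (Z v) = 0 := dirDeriv_const r v (Z v)
    rw [e3, zero_mul, zero_add]
    exact ((h.1 φ hφ).2 r v).symm

end Unique

lemma deriv_pull {Z : VField VV V} {Y : VField VN N}
    (h : ∀ v, mfderiv 𝓘(ℝ, VV) 𝓘(ℝ, VN) B.proj v (Z v) = Y (B.proj v)) (f : SmoothFun VN N) :
    Z.deriv (B.pull f) = B.pull (Y.deriv f) := by
  ext v
  have e1 : Z.deriv (B.pull f) v = dirDeriv (fun y => f (B.proj y)) v (Z v) := rfl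
  rw [e1, dirDeriv_comp (f.mdifferentiableAt _) (B.mdifferentiableAt_proj v), h]
  rfl

/-- A homogeneous vector field is projectable: `T q (Z v)` is the same for all `v` in a fibre, since it
is invariant under the multiplication by `0`. -/
lemma IsHomogeneous.exists_base {Z : VField VV V} (h : B.IsHomogeneous Z) :
    ∃ Y : VField VN N, ∀ v, mfderiv 𝓘(ℝ, VV) 𝓘(ℝ, VN) B.proj v (Z v) = Y (B.proj v) := by
  have key : ∀ (v : V) (f : SmoothFun VN N),
      dirDeriv f (B.proj v) (mfderiv 𝓘(ℝ, VV) 𝓘(ℝ, VN) B.proj v (Z v)) =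
        Z.deriv (B.pull f) (B.zero (B.proj v)) := by
    intro v f
    rw [← dirDeriv_comp (f.mdifferentiableAt _) (B.mdifferentiableAt_proj v), ← B.zero_smul',
      VField.deriv_apply, ← h 0 v,
      ← dirDeriv_comp ((B.pull f).mdifferentiableAt _) (B.mdifferentiableAt_smul 0 v)]
    congr 1
    funext y
    rw [pull_apply, B.proj_smul]
  let Y₀ : ∀ x : N, TangentSpace 𝓘(ℝ, VN) x := fun x =>
    (mfderiv 𝓘(ℝ, VV) 𝓘(ℝ, VN) B.proj (B.zero x) (Z (B.zero x)) : VN)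
  have hY₀ : ∀ (f : SmoothFun VN N) (x : N), dirDeriv f x (Y₀ x) = Z.deriv (B.pull f) (B.zero x) := by
    intro f x
    have := key (B.zero x) f
    rw [B.proj_zero] at this
    rw [← this]
    rfl
  refine ⟨VField.ofDirDeriv Y₀ fun f => ?_, fun v => _root_.tangent_ext fun f => ?_⟩
  · simp_rw [hY₀]
    exact (Z.deriv (B.pull f)).contMDiff.comp B.contMDiff_zero
  · rw [key]
    exact (hY₀ f _).symm

/-- A vector field on the total space that is invariant under scalar multiplication corresponds to a
derivation. -/
lemma IsHomogeneous.exists_der {Z : VField VV V} (h : B.IsHomogeneous Z) :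
    ∃ Δ : Der VN N B.Sec, B.Corresponds Z Δ := by
  obtain ⟨Y, hY⟩ := h.exists_base
  have hlin : ∀ φ, B.IsFibreLinear φ → B.IsFibreLinear (Z.deriv φ) := by
    intro φ hφ
    refine B.isFibreLinear_of_homogeneous fun r v => ?_
    rw [VField.deriv_apply, ← h r v,
      ← dirDeriv_comp (φ.mdifferentiableAt _) (B.mdifferentiableAt_smul r v)]
    have e2 : (fun y => φ (B.smul r y)) = fun y => algebraMap ℝ (SmoothFun VV V) r y * φ y :=
      funext fun y => hφ.2 r y
    rw [e2, dirDeriv_mul ((algebraMap ℝ (SmoothFun VV V) r).mdifferentiableAt v)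
      (φ.mdifferentiableAt v)]
    have e3 : dirDeriv (algebraMap ℝ (SmoothFun VV V) r) v (Z v) = 0 := dirDeriv_const r v (Z v)
    rw [e3, zero_mul, zero_add]
    rfl
  have hex : ∀ s : B.Sec, ∃ t : B.Sec, B.IsDerivOf Z Y s t := by
    intro s
    refine B.exists_sec_of_dual
      (T := fun φ x => Y.deriv (B.pairing φ s) x - Z.deriv φ (s x)) (fun φ hφ => ?_)
      (fun φ ψ hφ hψ x => ?_) fun f φ hφ x => ?_
    · exact (Y.deriv (B.pairing φ s)).contMDiff.sub ((Z.deriv φ).contMDiff.comp s.contMDiff)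
    · have e1 : B.pairing (φ + ψ) s = B.pairing φ s + B.pairing ψ s := rfl
      rw [e1, Y.deriv_add, Z.deriv_add, SmoothFun.add_apply, SmoothFun.add_apply]
      ring
    · have e1 : B.pairing (B.pull f * φ) s = f * B.pairing φ s := by
        ext y
        show f (B.proj (s y)) * φ (s y) = f y * φ (s y)
        rw [s.proj_apply]; rfl
      rw [e1, Y.deriv_mul, Z.deriv_mul, deriv_pull hY]
      show Y.deriv f x * φ (s x) + f x * Y.deriv (B.pairing φ s) x -
        (Y.deriv f (B.proj (s x)) * φ (s x) + f (B.proj (s x)) * Z.deriv φ (s x)) = _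
      rw [s.proj_apply]
      show Y.deriv f x * φ (s x) + f x * Y.deriv (B.pairing φ s) x -
        (Y.deriv f x * φ (s x) + f x * Z.deriv φ (s x)) = _
      ring
  choose d hd using hex
  have hleib : ∀ (f : SmoothFun VN N) s, d (f • s) = Y.deriv f • s + f • d s := by
    intro f s
    refine SecAlong.ext_fibreLinear fun φ hφ x => ?_
    have e1 : B.pairing φ (f • s) = f * B.pairing φ s :=
      ContMDiffMap.ext fun y => hφ.sec_smul f s y
    rw [hd (f • s) φ hφ x, hφ.sec_add, hφ.sec_smul, hφ.sec_smul, hd s φ hφ x, e1, Y.deriv_mul,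
      (hlin φ hφ).sec_smul]
    show Y.deriv f x * φ (s x) + f x * _ - _ = _
    ring
  refine ⟨⟨d, Y, fun s t => ?_, fun r s => ?_, hleib⟩, hlin, hY, hd⟩
  · refine SecAlong.ext_fibreLinear fun φ hφ x => ?_
    have e1 : B.pairing φ (s + t) = B.pairing φ s + B.pairing φ t :=
      ContMDiffMap.ext fun y => hφ.sec_add s t y
    rw [hd (s + t) φ hφ x, hφ.sec_add, hd s φ hφ x, hd t φ hφ x, e1, Y.deriv_add,
      (hlin φ hφ).sec_add, SmoothFun.add_apply]
    ring
  · rw [hleib, Y.deriv_const, zero_smul, zero_add]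

/-! #### The linear vector field of a derivation -/

/-- The vertical lift of `w` at `v`. -/
lemma exists_vertical (B : VBundle VV V VN N) {v w : V} (hvw : B.proj w = B.proj v) :
    ∃ u : TangentSpace 𝓘(ℝ, VV) v, mfderiv 𝓘(ℝ, VV) 𝓘(ℝ, VN) B.proj v u = 0 ∧
      ∀ ψ : SmoothFun VV V, B.IsFibreLinear ψ → dirDeriv ψ v u = ψ w := by
  have hex : ∃ c : ℝ → V, ContMDiff 𝓘(ℝ, ℝ) 𝓘(ℝ, VV) ∞ c ∧ (∀ t, B.proj (c t) = B.proj w) ∧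
      (∀ t ψ, B.IsFibreLinear ψ → ψ (c t) = ψ v + t * ψ w) ∧ c 0 = v := by
    have hp : ∀ t, B.proj v = B.proj (B.smul t w) := fun t => by rw [B.proj_smul, hvw]
    refine ⟨fun t => B.add v (B.smul t w), B.contMDiff_add_comp contMDiff_const
      (B.contMDiff_smul_curve w) hp, fun t => (B.proj_add _ _ (hp t)).trans hvw.symm,
      fun t ψ hψ => by rw [hψ.1 _ _ (hp t), hψ.2], ?_⟩
    show B.add v (B.smul 0 w) = v
    rw [B.zero_smul', hvw, B.add_zero']
  obtain ⟨c, hc, hcp, hcψ, rfl⟩ := hex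
  have hcd : MDifferentiableAt 𝓘(ℝ, ℝ) 𝓘(ℝ, VV) c 0 := (hc 0).mdifferentiableAt (by simp)
  refine ⟨mfderiv 𝓘(ℝ, ℝ) 𝓘(ℝ, VV) c 0 (1 : ℝ), ?_, fun ψ hψ => ?_⟩
  · have e1 := mfderiv_comp 0 (B.mdifferentiableAt_proj (c 0)) hcd
    have e2 : B.proj ∘ c = fun _ => B.proj w := funext hcp
    rw [e2, mfderiv_const] at e1
    exact (congrArg (fun L => L (1 : ℝ)) e1).symm
  · refine (dirDeriv_comp (ψ.mdifferentiableAt _) hcd _).symm.trans ?_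
    have e2 : (fun t => ψ (c t)) = fun t => ψ (c 0) + t * ψ w := funext fun t => hcψ t ψ hψ
    rw [e2]
    unfold dirDeriv
    rw [mfderiv_eq_fderiv]
    have h3 : HasDerivAt (fun t : ℝ => ψ (c 0) + t * ψ w) (ψ w) 0 := by
      simpa using ((hasDerivAt_id (0 : ℝ)).mul_const (ψ w)).const_add (ψ (c 0))
    show (fderiv ℝ (fun t : ℝ => ψ (c 0) + t * ψ w) 0) 1 = ψ w
    rw [fderiv_apply_one_eq_deriv, h3.deriv]

/-- The function `⟨ψ, s⟩ ↦ σ(Δ)⟨ψ, s⟩ - ⟨ψ, Δ s⟩` is tensorial in `s`. -/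
lemma der_pairing_congr (Δ : Der VN N B.Sec) {ψ : SmoothFun VV V} (hψ : B.IsFibreLinear ψ) {x : N}
    {s t : B.Sec} (h : s x = t x) :
    Δ.symbol.deriv (B.pairing ψ s) x - ψ (Δ s x) =
      Δ.symbol.deriv (B.pairing ψ t) x - ψ (Δ t x) := by
  refine B.tensorial_sec_congr (x := x)
    (T := fun s => Δ.symbol.deriv (B.pairing ψ s) x - ψ (Δ s x)) (fun s t => ?_) (fun f s => ?_) h
  · have e1 : B.pairing ψ (s + t) = B.pairing ψ s + B.pairing ψ t :=
      ContMDiffMap.ext fun y => hψ.sec_add s t y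
    show Δ.symbol.deriv (B.pairing ψ (s + t)) x - ψ (Δ (s + t) x) = _
    rw [e1, VField.deriv_add, Δ.map_add, hψ.sec_add, SmoothFun.add_apply]
    ring
  · have e1 : B.pairing ψ (f • s) = f * B.pairing ψ s :=
      ContMDiffMap.ext fun y => hψ.sec_smul f s y
    show Δ.symbol.deriv (B.pairing ψ (f • s)) x - ψ (Δ (f • s) x) = f x * _
    rw [e1, VField.deriv_mul, Δ.leibniz, hψ.sec_add, hψ.sec_smul, hψ.sec_smul]
    show Δ.symbol.deriv f x * ψ (s x) + f x * _ - _ = _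
    ring

/-- Every derivation comes from a linear vector field: its value at `v` is the sum of the tangent
vector `T s (σ(Δ))` of a section `s` through `v` and of the vertical vector `-Δ s`. -/
lemma exists_corresponds (Δ : Der VN N B.Sec) : ∃ Z : VField VV V, B.Corresponds Z Δ := by
  choose σ hσ using B.exists_sec_eq
  -- the prescribed action of `Z` on fibrewise linear functions
  let E : SmoothFun VV V → V → ℝ := fun ψ v =>
    Δ.symbol.deriv (B.pairing ψ (σ v)) (B.proj v) - ψ (Δ (σ v) (B.proj v))
  have hE : ∀ ψ, B.IsFibreLinear ψ → ∀ (s : B.Sec) x,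
      E ψ (s x) = Δ.symbol.deriv (B.pairing ψ s) x - ψ (Δ s x) := by
    intro ψ hψ s x
    have hx : B.proj (s x) = x := s.proj_apply x
    have e1 : σ (s x) x = s x := by
      have := hσ (s x)
      rwa [hx] at this
    show Δ.symbol.deriv (B.pairing ψ (σ (s x))) (B.proj (s x)) -
      ψ (Δ (σ (s x)) (B.proj (s x))) = _
    rw [hx]
    exact der_pairing_congr Δ hψ e1
  have hadd : ∀ ψ, B.IsFibreLinear ψ → ∀ s t : B.Sec, ∀ x, E ψ ((s + t) x) = E ψ (s x) + E ψ (t x) := by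
    intro ψ hψ s t x
    rw [hE ψ hψ, hE ψ hψ, hE ψ hψ, Δ.map_add, hψ.sec_add]
    have e1 : B.pairing ψ (s + t) = B.pairing ψ s + B.pairing ψ t :=
      ContMDiffMap.ext fun y => hψ.sec_add s t y
    rw [e1, VField.deriv_add, SmoothFun.add_apply]
    ring
  have hsmul : ∀ ψ, B.IsFibreLinear ψ → ∀ (r : ℝ) v, E ψ (B.smul r v) = r * E ψ v := by
    intro ψ hψ r v
    let c : SmoothFun VN N := algebraMap ℝ (SmoothFun VN N) r
    have e0 : B.smul r v = (c • σ v) (B.proj v) := by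
      conv_lhs => rw [← hσ v]
      rfl
    have e1 : B.pairing ψ (c • σ v) = c * B.pairing ψ (σ v) :=
      ContMDiffMap.ext fun y => hψ.sec_smul c (σ v) y
    rw [e0, hE ψ hψ, Δ.leibniz, Δ.symbol.deriv_const, zero_smul, zero_add, hψ.sec_smul, e1,
      VField.deriv_mul, Δ.symbol.deriv_const, zero_mul, zero_add]
    show r * _ - r * _ = _
    rw [← mul_sub]
  have hEadd : ∀ ψ, B.IsFibreLinear ψ → ∀ v w, B.proj v = B.proj w →
      E ψ (B.add v w) = E ψ v + E ψ w := by
    intro ψ hψ v w hvw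
    have e1 : w = σ w (B.proj v) := by rw [hvw, hσ]
    have := hadd ψ hψ (σ v) (σ w) (B.proj v)
    rwa [SecAlong.add_apply, hσ v, ← e1] at this
  -- smoothness, by expansion in a local frame
  have hEsm : ∀ ψ, B.IsFibreLinear ψ → ContMDiff 𝓘(ℝ, VV) 𝓘(ℝ, ℝ) ∞ (E ψ) := by
    intro ψ hψ v₀
    obtain ⟨n, ρ, φ, s, h0, h1, -, h2⟩ := B.exists_dual_pair (B.proj v₀)
    let Q : Fin n → SmoothFun VN N := fun j =>
      Δ.symbol.deriv (B.pairing ψ (s j)) - B.pairing ψ (Δ (s j))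
    have hQ : ∀ j x, E ψ (s j x) = Q j x := fun j x => hE ψ hψ (s j) x
    have hsm : ContMDiffAt 𝓘(ℝ, VV) 𝓘(ℝ, ℝ) ∞ (∑ j, φ j * B.pull (Q j) : SmoothFun VV V) v₀ :=
      (∑ j, φ j * B.pull (Q j) : SmoothFun VV V).contMDiff v₀
    refine hsm.congr_of_eventuallyEq ?_
    filter_upwards [B.contMDiff_proj.continuous.continuousAt.eventually h0] with v hv
    have e1 : v = (∑ j, algebraMap ℝ (SmoothFun VN N) (φ j v) • s j) (B.proj v) := by
      refine B.ext_fibreLinear (SecAlong.proj_apply (h := ContMDiffMap.id) _ _).symm fun χ hχ => ?_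
      have e2 := congrArg (fun t : B.Sec => χ (t (B.proj v))) (h2 (σ v))
      rw [hχ.sec_sum, hχ.sec_smul, hv, one_mul, hσ] at e2
      rw [hχ.sec_sum, ← e2]
      refine Finset.sum_congr rfl fun j _ => ?_
      rw [hχ.sec_smul, hχ.sec_smul, pairing_apply, hσ]
      rfl
    rw [SmoothFun.sum_apply]
    conv_lhs => rw [e1]
    have hsum : ∀ (I : Finset (Fin n)) (t : Fin n → B.Sec),
        E ψ ((∑ j ∈ I, t j) (B.proj v)) = ∑ j ∈ I, E ψ (t j (B.proj v)) := by
      intro I t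
      classical
      induction I using Finset.induction_on with
      | empty =>
        have := hadd ψ hψ 0 0 (B.proj v)
        rw [add_zero] at this
        simpa using this
      | insert a I ha ih => rw [Finset.sum_insert ha, Finset.sum_insert ha, hadd ψ hψ, ih]
    rw [hsum]
    refine Finset.sum_congr rfl fun j _ => ?_
    rw [SecAlong.smul_apply, hsmul ψ hψ, hQ]
    rfl
  have hex : ∀ v, ∃ u : TangentSpace 𝓘(ℝ, VV) v,
      mfderiv 𝓘(ℝ, VV) 𝓘(ℝ, VN) B.proj v u = Δ.symbol (B.proj v) ∧
      ∀ ψ : SmoothFun VV V, B.IsFibreLinear ψ → dirDeriv ψ v u = E ψ v := by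
    intro v
    obtain ⟨s, x, rfl⟩ : ∃ (s : B.Sec) (x : N), s x = v := ⟨σ v, B.proj v, hσ v⟩
    have hx : B.proj (s x) = x := s.proj_apply x
    obtain ⟨u, hu1, hu2⟩ := B.exists_vertical (v := s x) (w := Δ s x)
      (((Δ s).proj_apply x).trans hx.symm)
    refine ⟨mfderiv 𝓘(ℝ, VN) 𝓘(ℝ, VV) s x (Δ.symbol x) - u, ?_, fun ψ hψ => ?_⟩
    · rw [map_sub, hu1, sub_zero]
      have e1 := mfderiv_comp x (B.mdifferentiableAt_proj (s x)) (s.mdifferentiableAt x)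
      have e2 : B.proj ∘ s = id := funext fun x => s.proj_apply x
      rw [e2, mfderiv_id] at e1
      have e3 := congrArg (fun L => L (Δ.symbol x)) e1
      have e4 : (Δ.symbol (B.proj (s x)) : VN) = (Δ.symbol x : VN) := by rw [hx]
      exact (e3.symm.trans (by rfl)).trans e4.symm
    · rw [dirDeriv_map_sub, hu2 ψ hψ,
        ← dirDeriv_comp (ψ.mdifferentiableAt _) (s.mdifferentiableAt x), hE ψ hψ]
      rfl
  choose Z₀ hZ₁ hZ₂ using hex
  obtain ⟨Z, hZ⟩ := B.exists_vfield (Z := Z₀) (Y := Δ.symbol) hZ₁ fun φ hφ => by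
    simp_rw [hZ₂ _ _ hφ]
    exact hEsm φ hφ
  have hZφ : ∀ φ, B.IsFibreLinear φ → ∀ v, Z.deriv φ v = E φ v := fun φ hφ v => by
    rw [VField.deriv_apply, hZ, hZ₂ v φ hφ]
  refine ⟨Z, fun φ hφ => ⟨fun v w hvw => ?_, fun r v => ?_⟩, fun v => by rw [hZ, hZ₁],
    fun s φ hφ x => ?_⟩
  · rw [hZφ φ hφ, hZφ φ hφ, hZφ φ hφ, hEadd φ hφ v w hvw]
  · rw [hZφ φ hφ, hZφ φ hφ, hsmul φ hφ]
  · rw [hZφ φ hφ, hE φ hφ]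
    ring

/-! #### The flow of a linear vector field -/

section Flow

variable {Z : VField VV V} {Y : VField VN N}

lemma IsHomogeneous.flowsTo_smul (hZ : B.IsHomogeneous Z) {t : ℝ} {v w : V} (r : ℝ)
    (h : Z.FlowsTo t v w) : Z.FlowsTo t (B.smul r v) (B.smul r w) :=
  h.map (B.contMDiff_smul r) (hZ r)

/-- The flow of a linear vector field is defined on whole fibres: by homogeneity it is enough to flow
vectors near the zero section. -/
lemma IsHomogeneous.defined_iff (hZ : B.IsHomogeneous Z)
    (hY : ∀ v, mfderiv 𝓘(ℝ, VV) 𝓘(ℝ, VN) B.proj v (Z v) = Y (B.proj v)) {t : ℝ} {v : V} :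
    Z.Defined t v ↔ Y.Defined t (B.proj v) := by
  refine ⟨fun h => (h.flowsTo.map B.contMDiff_proj hY).defined, fun h => ?_⟩
  obtain ⟨a, b, h0, ht, hd, hγ⟩ := h.exists_Ioo
  -- the local flow near the zero vector over `φ_τ x` moves `r φ_τ v` for small `r > 0`
  refine isPreconnected_Ioo.propagate (s := Ioo a b) (p := fun τ => Z.Defined τ v) (fun τ hτ => ?_)
    h0 ht (Z.defined_zero v)
  obtain ⟨ε, Q, hε, hQ, hy, hloc⟩ := Z.exists_local_flow (B.zero (Y.flow τ (B.proj v)))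
  have hcont : ContinuousAt (fun s => B.zero (Y.flow s (B.proj v))) τ :=
    ContinuousAt.comp (f := fun s => Y.flow s (B.proj v)) B.contMDiff_zero.continuous.continuousAt
      (hd τ hτ).hasMFDerivAt.continuousAt
  refine ⟨_, Filter.inter_mem (hcont.preimage_mem_nhds (hQ.mem_nhds hy))
    (Ioo_mem_nhds (a := τ - ε / 2) (b := τ + ε / 2) (by linarith) (by linarith)), ?_⟩
  rintro t₁ ⟨h1Q, h1l, h1r⟩ t₂ ⟨-, h2l, h2r⟩ hdef
  have hw := hdef.flowsTo
  have hp : B.proj (Z.flow t₁ v) = Y.flow t₁ (B.proj v) :=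
    ((hw.map B.contMDiff_proj hY).flow_eq).symm
  have hsm : Filter.Tendsto (fun r : ℝ => B.smul r (Z.flow t₁ v)) (𝓝 0)
      (𝓝 (B.zero (B.proj (Z.flow t₁ v)))) := by
    rw [← B.zero_smul']
    exact (B.contMDiff_smul_curve (Z.flow t₁ v)).continuous.continuousAt
  have hev : ∀ᶠ r in 𝓝[>] (0 : ℝ), B.smul r (Z.flow t₁ v) ∈ Q :=
    (hsm.mono_left nhdsWithin_le_nhds).eventually (hQ.mem_nhds (by rw [hp]; exact h1Q))
  obtain ⟨r, hr, hrpos⟩ := (hev.and self_mem_nhdsWithin).exists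
  have h3 := (hloc _ hr (t₂ - t₁) ⟨by linarith, by linarith⟩).1.flowsTo
  have h4 := hZ.flowsTo_smul r⁻¹ h3
  rw [B.smul_smul', inv_mul_cancel₀ (ne_of_gt hrpos), B.one_smul'] at h4
  have h5 := hw.trans h4
  rw [add_sub_cancel] at h5
  exact h5.defined

lemma proj_flow (hY : ∀ v, mfderiv 𝓘(ℝ, VV) 𝓘(ℝ, VN) B.proj v (Z v) = Y (B.proj v)) {t : ℝ} {v : V}
    (h : Z.Defined t v) : B.proj (Z.flow t v) = Y.flow t (B.proj v) :=
  ((h.flowsTo.map B.contMDiff_proj hY).flow_eq).symm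

/-- The flow of a linear vector field consists of vector bundle morphisms. -/
lemma IsHomogeneous.isMorphismOn_flow (hZ : B.IsHomogeneous Z)
    (hY : ∀ v, mfderiv 𝓘(ℝ, VV) 𝓘(ℝ, VN) B.proj v (Z v) = Y (B.proj v)) (t : ℝ) :
    B.IsMorphismOn B {x | Y.Defined t x} (Z.flow t) (Y.flow t) := by
  refine B.isMorphismOn_of_homogeneous B (Y.isOpen_defined t) (fun v hv => ?_) (fun r v hv => ?_)
    fun x hx => ?_
  · exact ((hZ.defined_iff hY).2 hv).contMDiffAt_flow.contMDiffWithinAt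
  · exact (hZ.flowsTo_smul r ((hZ.defined_iff hY).2 hv).flowsTo).flow_eq
  · rw [proj_flow hY ((hZ.defined_iff hY).2 (by rw [B.proj_zero]; exact hx)), B.proj_zero]

end Flow

end VBundle

/-! ### Lie algebroids and their differential -/

section LieAlgebroids

variable {VV : Type*} [NormedAddCommGroup VV] [NormedSpace ℝ VV]
  {V : Type*} [TopologicalSpace V] [ChartedSpace VV V] [IsManifold 𝓘(ℝ, VV) ∞ V]
  {VN : Type*} [NormedAddCommGroup VN] [NormedSpace ℝ VN]
  {N : Type*} [TopologicalSpace N] [ChartedSpace VN N] [IsManifold 𝓘(ℝ, VN) ∞ N]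
  [FiniteDimensional ℝ VV] [T2Space V] [FiniteDimensional ℝ VN] [T2Space N]
  {B : VBundle VV V VN N}

/-- The transpose of the anchor: the fibrewise linear function `v ↦ ρ(v)(f)`. -/
def AnchorMap.dualFun (L : AnchorMap B) (f : SmoothFun VN N) : SmoothFun VV V :=
  ⟨fun v => dirDeriv f (B.proj v) (L.anchor (B.proj v) v),
    (contMDiff_snd_tangentBundle_modelSpace ℝ 𝓘(ℝ, ℝ)).comp
      ((f.contMDiff.contMDiff_tangentMap (m := ∞) (by simp)).comp L.anchor_smooth)⟩

namespace AnchorMap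

variable (L : AnchorMap B)

lemma dualFun_apply (f : SmoothFun VN N) {v : V} {x : N} (h : B.proj v = x) :
    L.dualFun f v = dirDeriv f x (L.anchor x v) := by
  subst h; rfl

lemma dualFun_lin (f : SmoothFun VN N) : B.IsFibreLinear (L.dualFun f) := by
  refine ⟨fun v w h => ?_, fun r v => ?_⟩
  · rw [L.dualFun_apply f (B.proj_add v w h), L.dualFun_apply f rfl, L.dualFun_apply f h.symm,
      L.anchor_add _ _ _ rfl h.symm, dirDeriv_map_add]
  · rw [L.dualFun_apply f (B.proj_smul r v), L.dualFun_apply f rfl, L.anchor_smul _ _ _ rfl,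
      dirDeriv_map_smul]
    rfl

lemma field_deriv (s : B.Sec) (f : SmoothFun VN N) : (L.field s).deriv f = B.pairing (L.dualFun f) s :=
  ContMDiffMap.ext fun x => (L.dualFun_apply f (s.proj_apply x)).symm

end AnchorMap

namespace LieAlgebroid

variable (L : LieAlgebroid B)

lemma bracket_skew (s t : B.Sec) : L.bracket s t = -L.bracket t s := by
  have h := L.bracket_self (s + t)
  rw [L.bracket_add_left, L.bracket_add_right, L.bracket_add_right, L.bracket_self, L.bracket_self,
    zero_add, add_zero] at h
  exact eq_neg_of_add_eq_zero_left h

lemma leibniz_left (f : SmoothFun VN N) (s t : B.Sec) :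
    L.bracket (f • s) t = f • L.bracket s t - (L.field t).deriv f • s := by
  rw [L.bracket_skew, L.leibniz, L.bracket_skew t s, smul_neg]
  abel

/-- The differential `dξ(s, t) = ρ(s)⟨ξ, t⟩ - ρ(t)⟨ξ, s⟩ - ⟨ξ, [s, t]⟩` of a fibrewise linear function,
i.e. of a section of the dual bundle. -/
def diff (ξ : SmoothFun VV V) (s t : B.Sec) : SmoothFun VN N :=
  (L.field s).deriv (B.pairing ξ t) - (L.field t).deriv (B.pairing ξ s) - B.pairing ξ (L.bracket s t)

lemma diff_apply (ξ : SmoothFun VV V) (s t : B.Sec) (x : N) : L.diff ξ s t x =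
    (L.field s).deriv (B.pairing ξ t) x - (L.field t).deriv (B.pairing ξ s) x -
      ξ (L.bracket s t x) := rfl

variable {ξ : SmoothFun VV V} (hξ : B.IsFibreLinear ξ)

include hξ

omit [IsManifold 𝓘(ℝ, VV) ∞ V] [IsManifold 𝓘(ℝ, VN) ∞ N] [FiniteDimensional ℝ VV] [T2Space V]
  [FiniteDimensional ℝ VN] [T2Space N] in
lemma _root_.VBundle.IsFibreLinear.pairing_add (s t : B.Sec) :
    B.pairing ξ (s + t) = B.pairing ξ s + B.pairing ξ t :=
  ContMDiffMap.ext fun y => hξ.sec_add s t y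

lemma _root_.VBundle.IsFibreLinear.pairing_smul (f : SmoothFun VN N) (s : B.Sec) :
    B.pairing ξ (f • s) = f * B.pairing ξ s :=
  ContMDiffMap.ext fun y => hξ.sec_smul f s y

lemma diff_swap (s t : B.Sec) (x : N) : L.diff ξ s t x = -L.diff ξ t s x := by
  rw [diff_apply, diff_apply, L.bracket_skew s t, hξ.sec_neg]
  ring

lemma diff_add_left (s s' t : B.Sec) (x : N) :
    L.diff ξ (s + s') t x = L.diff ξ s t x + L.diff ξ s' t x := by
  simp only [diff_apply, L.bracket_add_left, hξ.sec_add, hξ.pairing_add, VField.deriv_add,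
    L.field_deriv (s + s'), (L.dualFun_lin _).pairing_add, SmoothFun.add_apply, ← L.field_deriv]
  ring

lemma diff_smul_left (f : SmoothFun VN N) (s t : B.Sec) (x : N) :
    L.diff ξ (f • s) t x = f x * L.diff ξ s t x := by
  simp only [diff_apply, L.leibniz_left, hξ.sec_sub, hξ.sec_smul, hξ.pairing_smul, VField.deriv_mul,
    L.field_deriv (f • s), (L.dualFun_lin _).pairing_smul, SmoothFun.add_apply,
    SmoothFun.mul_apply, ← L.field_deriv]
  rw [B.pairing_apply]
  ring

lemma diff_add_right (s t t' : B.Sec) (x : N) :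
    L.diff ξ s (t + t') x = L.diff ξ s t x + L.diff ξ s t' x := by
  rw [L.diff_swap hξ, L.diff_add_left hξ, L.diff_swap hξ s t, L.diff_swap hξ s t']
  ring

lemma diff_smul_right (f : SmoothFun VN N) (s t : B.Sec) (x : N) :
    L.diff ξ s (f • t) x = f x * L.diff ξ s t x := by
  rw [L.diff_swap hξ, L.diff_smul_left hξ, L.diff_swap hξ s t]
  ring

lemma diff_congr {s s' t t' : B.Sec} {x : N} (hs : s x = s' x) (ht : t x = t' x) :
    L.diff ξ s t x = L.diff ξ s' t' x := by
  have e1 : L.diff ξ s t x = L.diff ξ s' t x :=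
    B.tensorial_sec_congr (T := fun s => L.diff ξ s t x) (fun a b => L.diff_add_left hξ a b t x)
      (fun f a => L.diff_smul_left hξ f a t x) hs
  rw [e1]
  exact B.tensorial_sec_congr (T := fun t => L.diff ξ s' t x)
    (fun a b => L.diff_add_right hξ s' a b x) (fun f a => L.diff_smul_right hξ f s' a x) ht

lemma diff_sum_left {n : ℕ} (s : Fin n → B.Sec) (t : B.Sec) (x : N) :
    L.diff ξ (∑ j, s j) t x = ∑ j, L.diff ξ (s j) t x := by
  have h0 : L.diff ξ 0 t x = 0 := by
    have := L.diff_smul_left hξ 0 0 t x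
    rw [zero_smul] at this
    rw [this]; exact zero_mul _
  have key : ∀ I : Finset (Fin n), L.diff ξ (∑ j ∈ I, s j) t x = ∑ j ∈ I, L.diff ξ (s j) t x := by
    intro I
    classical
    induction I using Finset.induction_on with
    | empty => simpa using h0
    | insert a I ha ih => rw [Finset.sum_insert ha, Finset.sum_insert ha, L.diff_add_left hξ, ih]
  exact key _

/-- The differential is determined by its values on a local frame. -/
lemma diff_eq_sum {n : ℕ} {ρ : SmoothFun VN N} {φ : Fin n → SmoothFun VV V} {σ : Fin n → B.Sec}
    (h : ∀ t : B.Sec, ∑ j, B.pairing (φ j) t • σ j = ρ • t) (s t : B.Sec) {x : N} (hx : ρ x = 1) :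
    L.diff ξ s t x = ∑ j, φ j (s x) * ∑ k, φ k (t x) * L.diff ξ (σ j) (σ k) x := by
  have e1 : ∀ s t, L.diff ξ s t x = ∑ j, φ j (s x) * L.diff ξ (σ j) t x := fun s t => by
    have := L.diff_smul_left hξ ρ s t x
    rw [hx, one_mul, ← h s, L.diff_sum_left hξ] at this
    rw [← this]
    exact Finset.sum_congr rfl fun j _ => L.diff_smul_left hξ _ _ _ _
  rw [e1]
  refine Finset.sum_congr rfl fun j _ => ?_
  rw [L.diff_swap hξ, e1]
  congr 1
  rw [← Finset.sum_neg_distrib]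
  refine Finset.sum_congr rfl fun k _ => ?_
  rw [L.diff_swap hξ (σ k)]
  ring

end LieAlgebroid

end LieAlgebroids

/-! ### Flows of Lie algebroid derivations -/

/-- A solution of a homogeneous linear inequality that vanishes at one time vanishes identically. -/
lemma eq_zero_of_norm_deriv_le {G : Type*} [NormedAddCommGroup G] [NormedSpace ℝ G] {d d' : ℝ → G}
    {a b C t₁ t₂ : ℝ} (hd : ∀ τ ∈ Ioo a b, HasDerivAt d (d' τ) τ)
    (hC : ∀ τ ∈ Ioo a b, ‖d' τ‖ ≤ C * ‖d τ‖) (h1 : t₁ ∈ Ioo a b) (h2 : t₂ ∈ Ioo a b)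
    (h0 : d t₁ = 0) : d t₂ = 0 := by
  have key : ∀ (e e' : ℝ → G) (a b t₁ t₂ : ℝ), (∀ τ ∈ Ioo a b, HasDerivAt e (e' τ) τ) →
      (∀ τ ∈ Ioo a b, ‖e' τ‖ ≤ C * ‖e τ‖) → t₁ ∈ Ioo a b → t₂ ∈ Ioo a b → e t₁ = 0 → t₁ ≤ t₂ →
      e t₂ = 0 := by
    intro e e' a b t₁ t₂ he hC h1 h2 h0 hle
    have hsub : Icc t₁ t₂ ⊆ Ioo a b := fun τ hτ => ⟨h1.1.trans_le hτ.1, hτ.2.trans_lt h2.2⟩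
    have := norm_le_gronwallBound_of_norm_deriv_right_le (f := e) (f' := e') (δ := 0) (K := C)
      (ε := 0) (a := t₁) (b := t₂) (fun τ hτ => (he τ (hsub hτ)).continuousAt.continuousWithinAt)
      (fun τ hτ => (he τ (hsub (Ico_subset_Icc_self hτ))).hasDerivWithinAt) (by simp [h0])
      (fun τ hτ => by simpa using hC τ (hsub (Ico_subset_Icc_self hτ))) t₂ ⟨hle, le_rfl⟩
    rw [gronwallBound_ε0, zero_mul] at this
    exact norm_le_zero_iff.1 this
  rcases le_total t₁ t₂ with h | h
  · exact key d d' a b t₁ t₂ hd hC h1 h2 h0 h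
  · have := key (fun τ => d (-τ)) (fun τ => -d' (-τ)) (-b) (-a) (-t₁) (-t₂) (fun τ hτ => ?_)
      (fun τ hτ => ?_) ⟨neg_lt_neg h1.2, neg_lt_neg h1.1⟩ ⟨neg_lt_neg h2.2, neg_lt_neg h2.1⟩
      (by simpa using h0) (neg_le_neg h)
    · simpa using this
    · have h3 : -τ ∈ Ioo a b := ⟨by linarith [hτ.2], by linarith [hτ.1]⟩
      have h4 := (hd _ h3).scomp τ (hasDerivAt_neg τ)
      rw [neg_one_smul] at h4
      exact h4
    · have h3 : -τ ∈ Ioo a b := ⟨by linarith [hτ.2], by linarith [hτ.1]⟩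
      simpa using hC _ h3

/-- A family of functionals `D τ` on functions, tensorial in the sense of being locally determined by
finitely many functions `c j` and evolving by `D' f = D (Zf)`, vanishes near a time at which it
vanishes, because the `D τ (c j)` solve a linear differential equation. -/
lemma exists_nhds_propagate {𝓕 : Type*} {S : Set 𝓕} {D : ℝ → 𝓕 → ℝ} {z : 𝓕 → 𝓕} {n : ℕ}
    {c : Fin n → 𝓕} {k : 𝓕 → Fin n → ℝ → ℝ} {τ₀ : ℝ} (hcS : ∀ j, c j ∈ S) (hzS : ∀ j, z (c j) ∈ S)
    (hD : ∀ᶠ τ in 𝓝 τ₀, ∀ f ∈ S, D τ f = ∑ j, k f j τ * D τ (c j))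
    (hk : ∀ j i, ContinuousAt (k (z (c j)) i) τ₀)
    (hd : ∀ᶠ τ in 𝓝 τ₀, ∀ j, HasDerivAt (fun τ => D τ (c j)) (D τ (z (c j))) τ) :
    ∃ O ∈ 𝓝 τ₀, ∀ t₁ ∈ O, ∀ t₂ ∈ O, (∀ f ∈ S, D t₁ f = 0) → ∀ f ∈ S, D t₂ f = 0 := by
  have hb : ∀ᶠ τ in 𝓝 τ₀, ∀ j i, |k (z (c j)) i τ| ≤ |k (z (c j)) i τ₀| + 1 := by
    refine Filter.eventually_all.2 fun j => Filter.eventually_all.2 fun i => ?_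
    exact ((hk j i).abs.eventually (gt_mem_nhds (lt_add_one _))).mono fun τ hτ => hτ.le
  let C : ℝ := ∑ j, ∑ i, (|k (z (c j)) i τ₀| + 1)
  obtain ⟨ε, hε, hball⟩ := Metric.eventually_nhds_iff_ball.1 (hD.and (hb.and hd))
  rw [Real.ball_eq_Ioo] at hball
  refine ⟨_, Ioo_mem_nhds (a := τ₀ - ε) (b := τ₀ + ε) (by linarith) (by linarith),
    fun t₁ h1 t₂ h2 h0 f hf => ?_⟩
  have hz : (fun j => D t₂ (c j)) = 0 := by
    refine eq_zero_of_norm_deriv_le (d := fun τ j => D τ (c j)) (d' := fun τ j => D τ (z (c j)))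
      (C := C) (fun τ hτ => hasDerivAt_pi.2 fun j => (hball τ hτ).2.2 j) (fun τ hτ => ?_) h1 h2
      (funext fun j => h0 _ (hcS j))
    have hC : 0 ≤ C := Finset.sum_nonneg fun j _ => Finset.sum_nonneg fun i _ => by positivity
    refine (pi_norm_le_iff_of_nonneg (mul_nonneg hC (norm_nonneg _))).2 fun j => ?_
    show ‖D τ (z (c j))‖ ≤ _
    rw [(hball τ hτ).1 _ (hzS j)]
    refine (norm_sum_le _ _).trans ?_
    have h3 : ∀ i, ‖k (z (c j)) i τ * D τ (c i)‖ ≤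
        (|k (z (c j)) i τ₀| + 1) * ‖fun j => D τ (c j)‖ := fun i => by
      rw [norm_mul]
      exact mul_le_mul ((hball τ hτ).2.1 j i) (norm_le_pi_norm (fun j => D τ (c j)) i)
        (norm_nonneg _) (by positivity)
    refine (Finset.sum_le_sum fun i _ => h3 i).trans ?_
    rw [← Finset.sum_mul]
    refine mul_le_mul_of_nonneg_right ?_ (norm_nonneg _)
    exact Finset.single_le_sum (f := fun j => ∑ i, (|k (z (c j)) i τ₀| + 1))
      (fun j _ => Finset.sum_nonneg fun i _ => by positivity) (Finset.mem_univ j)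
  rw [(hball t₂ h2).1 f hf]
  refine Finset.sum_eq_zero fun j _ => ?_
  rw [show D t₂ (c j) = 0 from congrFun hz j, mul_zero]

section

variable {VN : Type*} [NormedAddCommGroup VN] [NormedSpace ℝ VN]
  {N : Type*} [TopologicalSpace N] [ChartedSpace VN N] [IsManifold 𝓘(ℝ, VN) ∞ N]
  [FiniteDimensional ℝ VN] [T2Space N]
  {VP : Type*} [NormedAddCommGroup VP] [NormedSpace ℝ VP]
  {P : Type*} [TopologicalSpace P] [ChartedSpace VP P] [IsManifold 𝓘(ℝ, VP) ∞ P]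

/-- Local coordinate functions, extended to the whole manifold. -/
lemma exists_coordinates (y₀ : N) : ∃ (n : ℕ) (c : Fin n → SmoothFun VN N)
    (k : SmoothFun VN N → Fin n → N → ℝ), (∀ f j, ContinuousAt (k f j) y₀) ∧
    ∀ᶠ y in 𝓝 y₀, ∀ (f : SmoothFun VN N) (u : TangentSpace 𝓘(ℝ, VN) y),
      dirDeriv f y u = ∑ j, k f j y * dirDeriv (c j) y u := by
  obtain ⟨h, hh, hx⟩ := exists_chartFun (VN := VN) y₀
  let b := Module.finBasis ℝ VN
  let ℓ : Fin (Module.finrank ℝ VN) → VN →L[ℝ] ℝ := fun j => LinearMap.toContinuousLinearMap (b.coord j)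
  let e := extChartAt 𝓘(ℝ, VN) y₀
  have hsrc : ∀ᶠ y in 𝓝 y₀, y ∈ e.source := extChartAt_source_mem_nhds y₀
  have hf : ∀ (f : SmoothFun VN N) y, y ∈ e.source → ContDiffAt ℝ ∞ (fun z => f (e.symm z)) (e y) := by
    intro f y hy
    rw [← contMDiffAt_iff_contDiffAt]
    exact (f.contMDiff _).comp _ ((contMDiffOn_extChartAt_symm y₀).contMDiffAt
      ((isOpen_extChartAt_target y₀).mem_nhds (e.map_source hy)))
  refine ⟨_, fun j => ⟨fun y => ℓ j (h y), (ℓ j).contMDiff.comp hh⟩,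
    fun f j y => fderiv ℝ (fun z => f (e.symm z)) (h y) (b j), fun f j => ?_, ?_⟩
  · have h1 := hf f y₀ (mem_extChartAt_source y₀)
    rw [← hx.self_of_nhds] at h1
    have h2 : ContinuousAt (fderiv ℝ (fun z => f (e.symm z))) (h y₀) :=
      (h1.fderiv_right (m := 0) (by simp)).continuousAt
    exact (ContinuousAt.comp (f := h) h2 hh.continuous.continuousAt).clm_apply continuousAt_const
  · filter_upwards [hx.eventually_nhds, hsrc, hsrc.eventually_nhds] with y hy hys hyn f u
    have hhd : MDifferentiableAt 𝓘(ℝ, VN) 𝓘(ℝ, VN) h y := (hh y).mdifferentiableAt (by simp)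
    have e1 : f =ᶠ[𝓝 y] fun y => (fun z => f (e.symm z)) (h y) := by
      filter_upwards [hy, hyn] with w hw hws
      show f w = f (e.symm (h w))
      rw [hw, e.left_inv hws]
    have h1 := hf f y hys
    have hye : h y = e y := hy.self_of_nhds
    rw [← hye] at h1
    have e2 := dirDeriv_comp_fderiv (h1.differentiableAt (by simp)) hhd u
    rw [dirDeriv_congr e1 u, e2]
    conv_lhs => rw [← b.sum_repr (dirDeriv h y u)]
    rw [map_sum]
    refine Finset.sum_congr rfl fun j _ => ?_
    rw [map_smul, smul_eq_mul, mul_comm]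
    congr 1
    have e3 := dirDeriv_comp_fderiv (g := ℓ j) (ℓ j).differentiableAt hhd u
    rw [ContinuousLinearMap.fderiv] at e3
    exact e3.symm

/-- The derivative along a flow commutes with a directional derivative. -/
lemma hasDerivAt_dirDeriv_flow {X : VField VN N} {s : P → N} (hs : ContMDiff 𝓘(ℝ, VP) 𝓘(ℝ, VN) ∞ s)
    {τ : ℝ} {x : P} (h : X.Defined τ (s x)) (f : SmoothFun VN N) (u : TangentSpace 𝓘(ℝ, VP) x) :
    HasDerivAt (fun t => dirDeriv (fun y => f (X.flow t (s y))) x u)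
      (dirDeriv (fun y => X.deriv f (X.flow τ (s y))) x u) τ := by
  have h1 : ContMDiffAt (𝓘(ℝ, ℝ).prod 𝓘(ℝ, VP)) (𝓘(ℝ, ℝ).prod 𝓘(ℝ, VN)) ∞
      (fun p : ℝ × P => (p.1, s p.2)) (τ, x) :=
    contMDiffAt_fst.prodMk ((hs x).comp (τ, x) contMDiffAt_snd)
  have h2 : ContMDiffAt (𝓘(ℝ, ℝ).prod 𝓘(ℝ, VP)) 𝓘(ℝ, ℝ) ∞
      (fun p : ℝ × P => f (X.flow p.1 (s p.2))) (τ, x) :=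
    (f.contMDiff _).comp (τ, x) (ContMDiffAt.comp (τ, x) (g := fun p : ℝ × N => X.flow p.1 p.2)
      h.contMDiffAt h1)
  have h3 := hasDerivAt_dirDeriv_param h2 u
  refine h3.congr_deriv (dirDeriv_congr ?_ u)
  filter_upwards [hs.continuous.continuousAt.eventually ((X.isOpen_defined τ).mem_nhds h)] with y hy
  exact (VField.Defined.hasDerivAt hy (f.mdifferentiableAt _)).deriv

end

section LieAlgebroids

variable {VV : Type*} [NormedAddCommGroup VV] [NormedSpace ℝ VV]
  {V : Type*} [TopologicalSpace V] [ChartedSpace VV V] [IsManifold 𝓘(ℝ, VV) ∞ V]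
  {VN : Type*} [NormedAddCommGroup VN] [NormedSpace ℝ VN]
  {N : Type*} [TopologicalSpace N] [ChartedSpace VN N] [IsManifold 𝓘(ℝ, VN) ∞ N]
  [FiniteDimensional ℝ VV] [T2Space V] [FiniteDimensional ℝ VN] [T2Space N]
  {B : VBundle VV V VN N} {Z : VField VV V} {Y : VField VN N}

namespace AnchorMap

variable {L : AnchorMap B}

/-- If `Z` preserves the anchor infinitesimally, then its flow preserves the anchor. -/
lemma mfderiv_flow (hZ : B.IsHomogeneous Z)
    (hY : ∀ v, mfderiv 𝓘(ℝ, VV) 𝓘(ℝ, VN) B.proj v (Z v) = Y (B.proj v))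
    (hA : ∀ f, Z.deriv (L.dualFun f) = L.dualFun (Y.deriv f)) {t : ℝ} {v : V}
    (h : Y.Defined t (B.proj v)) :
    mfderiv 𝓘(ℝ, VN) 𝓘(ℝ, VN) (Y.flow t) (B.proj v) (L.anchor (B.proj v) v) =
      L.anchor (Y.flow t (B.proj v)) (Z.flow t v) := by
  let x := B.proj v
  -- the difference of the two sides, applied to `f`, is tensorial in `f` and evolves by `Y`
  let D : ℝ → SmoothFun VN N → ℝ := fun τ f => L.dualFun f (Z.flow τ v) -
    dirDeriv (fun y => f (Y.flow τ y)) x (L.anchor x v)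
  have hdual : ∀ {τ}, Y.Defined τ x → ∀ f, L.dualFun f (Z.flow τ v) =
      dirDeriv f (Y.flow τ x) (L.anchor (Y.flow τ x) (Z.flow τ v)) := fun hτ f =>
    L.dualFun_apply f (VBundle.proj_flow hY ((hZ.defined_iff hY).2 hτ))
  have hcomp : ∀ {τ}, Y.Defined τ x → ∀ f : SmoothFun VN N,
      dirDeriv (fun y => f (Y.flow τ y)) x (L.anchor x v) = dirDeriv f (Y.flow τ x)
        (mfderiv 𝓘(ℝ, VN) 𝓘(ℝ, VN) (Y.flow τ) x (L.anchor x v)) := fun hτ f =>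
    dirDeriv_comp (f.mdifferentiableAt _) (hτ.contMDiffAt_flow.mdifferentiableAt (by simp)) _
  have hD' : ∀ {τ}, Y.Defined τ x → ∀ f, HasDerivAt (fun τ => D τ f) (D τ (Y.deriv f)) τ := by
    intro τ hτ f
    have h1 := ((hZ.defined_iff hY).2 hτ).hasDerivAt ((L.dualFun f).mdifferentiableAt _)
    have h2 := hasDerivAt_dirDeriv_flow (X := Y) (s := fun y => y) contMDiff_id hτ f (L.anchor x v)
    refine (h1.sub h2).congr_deriv ?_
    show Z.deriv (L.dualFun f) (Z.flow τ v) - _ = _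
    rw [hA]
  obtain ⟨a, b, h0, ht, hd, hγ⟩ := h.exists_Ioo
  have key := isPreconnected_Ioo.propagate (s := Ioo a b) (p := fun τ => ∀ f ∈ univ, D τ f = 0)
    (fun τ hτ => ?_) h0 ht ?_
  · refine (tangent_ext fun f => ?_).symm
    have h1 := key f (mem_univ f)
    have h2 := hdual h f
    have h3 := hcomp h f
    rw [← h2, ← h3]
    linarith
  · obtain ⟨n, c, k, hk, hky⟩ := exists_coordinates (VN := VN) (Y.flow τ x)
    have hcont : ContinuousAt (fun s => Y.flow s x) τ := (hd τ hτ).hasMFDerivAt.continuousAt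
    refine exists_nhds_propagate (z := Y.deriv) (c := c) (k := fun f j τ => k f j (Y.flow τ x))
      (fun _ => mem_univ _) (fun _ => mem_univ _) ?_ (fun j i => ?_) ?_
    · filter_upwards [hcont.eventually hky, (hd τ hτ).eventually] with r hr hdr f _
      show L.dualFun f _ - _ = ∑ j, _ * (L.dualFun (c j) _ - _)
      simp_rw [hdual hdr, hcomp hdr, mul_sub, Finset.sum_sub_distrib]
      rw [hr, hr]
    · exact ContinuousAt.comp (f := fun s => Y.flow s x) (hk _ i) hcont
    · exact (hd τ hτ).eventually.mono fun r hr j => hD' hr (c j)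
  · intro f _
    show L.dualFun f (Z.flow 0 v) - dirDeriv (fun y => f (Y.flow 0 y)) x _ = 0
    simp_rw [VField.flow_zero]
    rw [L.dualFun_apply f rfl]
    exact sub_self _

/-- Conversely, a flow that preserves the anchor preserves it infinitesimally. -/
lemma deriv_dualFun_of_flow (hZ : B.IsHomogeneous Z)
    (hY : ∀ v, mfderiv 𝓘(ℝ, VV) 𝓘(ℝ, VN) B.proj v (Z v) = Y (B.proj v))
    (h : ∀ t v, Y.Defined t (B.proj v) →
      mfderiv 𝓘(ℝ, VN) 𝓘(ℝ, VN) (Y.flow t) (B.proj v) (L.anchor (B.proj v) v) =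
        L.anchor (Y.flow t (B.proj v)) (Z.flow t v)) (f : SmoothFun VN N) :
    Z.deriv (L.dualFun f) = L.dualFun (Y.deriv f) := by
  ext v
  have hd := Y.defined_zero (B.proj v)
  have h1 := (Z.defined_zero v).hasDerivAt ((L.dualFun f).mdifferentiableAt _)
  have h2 := hasDerivAt_dirDeriv_flow (X := Y) (s := fun y => y) contMDiff_id hd f
    (L.anchor (B.proj v) v)
  have h3 : (fun t => dirDeriv (fun y => f (Y.flow t y)) (B.proj v) (L.anchor (B.proj v) v)) =ᶠ[𝓝 0]
      fun t => L.dualFun f (Z.flow t v) := by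
    filter_upwards [hd.eventually] with t ht
    rw [L.dualFun_apply f (VBundle.proj_flow hY ((hZ.defined_iff hY).2 ht)), ← h t v ht]
    exact dirDeriv_comp (f.mdifferentiableAt _) (ht.contMDiffAt_flow.mdifferentiableAt (by simp)) _
  have h4 := h1.unique (h2.congr_of_eventuallyEq h3.symm)
  have h5 : Z.deriv (L.dualFun f) (Z.flow 0 v) =
      dirDeriv (fun y => Y.deriv f (Y.flow 0 y)) (B.proj v) (L.anchor (B.proj v) v) := h4
  simp_rw [VField.flow_zero] at h5
  exact h5

end AnchorMap

end LieAlgebroids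

/-! #### The differential along a flow -/

section LieAlgebroids

variable {VV : Type*} [NormedAddCommGroup VV] [NormedSpace ℝ VV]
  {V : Type*} [TopologicalSpace V] [ChartedSpace VV V] [IsManifold 𝓘(ℝ, VV) ∞ V]
  {VN : Type*} [NormedAddCommGroup VN] [NormedSpace ℝ VN]
  {N : Type*} [TopologicalSpace N] [ChartedSpace VN N] [IsManifold 𝓘(ℝ, VN) ∞ N]
  [FiniteDimensional ℝ VV] [T2Space V] [FiniteDimensional ℝ VN] [T2Space N]
  {B : VBundle VV V VN N} {Z : VField VV V} {Y : VField VN N}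

/-- A section over an open set agrees near any given point of it with a global section. -/
lemma VBundle.exists_sec_eventuallyEq (B : VBundle VV V VN N) {O : Set N} (hO : IsOpen O) {x : N}
    (hx : x ∈ O) {σ : N → V} (hσ : ContMDiffOn 𝓘(ℝ, VN) 𝓘(ℝ, VV) ∞ σ O)
    (hp : ∀ y ∈ O, B.proj (σ y) = y) : ∃ s : B.Sec, ∀ᶠ y in 𝓝 x, s y = σ y := by
  classical
  obtain ⟨n, ρ, φ, σ', h0, h1, h2, -⟩ := B.exists_dual_pair x
  obtain ⟨θ, hθ1, hθs⟩ := exists_bump (VN := VN) (hO.mem_nhds hx)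
  have hc : ∀ j, ContMDiff 𝓘(ℝ, VN) 𝓘(ℝ, ℝ) ∞ fun y => θ y • φ j (σ y) := fun j =>
    contMDiff_cutoff θ.contMDiff hO hθs ((φ j).contMDiff.comp_contMDiffOn hσ)
  let c : Fin n → SmoothFun VN N := fun j => ⟨_, hc j⟩
  refine ⟨∑ j, c j • σ' j, ?_⟩
  filter_upwards [h0, hθ1, hO.mem_nhds hx] with y hy hθ hyO
  have hpy : B.proj ((∑ j, c j • σ' j) y) = y := SecAlong.proj_apply (h := ContMDiffMap.id) _ _
  refine B.ext_fibreLinear (hpy.trans (hp y hyO).symm) fun ψ hψ => ?_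
  rw [hψ.sec_sum]
  have := congrArg (fun f : SmoothFun VV V => f (σ y)) (h2 ψ hψ)
  rw [SmoothFun.sum_apply] at this
  refine Eq.trans (Finset.sum_congr rfl fun j _ => ?_) (this.trans ?_)
  · rw [hψ.sec_smul]
    show θ y * φ j (σ y) * ψ (σ' j y) = ψ (σ' j (B.proj (σ y))) * φ j (σ y)
    rw [hθ, one_mul, mul_comm, hp y hyO]
  · show ρ (B.proj (σ y)) * ψ (σ y) = _
    rw [hp y hyO, hy, one_mul]

lemma VBundle.SecAlong.proj_eq (s : B.Sec) (x : N) : B.proj (s x) = x := s.proj_apply x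

/-- A section through a given vector. -/
def VBundle.through (B : VBundle VV V VN N) (v : V) : B.Sec := (B.exists_sec_eq v).choose

lemma VBundle.through_apply (B : VBundle VV V VN N) (v : V) : B.through v (B.proj v) = v :=
  (B.exists_sec_eq v).choose_spec

namespace LieAlgebroid

variable (L : LieAlgebroid B)

/-- The value of `dξ` on two vectors of one fibre. -/
def diffAt (ξ : SmoothFun VV V) (v w : V) : ℝ := L.diff ξ (B.through v) (B.through w) (B.proj v)

variable {L} {Δ : Der VN N B.Sec}

lemma diffAt_eq {ξ : SmoothFun VV V} (hξ : B.IsFibreLinear ξ) {v w : V} {s t : B.Sec} {x : N}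
    (hv : s x = v) (hw : t x = w) : L.diffAt ξ v w = L.diff ξ s t x := by
  have h1 : B.proj v = x := hv ▸ s.proj_apply x
  have h2 : B.proj w = x := hw ▸ t.proj_apply x
  have e1 := B.through_apply v
  have e2 := B.through_apply w
  rw [h1] at e1
  rw [h2] at e2
  unfold diffAt
  rw [h1]
  exact L.diff_congr hξ (e1.trans hv.symm) (e2.trans hw.symm)

lemma diff_add {ξ η : SmoothFun VV V} (s t : B.Sec) (x : N) :
    L.diff (ξ + η) s t x = L.diff ξ s t x + L.diff η s t x := by
  have e : ∀ s, B.pairing (ξ + η) s = B.pairing ξ s + B.pairing η s := fun _ => rfl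
  simp only [diff_apply, e, VField.deriv_add, SmoothFun.add_apply]
  ring

lemma diff_pull_mul (f : SmoothFun VN N) (ξ : SmoothFun VV V) (s t : B.Sec) (x : N) :
    L.diff (B.pull f * ξ) s t x = f x * L.diff ξ s t x + L.dualFun f (s x) * ξ (t x) -
      L.dualFun f (t x) * ξ (s x) := by
  have e : ∀ s, B.pairing (B.pull f * ξ) s = f * B.pairing ξ s := fun s =>
    ContMDiffMap.ext fun y => by
      show f (B.proj (s y)) * ξ (s y) = f y * ξ (s y)
      rw [s.proj_apply]; rfl
  have e2 : (B.pull f * ξ) (L.bracket s t x) = f x * ξ (L.bracket s t x) := congrArg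
    (fun g : SmoothFun VN N => g x) (e (L.bracket s t))
  simp only [diff_apply, e, e2, VField.deriv_mul, SmoothFun.add_apply, SmoothFun.mul_apply]
  rw [L.field_deriv s f, L.field_deriv t f]
  simp only [B.pairing_apply]
  ring

lemma _root_.VBundle.Corresponds.symbol_deriv_pairing (hC : B.Corresponds Z Δ) {φ : SmoothFun VV V}
    (hφ : B.IsFibreLinear φ) (s : B.Sec) :
    Δ.symbol.deriv (B.pairing φ s) = B.pairing (Z.deriv φ) s + B.pairing φ (Δ s) :=
  ContMDiffMap.ext fun x => by
    have := hC.2.2 s φ hφ x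
    show _ = Z.deriv φ (s x) + φ (Δ s x)
    linarith

/-- The Lie derivative of a differential: it fails to be the differential of the Lie derivative by the
failure of `Δ` to be a derivation of the bracket. -/
lemma symbol_deriv_diff (hC : B.Corresponds Z Δ)
    (hA : ∀ f, Z.deriv (L.dualFun f) = L.dualFun (Δ.symbol.deriv f)) {ξ : SmoothFun VV V}
    (hξ : B.IsFibreLinear ξ) (s t : B.Sec) (x : N) :
    Δ.symbol.deriv (L.diff ξ s t) x = L.diff (Z.deriv ξ) s t x + L.diff ξ (Δ s) t x +
      L.diff ξ s (Δ t) x -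
      ξ ((Δ (L.bracket s t) - L.bracket (Δ s) t - L.bracket s (Δ t)) x) := by
  have e1 : ∀ (s : B.Sec) f, Δ.symbol.deriv ((L.field s).deriv f) =
      (L.field s).deriv (Δ.symbol.deriv f) + (L.field (Δ s)).deriv f := fun s f => by
    rw [L.field_deriv, hC.symbol_deriv_pairing (L.dualFun_lin f), hA, ← L.field_deriv,
      ← L.field_deriv]
  have e2 : L.diff ξ s t = (L.field s).deriv (B.pairing ξ t) -
    (L.field t).deriv (B.pairing ξ s) - B.pairing ξ (L.bracket s t) := rfl
  rw [e2, VField.deriv_sub, VField.deriv_sub, e1, e1, hC.symbol_deriv_pairing hξ,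
    hC.symbol_deriv_pairing hξ, hC.symbol_deriv_pairing hξ, VField.deriv_add, VField.deriv_add]
  simp only [SmoothFun.add_apply, SmoothFun.sub_apply, diff_apply, hξ.sec_sub, B.pairing_apply]
  ring

/-- The derivative of `dξ` along the flow of a linear vector field. -/
lemma hasDerivAt_diffAt_flow (hC : B.Corresponds Z Δ) {ξ : SmoothFun VV V}
    (hξ : B.IsFibreLinear ξ) {v w : V} {x : N} (hv : B.proj v = x) (hw : B.proj w = x) {τ : ℝ}
    (h : Δ.symbol.Defined τ x) {s t : B.Sec} (hs : s (Δ.symbol.flow τ x) = Z.flow τ v)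
    (ht : t (Δ.symbol.flow τ x) = Z.flow τ w) :
    HasDerivAt (fun τ => L.diffAt ξ (Z.flow τ v) (Z.flow τ w))
      (Δ.symbol.deriv (L.diff ξ s t) (Δ.symbol.flow τ x) -
        L.diff ξ (Δ s) t (Δ.symbol.flow τ x) - L.diff ξ s (Δ t) (Δ.symbol.flow τ x)) τ := by
  set y := Δ.symbol.flow τ x with hy
  have hdef : ∀ {r}, Δ.symbol.Defined r x → ∀ {u}, B.proj u = x → Z.Defined r u := fun hr u hu =>
    (hC.isHomogeneous.defined_iff hC.2.1).2 (by rwa [hu])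
  obtain ⟨n, ρ, φ, σ, h0, h1, -, h2⟩ := B.exists_dual_pair y
  have hcont : ContinuousAt (fun s => Δ.symbol.flow s x) τ := h.hasMFDerivAt.continuousAt
  -- the value of `dξ` in terms of the frame
  have e1 : (fun τ => L.diffAt ξ (Z.flow τ v) (Z.flow τ w)) =ᶠ[𝓝 τ] fun τ =>
      ∑ j, φ j (Z.flow τ v) * ∑ k, φ k (Z.flow τ w) * L.diff ξ (σ j) (σ k) (Δ.symbol.flow τ x) := by
    filter_upwards [hcont.eventually h0, h.eventually] with r hr hdr
    have p1 : B.proj (Z.flow r v) = Δ.symbol.flow r x := by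
      rw [VBundle.proj_flow hC.2.1 (hdef hdr hv), hv]
    have p2 : B.proj (Z.flow r w) = Δ.symbol.flow r x := by
      rw [VBundle.proj_flow hC.2.1 (hdef hdr hw), hw]
    have q1 := B.through_apply (Z.flow r v)
    have q2 := B.through_apply (Z.flow r w)
    unfold diffAt
    rw [p1] at q1 ⊢
    rw [p2] at q2
    rw [L.diff_eq_sum hξ h2 _ _ hr, q1]
    simp_rw [q2]
  have d1 : ∀ j, HasDerivAt (fun r => φ j (Z.flow r v)) (Z.deriv (φ j) (Z.flow τ v)) τ := fun j =>
    (hdef h hv).hasDerivAt ((φ j).mdifferentiableAt _)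
  have d2 : ∀ j, HasDerivAt (fun r => φ j (Z.flow r w)) (Z.deriv (φ j) (Z.flow τ w)) τ := fun j =>
    (hdef h hw).hasDerivAt ((φ j).mdifferentiableAt _)
  have d3 : ∀ j k, HasDerivAt (fun r => L.diff ξ (σ j) (σ k) (Δ.symbol.flow r x))
      (Δ.symbol.deriv (L.diff ξ (σ j) (σ k)) y) τ := fun j k =>
    h.hasDerivAt ((L.diff ξ (σ j) (σ k)).mdifferentiableAt _)
  have d4 := HasDerivAt.fun_sum (u := Finset.univ) fun j _ => (d1 j).mul
    (HasDerivAt.fun_sum (u := Finset.univ) fun k _ => (d2 k).mul (d3 j k))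
  refine (HasDerivAt.congr_of_eventuallyEq d4 e1).congr_deriv ?_
  -- the same computation for sections through the two vectors
  have e3 : Δ.symbol.deriv (L.diff ξ s t) y = Δ.symbol.deriv
      (∑ j, B.pairing (φ j) s * ∑ k, B.pairing (φ k) t * L.diff ξ (σ j) (σ k)) y := by
    refine VField.deriv_congr _ ?_
    filter_upwards [h0] with z hz
    rw [L.diff_eq_sum hξ h2 s t hz, SmoothFun.sum_apply]
    refine Finset.sum_congr rfl fun j _ => ?_
    rw [SmoothFun.mul_apply, SmoothFun.sum_apply]
    rfl
  rw [e3, L.diff_eq_sum hξ h2 (Δ s) t h0.self_of_nhds,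
    L.diff_eq_sum hξ h2 s (Δ t) h0.self_of_nhds]
  simp only [VField.deriv_sum, VField.deriv_mul, SmoothFun.sum_apply, SmoothFun.add_apply,
    SmoothFun.mul_apply, hC.symbol_deriv_pairing (h1 _), B.pairing_apply, hs, ht, ← hy]
  rw [← Finset.sum_sub_distrib, ← Finset.sum_sub_distrib]
  refine Finset.sum_congr rfl fun j _ => ?_
  rw [add_mul, add_sub_right_comm, add_sub_cancel_right, add_sub_assoc, ← mul_sub,
    ← Finset.sum_sub_distrib]
  congr 2
  refine Finset.sum_congr rfl fun k _ => ?_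
  ring

end LieAlgebroid

end LieAlgebroids

/-! #### Flows of Lie algebroid morphisms -/

section LieAlgebroids

variable {VV : Type*} [NormedAddCommGroup VV] [NormedSpace ℝ VV]
  {V : Type*} [TopologicalSpace V] [ChartedSpace VV V] [IsManifold 𝓘(ℝ, VV) ∞ V]
  {VN : Type*} [NormedAddCommGroup VN] [NormedSpace ℝ VN]
  {N : Type*} [TopologicalSpace N] [ChartedSpace VN N] [IsManifold 𝓘(ℝ, VN) ∞ N]
  [FiniteDimensional ℝ VV] [T2Space V] [FiniteDimensional ℝ VN] [T2Space N]
  {B : VBundle VV V VN N} {Z : VField VV V}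

namespace LieAlgebroid

variable {L : LieAlgebroid B} {Δ : Der VN N B.Sec}

variable (L Z) in
/-- The pull-back of `dξ` by the flow, evaluated on two sections by means of the pulled back functions
and of the bracket of the two sections. -/
def diffPull (s₁ s₂ : B.Sec) (x : N) (τ : ℝ) (ξ : SmoothFun VV V) : ℝ :=
  dirDeriv (fun y => ξ (Z.flow τ (s₂ y))) x (L.field s₁ x) -
    dirDeriv (fun y => ξ (Z.flow τ (s₁ y))) x (L.field s₂ x) - ξ (Z.flow τ (L.bracket s₁ s₂ x))

section

variable (hC : B.Corresponds Z Δ)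

include hC

lemma _root_.VBundle.Corresponds.defined_iff {t : ℝ} {v : V} :
    Z.Defined t v ↔ Δ.symbol.Defined t (B.proj v) := hC.isHomogeneous.defined_iff hC.2.1

lemma _root_.VBundle.Corresponds.defined_sec {t : ℝ} {x : N} (h : Δ.symbol.Defined t x) (s : B.Sec) :
    Z.Defined t (s x) := hC.defined_iff.2 ((s.proj_apply x).symm ▸ h)

lemma _root_.VBundle.Corresponds.proj_flow_sec {t : ℝ} {x : N} (h : Δ.symbol.Defined t x)
    (s : B.Sec) : B.proj (Z.flow t (s x)) = Δ.symbol.flow t x := by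
  rw [VBundle.proj_flow hC.2.1 (hC.defined_sec h s), s.proj_apply]; rfl

lemma hasDerivAt_diffPull (s₁ s₂ : B.Sec) {x : N} {τ : ℝ} (h : Δ.symbol.Defined τ x)
    (ξ : SmoothFun VV V) :
    HasDerivAt (fun τ => L.diffPull Z s₁ s₂ x τ ξ) (L.diffPull Z s₁ s₂ x τ (Z.deriv ξ)) τ :=
  ((hasDerivAt_dirDeriv_flow s₂.contMDiff (hC.defined_sec h s₂) ξ _).sub
    (hasDerivAt_dirDeriv_flow s₁.contMDiff (hC.defined_sec h s₁) ξ _)).sub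
    ((hC.defined_sec h (L.bracket s₁ s₂)).hasDerivAt (ξ.mdifferentiableAt _))

lemma mdifferentiableAt_flow_sec {x : N} {τ : ℝ} (h : Δ.symbol.Defined τ x) (ξ : SmoothFun VV V)
    (s : B.Sec) : MDifferentiableAt 𝓘(ℝ, VN) 𝓘(ℝ, ℝ) (fun y => ξ (Z.flow τ (s y))) x :=
  (ContMDiffAt.comp x (ξ.contMDiff _) (ContMDiffAt.comp x (hC.defined_sec h s).contMDiffAt_flow
    (s.contMDiff x))).mdifferentiableAt (by simp)

lemma diffPull_add (s₁ s₂ : B.Sec) {x : N} {τ : ℝ} (h : Δ.symbol.Defined τ x)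
    (ξ η : SmoothFun VV V) :
    L.diffPull Z s₁ s₂ x τ (ξ + η) = L.diffPull Z s₁ s₂ x τ ξ + L.diffPull Z s₁ s₂ x τ η := by
  have e : ∀ (s : B.Sec) u, dirDeriv (fun y => (ξ + η) (Z.flow τ (s y))) x u =
      dirDeriv (fun y => ξ (Z.flow τ (s y))) x u + dirDeriv (fun y => η (Z.flow τ (s y))) x u :=
    fun s u => dirDeriv_add (mdifferentiableAt_flow_sec hC h ξ s)
      (mdifferentiableAt_flow_sec hC h η s) u
  unfold diffPull
  rw [e, e, SmoothFun.add_apply]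
  ring

/-- If the flow preserves the anchor, then `diffPull` obeys the same Leibniz rule as the differential. -/
lemma diffPull_pull_mul (hanch : ∀ v, Δ.symbol.Defined τ (B.proj v) →
      mfderiv 𝓘(ℝ, VN) 𝓘(ℝ, VN) (Δ.symbol.flow τ) (B.proj v) (L.anchor (B.proj v) v) =
        L.anchor (Δ.symbol.flow τ (B.proj v)) (Z.flow τ v))
    (s₁ s₂ : B.Sec) {x : N} (h : Δ.symbol.Defined τ x) (f : SmoothFun VN N) (ξ : SmoothFun VV V) :
    L.diffPull Z s₁ s₂ x τ (B.pull f * ξ) = f (Δ.symbol.flow τ x) * L.diffPull Z s₁ s₂ x τ ξ +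
      L.dualFun f (Z.flow τ (s₁ x)) * ξ (Z.flow τ (s₂ x)) -
      L.dualFun f (Z.flow τ (s₂ x)) * ξ (Z.flow τ (s₁ x)) := by
  have hfd : MDifferentiableAt 𝓘(ℝ, VN) 𝓘(ℝ, ℝ) (fun y => f (Δ.symbol.flow τ y)) x :=
    (ContMDiffAt.comp x (f.contMDiff _) h.contMDiffAt_flow).mdifferentiableAt (by simp)
  have e0 : ∀ s : B.Sec, dirDeriv (fun y => f (Δ.symbol.flow τ y)) x (L.field s x) =
      L.dualFun f (Z.flow τ (s x)) := fun s => by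
    rw [L.dualFun_apply f (hC.proj_flow_sec h s)]
    have hx : B.proj (s x) = x := s.proj_apply x
    have h2 := hanch (s x) (by rwa [hx])
    rw [hx] at h2
    have h3 := dirDeriv_comp (f.mdifferentiableAt (Δ.symbol.flow τ x))
      (h.contMDiffAt_flow.mdifferentiableAt (by simp)) (L.field s x)
    rw [h3, ← h2]
    rfl
  have e : ∀ s s' : B.Sec, dirDeriv (fun y => (B.pull f * ξ) (Z.flow τ (s y))) x (L.field s' x) =
      L.dualFun f (Z.flow τ (s' x)) * ξ (Z.flow τ (s x)) +
        f (Δ.symbol.flow τ x) * dirDeriv (fun y => ξ (Z.flow τ (s y))) x (L.field s' x) := by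
    intro s s'
    rw [← e0 s', ← dirDeriv_mul hfd (mdifferentiableAt_flow_sec hC h ξ s)]
    refine dirDeriv_congr ?_ _
    filter_upwards [(Δ.symbol.isOpen_defined τ).mem_nhds h] with y hy
    show f (B.proj _) * _ = _
    rw [hC.proj_flow_sec hy s]
  have e2 : (B.pull f * ξ) (Z.flow τ (L.bracket s₁ s₂ x)) =
      f (Δ.symbol.flow τ x) * ξ (Z.flow τ (L.bracket s₁ s₂ x)) := by
    show f (B.proj _) * _ = _
    rw [hC.proj_flow_sec h (L.bracket s₁ s₂)]
  unfold diffPull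
  rw [e, e, e2]
  ring

/-- The flow intertwines the differential with its pull-back as soon as `Δ` is infinitesimally
compatible with the anchor and the bracket: the difference `D` is tensorial, vanishes at time `0` and
solves a linear differential equation. -/
lemma diffAt_flow_eq (hA : ∀ f, Z.deriv (L.dualFun f) = L.dualFun (Δ.symbol.deriv f))
    (hB : ∀ s t, Δ (L.bracket s t) = L.bracket (Δ s) t + L.bracket s (Δ t)) (s₁ s₂ : B.Sec) {x : N}
    {t : ℝ} (h : Δ.symbol.Defined t x) {ξ : SmoothFun VV V} (hξ : B.IsFibreLinear ξ) :
    L.diffAt ξ (Z.flow t (s₁ x)) (Z.flow t (s₂ x)) = L.diffPull Z s₁ s₂ x t ξ := by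
  let D : ℝ → SmoothFun VV V → ℝ := fun τ ξ =>
    L.diffAt ξ (Z.flow τ (s₁ x)) (Z.flow τ (s₂ x)) - L.diffPull Z s₁ s₂ x τ ξ
  have hth : ∀ {τ}, Δ.symbol.Defined τ x → ∀ s : B.Sec,
      B.through (Z.flow τ (s x)) (Δ.symbol.flow τ x) = Z.flow τ (s x) := fun {τ} hτ s => by
    have e := B.through_apply (Z.flow τ (s x))
    rwa [hC.proj_flow_sec hτ s] at e
  have hD' : ∀ {τ}, Δ.symbol.Defined τ x → ∀ ξ, B.IsFibreLinear ξ →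
      HasDerivAt (fun τ => D τ ξ) (D τ (Z.deriv ξ)) τ := by
    intro τ hτ ξ hξ
    have h1 := hasDerivAt_diffAt_flow (L := L) hC hξ (s₁.proj_eq x) (s₂.proj_eq x) hτ (hth hτ s₁)
      (hth hτ s₂)
    refine (h1.sub (hasDerivAt_diffPull hC s₁ s₂ hτ ξ)).congr_deriv ?_
    rw [symbol_deriv_diff hC hA hξ, hB]
    have e1 := diffAt_eq (L := L) (hC.1 ξ hξ) (hth hτ s₁) (hth hτ s₂)
    show _ = L.diffAt (Z.deriv ξ) (Z.flow τ (s₁ x)) (Z.flow τ (s₂ x)) - _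
    rw [e1, hξ.sec_sub, hξ.sec_sub, hξ.sec_add]
    ring
  have hadd : ∀ {τ}, Δ.symbol.Defined τ x → ∀ ξ η, B.IsFibreLinear ξ → B.IsFibreLinear η →
      D τ (ξ + η) = D τ ξ + D τ η := by
    intro τ hτ ξ η hξ hη
    show L.diffAt (ξ + η) _ _ - _ = L.diffAt ξ _ _ - _ + (L.diffAt η _ _ - _)
    rw [diffAt_eq (hξ.add hη) (hth hτ s₁) (hth hτ s₂), diffAt_eq hξ (hth hτ s₁) (hth hτ s₂),
      diffAt_eq hη (hth hτ s₁) (hth hτ s₂), diff_add, diffPull_add hC s₁ s₂ hτ]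
    ring
  have hmul : ∀ {τ}, Δ.symbol.Defined τ x → ∀ f ξ, B.IsFibreLinear ξ →
      D τ (B.pull f * ξ) = f (Δ.symbol.flow τ x) * D τ ξ := by
    intro τ hτ f ξ hξ
    show L.diffAt (B.pull f * ξ) _ _ - _ = _ * (L.diffAt ξ _ _ - _)
    rw [diffAt_eq (hξ.pull_mul f) (hth hτ s₁) (hth hτ s₂), diffAt_eq hξ (hth hτ s₁) (hth hτ s₂),
      diff_pull_mul, diffPull_pull_mul hC (fun v hv => L.mfderiv_flow hC.isHomogeneous hC.2.1 hA hv)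
        s₁ s₂ hτ, hth hτ, hth hτ]
    ring
  obtain ⟨a, b, h0, ht, hd, hγ⟩ := h.exists_Ioo
  have key := isPreconnected_Ioo.propagate (s := Ioo a b)
    (p := fun τ => ∀ ξ ∈ {ξ | B.IsFibreLinear ξ}, D τ ξ = 0) (fun τ hτ => ?_) h0 ht ?_
  · exact sub_eq_zero.1 (key ξ hξ)
  · obtain ⟨n, ρ, φ, σ, g0, g1, g2, -⟩ := B.exists_dual_pair (Δ.symbol.flow τ x)
    have hcont : ContinuousAt (fun s => Δ.symbol.flow s x) τ := (hd τ hτ).hasMFDerivAt.continuousAt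
    refine exists_nhds_propagate (z := Z.deriv) (c := φ)
      (k := fun ξ j τ => ξ (σ j (Δ.symbol.flow τ x))) g1 (fun j => hC.1 _ (g1 j)) ?_ (fun j i => ?_) ?_
    · filter_upwards [hcont.eventually g0, (hd τ hτ).eventually] with r hr hdr ξ hξ
      have := B.tensorial_eq_sum (T := D r) (hadd hdr) (hmul hdr) g1 g2 hξ
      rwa [hr, one_mul] at this
    · exact ContinuousAt.comp (f := fun s => Δ.symbol.flow s x)
        (g := fun y => Z.deriv (φ j) (σ i y))
        ((Z.deriv (φ j)).contMDiff.continuous.comp (σ i).contMDiff.continuous).continuousAt hcont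
    · exact (hd τ hτ).eventually.mono fun r hr j => hD' hr _ (g1 j)
  · intro ξ hξ
    refine sub_eq_zero.2 ?_
    have h1 := diffAt_eq (L := L) hξ (v := s₁ x) (w := s₂ x) (s := s₁) (t := s₂) (x := x) rfl rfl
    unfold diffPull
    simp_rw [VField.flow_zero]
    exact h1

/-- If `Δ` is infinitesimally compatible with the anchor and with the bracket, then the flow of the
corresponding linear vector field consists of Lie algebroid morphisms. -/
theorem isMorphismOn_flow (hA : ∀ f, Z.deriv (L.dualFun f) = L.dualFun (Δ.symbol.deriv f))
    (hB : ∀ s t, Δ (L.bracket s t) = L.bracket (Δ s) t + L.bracket s (Δ t)) (t : ℝ) :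
    L.IsMorphismOn {x | Δ.symbol.Defined t x} (Z.flow t) (Δ.symbol.flow t) := by
  have hanch : ∀ v, Δ.symbol.Defined t (B.proj v) → _ := fun v hv =>
    L.mfderiv_flow hC.isHomogeneous hC.2.1 hA hv
  refine ⟨hC.isHomogeneous.isMorphismOn_flow hC.2.1 t, hanch, ?_⟩
  intro O hO hOS s₁ s₂ t₁ t₂ h1 h2 x hx
  have hd : Δ.symbol.Defined t x := hOS hx
  refine B.ext_fibreLinear ((hC.proj_flow_sec hd _).trans ((L.bracket t₁ t₂).proj_apply _).symm)
    fun ξ hξ => ?_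
  have e1 := diffAt_flow_eq hC hA hB s₁ s₂ hd hξ
  rw [diffAt_eq hξ (h1 x hx).symm (h2 x hx).symm, diff_apply] at e1
  unfold diffPull at e1
  have e2 : ∀ s s' t' t'' : B.Sec, (∀ x ∈ O, Z.flow t (s x) = t' (Δ.symbol.flow t x)) →
      (∀ x ∈ O, Z.flow t (s' x) = t'' (Δ.symbol.flow t x)) →
      dirDeriv (fun y => ξ (Z.flow t (s y))) x (L.field s' x) =
        (L.field t'').deriv (B.pairing ξ t') (Δ.symbol.flow t x) := by
    intro s s' t' t'' hs hs'
    have e3 : (fun y => ξ (Z.flow t (s y))) =ᶠ[𝓝 x] fun y => B.pairing ξ t' (Δ.symbol.flow t y) := by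
      filter_upwards [hO.mem_nhds hx] with y hy
      rw [hs y hy]; rfl
    have hpx : B.proj (s' x) = x := s'.proj_apply x
    have h2 := hanch (s' x) (by rwa [hpx])
    rw [hpx] at h2
    rw [dirDeriv_congr e3, dirDeriv_comp ((B.pairing ξ t').mdifferentiableAt _)
      (hd.contMDiffAt_flow.mdifferentiableAt (by simp))]
    refine congrArg _ (h2.trans ?_)
    rw [hs' x hx]
    rfl
  rw [e2 s₂ s₁ t₂ t₁ h2 h1, e2 s₁ s₂ t₁ t₂ h1 h2] at e1
  linarith

/-- If the flow of a linear vector field consists of Lie algebroid morphisms, then the corresponding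
derivation is a derivation of the bracket. -/
theorem der_bracket_of_flow
    (h : ∀ t, L.IsMorphismOn {x | Δ.symbol.Defined t x} (Z.flow t) (Δ.symbol.flow t)) (s₁ s₂ : B.Sec) :
    Δ (L.bracket s₁ s₂) = L.bracket (Δ s₁) s₂ + L.bracket s₁ (Δ s₂) := by
  have hanch : ∀ t v, Δ.symbol.Defined t (B.proj v) → _ := fun t v hv => (h t).anchor v hv
  have hA := L.deriv_dualFun_of_flow hC.isHomogeneous hC.2.1 hanch
  refine VBundle.SecAlong.ext_fibreLinear fun ξ hξ x => ?_
  have hd := Δ.symbol.defined_zero x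
  -- for small times the pull-back of `dξ` by the flow is given by the bracket
  have key : ∀ t, Δ.symbol.Defined t x →
      L.diffAt ξ (Z.flow t (s₁ x)) (Z.flow t (s₂ x)) = L.diffPull Z s₁ s₂ x t ξ := by
    intro t ht
    -- the sections transported by the flow
    have hσ : ∀ s : B.Sec, ∃ t' : B.Sec, ∀ᶠ y in 𝓝 x, Z.flow t (s y) = t' (Δ.symbol.flow t y) := by
      intro s
      have hback := ht.flowsTo.symm
      have hO := Δ.symbol.isOpen_defined (-t)
      have hfwd : ∀ y, Δ.symbol.Defined (-t) y → Δ.symbol.FlowsTo t (Δ.symbol.flow (-t) y) y := by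
        intro y hy
        have h1 := hy.flowsTo.symm
        rwa [neg_neg] at h1
      have hsm : ContMDiffOn 𝓘(ℝ, VN) 𝓘(ℝ, VV) ∞
          (fun y => Z.flow t (s (Δ.symbol.flow (-t) y))) {y | Δ.symbol.Defined (-t) y} := by
        intro y hy
        exact (ContMDiffAt.comp y (g := fun z => Z.flow t (s z)) (ContMDiffAt.comp _
          (hC.defined_sec (hfwd y hy).defined s).contMDiffAt_flow (s.contMDiff _))
          (VField.Defined.contMDiffAt_flow hy)).contMDiffWithinAt
      obtain ⟨t', ht'⟩ := B.exists_sec_eventuallyEq hO hback.defined hsm fun y hy =>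
        (hC.proj_flow_sec (hfwd y hy).defined s).trans (hfwd y hy).flow_eq
      refine ⟨t', ?_⟩
      filter_upwards [ht.contMDiffAt_flow.continuousAt.eventually ht',
        (Δ.symbol.isOpen_defined t).mem_nhds ht] with y hy hyd
      rw [hy, (VField.Defined.flowsTo hyd).symm.flow_eq]
    obtain ⟨t₁, h1⟩ := hσ s₁
    obtain ⟨t₂, h2⟩ := hσ s₂
    obtain ⟨O, hOsub, hO, hx⟩ := mem_nhds_iff.1 (Filter.inter_mem (h1.and h2)
      ((Δ.symbol.isOpen_defined t).mem_nhds ht))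
    have hb := (h t).bracket O hO (fun y hy => (hOsub hy).2) s₁ s₂ t₁ t₂
      (fun y hy => (hOsub hy).1.1) (fun y hy => (hOsub hy).1.2) x hx
    rw [diffAt_eq hξ (hOsub hx).1.1.symm (hOsub hx).1.2.symm, diff_apply]
    unfold diffPull
    have e2 : ∀ s s' t' t'' : B.Sec, (∀ᶠ y in 𝓝 x, Z.flow t (s y) = t' (Δ.symbol.flow t y)) →
        (Z.flow t (s' x) = t'' (Δ.symbol.flow t x)) →
        dirDeriv (fun y => ξ (Z.flow t (s y))) x (L.field s' x) =
          (L.field t'').deriv (B.pairing ξ t') (Δ.symbol.flow t x) := by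
      intro s s' t' t'' hs hs'
      have e3 : (fun y => ξ (Z.flow t (s y))) =ᶠ[𝓝 x]
          fun y => B.pairing ξ t' (Δ.symbol.flow t y) := by
        filter_upwards [hs] with y hy
        rw [hy]; rfl
      have hpx : B.proj (s' x) = x := s'.proj_apply x
      have h2 := hanch t (s' x) (by rwa [hpx])
      rw [hpx] at h2
      rw [dirDeriv_congr e3, dirDeriv_comp ((B.pairing ξ t').mdifferentiableAt _)
        (ht.contMDiffAt_flow.mdifferentiableAt (by simp))]
      refine congrArg _ (h2.trans ?_)
      rw [hs']
      rfl
    rw [e2 s₂ s₁ t₂ t₁ h2 h1.self_of_nhds, e2 s₁ s₂ t₁ t₂ h1 h2.self_of_nhds, hb]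
  have h1 := hasDerivAt_diffAt_flow (L := L) hC hξ (s₁.proj_eq x) (s₂.proj_eq x) hd
    (s := s₁) (t := s₂) (by simp only [VField.flow_zero]) (by simp only [VField.flow_zero])
  have h2 := hasDerivAt_diffPull (L := L) hC s₁ s₂ hd ξ
  have h3 := h1.unique (h2.congr_of_eventuallyEq (hd.eventually.mono fun t ht => key t ht))
  rw [VField.flow_zero, symbol_deriv_diff hC hA hξ] at h3
  have h4 : L.diffPull Z s₁ s₂ x 0 (Z.deriv ξ) = L.diff (Z.deriv ξ) s₁ s₂ x := by
    unfold diffPull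
    simp_rw [VField.flow_zero]
    rfl
  rw [h4, hξ.sec_sub, hξ.sec_sub] at h3
  rw [hξ.sec_add]
  linarith

end

end LieAlgebroid

end LieAlgebroids

/-! ### Double vector bundles -/

/-- The derivative with respect to a parameter depends smoothly on the other variables. -/
lemma contMDiff_deriv_param {VP : Type*} [NormedAddCommGroup VP] [NormedSpace ℝ VP]
    {P : Type*} [TopologicalSpace P] [ChartedSpace VP P] [IsManifold 𝓘(ℝ, VP) ∞ P] {K : P → ℝ → ℝ}
    (hK : ContMDiff (𝓘(ℝ, VP).prod 𝓘(ℝ, ℝ)) 𝓘(ℝ, ℝ) ∞ fun p : P × ℝ => K p.1 p.2) :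
    ContMDiff 𝓘(ℝ, VP) 𝓘(ℝ, ℝ) ∞ fun x => deriv (K x) 0 := by
  intro x
  have h1 := ContMDiffAt.mfderiv (m := ∞) (x₀ := x) K (fun _ => (0 : ℝ)) (hK (x, 0))
    contMDiffAt_const (by simp)
  let ϕ : P → ℝ →L[ℝ] ℝ := fun y => mfderiv 𝓘(ℝ, ℝ) 𝓘(ℝ, ℝ) (K y) 0
  have h2 : ContMDiffAt 𝓘(ℝ, VP) 𝓘(ℝ, ℝ →L[ℝ] ℝ) ∞ ϕ x := by
    have e := inTangentCoordinates_model_space (I := 𝓘(ℝ, ℝ)) (I' := 𝓘(ℝ, ℝ)) (fun _ : P => (0 : ℝ))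
      (fun y => K y 0) ϕ x
    exact e ▸ h1
  have h2 := h2.clm_apply (contMDiffAt_const (c := (1 : ℝ)))
  refine h2.congr_of_eventuallyEq (Filter.Eventually.of_forall fun y => ?_)
  show deriv (K y) 0 = mfderiv 𝓘(ℝ, ℝ) 𝓘(ℝ, ℝ) (K y) 0 (1 : ℝ)
  rw [mfderiv_eq_fderiv]
  exact (fderiv_apply_one_eq_deriv (f := K y) (x := 0)).symm

namespace VBundle

variable {VV : Type*} [NormedAddCommGroup VV] [NormedSpace ℝ VV]
  {V : Type*} [TopologicalSpace V] [ChartedSpace VV V]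
  {VN : Type*} [NormedAddCommGroup VN] [NormedSpace ℝ VN]
  {N : Type*} [TopologicalSpace N] [ChartedSpace VN N] (B : VBundle VV V VN N)

lemma zero_add' (v : V) : B.add (B.zero (B.proj v)) v = v := by
  obtain ⟨c, hi, h0, ha, -⟩ := B.exists_fibreCoord (B.proj v)
  have hz := B.proj_zero (B.proj v)
  exact hi _ _ ((B.proj_add _ _ hz).trans hz) rfl (by rw [ha _ _ hz rfl, h0, zero_add])

lemma add_smul' (r s : ℝ) (v : V) : B.smul (r + s) v = B.add (B.smul r v) (B.smul s v) := by
  obtain ⟨c, hi, h0, ha, hm⟩ := B.exists_fibreCoord (B.proj v)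
  have h1 := B.proj_smul r v
  have h2 := B.proj_smul s v
  exact hi _ _ (B.proj_smul _ _) ((B.proj_add _ _ (h1.trans h2.symm)).trans h1)
    (by rw [ha _ _ h1 h2, hm _ _ rfl, hm _ _ rfl, hm _ _ rfl, add_smul])

/-- The difference of two vectors of one fibre. -/
def sub (v w : V) : V := B.add v (B.smul (-1) w)

variable {B}

lemma proj_sub {v w : V} (h : B.proj v = B.proj w) : B.proj (B.sub v w) = B.proj v :=
  B.proj_add _ _ (by rw [B.proj_smul, h])

lemma sub_self' (v : V) : B.sub v v = B.zero (B.proj v) := by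
  have := B.add_smul' 1 (-1) v
  rw [B.one_smul', add_neg_cancel, B.zero_smul'] at this
  exact this.symm

lemma add_sub' {v w : V} (h : B.proj v = B.proj w) : B.add v (B.sub w v) = w := by
  obtain ⟨c, hi, h0, ha, hm⟩ := B.exists_fibreCoord (B.proj v)
  have h2 := (B.proj_smul (-1) v)
  have h3 : B.proj (B.sub w v) = B.proj v := (proj_sub h.symm).trans h.symm
  refine hi _ _ (B.proj_add _ _ h3.symm) h.symm ?_
  rw [ha _ _ rfl h3]
  unfold sub
  rw [ha _ _ h.symm h2, hm _ _ rfl]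
  simp

end VBundle

namespace DoubleVB

variable {VW : Type*} [NormedAddCommGroup VW] [NormedSpace ℝ VW] [FiniteDimensional ℝ VW]
  {W : Type*} [TopologicalSpace W] [ChartedSpace VW W] [IsManifold 𝓘(ℝ, VW) ∞ W] [T2Space W]
  {VE : Type*} [NormedAddCommGroup VE] [NormedSpace ℝ VE] [FiniteDimensional ℝ VE]
  {E : Type*} [TopologicalSpace E] [ChartedSpace VE E] [IsManifold 𝓘(ℝ, VE) ∞ E] [T2Space E]
  {VA : Type*} [NormedAddCommGroup VA] [NormedSpace ℝ VA] [FiniteDimensional ℝ VA]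
  {A : Type*} [TopologicalSpace A] [ChartedSpace VA A] [IsManifold 𝓘(ℝ, VA) ∞ A] [T2Space A]
  {VM : Type*} [NormedAddCommGroup VM] [NormedSpace ℝ VM] [FiniteDimensional ℝ VM]
  {M : Type*} [TopologicalSpace M] [ChartedSpace VM M] [IsManifold 𝓘(ℝ, VM) ∞ M] [T2Space M]
  (D : DoubleVB VW W VE E VA A VM M)

lemma projA_addE {w w' : W} (h : D.overE.proj w = D.overE.proj w') :
    D.overA.proj (D.overE.add w w') = D.bA.add (D.overA.proj w) (D.overA.proj w') :=
  D.projA_morphism.map_add _ _ (mem_univ _) h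

lemma projA_smulE (r : ℝ) (w : W) :
    D.overA.proj (D.overE.smul r w) = D.bA.smul r (D.overA.proj w) :=
  D.projA_morphism.map_smul _ _ (mem_univ _)

lemma projE_addA {w w' : W} (h : D.overA.proj w = D.overA.proj w') :
    D.overE.proj (D.overA.add w w') = D.bE.add (D.overE.proj w) (D.overE.proj w') :=
  D.projE_morphism.map_add _ _ (mem_univ _) h

lemma projE_smulA (r : ℝ) (w : W) :
    D.overE.proj (D.overA.smul r w) = D.bE.smul r (D.overE.proj w) :=
  D.projE_morphism.map_smul _ _ (mem_univ _)

lemma bA_projA (w : W) : D.bA.proj (D.overA.proj w) = D.bE.proj (D.overE.proj w) :=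
  D.projA_morphism.proj _ (mem_univ _)

lemma projE_zeroA (a : A) : D.overE.proj (D.overA.zero a) = D.bE.zero (D.bA.proj a) := by
  have hz := D.overA.smul_zero' 0 a
  rw [← hz, projE_smulA, D.bE.zero_smul', ← bA_projA, D.overA.proj_zero]

lemma smulA_zeroE (r : ℝ) (e : E) :
    D.overA.smul r (D.overE.zero e) = D.overE.zero (D.bE.smul r e) :=
  (IsLinearOver.zero.map_smul r e (mem_univ _)).symm

lemma smulE_zeroA (r : ℝ) (a : A) :
    D.overE.smul r (D.overA.zero a) = D.overA.zero (D.bA.smul r a) := by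
  have h := D.smul_comm r 0 (D.overA.zero a)
  rwa [D.overA.zero_smul', D.overA.proj_zero, D.overA.zero_smul',
    projA_smulE, D.overA.proj_zero] at h

lemma zeroE_zero (m : M) : D.overE.zero (D.bE.zero m) = D.overA.zero (D.bA.zero m) := by
  have h := D.smulA_zeroE 0 (D.bE.zero m)
  rw [D.overA.zero_smul', projA_zeroE, D.bE.proj_zero, D.bE.smul_zero'] at h
  exact h.symm

/-- The points of the core over `m`. -/
def IsCore (m : M) (c : W) : Prop :=
  D.overE.proj c = D.bE.zero m ∧ D.overA.proj c = D.bA.zero m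

variable {D}

lemma isCore_coreSec (χ : D.CoreSec) (m : M) : D.IsCore m (χ.1 m) := ⟨χ.1.proj_apply m, χ.2 m⟩

lemma IsCore.smulE {m : M} {c : W} (h : D.IsCore m c) (r : ℝ) : D.IsCore m (D.overE.smul r c) :=
  ⟨(D.overE.proj_smul _ _).trans h.1, by rw [projA_smulE, h.2, D.bA.smul_zero']⟩

/-- On the core the two additions agree. -/
lemma IsCore.add_eq {m : M} {c c' : W} (h : D.IsCore m c) (h' : D.IsCore m c') :
    D.overE.add c c' = D.overA.add c c' := by
  have hE := D.overE.proj_zero (D.bE.zero m)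
  have hA := D.overA.proj_zero (D.bA.zero m)
  have hz := D.zeroE_zero m
  have hA' : D.overA.proj (D.overE.zero (D.bE.zero m)) = D.bA.zero m := by rw [hz, hA]
  have e := D.interchange c (D.overE.zero (D.bE.zero m)) (D.overE.zero (D.bE.zero m)) c'
    (h.1.trans hE.symm) (hE.trans h'.1.symm) (h.2.trans hA'.symm) (hA'.trans h'.2.symm)
  have e1 := D.overE.add_zero' c
  have e2 := D.overE.zero_add' c'
  have e3 := D.overA.add_zero' c
  have e4 := D.overA.zero_add' c'
  rw [h.1] at e1
  rw [h'.1] at e2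
  rw [h.2, ← hz] at e3
  rw [h'.2, ← hz] at e4
  rw [e1, e2, e3, e4] at e
  exact e.symm

/-- On the core the two scalar multiplications agree: a continuous additive function of the scalar is
linear. -/
lemma IsCore.smul_eq {m : M} {c : W} (h : D.IsCore m c) (r : ℝ) :
    D.overE.smul r c = D.overA.smul r c := by
  refine D.overA.ext_fibreLinear ?_ fun ψ hψ => ?_
  · rw [(h.smulE r).2, D.overA.proj_smul, h.2]
  · let g : ℝ →+ ℝ := AddMonoidHom.mk' (fun r => ψ (D.overE.smul r c)) fun r s => by
      show ψ (D.overE.smul (r + s) c) = _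
      rw [D.overE.add_smul', (h.smulE r).add_eq (h.smulE s),
        hψ.1 _ _ ((h.smulE r).2.trans (h.smulE s).2.symm)]
    have hg : Continuous g := ψ.contMDiff.continuous.comp
      (D.overE.contMDiff_smul_curve c).continuous
    have h1 := (g.toRealLinearMap hg).map_smul r 1
    rw [smul_eq_mul, mul_one] at h1
    have h2 : ψ (D.overE.smul r c) = r * ψ (D.overE.smul 1 c) := h1
    rw [h2, hψ.2, D.overE.one_smul']

/-! ### Linear sections and core sections via scalar multiplications -/

lemma isLinearOver_of_homogeneous {s : D.overE.Sec}
    (h : ∀ r e, s (D.bE.smul r e) = D.overA.smul r (s e)) : s ∈ D.LinSec := by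
  let a : D.bA.Sec := ⟨fun m => D.overA.proj (s (D.bE.zero m)),
    D.overA.contMDiff_proj.comp (s.contMDiff.comp D.bE.contMDiff_zero), fun m => by
      rw [bA_projA, s.proj_eq, D.bE.proj_zero]; rfl⟩
  exact ⟨a, D.bE.isMorphismOn_of_homogeneous D.overA isOpen_univ s.contMDiff.contMDiffOn
    (fun r e _ => h r e) fun m _ => rfl⟩

lemma linSec_smul (s : D.LinSec) (r : ℝ) (e : E) :
    s.1 (D.bE.smul r e) = D.overA.smul r (s.1 e) :=
  (D.fatProj_spec s).map_smul r e (mem_univ _)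

lemma projA_linSec (s : D.LinSec) (e : E) :
    D.overA.proj (s.1 e) = D.fatProj s (D.bE.proj e) := (D.fatProj_spec s).projA e

lemma hat_apply (χ : D.CoreSec) (e : E) :
    D.hat χ e = D.overA.add (D.overE.zero e) (χ.1 (D.bE.proj e)) := rfl

lemma projA_hat (χ : D.CoreSec) (e : E) : D.overA.proj (D.hat χ e) = D.bA.zero (D.bE.proj e) := by
  rw [hat_apply, D.overA.proj_add _ _ ((D.projA_zeroE e).trans (isCore_coreSec χ _).2.symm), projA_zeroE]

/-- Both scalar multiplications of `0_{W,E}(e) + c`, for a core vector `c`, act on `c` by the same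
scalar. -/
lemma smulE_shift {e : E} {c : W} (h : D.IsCore (D.bE.proj e) c) (r : ℝ) :
    D.overE.smul r (D.overA.add (D.overE.zero e) c) =
      D.overA.add (D.overE.zero e) (D.overE.smul r c) := by
  rw [D.smulE_addA _ _ _ ((D.projA_zeroE e).trans h.2.symm), D.overE.smul_zero']

lemma smulA_shift {e : E} {c : W} (h : D.IsCore (D.bE.proj e) c) (r : ℝ) :
    D.overA.smul r (D.overA.add (D.overE.zero e) c) =
      D.overA.add (D.overE.zero (D.bE.smul r e)) (D.overE.smul r c) := by
  have h0 : D.overA.proj (D.overE.zero e) = D.overA.proj c := (D.projA_zeroE e).trans h.2.symm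
  obtain ⟨k, hi, -, ha, hm⟩ := D.overA.exists_fibreCoord (D.overA.proj c)
  have h1 := D.overA.proj_smul r (D.overE.zero e)
  have h2 := D.overA.proj_smul r c
  rw [h.smul_eq, ← smulA_zeroE]
  refine hi _ _ ((D.overA.proj_smul _ _).trans ((D.overA.proj_add _ _ h0).trans h0))
    ((D.overA.proj_add _ _ (h1.trans (h0.trans h2.symm))).trans (h1.trans h0)) ?_
  rw [hm _ _ ((D.overA.proj_add _ _ h0).trans h0), ha _ _ h0 rfl, ha _ _ (h1.trans h0) h2,
    hm _ _ h0, hm _ _ rfl, smul_add]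

lemma smul_hat (χ : D.CoreSec) (r : ℝ) (e : E) :
    D.overE.smul r (D.hat χ (D.bE.smul r e)) = D.overA.smul r (D.hat χ e) := by
  have h := isCore_coreSec χ (D.bE.proj e)
  rw [hat_apply, hat_apply, smulA_shift h, smulE_shift (by rw [D.bE.proj_smul]; exact h),
    D.bE.proj_smul]

/-- Vectors of `W → E` that project to a zero vector of `A` are of the form `0_{W,E}(e) + c`. -/
lemma exists_shift {w : W} (h : D.overA.proj w = D.bA.zero (D.bE.proj (D.overE.proj w))) :
    ∃ c, D.IsCore (D.bE.proj (D.overE.proj w)) c ∧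
      w = D.overA.add (D.overE.zero (D.overE.proj w)) c := by
  set e := D.overE.proj w
  have h0 : D.overA.proj (D.overE.zero e) = D.overA.proj w := (D.projA_zeroE e).trans h.symm
  refine ⟨D.overA.sub w (D.overE.zero e), ⟨?_, (VBundle.proj_sub h0.symm).trans h⟩,
    (VBundle.add_sub' h0).symm⟩
  unfold VBundle.sub
  rw [projE_addA _ (by rw [D.overA.proj_smul, h0]), projE_smulA, D.overE.proj_zero]
  exact VBundle.sub_self' e

/-- A section of `W → E` is a core section if it is homogeneous of degree `-1`. -/
lemma exists_hat_eq {t : D.overE.Sec}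
    (h : ∀ r e, D.overE.smul r (t (D.bE.smul r e)) = D.overA.smul r (t e)) :
    ∃ χ : D.CoreSec, D.hat χ = t := by
  have hz : ∀ e, D.overA.proj (t e) = D.bA.zero (D.bE.proj e) := by
    intro e
    have h1 := congrArg D.overA.proj (h 0 e)
    rw [D.overA.proj_smul, projA_smulE, D.bA.zero_smul', bA_projA, t.proj_eq, D.bE.proj_smul] at h1
    exact h1.symm
  let χ : D.CoreSec := ⟨⟨fun m => t (D.bE.zero m), t.contMDiff.comp D.bE.contMDiff_zero,
    fun m => t.proj_eq _⟩, fun m => by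
      show D.overA.proj (t (D.bE.zero m)) = _
      rw [hz, D.bE.proj_zero]⟩
  refine ⟨χ, VBundle.SecAlong.ext fun e => ?_⟩
  obtain ⟨c, hc, hce⟩ := D.exists_shift (w := t e) (by rw [hz, t.proj_eq])
  rw [t.proj_eq] at hc hce
  rw [hat_apply, hce]
  congr 1
  -- both sides are the limit of `t (r e)` for `r → 0`
  have l1 : Filter.Tendsto (fun r : ℝ => t (D.bE.smul r e)) (𝓝[≠] 0) (𝓝 (χ.1 (D.bE.proj e))) := by
    have h2 : Filter.Tendsto (fun r : ℝ => t (D.bE.smul r e)) (𝓝 0) (𝓝 (t (D.bE.smul 0 e))) :=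
      (t.contMDiff.continuous.comp (D.bE.contMDiff_smul_curve e).continuous).continuousAt
    rw [D.bE.zero_smul'] at h2
    exact h2.mono_left nhdsWithin_le_nhds
  have hk : ContMDiff 𝓘(ℝ, ℝ) 𝓘(ℝ, VW) ∞ fun r : ℝ =>
      D.overA.add (D.overE.zero (D.bE.smul r e)) c :=
    D.overA.contMDiff_add_comp (D.overE.contMDiff_zero.comp (D.bE.contMDiff_smul_curve e))
      contMDiff_const fun r => by rw [projA_zeroE, D.bE.proj_smul, hc.2]
  have l2 : Filter.Tendsto (fun r : ℝ => D.overA.add (D.overE.zero (D.bE.smul r e)) c) (𝓝[≠] 0)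
      (𝓝 c) := by
    have h2 : Filter.Tendsto (fun r : ℝ => D.overA.add (D.overE.zero (D.bE.smul r e)) c) (𝓝 0)
        (𝓝 (D.overA.add (D.overE.zero (D.bE.smul 0 e)) c)) := hk.continuous.continuousAt
    have e4 := D.overA.zero_add' c
    rw [hc.2, ← zeroE_zero] at e4
    rw [D.bE.zero_smul', e4] at h2
    exact h2.mono_left nhdsWithin_le_nhds
  refine tendsto_nhds_unique l1 (l2.congr' ?_)
  filter_upwards [self_mem_nhdsWithin] with r hr
  have hr0 : r ≠ 0 := hr
  have h3 := h r e
  rw [hce, smulA_shift hc] at h3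
  have h4 := congrArg (D.overE.smul r⁻¹) h3
  rw [D.overE.smul_smul', inv_mul_cancel₀ hr0, D.overE.one_smul'] at h4
  have h5 : D.IsCore (D.bE.proj (D.bE.smul r e)) (D.overE.smul r c) := by
    rw [D.bE.proj_smul]; exact hc.smulE r
  rw [h4, smulE_shift h5, D.overE.smul_smul', inv_mul_cancel₀ hr0, D.overE.one_smul']

/-! #### Sums of core sections -/

lemma hat_add (χ χ' : D.CoreSec) : D.hat (χ + χ') = D.hat χ + D.hat χ' := by
  refine VBundle.SecAlong.ext fun e => ?_
  have h1 := (isCore_coreSec χ (D.bE.proj e))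
  have h2 := (isCore_coreSec χ' (D.bE.proj e))
  have h0 := D.projA_zeroE e
  have h0' := D.overE.proj_zero e
  show D.overA.add (D.overE.zero e) (D.overE.add (χ.1 _) (χ'.1 _)) =
    D.overE.add (D.overA.add (D.overE.zero e) (χ.1 _)) (D.overA.add (D.overE.zero e) (χ'.1 _))
  rw [← D.interchange _ _ _ _ rfl (h1.1.trans h2.1.symm) (h0.trans h1.2.symm) (h0.trans h2.2.symm)]
  congr 1
  have := D.overE.add_zero' (D.overE.zero e)
  rw [h0'] at this
  exact this.symm

lemma hat_smul (f : SmoothFun VM M) (χ : D.CoreSec) : D.hat (f • χ) = D.pullE f • D.hat χ := by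
  refine VBundle.SecAlong.ext fun e => ?_
  exact (smulE_shift (isCore_coreSec χ (D.bE.proj e)) (f (D.bE.proj e))).symm

lemma hat_injective {χ χ' : D.CoreSec} (h : D.hat χ = D.hat χ') : χ = χ' := by
  refine Subtype.ext (VBundle.SecAlong.ext fun m => ?_)
  have h1 : ∀ χ : D.CoreSec, D.hat χ (D.bE.zero m) = χ.1 m := fun χ => by
    have e4 := D.overA.zero_add' (χ.1 m)
    rw [(isCore_coreSec χ m).2, ← zeroE_zero] at e4
    rw [hat_apply, D.bE.proj_zero, e4]
  rw [← h1 χ, ← h1 χ', h]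

lemma hat_zero : D.hat 0 = 0 := by
  have := hat_smul (D := D) 0 0
  rw [zero_smul] at this
  rw [this]
  exact zero_smul (SmoothFun VE E) (D.hat 0)

lemma hat_sub (χ χ' : D.CoreSec) : D.hat (χ - χ') = D.hat χ - D.hat χ' := by
  have := hat_add (χ - χ') χ'
  rw [sub_add_cancel] at this
  rw [this, add_sub_cancel_right]

lemma hat_sum {ι : Type*} (I : Finset ι) (χ : ι → D.CoreSec) :
    D.hat (∑ i ∈ I, χ i) = ∑ i ∈ I, D.hat (χ i) := by
  classical
  induction I using Finset.induction_on with
  | empty => simpa using hat_zero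
  | insert a I ha ih => rw [Finset.sum_insert ha, Finset.sum_insert ha, hat_add, ih]

end DoubleVB

lemma VBundle.contMDiff_smul_prod {VV : Type*} [NormedAddCommGroup VV] [NormedSpace ℝ VV]
    {V : Type*} [TopologicalSpace V] [ChartedSpace VV V]
    {VN : Type*} [NormedAddCommGroup VN] [NormedSpace ℝ VN]
    {N : Type*} [TopologicalSpace N] [ChartedSpace VN N] (B : VBundle VV V VN N) :
    ContMDiff (𝓘(ℝ, VV).prod 𝓘(ℝ, ℝ)) 𝓘(ℝ, VV) ∞ fun p : V × ℝ => B.smul p.2 p.1 := by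
  let : ChartedSpace (VV × ℝ) (V × ℝ) := prodChartedSpace VV V ℝ ℝ
  have h := modelWithCornersSelf_prod (𝕜 := ℝ) (E := VV) (F := ℝ)
  have h1 : ContMDiff 𝓘(ℝ, VV × ℝ) 𝓘(ℝ, ℝ) ∞ (fun p : V × ℝ => p.2) := by
    rw [h]; exact contMDiff_snd
  have h2 : ContMDiff 𝓘(ℝ, VV × ℝ) 𝓘(ℝ, VV) ∞ (fun p : V × ℝ => p.1) := by
    rw [h]; exact contMDiff_fst
  have h3 := B.contMDiff_smul_comp h1 h2
  rw [h] at h3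
  exact h3

namespace DoubleVB

variable {VW : Type*} [NormedAddCommGroup VW] [NormedSpace ℝ VW] [FiniteDimensional ℝ VW]
  {W : Type*} [TopologicalSpace W] [ChartedSpace VW W] [IsManifold 𝓘(ℝ, VW) ∞ W] [T2Space W]
  {VE : Type*} [NormedAddCommGroup VE] [NormedSpace ℝ VE] [FiniteDimensional ℝ VE]
  {E : Type*} [TopologicalSpace E] [ChartedSpace VE E] [IsManifold 𝓘(ℝ, VE) ∞ E] [T2Space E]
  {VA : Type*} [NormedAddCommGroup VA] [NormedSpace ℝ VA] [FiniteDimensional ℝ VA]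
  {A : Type*} [TopologicalSpace A] [ChartedSpace VA A] [IsManifold 𝓘(ℝ, VA) ∞ A] [T2Space A]
  {VM : Type*} [NormedAddCommGroup VM] [NormedSpace ℝ VM] [FiniteDimensional ℝ VM]
  {M : Type*} [TopologicalSpace M] [ChartedSpace VM M] [IsManifold 𝓘(ℝ, VM) ∞ M] [T2Space M]
  {D : DoubleVB VW W VE E VA A VM M}

/-! ### Local generators of the sections of a double vector bundle -/

lemma IsLinearOver.unique {s : D.overE.Sec} {a b : D.bA.Sec} (ha : D.IsLinearOver s a)
    (hb : D.IsLinearOver s b) : a = b := by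
  refine VBundle.SecAlong.ext fun m => ?_
  have h1 := ha.projA (D.bE.zero m)
  have h2 := hb.projA (D.bE.zero m)
  rw [D.bE.proj_zero] at h1 h2
  exact h1.symm.trans h2

lemma isFibreLinear_pullA {a : SmoothFun VA A} (ha : D.bA.IsFibreLinear a) :
    D.overE.IsFibreLinear (D.overA.pull a) :=
  D.overE.isFibreLinear_of_homogeneous fun r w => by
    rw [VBundle.pull_apply, VBundle.pull_apply, projA_smulE, ha.2]

lemma isFibreLinear_pullE {φ : SmoothFun VE E} (hφ : D.bE.IsFibreLinear φ) :
    D.overA.IsFibreLinear (D.overE.pull φ) :=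
  D.overA.isFibreLinear_of_homogeneous fun r w => by
    rw [VBundle.pull_apply, VBundle.pull_apply, projE_smulA, hφ.2]

variable (D) in
/-- Linear sections exist locally over any section of `A`: the linearization `d/dt σ(t e)` at `t = 0`,
computed in `W → A`, of a section `σ` of `W → E` whose restriction to the zero section of `E` consists
of zero vectors of `W → A`. -/
lemma exists_linSec (m₀ : M) : ∃ r : SmoothFun VM M, (∀ᶠ m in 𝓝 m₀, r m = 1) ∧
    ∀ a : D.bA.Sec, ∃ s : D.LinSec, D.IsLinearOver s.1 (r • a) := by
  obtain ⟨n, ρ, φ, s, h0, h1, h2, -⟩ := D.overE.exists_dual_pair (D.bE.zero m₀)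
  let r : SmoothFun VM M := ⟨fun m => ρ (D.bE.zero m), ρ.contMDiff.comp D.bE.contMDiff_zero⟩
  refine ⟨r, D.bE.contMDiff_zero.continuous.continuousAt.eventually h0, fun a => ?_⟩
  have hz : ContMDiff 𝓘(ℝ, VE) 𝓘(ℝ, VW) ∞ fun e => D.overA.zero (a (D.bE.proj e)) :=
    D.overA.contMDiff_zero.comp (a.contMDiff.comp D.bE.contMDiff_proj)
  let c : Fin n → SmoothFun VE E := fun j =>
    ⟨fun e => φ j (D.overA.zero (a (D.bE.proj e))), (φ j).contMDiff.comp hz⟩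
  let σ : D.overE.Sec := ∑ j, c j • s j
  -- on the zero section, `σ` is a zero vector of `W → A`
  have hσ0 : ∀ m, σ (D.bE.zero m) = D.overA.zero ((r • a) m) := by
    intro m
    have hp : D.overE.proj (D.overA.zero (a m)) = D.bE.zero m := by rw [projE_zeroA, a.proj_eq]
    have e0 : D.overA.zero ((r • a) m) = D.overE.smul (r m) (D.overA.zero (a m)) :=
      (D.smulE_zeroA _ _).symm
    refine D.overE.ext_fibreLinear ?_ fun ψ hψ => ?_
    · rw [σ.proj_eq, e0, D.overE.proj_smul, hp]
    · have e1 := congrArg (fun f : SmoothFun VW W => f (D.overA.zero (a m))) (h2 ψ hψ)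
      rw [SmoothFun.sum_apply] at e1
      rw [e0, hψ.2, hψ.sec_sum]
      refine Eq.trans (Finset.sum_congr rfl fun j _ => ?_) (e1.trans ?_)
      · rw [hψ.sec_smul]
        show φ j (D.overA.zero (a (D.bE.proj (D.bE.zero m)))) * ψ (s j (D.bE.zero m)) =
          ψ (s j (D.overE.proj (D.overA.zero (a m)))) * φ j (D.overA.zero (a m))
        rw [D.bE.proj_zero, hp, mul_comm]
      · show ρ (D.overE.proj (D.overA.zero (a m))) * ψ _ = ρ (D.bE.zero m) * ψ _
        rw [hp]
  have hcurve : ∀ e, ContMDiff 𝓘(ℝ, ℝ) 𝓘(ℝ, VW) ∞ fun t : ℝ => σ (D.bE.smul t e) := fun e =>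
    σ.contMDiff.comp (D.bE.contMDiff_smul_curve e)
  have hdiff : ∀ (ψ : SmoothFun VW W) e, DifferentiableAt ℝ (fun t : ℝ => ψ (σ (D.bE.smul t e))) 0 :=
    fun ψ e => mdifferentiableAt_iff_differentiableAt.1
      ((ψ.contMDiff.comp (hcurve e) 0).mdifferentiableAt (by simp))
  let h : C^∞⟮𝓘(ℝ, VE), E; 𝓘(ℝ, VA), A⟯ :=
    ⟨fun e => (r • a) (D.bE.proj e), (r • a).contMDiff.comp D.bE.contMDiff_proj⟩
  have hσ0' : ∀ e, σ (D.bE.smul 0 e) = D.overA.zero (h e) := fun e => by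
    rw [D.bE.zero_smul', hσ0]; rfl
  have hTsm : ∀ ψ : SmoothFun VW W, ContMDiff 𝓘(ℝ, VE) 𝓘(ℝ, ℝ) ∞
      fun e => deriv (fun t : ℝ => ψ (σ (D.bE.smul t e))) 0 := fun ψ =>
    contMDiff_deriv_param (K := fun e t => ψ (σ (D.bE.smul t e)))
      (ψ.contMDiff.comp (σ.contMDiff.comp D.bE.contMDiff_smul_prod))
  have hTmul : ∀ (f : SmoothFun VA A) (ψ : SmoothFun VW W), D.overA.IsFibreLinear ψ → ∀ e,
      deriv (fun t : ℝ => (D.overA.pull f * ψ) (σ (D.bE.smul t e))) 0 =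
        f (h e) * deriv (fun t : ℝ => ψ (σ (D.bE.smul t e))) 0 := by
    intro f ψ hψ e
    have e1 := (hdiff (D.overA.pull f) e).hasDerivAt.mul (hdiff ψ e).hasDerivAt
    refine e1.deriv.trans ?_
    rw [hσ0', hψ.apply_zero, mul_zero, zero_add, VBundle.pull_apply, D.overA.proj_zero]
  obtain ⟨l, hl⟩ := D.overA.exists_secAlong_of_dual h
    (T := fun ψ e => deriv (fun t : ℝ => ψ (σ (D.bE.smul t e))) 0) (fun ψ _ => hTsm ψ)
    (fun φ ψ _ _ e => deriv_fun_add (hdiff φ e) (hdiff ψ e)) hTmul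
  have hlE : ∀ e, D.overE.proj (l e) = e := by
    intro e
    refine D.bE.ext_fibreLinear ?_ fun φ hφ => ?_
    · rw [← bA_projA, l.proj_apply]
      exact (r • a).proj_eq _
    · have e1 := hl _ (isFibreLinear_pullE hφ) e
      have e2 : (fun t : ℝ => D.overE.pull φ (σ (D.bE.smul t e))) = fun t : ℝ => t * φ e :=
        funext fun t => by rw [VBundle.pull_apply, σ.proj_eq, hφ.2]
      rw [e2] at e1
      refine e1.trans ?_
      simp
  have hlA : ∀ e, D.overA.proj (l e) = (r • a) (D.bE.proj e) := fun e => l.proj_apply e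
  let s' : D.overE.Sec := ⟨l, l.contMDiff, hlE⟩
  have hs' : s' ∈ D.LinSec := by
    refine isLinearOver_of_homogeneous fun t e => ?_
    show l _ = D.overA.smul t (l e)
    refine D.overA.ext_fibreLinear (by rw [hlA, D.overA.proj_smul, hlA, D.bE.proj_smul])
      fun ψ hψ => ?_
    rw [hl ψ hψ, hψ.2, hl ψ hψ]
    have e3 := (hdiff ψ e).hasDerivAt
    rw [← zero_mul t] at e3
    have e4 := (e3.comp (0 : ℝ) ((hasDerivAt_id (0 : ℝ)).mul_const t)).deriv
    have e5 : (fun u : ℝ => ψ (σ (D.bE.smul u (D.bE.smul t e)))) =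
        (fun u : ℝ => ψ (σ (D.bE.smul u e))) ∘ fun u => id u * t :=
      funext fun u => by rw [D.bE.smul_smul']; rfl
    rw [e5, e4, one_mul, zero_mul, mul_comm]
  refine ⟨⟨s', hs'⟩, ?_⟩
  have e1 := D.fatProj_spec ⟨s', hs'⟩
  have e2 : D.fatProj ⟨s', hs'⟩ = r • a := by
    refine VBundle.SecAlong.ext fun m => ?_
    have e3 := e1.projA (D.bE.zero m)
    rw [D.bE.proj_zero] at e3
    rw [← e3]
    have e4 := hlA (D.bE.zero m)
    rwa [D.bE.proj_zero] at e4
  rwa [e2] at e1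

variable (D) in
/-- Linearization with respect to `W → A` of functions that are linear with respect to `W → E`. -/
lemma exists_doublyLinear {ψ : SmoothFun VW W} (hψ : D.overE.IsFibreLinear ψ) :
    ∃ β : SmoothFun VW W, D.overE.IsFibreLinear β ∧ D.overA.IsFibreLinear β ∧
      ∀ m c, D.IsCore m c → β c = ψ c := by
  have hdiff : ∀ w, DifferentiableAt ℝ (fun t : ℝ => ψ (D.overA.smul t w)) 0 :=
    fun w => mdifferentiableAt_iff_differentiableAt.1
      ((ψ.contMDiff.comp (D.overA.contMDiff_smul_curve w) 0).mdifferentiableAt (by simp))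
  let β : SmoothFun VW W := ⟨fun w => deriv (fun t : ℝ => ψ (D.overA.smul t w)) 0,
    contMDiff_deriv_param (K := fun w t => ψ (D.overA.smul t w)) (ψ.contMDiff.comp
      D.overA.contMDiff_smul_prod)⟩
  refine ⟨β, D.overE.isFibreLinear_of_homogeneous fun r w => ?_,
    D.overA.isFibreLinear_of_homogeneous fun r w => ?_, fun m c hc => ?_⟩
  · show deriv (fun t : ℝ => ψ (D.overA.smul t (D.overE.smul r w))) 0 = r * deriv _ 0
    simp_rw [← D.smul_comm, hψ.2]
    exact deriv_const_mul r (hdiff w)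
  · show deriv (fun t : ℝ => ψ (D.overA.smul t (D.overA.smul r w))) 0 = r * deriv _ 0
    have e3 := (hdiff w).hasDerivAt
    rw [← zero_mul r] at e3
    have e4 := (e3.comp (0 : ℝ) ((hasDerivAt_id (0 : ℝ)).mul_const r)).deriv
    have e5 : (fun u : ℝ => ψ (D.overA.smul u (D.overA.smul r w))) =
        (fun u : ℝ => ψ (D.overA.smul u w)) ∘ fun u => id u * r :=
      funext fun u => by rw [D.overA.smul_smul']; rfl
    rw [e5, e4, one_mul, zero_mul, mul_comm]
  · show deriv (fun t : ℝ => ψ (D.overA.smul t c)) 0 = ψ c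
    have e2 : (fun t : ℝ => ψ (D.overA.smul t c)) = fun t : ℝ => t * ψ c :=
      funext fun t => by rw [← hc.smul_eq, hψ.2]
    rw [e2]
    simp

variable (D) in
/-- Local generators of the core sections, with dual functions. -/
lemma exists_core_generators (m₀ : M) : ∃ (n : ℕ) (r : SmoothFun VM M) (β : Fin n → SmoothFun VW W)
    (χ : Fin n → D.CoreSec), (∀ᶠ m in 𝓝 m₀, r m = 1) ∧ (∀ j, D.overE.IsFibreLinear (β j)) ∧
    (∀ j, D.overA.IsFibreLinear (β j)) ∧ ∀ (t : D.overE.Sec) e,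
      D.overA.proj (t e) = D.bA.zero (D.bE.proj e) →
      (∑ j, D.overE.pairing (β j) t • D.hat (χ j)) e = (D.pullE r • t) e := by
  obtain ⟨n, ρ, φ, s, h0, h1, h2, -⟩ := D.overE.exists_dual_pair (D.bE.zero m₀)
  choose β hβE hβA hβ using fun j => D.exists_doublyLinear (h1 j)
  let r : SmoothFun VM M := ⟨fun m => ρ (D.bE.zero m), ρ.contMDiff.comp D.bE.contMDiff_zero⟩
  have hpE : ∀ j m, D.overE.proj (s j (D.bE.zero m)) =
      D.overE.proj (D.overA.zero (D.overA.proj (s j (D.bE.zero m)))) := fun j m => by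
    rw [projE_zeroA, bA_projA, (s j).proj_eq, D.bE.proj_zero]
  have hsm : ∀ j, ContMDiff 𝓘(ℝ, VM) 𝓘(ℝ, VW) ∞ fun m => s j (D.bE.zero m) := fun j =>
    (s j).contMDiff.comp D.bE.contMDiff_zero
  -- the core parts of the values of the `s j` on the zero section
  let χ : Fin n → D.CoreSec := fun j =>
    ⟨⟨fun m => D.overE.sub (s j (D.bE.zero m)) (D.overA.zero (D.overA.proj (s j (D.bE.zero m)))),
      D.overE.contMDiff_add_comp (hsm j) ((D.overE.contMDiff_smul (-1)).comp
        (D.overA.contMDiff_zero.comp (D.overA.contMDiff_proj.comp (hsm j))))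
        (fun m => by
          show _ = D.overE.proj (D.overE.smul (-1) _)
          rw [D.overE.proj_smul]; exact hpE j m),
      fun m => (VBundle.proj_sub (hpE j m)).trans ((s j).proj_eq _)⟩, fun m => by
        show D.overA.proj (D.overE.sub _ _) = _
        unfold VBundle.sub
        rw [projA_addE _ (by rw [D.overE.proj_smul]; exact hpE j m), projA_smulE,
          D.overA.proj_zero]
        refine (VBundle.sub_self' (B := D.bA) (D.overA.proj (s j (D.bE.zero m)))).trans ?_
        rw [bA_projA, (s j).proj_eq, D.bE.proj_zero]⟩
  have hχ : ∀ j m, (χ j).1 m =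
      D.overE.sub (s j (D.bE.zero m)) (D.overA.zero (D.overA.proj (s j (D.bE.zero m)))) :=
    fun _ _ => rfl
  refine ⟨n, r, β, χ, D.bE.contMDiff_zero.continuous.continuousAt.eventually h0, hβE, hβA,
    fun t e he => ?_⟩
  obtain ⟨c, hc, hce⟩ := D.exists_shift (w := t e) (by rw [he, t.proj_eq])
  rw [t.proj_eq] at hc hce
  set m := D.bE.proj e with hm
  -- the expansion of core vectors
  have key : D.overE.smul (r m) c =
      (∑ j, algebraMap ℝ (SmoothFun VM M) (φ j c) • χ j : D.CoreSec).1 m := by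
    refine D.overE.ext_fibreLinear ?_ fun ψ hψ => ?_
    · rw [(hc.smulE _).1, (isCore_coreSec _ m).1]
    have hη : D.bA.IsFibreLinear (⟨fun a => ψ (D.overA.zero a),
        ψ.contMDiff.comp D.overA.contMDiff_zero⟩ : SmoothFun VA A) :=
      D.bA.isFibreLinear_of_homogeneous fun r a => by
        show ψ _ = r * ψ _
        rw [← smulE_zeroA, hψ.2]
    have e1 := congrArg (fun f : SmoothFun VW W => f c) (h2 ψ hψ)
    have e2 := congrArg (fun f : SmoothFun VW W => f c) (h2 _ (isFibreLinear_pullA (D := D) hη))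
    rw [SmoothFun.sum_apply] at e1 e2
    have e3 : (D.overE.pull ρ * D.overA.pull (⟨fun a => ψ (D.overA.zero a),
        ψ.contMDiff.comp D.overA.contMDiff_zero⟩ : SmoothFun VA A)) c = 0 := by
      show ρ _ * ψ (D.overA.zero (D.overA.proj c)) = 0
      rw [hc.2, ← zeroE_zero, hψ.apply_zero, mul_zero]
    have e4 : (D.overE.pull ρ * ψ) c = r m * ψ c := by
      show ρ _ * ψ c = _
      rw [hc.1]
      rfl
    have e2' := e2.trans e3
    have e1' := e1.trans e4
    rw [Submodule.coe_sum, hψ.sec_sum, hψ.2, ← e1', ← sub_zero (∑ j, _ : ℝ), ← e2',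
      ← Finset.sum_sub_distrib]
    refine Finset.sum_congr rfl fun j _ => ?_
    rw [Submodule.coe_smul, hψ.sec_smul, hχ]
    unfold VBundle.sub
    rw [hψ.1 _ _ (by rw [D.overE.proj_smul]; exact hpE j m), hψ.2]
    show ψ (s j (D.overE.proj c)) * φ j c -
      ψ (D.overA.zero (D.overA.proj (s j (D.overE.proj c)))) * φ j c = φ j c * _
    rw [hc.1]
    ring
  have hβw : ∀ j, β j (t e) = φ j c := by
    intro j
    rw [hce, (hβA j).1 _ _ ((D.projA_zeroE e).trans hc.2.symm), (hβE j).apply_zero, zero_add,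
      hβ j m c hc]
  have e5 : (D.pullE r • t) e = D.hat (∑ j, algebraMap ℝ (SmoothFun VM M) (φ j c) • χ j) e := by
    rw [hat_apply, ← hm, ← key]
    show D.overE.smul (r m) (t e) = _
    rw [hce, smulE_shift hc]
  rw [e5, hat_sum]
  refine D.overE.ext_fibreLinear (by rw [VBundle.SecAlong.proj_eq, VBundle.SecAlong.proj_eq])
    fun ψ hψ => ?_
  rw [hψ.sec_sum, hψ.sec_sum]
  refine Finset.sum_congr rfl fun j _ => ?_
  rw [hat_smul, hψ.sec_smul, hψ.sec_smul, VBundle.pairing_apply, hβw]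
  rfl

variable (D) in
/-- The sections of `W → E` are locally generated by linear sections and core sections; the
coefficients are given by functions of degree `(1, 0)` and `(1, 1)` for the scalar multiplications of
`W → E` and `W → A`. -/
lemma exists_generators (m₀ : M) : ∃ (n k : ℕ) (ρ : SmoothFun VM M) (a : Fin n → SmoothFun VA A)
    (s : Fin n → D.LinSec) (β : Fin k → SmoothFun VW W) (χ : Fin k → D.CoreSec),
    (∀ᶠ m in 𝓝 m₀, ρ m = 1) ∧ (∀ i, D.bA.IsFibreLinear (a i)) ∧
    (∀ j, D.overE.IsFibreLinear (β j)) ∧ (∀ j, D.overA.IsFibreLinear (β j)) ∧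
    ∀ t : D.overE.Sec, ∑ i, D.overE.pairing (D.overA.pull (a i)) t • (s i).1 +
      ∑ j, D.overE.pairing (β j) t • D.hat (χ j) = D.pullE ρ • t := by
  obtain ⟨r, hr, hlin⟩ := D.exists_linSec m₀
  obtain ⟨n, ρ, a, t₀, h0, h1, h2, -⟩ := D.bA.exists_dual_pair m₀
  obtain ⟨k, r', β, χ, hr', hβE, hβA, hβ⟩ := D.exists_core_generators m₀
  choose s hs using fun i => hlin (t₀ i)
  -- subtracting the part of `t` in the span of the `s i` leaves a section over the zero section of `A`
  let g : SmoothFun VM M := r * ρ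
  let β' : Fin k → SmoothFun VW W := fun j => D.overE.pull (D.pullE g) * β j -
    ∑ i, D.overE.pull (D.overE.pairing (β j) (s i).1) * D.overA.pull (a i)
  refine ⟨n, k, r' * g, fun i => D.bA.pull r' * a i, s, β', χ, ?_, fun i => (h1 i).pull_mul _,
    fun j => ((hβE j).pull_mul _).sub (VBundle.IsFibreLinear.sum _ fun i _ =>
      (isFibreLinear_pullA (h1 i)).pull_mul _), fun j => ?_, fun t => ?_⟩
  · filter_upwards [hr, h0, hr'] with m hm1 hm2 hm3
    show r' m * (r m * ρ m) = 1
    rw [hm1, hm2, hm3, one_mul, one_mul]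
  · refine D.overA.isFibreLinear_of_homogeneous fun u w => ?_
    rw [SmoothFun.sub_apply, SmoothFun.sub_apply, SmoothFun.sum_apply, SmoothFun.sum_apply, mul_sub,
      Finset.mul_sum]
    congr 1
    · show g (D.bE.proj (D.overE.proj (D.overA.smul u w))) * β j _ =
        u * (g (D.bE.proj (D.overE.proj w)) * β j w)
      rw [projE_smulA, D.bE.proj_smul, (hβA j).2]
      ring
    · refine Finset.sum_congr rfl fun i _ => ?_
      show β j ((s i).1 (D.overE.proj (D.overA.smul u w))) * a i (D.overA.proj (D.overA.smul u w)) =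
        u * (β j ((s i).1 (D.overE.proj w)) * a i (D.overA.proj w))
      rw [projE_smulA, linSec_smul, (hβA j).2, D.overA.proj_smul]
      ring
  · let t' : D.overE.Sec := D.pullE g • t - ∑ i, D.overE.pairing (D.overA.pull (a i)) t • (s i).1
    have ht' : ∀ ψ, D.overE.IsFibreLinear ψ → ∀ e, ψ (t' e) = g (D.bE.proj e) * ψ (t e) -
        ∑ i, a i (D.overA.proj (t e)) * ψ ((s i).1 e) := fun ψ hψ e => by
      rw [hψ.sec_sub, hψ.sec_sum, hψ.sec_smul]
      congr 1
      exact Finset.sum_congr rfl fun i _ => hψ.sec_smul _ _ _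
    have hproj : ∀ e, D.overA.proj (t' e) = D.bA.zero (D.bE.proj e) := by
      intro e
      refine D.bA.ext_fibreLinear ?_ fun f hf => ?_
      · rw [bA_projA, t'.proj_eq, D.bA.proj_zero]
      · have e1 := ht' _ (isFibreLinear_pullA (D := D) hf) e
        rw [VBundle.pull_apply, VBundle.pull_apply] at e1
        have e2 := congrArg (fun f : SmoothFun VA A => f (D.overA.proj (t e))) (h2 f hf)
        rw [SmoothFun.sum_apply] at e2
        have hb : D.bA.proj (D.overA.proj (t e)) = D.bE.proj e := by rw [bA_projA, t.proj_eq]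
        have e3 : ∑ i, f (t₀ i (D.bE.proj e)) * a i (D.overA.proj (t e)) =
            ρ (D.bE.proj e) * f (D.overA.proj (t e)) := by
          rw [← hb]; exact e2
        rw [e1, hf.apply_zero]
        show r _ * ρ _ * f _ - _ = 0
        rw [mul_assoc, ← e3, Finset.mul_sum, ← Finset.sum_sub_distrib]
        refine Finset.sum_eq_zero fun i _ => ?_
        rw [VBundle.pull_apply, (hs i).projA, hf.sec_smul]
        ring
    refine VBundle.SecAlong.ext fun e => ?_
    have e1 := hβ t' e (hproj e)
    refine D.overE.ext_fibreLinear (by rw [VBundle.SecAlong.proj_eq, VBundle.SecAlong.proj_eq])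
      fun ψ hψ => ?_
    have e2 := congrArg ψ e1
    rw [hψ.sec_sum, hψ.sec_smul, ht' ψ hψ] at e2
    rw [hψ.sec_add, hψ.sec_sum, hψ.sec_sum, hψ.sec_smul]
    have e3 : ∀ j, ψ ((D.overE.pairing (β' j) t • D.hat (χ j)) e) =
        ψ ((D.overE.pairing (β j) t' • D.hat (χ j)) e) := fun j => by
      rw [hψ.sec_smul, hψ.sec_smul, VBundle.pairing_apply, VBundle.pairing_apply, ht' _ (hβE j),
        SmoothFun.sub_apply, SmoothFun.sum_apply]
      congr 2
      · show g (D.bE.proj (D.overE.proj (t e))) * _ = _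
        rw [t.proj_eq]
      · refine Finset.sum_congr rfl fun i _ => ?_
        show β j ((s i).1 (D.overE.proj (t e))) * a i _ = _
        rw [t.proj_eq, mul_comm]
    simp_rw [e3]
    rw [e2]
    have e4 : ∀ i, ψ ((D.overE.pairing (D.overA.pull (D.bA.pull r' * a i)) t • (s i).1) e) =
        r' (D.bE.proj e) * (a i (D.overA.proj (t e)) * ψ ((s i).1 e)) := fun i => by
      rw [hψ.sec_smul]
      show r' (D.bA.proj (D.overA.proj (t e))) * a i (D.overA.proj (t e)) * _ = _
      rw [bA_projA, t.proj_eq]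
      ring
    simp_rw [e4]
    rw [← Finset.mul_sum]
    show _ + r' _ * _ = r' _ * (g _) * _
    ring

end DoubleVB

/-! ### The commutator of vector fields -/

/-- The commutator of two vector fields, which is a second order operator a priori, is the derivative
in a direction. -/
lemma VField.exists_commutator {VN : Type*} [NormedAddCommGroup VN] [NormedSpace ℝ VN]
    {N : Type*} [TopologicalSpace N] [ChartedSpace VN N] [IsManifold 𝓘(ℝ, VN) ∞ N]
    [FiniteDimensional ℝ VN] [T2Space N] (X Y : VField VN N) (x : N) :
    ∃ u : TangentSpace 𝓘(ℝ, VN) x, ∀ f : SmoothFun VN N,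
      dirDeriv f x u = X.deriv (Y.deriv f) x - Y.deriv (X.deriv f) x := by
  obtain ⟨c, hc, hcx⟩ := exists_chartFun (VN := VN) x
  have h1 : ∀ v : TangentSpace 𝓘(ℝ, VN) x, dirDeriv c x v = (v : VN) := fun v => by
    rw [dirDeriv_congr hcx]
    unfold dirDeriv
    rw [mfderiv_extChartAt_self]
    rfl
  let Xc : N → VN := fun y => dirDeriv c y (X y)
  let Yc : N → VN := fun y => dirDeriv c y (Y y)
  have hXc : ContMDiff 𝓘(ℝ, VN) 𝓘(ℝ, VN) ∞ Xc := X.contMDiff_dirDeriv hc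
  have hYc : ContMDiff 𝓘(ℝ, VN) 𝓘(ℝ, VN) ∞ Yc := Y.contMDiff_dirDeriv hc
  -- the commutator in the chart; the second derivatives of `f` cancel by symmetry
  let u : TangentSpace 𝓘(ℝ, VN) x := (dirDeriv Yc x (X x) - dirDeriv Xc x (Y x) : VN)
  refine ⟨u, fun f => ?_⟩
  let F : VN → ℝ := fun z => f ((extChartAt 𝓘(ℝ, VN) x).symm z)
  have hcx0 : c x = extChartAt 𝓘(ℝ, VN) x x := hcx.self_of_nhds
  have hF : ContDiffAt ℝ ∞ F (c x) := by
    rw [hcx0, ← contMDiffAt_iff_contDiffAt]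
    exact (f.contMDiff _).comp _ ((contMDiffOn_extChartAt_symm (I := 𝓘(ℝ, VN)) x).contMDiffAt
      (extChartAt_target_mem_nhds x))
  have hfF : ∀ᶠ y in 𝓝 x, f y = F (c y) := by
    filter_upwards [hcx, extChartAt_source_mem_nhds (I := 𝓘(ℝ, VN)) x] with y hy hys
    show f y = f ((extChartAt 𝓘(ℝ, VN) x).symm (c y))
    rw [hy, (extChartAt 𝓘(ℝ, VN) x).left_inv hys]
  have hcd : ∀ y, MDifferentiableAt 𝓘(ℝ, VN) 𝓘(ℝ, VN) c y := fun y =>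
    (hc y).mdifferentiableAt (by simp)
  have hFev : ∀ᶠ y in 𝓝 x, DifferentiableAt ℝ F (c y) := by
    have h2 : ContDiffAt ℝ 2 F (c x) := by exact_mod_cast contDiffAt_infty.1 hF 2
    have h3 := (h2.eventually (by simp)).mono fun z hz => hz.differentiableAt (n := 2) (by simp)
    exact hc.continuous.continuousAt.eventually h3
  have hZ : ∀ Z : VField VN N, ∀ᶠ y in 𝓝 x,
      Z.deriv f y = fderiv ℝ F (c y) (dirDeriv c y (Z y)) := fun Z => by
    filter_upwards [hfF.eventually_nhds, hFev] with y hy hd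
    rw [VField.deriv_apply, dirDeriv_congr hy, dirDeriv_comp_fderiv hd (hcd y)]
  have hF2 : HasFDerivAt (fderiv ℝ F) (fderiv ℝ (fderiv ℝ F) (c x)) (c x) := by
    have h2 : ContDiffAt ℝ 2 F (c x) := by exact_mod_cast contDiffAt_infty.1 hF 2
    exact ((h2.fderiv_right (m := 1) (by norm_num)).differentiableAt (by simp)).hasFDerivAt
  have key : ∀ (Z : VField VN N), ContMDiff 𝓘(ℝ, VN) 𝓘(ℝ, VN) ∞ (fun y => dirDeriv c y (Z y)) →
      ∀ w : TangentSpace 𝓘(ℝ, VN) x, dirDeriv (Z.deriv f) x w =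
        fderiv ℝ (fderiv ℝ F) (c x) (dirDeriv c x w) (dirDeriv c x (Z x)) +
          fderiv ℝ F (c x) (dirDeriv (fun y => dirDeriv c y (Z y)) x w) := by
    intro Z hZs w
    rw [dirDeriv_congr (hZ Z)]
    let Q : VN × VN → ℝ := fun p => fderiv ℝ F p.1 p.2
    let q : N → VN × VN := fun y => (c y, dirDeriv c y (Z y))
    have hQ : HasFDerivAt Q (((fderiv ℝ F (c x)).comp (ContinuousLinearMap.snd ℝ VN VN)) +
        ((fderiv ℝ (fderiv ℝ F) (c x)).comp (ContinuousLinearMap.fst ℝ VN VN)).flip (q x).2)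
        (q x) := by
      have e1 : HasFDerivAt (fun p : VN × VN => fderiv ℝ F p.1)
        ((fderiv ℝ (fderiv ℝ F) (c x)).comp (ContinuousLinearMap.fst ℝ VN VN)) (q x) :=
        HasFDerivAt.comp (q x) (g := fderiv ℝ F) hF2 hasFDerivAt_fst
      exact e1.clm_apply hasFDerivAt_snd
    have hq : HasMFDerivAt 𝓘(ℝ, VN) 𝓘(ℝ, VN × VN) q x
        ((mfderiv 𝓘(ℝ, VN) 𝓘(ℝ, VN) c x).prod
          (mfderiv 𝓘(ℝ, VN) 𝓘(ℝ, VN) (fun y => dirDeriv c y (Z y)) x)) := by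
      have h2 := ((hZs x).mdifferentiableAt (by simp)).hasMFDerivAt
      exact ⟨(hcd x).hasMFDerivAt.1.prodMk h2.1, (hcd x).hasMFDerivAt.2.prodMk h2.2⟩
    have e2 := dirDeriv_comp_fderiv (g := Q) hQ.differentiableAt hq.mdifferentiableAt w
    have e3 : dirDeriv q x w = (dirDeriv c x w, dirDeriv (fun y => dirDeriv c y (Z y)) x w) := by
      unfold dirDeriv
      rw [hq.mfderiv]
      rfl
    refine e2.trans ?_
    rw [hQ.fderiv, e3, add_comm]
    rfl
  have hsymm : fderiv ℝ (fderiv ℝ F) (c x) (Xc x) (Yc x) =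
      fderiv ℝ (fderiv ℝ F) (c x) (Yc x) (Xc x) :=
    ((show ContDiffAt ℝ 2 F (c x) by exact_mod_cast contDiffAt_infty.1 hF 2).isSymmSndFDerivAt
      (by simp)).eq _ _
  have e4 := key Y hYc (X x)
  have e5 := key X hXc (Y x)
  have e6 : dirDeriv f x u = fderiv ℝ F (c x) (u : VN) := by
    rw [dirDeriv_congr hfF, dirDeriv_comp_fderiv hFev.self_of_nhds (hcd x), h1]
  have e7 : fderiv ℝ F (c x) (u : VN) = fderiv ℝ F (c x) (dirDeriv Yc x (X x)) -
      fderiv ℝ F (c x) (dirDeriv Xc x (Y x)) := map_sub _ _ _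
  rw [e6, e7, VField.deriv_apply, VField.deriv_apply, e4, e5, hsymm]
  ring

/-! ### Linear vector fields on a double vector bundle -/

namespace VBundle

variable {VV : Type*} [NormedAddCommGroup VV] [NormedSpace ℝ VV]
  {V : Type*} [TopologicalSpace V] [ChartedSpace VV V] [IsManifold 𝓘(ℝ, VV) ∞ V]
  {VN : Type*} [NormedAddCommGroup VN] [NormedSpace ℝ VN]
  {N : Type*} [TopologicalSpace N] [ChartedSpace VN N] [IsManifold 𝓘(ℝ, VN) ∞ N]
  [FiniteDimensional ℝ VV] [T2Space V] [FiniteDimensional ℝ VN] [T2Space N]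
  {B : VBundle VV V VN N} {X : VField VV V} {Y : VField VN N}

/-- The function `v ↦ φ (r v)`. -/
def precomp (B : VBundle VV V VN N) (r : ℝ) (φ : SmoothFun VV V) : SmoothFun VV V :=
  ⟨fun v => φ (B.smul r v), φ.contMDiff.comp (B.contMDiff_smul r)⟩

lemma precomp_apply (r : ℝ) (φ : SmoothFun VV V) (v : V) : B.precomp r φ v = φ (B.smul r v) := rfl

lemma deriv_precomp_apply (X : VField VV V) (r : ℝ) (φ : SmoothFun VV V) (v : V) :
    X.deriv (B.precomp r φ) v =
      dirDeriv φ (B.smul r v) (mfderiv 𝓘(ℝ, VV) 𝓘(ℝ, VV) (B.smul r) v (X v)) :=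
  dirDeriv_comp (φ.mdifferentiableAt _) (B.mdifferentiableAt_smul r v) (X v)

lemma IsHomogeneous.deriv_precomp (hX : B.IsHomogeneous X) (r : ℝ) (φ : SmoothFun VV V) :
    X.deriv (B.precomp r φ) = B.precomp r (X.deriv φ) :=
  ContMDiffMap.ext fun v => by
    rw [deriv_precomp_apply, hX r v]
    rfl

/-- If a vector field is invariant under a bundle map, then so is its projection to the base. -/
lemma related_base (hY : ∀ v, mfderiv 𝓘(ℝ, VV) 𝓘(ℝ, VN) B.proj v (X v) = Y (B.proj v)) {F : V → V}
    {f : N → N} (hF : ContMDiff 𝓘(ℝ, VV) 𝓘(ℝ, VV) ∞ F) (hf : ContMDiff 𝓘(ℝ, VN) 𝓘(ℝ, VN) ∞ f)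
    (hFf : ∀ v, B.proj (F v) = f (B.proj v))
    (h : ∀ v, mfderiv 𝓘(ℝ, VV) 𝓘(ℝ, VV) F v (X v) = X (F v)) (x : N) :
    mfderiv 𝓘(ℝ, VN) 𝓘(ℝ, VN) f x (Y x) = Y (f x) := by
  have key : ∀ v, mfderiv 𝓘(ℝ, VN) 𝓘(ℝ, VN) f (B.proj v) (Y (B.proj v)) = Y (f (B.proj v)) := by
    intro v
    refine _root_.tangent_ext fun g => ?_
    have hg := g.mdifferentiableAt (f (B.proj v))
    have hfd : MDifferentiableAt 𝓘(ℝ, VN) 𝓘(ℝ, VN) f (B.proj v) :=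
      (hf _).mdifferentiableAt (by simp)
    have hFd : MDifferentiableAt 𝓘(ℝ, VV) 𝓘(ℝ, VV) F v := (hF _).mdifferentiableAt (by simp)
    let gf : SmoothFun VN N := ⟨fun y => g (f y), g.contMDiff.comp hf⟩
    have e1 : dirDeriv gf (B.proj v) (Y (B.proj v)) = X.deriv (B.pull gf) v := by
      rw [deriv_pull hY]; rfl
    have e2 : X.deriv (B.pull gf) v = X.deriv (B.pull g) (F v) := by
      rw [VField.deriv_apply, VField.deriv_apply, ← h v,
        ← dirDeriv_comp ((B.pull g).mdifferentiableAt _) hFd]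
      refine congrArg (fun k : V → ℝ => dirDeriv k v (X v)) (funext fun w => ?_)
      show g (f (B.proj w)) = g (B.proj (F w))
      rw [hFf]
    rw [← dirDeriv_comp hg hfd]
    refine e1.trans (e2.trans ?_)
    rw [deriv_pull hY, ← hFf]
    rfl
  have := key (B.zero x)
  rwa [B.proj_zero] at this

end VBundle

lemma VField.deriv_const_mul {VN : Type*} [NormedAddCommGroup VN] [NormedSpace ℝ VN]
    {N : Type*} [TopologicalSpace N] [ChartedSpace VN N] [IsManifold 𝓘(ℝ, VN) ∞ N]
    [FiniteDimensional ℝ VN] [T2Space N] (X : VField VN N) (r : ℝ) (f : SmoothFun VN N) :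
    X.deriv (algebraMap ℝ (SmoothFun VN N) r * f) = algebraMap ℝ (SmoothFun VN N) r * X.deriv f := by
  rw [X.deriv_mul, X.deriv_const, zero_mul, zero_add]

namespace DoubleVB

variable {VW : Type*} [NormedAddCommGroup VW] [NormedSpace ℝ VW] [FiniteDimensional ℝ VW]
  {W : Type*} [TopologicalSpace W] [ChartedSpace VW W] [IsManifold 𝓘(ℝ, VW) ∞ W] [T2Space W]
  {VE : Type*} [NormedAddCommGroup VE] [NormedSpace ℝ VE] [FiniteDimensional ℝ VE]
  {E : Type*} [TopologicalSpace E] [ChartedSpace VE E] [IsManifold 𝓘(ℝ, VE) ∞ E] [T2Space E]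
  {VA : Type*} [NormedAddCommGroup VA] [NormedSpace ℝ VA] [FiniteDimensional ℝ VA]
  {A : Type*} [TopologicalSpace A] [ChartedSpace VA A] [IsManifold 𝓘(ℝ, VA) ∞ A] [T2Space A]
  {VM : Type*} [NormedAddCommGroup VM] [NormedSpace ℝ VM] [FiniteDimensional ℝ VM]
  {M : Type*} [TopologicalSpace M] [ChartedSpace VM M] [IsManifold 𝓘(ℝ, VM) ∞ M] [T2Space M]
  {D : DoubleVB VW W VE E VA A VM M} {X : VField VW W} {Δ : Der VE E D.overE.Sec}

/-- A tensorial functional of sections of `W → E` that vanishes on linear sections and on core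
sections is zero. -/
lemma tensorial_eq_zero {T : D.overE.Sec → ℝ} {e : E} (hadd : ∀ s t, T (s + t) = T s + T t)
    (hmul : ∀ (f : SmoothFun VE E) s, T (f • s) = f e * T s) (hl : ∀ s : D.LinSec, T s.1 = 0)
    (hc : ∀ χ, T (D.hat χ) = 0) (t : D.overE.Sec) : T t = 0 := by
  obtain ⟨n, k, ρ, a, s, β, χ, h0, -, -, -, h⟩ := D.exists_generators (D.bE.proj e)
  have e1 : T (D.pullE ρ • t) = T t := by
    rw [hmul]
    show ρ (D.bE.proj e) * T t = T t
    rw [h0.self_of_nhds, one_mul]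
  have e2 : ∀ u, T u = AddMonoidHom.mk' T hadd u := fun _ => rfl
  rw [← e1, ← h t, hadd, e2, e2, map_sum, map_sum]
  simp only [← e2, hmul, hl, hc, mul_zero, Finset.sum_const_zero, add_zero]

lemma ext_generators {φ ψ : SmoothFun VW W} (hφ : D.overE.IsFibreLinear φ)
    (hψ : D.overE.IsFibreLinear ψ) (hl : ∀ (s : D.LinSec) e, φ (s.1 e) = ψ (s.1 e))
    (hc : ∀ χ e, φ (D.hat χ e) = ψ (D.hat χ e)) : φ = ψ := by
  ext w
  obtain ⟨t, ht⟩ := D.overE.exists_sec_eq w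
  have := D.tensorial_eq_zero (T := fun t => φ (t (D.overE.proj w)) - ψ (t (D.overE.proj w)))
    (e := D.overE.proj w) (fun s t => by rw [hφ.sec_add, hψ.sec_add]; ring)
    (fun f s => by rw [hφ.sec_smul, hψ.sec_smul]; ring)
    (fun s => sub_eq_zero.2 (hl s _)) (fun χ => sub_eq_zero.2 (hc χ _)) t
  have h2 := sub_eq_zero.1 this
  rwa [ht] at h2

/-- Sections of the core are determined by the functions that are linear for both vector bundle
structures. -/
lemma coreSec_ext {χ χ' : D.CoreSec} (h : ∀ β : SmoothFun VW W, D.overE.IsFibreLinear β →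
    D.overA.IsFibreLinear β → ∀ m, β (χ.1 m) = β (χ'.1 m)) : χ = χ' := by
  refine Subtype.ext (VBundle.SecAlong.ext_fibreLinear fun ψ hψ m => ?_)
  obtain ⟨β, hE, hA, hβ⟩ := D.exists_doublyLinear hψ
  rw [← hβ m _ (isCore_coreSec χ m), ← hβ m _ (isCore_coreSec χ' m), h β hE hA]

lemma isFibreLinear_precomp (r : ℝ) {φ : SmoothFun VW W} (hφ : D.overE.IsFibreLinear φ) :
    D.overE.IsFibreLinear (D.overA.precomp r φ) :=
  D.overE.isFibreLinear_of_homogeneous fun u w => by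
    rw [VBundle.precomp_apply, VBundle.precomp_apply, ← D.smul_comm, hφ.2]

section

variable (hX : D.overE.Corresponds X Δ)
include hX

lemma symbol_isHomogeneous (hA : D.overA.IsHomogeneous X) : D.bE.IsHomogeneous Δ.symbol := fun r =>
  VBundle.related_base hX.2.1 (D.overA.contMDiff_smul r) (D.bE.contMDiff_smul r)
    (fun w => D.projE_smulA r w) (hA r)

/-- The scalar multiplications of `W → A` act on sections of homogeneous degree; the degree is `0` for
`k = 1` and `-1` for `k = r`. -/
lemma deriv_precomp_sec (hs : D.bE.IsHomogeneous Δ.symbol) {t : D.overE.Sec} {k r : ℝ}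
    (ht : ∀ e, D.overE.smul k (t (D.bE.smul r e)) = D.overA.smul r (t e)) {φ : SmoothFun VW W}
    (hφ : D.overE.IsFibreLinear φ) (e : E) :
    X.deriv (D.overA.precomp r φ) (t e) + φ (D.overA.smul r (Δ t e)) =
      X.deriv φ (D.overA.smul r (t e)) + k * φ (Δ t (D.bE.smul r e)) := by
  have e1 := hX.deriv_eq (isFibreLinear_precomp r hφ) t e
  have e2 := hX.deriv_eq hφ t (D.bE.smul r e)
  have e3 : D.overE.pairing (D.overA.precomp r φ) t =
      algebraMap ℝ (SmoothFun VE E) k * D.bE.precomp r (D.overE.pairing φ t) :=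
    ContMDiffMap.ext fun e => by
      show φ (D.overA.smul r (t e)) = k * φ (t (D.bE.smul r e))
      rw [← ht, hφ.2]
  rw [e3, VField.deriv_const_mul, hs.deriv_precomp, SmoothFun.mul_apply, SmoothFun.const_apply,
    VBundle.precomp_apply] at e1
  rw [e1, ← ht e, (hX.1 φ hφ).2, e2, VBundle.precomp_apply]
  ring

lemma der_homogeneous (hA : D.overA.IsHomogeneous X) {t : D.overE.Sec} {k r : ℝ}
    (ht : ∀ e, D.overE.smul k (t (D.bE.smul r e)) = D.overA.smul r (t e)) (e : E) :
    D.overE.smul k (Δ t (D.bE.smul r e)) = D.overA.smul r (Δ t e) := by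
  refine D.overE.ext_fibreLinear ?_ fun φ hφ => ?_
  · rw [D.overE.proj_smul, projE_smulA, (Δ t).proj_eq, (Δ t).proj_eq]
  · have e1 := deriv_precomp_sec hX (symbol_isHomogeneous hX hA) ht hφ e
    rw [hA.deriv_precomp, VBundle.precomp_apply] at e1
    rw [hφ.2]
    linarith

lemma der_linSec (hA : D.overA.IsHomogeneous X) (s : D.LinSec) : Δ s.1 ∈ D.LinSec :=
  isLinearOver_of_homogeneous fun r e => by
    have := der_homogeneous hX hA (t := s.1) (k := 1) (r := r)
      (fun e => by rw [D.overE.one_smul', linSec_smul]) e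
    rwa [D.overE.one_smul'] at this

lemma der_hat (hA : D.overA.IsHomogeneous X) (χ : D.CoreSec) : ∃ χ', D.hat χ' = Δ (D.hat χ) :=
  exists_hat_eq fun r e => der_homogeneous hX hA (fun e => smul_hat χ r e) e

/-- A vector field on `W` that is linear over `E` is linear over `A` if its derivation preserves linear
sections and core sections. -/
lemma isHomogeneous_of_der (hs : D.bE.IsHomogeneous Δ.symbol) (hl : ∀ s : D.LinSec, Δ s.1 ∈ D.LinSec)
    (hc : ∀ χ, ∃ χ', D.hat χ' = Δ (D.hat χ)) : D.overA.IsHomogeneous X := by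
  have key : ∀ r φ, D.overE.IsFibreLinear φ →
      X.deriv (D.overA.precomp r φ) = D.overA.precomp r (X.deriv φ) := by
    intro r φ hφ
    have gen : ∀ (t : D.overE.Sec) (k : ℝ),
        (∀ e, D.overE.smul k (t (D.bE.smul r e)) = D.overA.smul r (t e)) →
        (∀ e, D.overE.smul k (Δ t (D.bE.smul r e)) = D.overA.smul r (Δ t e)) → ∀ e,
        X.deriv (D.overA.precomp r φ) (t e) = D.overA.precomp r (X.deriv φ) (t e) := by
      intro t k h1 h2 e
      have e1 := deriv_precomp_sec hX hs h1 hφ e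
      rw [← h2 e, hφ.2] at e1
      rw [VBundle.precomp_apply]
      linarith
    refine ext_generators (hX.1 _ (isFibreLinear_precomp r hφ)) (isFibreLinear_precomp r (hX.1 _ hφ))
      (fun s => gen s.1 1 (fun e => ?_) fun e => ?_) fun χ => gen _ r (fun e => smul_hat χ r e) fun e => ?_
    · rw [D.overE.one_smul', linSec_smul]
    · rw [D.overE.one_smul']
      exact linSec_smul ⟨_, hl s⟩ r e
    · obtain ⟨χ', h'⟩ := hc χ
      rw [← h']
      exact smul_hat χ' r e
  intro r w
  refine D.overE.tangent_ext ?_ fun φ hφ => ?_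
  · refine Eq.trans ?_ (hX.2.1 _).symm
    have e1 := mfderiv_comp w (D.overE.mdifferentiableAt_proj (D.overA.smul r w))
      (D.overA.mdifferentiableAt_smul r w)
    have e2 : D.overE.proj ∘ D.overA.smul r = D.bE.smul r ∘ D.overE.proj :=
      funext fun w => D.projE_smulA r w
    rw [e2, mfderiv_comp w (D.bE.mdifferentiableAt_smul r _) (D.overE.mdifferentiableAt_proj w)] at e1
    have e3 := congrArg (fun A => A (X w)) e1
    refine e3.symm.trans ?_
    show mfderiv 𝓘(ℝ, VE) 𝓘(ℝ, VE) (D.bE.smul r) (D.overE.proj w)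
      (mfderiv 𝓘(ℝ, VW) 𝓘(ℝ, VE) D.overE.proj w (X w)) = _
    rw [hX.2.1, hs, projE_smulA]
  · rw [← VBundle.deriv_precomp_apply, key r φ hφ]
    rfl

end

end DoubleVB

/-! ### Derivations of Lie algebroids -/

section Defect

variable {VN : Type*} [NormedAddCommGroup VN] [NormedSpace ℝ VN]
  {N : Type*} [TopologicalSpace N] [ChartedSpace VN N] [IsManifold 𝓘(ℝ, VN) ∞ N]

lemma Der.map_zero {Γ : Type*} [AddCommGroup Γ] [Module (SmoothFun VN N) Γ] (Δ : Der VN N Γ) :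
    Δ 0 = 0 := _root_.map_zero (AddMonoidHom.mk' Δ.toFun Δ.map_add)

lemma Der.map_neg {Γ : Type*} [AddCommGroup Γ] [Module (SmoothFun VN N) Γ] (Δ : Der VN N Γ) (s : Γ) :
    Δ (-s) = -Δ s := _root_.map_neg (AddMonoidHom.mk' Δ.toFun Δ.map_add) s

lemma Der.map_sum {Γ : Type*} [AddCommGroup Γ] [Module (SmoothFun VN N) Γ] (Δ : Der VN N Γ)
    {ι : Type*} (I : Finset ι) (s : ι → Γ) : Δ (∑ i ∈ I, s i) = ∑ i ∈ I, Δ (s i) :=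
  _root_.map_sum (AddMonoidHom.mk' Δ.toFun Δ.map_add) s I

variable [FiniteDimensional ℝ VN] [T2Space N]
  {VV : Type*} [NormedAddCommGroup VV] [NormedSpace ℝ VV] [FiniteDimensional ℝ VV]
  {V : Type*} [TopologicalSpace V] [ChartedSpace VV V] [IsManifold 𝓘(ℝ, VV) ∞ V] [T2Space V]
  {B : VBundle VV V VN N} {Z : VField VV V} {Δ : Der VN N B.Sec}

/-- If `Z` preserves the anchor, then the anchor intertwines `Δ` with the commutator with the symbol
of `Δ`. -/
lemma AnchorMap.field_der {L : AnchorMap B} (hC : B.Corresponds Z Δ)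
    (hA : ∀ f, Z.deriv (L.dualFun f) = L.dualFun (Δ.symbol.deriv f)) (t : B.Sec) (f : SmoothFun VN N) :
    (L.field (Δ t)).deriv f =
      Δ.symbol.deriv ((L.field t).deriv f) - (L.field t).deriv (Δ.symbol.deriv f) := by
  ext x
  have h := hC.2.2 t _ (L.dualFun_lin f) x
  rw [hA] at h
  rw [L.field_deriv, L.field_deriv, L.field_deriv, VBundle.pairing_apply, h]
  rfl

namespace LieAlgebroid

variable {L : LieAlgebroid B}

/-- The failure of `Δ` to be a derivation of the bracket. -/
def defect (L : LieAlgebroid B) (Δ : Der VN N B.Sec) (s t : B.Sec) : B.Sec :=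
  Δ (L.bracket s t) - (L.bracket (Δ s) t + L.bracket s (Δ t))

lemma defect_add (s t t' : B.Sec) : L.defect Δ s (t + t') = L.defect Δ s t + L.defect Δ s t' := by
  unfold defect
  rw [L.bracket_add_right, L.bracket_add_right, Δ.map_add, Δ.map_add, L.bracket_add_right]
  abel

lemma defect_swap (s t : B.Sec) : L.defect Δ s t = -L.defect Δ t s := by
  unfold defect
  rw [L.bracket_skew s t, Δ.map_neg, L.bracket_skew (Δ s) t, L.bracket_skew s (Δ t)]
  abel

lemma defect_smul (hC : B.Corresponds Z Δ)
    (hA : ∀ f, Z.deriv (L.dualFun f) = L.dualFun (Δ.symbol.deriv f)) (s : B.Sec) (f : SmoothFun VN N)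
    (t : B.Sec) : L.defect Δ s (f • t) = f • L.defect Δ s t := by
  have h : Δ.symbol.deriv ((L.field s).deriv f) =
      (L.field (Δ s)).deriv f + (L.field s).deriv (Δ.symbol.deriv f) := by
    rw [L.field_der hC hA]; abel
  unfold defect
  rw [L.leibniz, L.leibniz, Δ.map_add, Δ.leibniz, Δ.leibniz, Δ.leibniz, L.bracket_add_right,
    L.leibniz, L.leibniz, h, add_smul, smul_sub, smul_add]
  abel

end LieAlgebroid

end Defect

/-! ### Infinitesimal automorphisms -/

/-- A vector field whose flow commutes with `F` is invariant under `F`. -/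
lemma VField.invariant_of_flow {VN : Type*} [NormedAddCommGroup VN] [NormedSpace ℝ VN]
    {N : Type*} [TopologicalSpace N] [ChartedSpace VN N] [IsManifold 𝓘(ℝ, VN) ∞ N]
    [FiniteDimensional ℝ VN] [T2Space N] {X : VField VN N} {F : N → N}
    (hF : ContMDiff 𝓘(ℝ, VN) 𝓘(ℝ, VN) ∞ F) {x : N}
    (h : ∀ᶠ t in 𝓝 0, X.flow t (F x) = F (X.flow t x)) :
    mfderiv 𝓘(ℝ, VN) 𝓘(ℝ, VN) F x (X x) = X (F x) := by
  refine tangent_ext fun f => ?_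
  have hFd : ∀ y, MDifferentiableAt 𝓘(ℝ, VN) 𝓘(ℝ, VN) F y := fun y => (hF y).mdifferentiableAt (by simp)
  let g : SmoothFun VN N := ⟨fun y => f (F y), f.contMDiff.comp hF⟩
  have h1 := (X.defined_zero (F x)).hasDerivAt (f.mdifferentiableAt _)
  have h2 := (X.defined_zero x).hasDerivAt (g.mdifferentiableAt _)
  rw [X.flow_zero] at h1 h2
  have h3 : HasDerivAt (fun s => f (X.flow s (F x))) (dirDeriv g x (X x)) 0 :=
    h2.congr_of_eventuallyEq (h.mono fun t ht => congrArg f ht)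
  rw [← dirDeriv_comp (f.mdifferentiableAt _) (hFd x)]
  exact h3.unique h1

/-- Being a morphism over `S` only depends on the values over `S`. -/
lemma LieAlgebroid.IsMorphismOn.congr {VV : Type*} [NormedAddCommGroup VV] [NormedSpace ℝ VV]
    {V : Type*} [TopologicalSpace V] [ChartedSpace VV V]
    {VN : Type*} [NormedAddCommGroup VN] [NormedSpace ℝ VN]
    {N : Type*} [TopologicalSpace N] [ChartedSpace VN N] [IsManifold 𝓘(ℝ, VN) ∞ N]
    {B : VBundle VV V VN N} {L : LieAlgebroid B} {S : Set N} (hS : IsOpen S) {F F' : V → V}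
    {f f' : N → N} (h : L.IsMorphismOn S F f) (hF : ∀ v, B.proj v ∈ S → F' v = F v)
    (hf : ∀ x ∈ S, f' x = f x) : L.IsMorphismOn S F' f' where
  vb :=
    { smooth_total := h.vb.smooth_total.congr hF
      smooth_base := h.vb.smooth_base.congr hf
      proj := fun v hv => by rw [hF v hv, hf _ hv, h.vb.proj v hv]
      map_add := fun v w hv hvw => by
        rw [hF _ (by rwa [B.proj_add _ _ hvw]), hF v hv, hF w (hvw ▸ hv), h.vb.map_add v w hv hvw]
      map_smul := fun r v hv => by
        rw [hF _ (by rwa [B.proj_smul]), hF v hv, h.vb.map_smul r v hv] }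
  anchor := fun v hv => by
    have e : f' =ᶠ[𝓝 (B.proj v)] f := by
      filter_upwards [hS.mem_nhds hv] with y hy using hf y hy
    rw [e.mfderiv_eq, hF v hv, hf _ hv]
    exact h.anchor v hv
  bracket := fun O hO hOS s₁ s₂ t₁ t₂ h1 h2 x hx => by
    have hp : ∀ (s : B.Sec), ∀ y ∈ O, B.proj (s y) ∈ S := fun s y hy => by
      have : B.proj (s y) = y := s.proj_apply y
      rw [this]; exact hOS hy
    rw [hF _ (hp _ x hx), hf x (hOS hx)]
    exact h.bracket O hO hOS s₁ s₂ t₁ t₂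
      (fun y hy => by rw [← hF _ (hp _ y hy), ← hf y (hOS hy)]; exact h1 y hy)
      (fun y hy => by rw [← hF _ (hp _ y hy), ← hf y (hOS hy)]; exact h2 y hy) x hx

namespace VBAlgebroid

variable {VW : Type*} [NormedAddCommGroup VW] [NormedSpace ℝ VW] [FiniteDimensional ℝ VW]
  {W : Type*} [TopologicalSpace W] [ChartedSpace VW W] [IsManifold 𝓘(ℝ, VW) ∞ W] [T2Space W]
  {VE : Type*} [NormedAddCommGroup VE] [NormedSpace ℝ VE] [FiniteDimensional ℝ VE]
  {E : Type*} [TopologicalSpace E] [ChartedSpace VE E] [IsManifold 𝓘(ℝ, VE) ∞ E] [T2Space E]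
  {VA : Type*} [NormedAddCommGroup VA] [NormedSpace ℝ VA] [FiniteDimensional ℝ VA]
  {A : Type*} [TopologicalSpace A] [ChartedSpace VA A] [IsManifold 𝓘(ℝ, VA) ∞ A] [T2Space A]
  {VM : Type*} [NormedAddCommGroup VM] [NormedSpace ℝ VM] [FiniteDimensional ℝ VM]
  {M : Type*} [TopologicalSpace M] [ChartedSpace VM M] [IsManifold 𝓘(ℝ, VM) ∞ M] [T2Space M]
  {D : VBAlgebroid VW W VE E VA A VM M} {X : VField VW W} {Δ : Der VE E D.overE.Sec}

variable (D) in
/-- The infinitesimal version of the conditions on the flow of an infinitesimal automorphism `X`, in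
terms of `X` and of the derivation `Δ` of `W → E` corresponding to it: `X` is linear with respect to
both vector bundle structures and preserves the anchor and the bracket of `W → E`. -/
structure IsInfinitesimal (X : VField VW W) (Δ : Der VE E D.overE.Sec) : Prop where
  corr : D.overE.Corresponds X Δ
  homA : D.overA.IsHomogeneous X
  anchor : ∀ f, X.deriv (D.lieW.dualFun f) = D.lieW.dualFun (Δ.symbol.deriv f)
  bracket : ∀ s t, Δ (D.lieW.bracket s t) = D.lieW.bracket (Δ s) t + D.lieW.bracket s (Δ t)

/-- Differentiating the conditions on the flow at time `0` gives the infinitesimal conditions. -/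
lemma IsInfAut.exists_isInfinitesimal (hX : D.IsInfAut X) : ∃ Δ, D.IsInfinitesimal X Δ := by
  choose U FW FE FA F hU hdom hflow hmor using hX
  have hflow' : ∀ t w, D.base w ∈ U t → X.flow t w = FW t w := fun t w h => (hflow t w h).flow_eq
  have hev : ∀ w, ∀ᶠ t in 𝓝 (0 : ℝ), D.base w ∈ U t := fun w =>
    (X.defined_zero w).eventually.mono fun t ht => (hdom t w).1 ht
  have hE : D.overE.IsHomogeneous X := fun r w => by
    refine VField.invariant_of_flow (D.overE.contMDiff_smul r) ((hev w).mono fun t ht => ?_)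
    have hb : D.base (D.overE.smul r w) ∈ U t := by
      unfold DoubleVB.base
      rw [D.overE.proj_smul]; exact ht
    rw [hflow' t _ hb, hflow' t w ht]
    exact (hmor t).rowW.vb.map_smul r w ht
  have hA : D.overA.IsHomogeneous X := fun r w => by
    refine VField.invariant_of_flow (D.overA.contMDiff_smul r) ((hev w).mono fun t ht => ?_)
    have hb : D.base (D.overA.smul r w) ∈ U t := by
      unfold DoubleVB.base
      rw [D.projE_smulA, D.bE.proj_smul]; exact ht
    rw [hflow' t _ hb, hflow' t w ht]
    refine (hmor t).columnW.map_smul r w ?_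
    show D.bA.proj (D.overA.proj w) ∈ U t
    rw [D.bA_projA]; exact ht
  obtain ⟨Δ, hΔ⟩ := hE.exists_der
  have hmor' : ∀ t, D.lieW.IsMorphismOn {e | Δ.symbol.Defined t e} (X.flow t) (Δ.symbol.flow t) := by
    intro t
    have hset : {e | Δ.symbol.Defined t e} = D.bE.proj ⁻¹' U t := by
      ext e
      have e1 := hΔ.defined_iff (t := t) (v := D.overE.zero e)
      have e2 := hdom t (D.overE.zero e)
      unfold DoubleVB.base at e2
      rw [D.overE.proj_zero] at e1 e2
      exact e1.symm.trans e2
    have hFW : ∀ w, D.overE.proj w ∈ D.bE.proj ⁻¹' U t → X.flow t w = FW t w := fun w hw => hflow' t w hw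
    rw [hset]
    refine (hmor t).rowW.congr ((hU t).preimage D.bE.contMDiff_proj.continuous) hFW fun e he => ?_
    have hz : D.overE.proj (D.overE.zero e) ∈ D.bE.proj ⁻¹' U t := by rwa [D.overE.proj_zero]
    have hd : X.Defined t (D.overE.zero e) := (hdom t _).2 hz
    have e1 := VBundle.proj_flow hΔ.2.1 hd
    rw [D.overE.proj_zero, hFW _ hz, (hmor t).rowW.vb.proj _ hz, D.overE.proj_zero] at e1
    exact e1.symm
  exact ⟨Δ, hΔ, hA, D.lieW.deriv_dualFun_of_flow hΔ.isHomogeneous hΔ.2.1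
    (fun t v h => (hmor' t).anchor v h), D.lieW.der_bracket_of_flow hΔ hmor'⟩

/-! #### The core-anchor and the representations of the fat algebroid -/

lemma hat_coreRep (s : D.LinSec) (χ : D.CoreSec) :
    D.hat (D.coreRep s χ) = D.lieW.bracket s.1 (D.hat χ) :=
  (D.bracket_lin_core s.1 s.2 χ).choose_spec.symm

lemma field_isHomogeneous (s : D.LinSec) : D.bE.IsHomogeneous (D.lieW.field s.1) := fun r e => by
  have h := D.anchor_smulA r (s.1 e)
  rw [s.1.proj_eq, ← D.linSec_smul] at h
  exact h

lemma field_proj (s : D.LinSec) (e : E) :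
    mfderiv 𝓘(ℝ, VE) 𝓘(ℝ, VM) D.bE.proj e (D.lieW.field s.1 e) = D.fatAnchor s (D.bE.proj e) := by
  have h := D.anchor_proj (s.1 e)
  rw [s.1.proj_eq, D.projA_linSec] at h
  exact h

lemma field_deriv_pull (s : D.LinSec) (f : SmoothFun VM M) :
    (D.lieW.field s.1).deriv (D.bE.pull f) = D.bE.pull ((D.fatAnchor s).deriv f) :=
  VBundle.deriv_pull (field_proj s) f

lemma field_hat_deriv_pull (χ : D.CoreSec) (f : SmoothFun VM M) :
    (D.lieW.field (D.hat χ)).deriv (D.bE.pull f) = 0 := by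
  ext e
  have h := D.anchor_proj (D.hat χ e)
  have h0 : D.lieA.anchor (D.bE.proj e) (D.bA.zero (D.bE.proj e)) = 0 := by
    have := D.lieA.anchor_smul (D.bE.proj e) 0 (D.bA.zero (D.bE.proj e)) (D.bA.proj_zero _)
    rwa [D.bA.smul_zero', zero_smul] at this
  rw [(D.hat χ).proj_eq, D.projA_hat, h0] at h
  show dirDeriv (fun e => f (D.bE.proj e)) e (D.lieW.field (D.hat χ) e) = 0
  rw [dirDeriv_comp (f.mdifferentiableAt _) (D.bE.mdifferentiableAt_proj e)]
  have h' : mfderiv 𝓘(ℝ, VE) 𝓘(ℝ, VM) D.bE.proj e (D.lieW.field (D.hat χ) e) = 0 := h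
  rw [h', dirDeriv_map_zero]

/-- The anchor of a core section is a vertical vector field that is constant on the fibres of `E`. -/
lemma field_hat_deriv (χ : D.CoreSec) {φ : SmoothFun VE E} (hφ : D.bE.IsFibreLinear φ) (e : E) :
    (D.lieW.field (D.hat χ)).deriv φ e =
      (D.lieW.field (D.hat χ)).deriv φ (D.bE.zero (D.bE.proj e)) := by
  set Y := D.lieW.field (D.hat χ)
  have h1 : ∀ r : ℝ, r ≠ 0 → Y.deriv φ (D.bE.smul r e) = Y.deriv φ e := by
    intro r hr
    have h := D.anchor_smulA r (D.hat χ e)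
    rw [(D.hat χ).proj_eq, ← D.smul_hat, D.lieW.anchor_smul _ _ _ ((D.hat χ).proj_eq _)] at h
    have h2 := congrArg (dirDeriv φ (D.bE.smul r e)) h
    rw [dirDeriv_map_smul, ← dirDeriv_comp (φ.mdifferentiableAt _) (D.bE.mdifferentiableAt_smul r e)]
      at h2
    have h3 : (fun y => φ (D.bE.smul r y)) = fun y => algebraMap ℝ (SmoothFun VE E) r y * φ y :=
      funext fun y => hφ.2 r y
    rw [h3, dirDeriv_mul ((algebraMap ℝ (SmoothFun VE E) r).mdifferentiableAt e)
      (φ.mdifferentiableAt e)] at h2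
    have h4 : ∀ u : TangentSpace 𝓘(ℝ, VE) e, dirDeriv (algebraMap ℝ (SmoothFun VE E) r) e u = 0 :=
      fun u => dirDeriv_const r e u
    rw [h4, zero_mul, zero_add] at h2
    exact (mul_left_cancel₀ hr h2).symm
  have hc : Continuous fun r : ℝ => Y.deriv φ (D.bE.smul r e) :=
    (Y.deriv φ).contMDiff.continuous.comp (D.bE.contMDiff_smul_curve e).continuous
  have h5 : Filter.Tendsto (fun r : ℝ => Y.deriv φ (D.bE.smul r e)) (𝓝[≠] 0)
      (𝓝 (Y.deriv φ (D.bE.smul 0 e))) := hc.continuousAt.mono_left nhdsWithin_le_nhds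
  have h6 : Filter.Tendsto (fun r : ℝ => Y.deriv φ (D.bE.smul r e)) (𝓝[≠] 0) (𝓝 (Y.deriv φ e)) :=
    tendsto_const_nhds.congr' (by
      filter_upwards [self_mem_nhdsWithin] with r hr using (h1 r hr).symm)
  rw [← D.bE.zero_smul']
  exact tendsto_nhds_unique h6 h5

lemma coreAnchor_spec (χ : D.CoreSec) {φ : SmoothFun VE E} (hφ : D.bE.IsFibreLinear φ) :
    (D.lieW.field (D.hat χ)).deriv φ = D.bE.pull (D.bE.pairing φ (D.coreAnchor χ)) := by
  set Y := D.lieW.field (D.hat χ) with hY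
  obtain ⟨ε, hε⟩ := D.bE.exists_sec_of_dual (T := fun φ m => Y.deriv φ (D.bE.zero m))
    (fun φ _ => (Y.deriv φ).contMDiff.comp D.bE.contMDiff_zero)
    (fun φ ψ _ _ m => by rw [Y.deriv_add]; rfl)
    (fun f φ _ m => by
      rw [Y.deriv_mul, hY, field_hat_deriv_pull, zero_mul, zero_add, SmoothFun.mul_apply,
        VBundle.pull_apply, D.bE.proj_zero])
  have hex : ∃ ε : D.bE.Sec, ∀ φ : SmoothFun VE E, D.bE.IsFibreLinear φ →
      ∀ e, (D.lieW.field (D.hat χ)).deriv φ e = φ (ε (D.bE.proj e)) :=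
    ⟨ε, fun φ hφ e => by rw [field_hat_deriv χ hφ, hε φ hφ]⟩
  exact ContMDiffMap.ext fun e => Classical.epsilon_spec hex φ hφ e

lemma sideRep_spec (s : D.LinSec) (ε : D.bE.Sec) :
    D.bE.IsDerivOf (D.lieW.field s.1) (D.fatAnchor s) ε (D.sideRep s ε) := by
  obtain ⟨δ, hδ⟩ := (field_isHomogeneous s).exists_der
  have hs : δ.symbol = D.fatAnchor s := by
    refine ContMDiffSection.ext fun m => ?_
    have e1 := hδ.2.1 (D.bE.zero m)
    have e2 := field_proj s (D.bE.zero m)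
    rw [D.bE.proj_zero] at e1 e2
    exact e1.symm.trans e2
  exact Classical.epsilon_spec (p := D.bE.IsDerivOf (D.lieW.field s.1) (D.fatAnchor s) ε)
    ⟨δ ε, hs ▸ hδ.2.2 ε⟩

lemma field_deriv_lin (s : D.LinSec) {φ : SmoothFun VE E} (hφ : D.bE.IsFibreLinear φ) :
    D.bE.IsFibreLinear ((D.lieW.field s.1).deriv φ) :=
  (field_isHomogeneous s).exists_der.choose_spec.1 φ hφ

lemma pairing_sideRep (s : D.LinSec) (ε : D.bE.Sec) {φ : SmoothFun VE E} (hφ : D.bE.IsFibreLinear φ) :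
    D.bE.pairing φ (D.sideRep s ε) = (D.fatAnchor s).deriv (D.bE.pairing φ ε) -
      D.bE.pairing ((D.lieW.field s.1).deriv φ) ε :=
  ContMDiffMap.ext fun m => sideRep_spec s ε φ hφ m

end VBAlgebroid

namespace DoubleVB

variable {VW : Type*} [NormedAddCommGroup VW] [NormedSpace ℝ VW] [FiniteDimensional ℝ VW]
  {W : Type*} [TopologicalSpace W] [ChartedSpace VW W] [IsManifold 𝓘(ℝ, VW) ∞ W] [T2Space W]
  {VE : Type*} [NormedAddCommGroup VE] [NormedSpace ℝ VE] [FiniteDimensional ℝ VE]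
  {E : Type*} [TopologicalSpace E] [ChartedSpace VE E] [IsManifold 𝓘(ℝ, VE) ∞ E] [T2Space E]
  {VA : Type*} [NormedAddCommGroup VA] [NormedSpace ℝ VA] [FiniteDimensional ℝ VA]
  {A : Type*} [TopologicalSpace A] [ChartedSpace VA A] [IsManifold 𝓘(ℝ, VA) ∞ A] [T2Space A]
  {VM : Type*} [NormedAddCommGroup VM] [NormedSpace ℝ VM] [FiniteDimensional ℝ VM]
  {M : Type*} [TopologicalSpace M] [ChartedSpace VM M] [IsManifold 𝓘(ℝ, VM) ∞ M] [T2Space M]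
  {D : DoubleVB VW W VE E VA A VM M} {X : VField VW W} {Δ : Der VE E D.overE.Sec}

/-! #### Sections of `Hom(E, C)` -/

lemma HomEC.isCore (Φ : D.HomEC) (e : E) : D.IsCore (D.bE.proj e) (Φ.toFun e) := ⟨Φ.projE e, Φ.projA e⟩

lemma HomEC.toLin_apply (Φ : D.HomEC) (e : E) :
    Φ.toLin.1 e = D.overA.add (D.overE.zero e) (Φ.toFun e) := rfl

/-- Functions that are linear for both structures only see the core part of `0_{W,E}(e) + c`. -/
lemma doublyLinear_shift {β : SmoothFun VW W} (hE : D.overE.IsFibreLinear β)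
    (hA : D.overA.IsFibreLinear β) {e : E} {c : W} (hc : D.IsCore (D.bE.proj e) c) :
    β (D.overA.add (D.overE.zero e) c) = β c := by
  rw [hA.1 _ _ ((D.projA_zeroE e).trans hc.2.symm), hE.apply_zero, zero_add]

lemma doublyLinear_hat {β : SmoothFun VW W} (hE : D.overE.IsFibreLinear β)
    (hA : D.overA.IsFibreLinear β) (χ : D.CoreSec) (e : E) :
    β (D.hat χ e) = β (χ.1 (D.bE.proj e)) := doublyLinear_shift hE hA (isCore_coreSec χ _)

/-- A linear section over the zero section of `A` comes from a morphism `E → C`. -/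
lemma exists_homEC {s : D.LinSec} (h : ∀ e, D.overA.proj (s.1 e) = D.bA.zero (D.bE.proj e)) :
    ∃ Φ : D.HomEC, Φ.toLin = s := by
  have h0 : ∀ e, D.overA.proj (s.1 e) = D.overA.proj (D.overE.zero e) := fun e =>
    (h e).trans (D.projA_zeroE e).symm
  let k : E → W := fun e => D.overA.sub (s.1 e) (D.overE.zero e)
  have hpA : ∀ e, D.overA.proj (k e) = D.bA.zero (D.bE.proj e) := fun e =>
    (VBundle.proj_sub (h0 e)).trans (h e)
  have hk : ContMDiff 𝓘(ℝ, VE) 𝓘(ℝ, VW) ∞ k :=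
    D.overA.contMDiff_add_comp s.1.contMDiff
      ((D.overA.contMDiff_smul (-1)).comp D.overE.contMDiff_zero) fun e => by
        show D.overA.proj (s.1 e) = D.overA.proj (D.overA.smul (-1) (D.overE.zero e))
        rw [D.overA.proj_smul, h0]
  have hsm : ∀ r e, k (D.bE.smul r e) = D.overA.smul r (k e) := by
    intro r e
    refine D.overA.ext_fibreLinear (by rw [hpA, D.overA.proj_smul, hpA, D.bE.proj_smul]) fun ψ hψ => ?_
    have e1 : ∀ e, ψ (k e) = ψ (s.1 e) - ψ (D.overE.zero e) := fun e => by
      show ψ (D.overA.add (s.1 e) (D.overA.smul (-1) (D.overE.zero e))) = _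
      rw [hψ.1 _ _ (by rw [D.overA.proj_smul, h0]), hψ.2]
      ring
    rw [e1, hψ.2, e1, linSec_smul, ← smulA_zeroE, hψ.2, hψ.2]
    ring
  have hmor := D.bE.isMorphismOn_of_homogeneous D.overA (f := fun m => D.bA.zero m) isOpen_univ
    hk.contMDiffOn (fun r e _ => hsm r e) fun m _ => by rw [hpA, D.bE.proj_zero]
  refine ⟨⟨k, hk, fun e => ?_, hpA, fun e e' he => hmor.map_add e e' (mem_univ _) he, hsm⟩,
    Subtype.ext (VBundle.SecAlong.ext fun e => VBundle.add_sub' (h0 e).symm)⟩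
  show D.overE.proj (D.overA.add (s.1 e) (D.overA.smul (-1) (D.overE.zero e))) = _
  rw [projE_addA _ (by rw [D.overA.proj_smul, h0]), projE_smulA, D.overE.proj_zero, s.1.proj_eq]
  exact VBundle.sub_self' e

/-! #### The derivations induced by a linear vector field on `W` -/

section

variable (hX : D.overE.Corresponds X Δ)
include hX

/-- The action on core sections, evaluated on functions that are linear for both structures. -/
lemma doublyLinear_der_hat {Y : VField VM M}
    (hY : ∀ e, mfderiv 𝓘(ℝ, VE) 𝓘(ℝ, VM) D.bE.proj e (Δ.symbol e) = Y (D.bE.proj e))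
    (hA : D.overA.IsHomogeneous X) {χ χ' : D.CoreSec} (h : D.hat χ' = Δ (D.hat χ))
    {β : SmoothFun VW W} (hβE : D.overE.IsFibreLinear β) (hβA : D.overA.IsFibreLinear β)
    {g : SmoothFun VM M} (hg : ∀ m, g m = β (χ.1 m)) (m : M) :
    β (χ'.1 m) = Y.deriv g m - X.deriv β (χ.1 m) := by
  have hXβ : D.overA.IsFibreLinear (X.deriv β) := hA.exists_der.choose_spec.1 β hβA
  have e1 := hX.2.2 (D.hat χ) β hβE (D.bE.zero m)
  have e2 : D.overE.pairing β (D.hat χ) = D.bE.pull g := ContMDiffMap.ext fun e => by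
    rw [VBundle.pairing_apply, VBundle.pull_apply, doublyLinear_hat hβE hβA, hg]
  rw [← h, e2, VBundle.deriv_pull hY, doublyLinear_hat hβE hβA, doublyLinear_hat (hX.1 β hβE) hXβ,
    VBundle.pull_apply, D.bE.proj_zero] at e1
  exact e1

/-- Sections of `Hom(E, C)` are preserved. -/
lemma projA_der_toLin (hA : D.overA.IsHomogeneous X) (Φ : D.HomEC) (e : E) :
    D.overA.proj (Δ Φ.toLin.1 e) = D.bA.zero (D.bE.proj e) := by
  obtain ⟨Y, hY⟩ := hA.exists_base
  have hYh : D.bA.IsHomogeneous Y := fun r =>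
    VBundle.related_base hY (D.overE.contMDiff_smul r) (D.bA.contMDiff_smul r)
      (fun w => D.projA_smulE r w) (hX.isHomogeneous r)
  have hp : ∀ e, D.overA.proj (Φ.toLin.1 e) = D.bA.zero (D.bE.proj e) := fun e => by
    rw [HomEC.toLin_apply, D.overA.proj_add _ _ ((D.projA_zeroE e).trans (Φ.projA e).symm), projA_zeroE]
  refine D.bA.ext_fibreLinear (by rw [bA_projA, (Δ Φ.toLin.1).proj_eq, D.bA.proj_zero]) fun a ha => ?_
  have e1 := hX.2.2 Φ.toLin.1 _ (isFibreLinear_pullA ha) e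
  have e2 : D.overE.pairing (D.overA.pull a) Φ.toLin.1 = 0 := ContMDiffMap.ext fun e => by
    rw [VBundle.pairing_apply, VBundle.pull_apply, hp, ha.apply_zero]
    rfl
  rw [e2, VField.deriv_zero, VBundle.deriv_pull hY, VBundle.pull_apply, VBundle.pull_apply, hp,
    (hYh.exists_der.choose_spec.1 a ha).apply_zero] at e1
  rw [e1, ha.apply_zero]
  exact sub_zero 0

/-- The derivation of `Â` induced by a linear vector field. -/
def derLin (hA : D.overA.IsHomogeneous X) {Y : VField VM M}
    (hY : ∀ e, mfderiv 𝓘(ℝ, VE) 𝓘(ℝ, VM) D.bE.proj e (Δ.symbol e) = Y (D.bE.proj e)) :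
    Der VM M D.LinSec where
  toFun s := ⟨Δ s.1, der_linSec hX hA s⟩
  symbol := Y
  map_add s t := Subtype.ext (Δ.map_add s.1 t.1)
  map_const_smul r s := Subtype.ext (Δ.map_const_smul r s.1)
  leibniz f s := Subtype.ext ((Δ.leibniz (D.pullE f) s.1).trans (by
    have e : Δ.symbol.deriv (D.pullE f) = D.pullE (Y.deriv f) := VBundle.deriv_pull hY f
    rw [e]
    rfl))

/-- The derivation of the core induced by a linear vector field. -/
lemma exists_derCore (hA : D.overA.IsHomogeneous X) {Y : VField VM M}
    (hY : ∀ e, mfderiv 𝓘(ℝ, VE) 𝓘(ℝ, VM) D.bE.proj e (Δ.symbol e) = Y (D.bE.proj e)) :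
    ∃ δ : Der VM M D.CoreSec, δ.symbol = Y ∧ ∀ χ, D.hat (δ χ) = Δ (D.hat χ) := by
  choose c hc using der_hat hX hA
  refine ⟨⟨c, Y, fun χ χ' => hat_injective ?_, fun r χ => hat_injective ?_,
    fun f χ => hat_injective ?_⟩, rfl, hc⟩
  · rw [hat_add, hc, hc, hc, hat_add, Δ.map_add]
  · rw [hat_smul, hc, hc, hat_smul]
    exact Δ.map_const_smul r (D.hat χ)
  · have e : Δ.symbol.deriv (D.pullE f) = D.pullE (Y.deriv f) := VBundle.deriv_pull hY f
    rw [hat_add, hat_smul, hat_smul, hc, hc, hat_smul, Δ.leibniz, e]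

end

end DoubleVB

namespace VBAlgebroid

variable {VW : Type*} [NormedAddCommGroup VW] [NormedSpace ℝ VW] [FiniteDimensional ℝ VW]
  {W : Type*} [TopologicalSpace W] [ChartedSpace VW W] [IsManifold 𝓘(ℝ, VW) ∞ W] [T2Space W]
  {VE : Type*} [NormedAddCommGroup VE] [NormedSpace ℝ VE] [FiniteDimensional ℝ VE]
  {E : Type*} [TopologicalSpace E] [ChartedSpace VE E] [IsManifold 𝓘(ℝ, VE) ∞ E] [T2Space E]
  {VA : Type*} [NormedAddCommGroup VA] [NormedSpace ℝ VA] [FiniteDimensional ℝ VA]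
  {A : Type*} [TopologicalSpace A] [ChartedSpace VA A] [IsManifold 𝓘(ℝ, VA) ∞ A] [T2Space A]
  {VM : Type*} [NormedAddCommGroup VM] [NormedSpace ℝ VM] [FiniteDimensional ℝ VM]
  {M : Type*} [TopologicalSpace M] [ChartedSpace VM M] [IsManifold 𝓘(ℝ, VM) ∞ M] [T2Space M]
  {D : VBAlgebroid VW W VE E VA A VM M} {X : VField VW W} {Δ : Der VE E D.overE.Sec}

open DoubleVB

namespace IsInfinitesimal

variable (I : D.IsInfinitesimal X Δ)
include I

/-- The anchor of the fat algebroid intertwines the induced derivation with the commutator. -/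
lemma fatAnchor_der {Y : VField VM M}
    (hY : ∀ e, mfderiv 𝓘(ℝ, VE) 𝓘(ℝ, VM) D.bE.proj e (Δ.symbol e) = Y (D.bE.proj e)) {s s' : D.LinSec}
    (h : s'.1 = Δ s.1) (f : SmoothFun VM M) : (D.fatAnchor s').deriv f =
      Y.deriv ((D.fatAnchor s).deriv f) - (D.fatAnchor s).deriv (Y.deriv f) := by
  have e1 := AnchorMap.field_der I.corr I.anchor s.1 (D.bE.pull f)
  rw [← h, field_deriv_pull, field_deriv_pull, VBundle.deriv_pull hY, VBundle.deriv_pull hY,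
    field_deriv_pull] at e1
  ext m
  have e2 := congrArg (fun g : SmoothFun VE E => g (D.bE.zero m)) e1
  have e3 : (D.fatAnchor s').deriv f (D.bE.proj (D.bE.zero m)) =
    Y.deriv ((D.fatAnchor s).deriv f) (D.bE.proj (D.bE.zero m)) -
      (D.fatAnchor s).deriv (Y.deriv f) (D.bE.proj (D.bE.zero m)) := e2
  rwa [D.bE.proj_zero] at e3

/-- An infinitesimal automorphism induces derivations of the fat algebroid, of the side and of the core
that are compatible with the core-anchor and the representations. -/
lemma exists_isTripleOf : ∃ T, D.IsTripleOf X T := by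
  obtain ⟨dE, hE⟩ := (symbol_isHomogeneous I.corr I.homA).exists_der
  set Y := dE.symbol with hYd
  have hY := hE.2.1
  let dA := derLin I.corr I.homA hY
  obtain ⟨dC, hCs, hdC⟩ := exists_derCore I.corr I.homA hY
  have hdA : ∀ s, (dA s).1 = Δ s.1 := fun _ => rfl
  refine ⟨{ dA := dA, dE := dE, dC := dC, bracket := fun s t => Subtype.ext (I.bracket s.1 t.1),
            symbol_E := rfl, symbol_C := hCs.symm, hom := fun Φ => ?_, core_anchor := fun χ => ?_,
            side := fun s ε => ?_, core := fun s χ => ?_ }, Δ, I.corr, fun s => rfl, hE,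
            fun χ => (hdC χ).symm⟩
  · obtain ⟨Ψ, hΨ⟩ := exists_homEC (s := dA Φ.toLin) fun e => projA_der_toLin I.corr I.homA Φ e
    refine ⟨Ψ, hΨ.symm, fun ε => coreSec_ext fun β hβE hβA m => ?_⟩
    have hXβ : D.overA.IsFibreLinear (X.deriv β) := I.homA.exists_der.choose_spec.1 β hβA
    let l : SmoothFun VE E := ⟨fun e => β (Φ.toFun e), β.contMDiff.comp Φ.smooth⟩
    have hl : D.bE.IsFibreLinear l := D.bE.isFibreLinear_of_homogeneous fun r e => by
      show β (Φ.toFun _) = r * β (Φ.toFun e)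
      rw [Φ.map_smul, hβA.2]
    have e1 := I.corr.2.2 Φ.toLin.1 β hβE (ε m)
    have e2 : D.overE.pairing β Φ.toLin.1 = l := ContMDiffMap.ext fun e => by
      rw [VBundle.pairing_apply, HomEC.toLin_apply, doublyLinear_shift hβE hβA (Φ.isCore e)]
      rfl
    rw [e2, ← hdA, ← hΨ, HomEC.toLin_apply, HomEC.toLin_apply,
      doublyLinear_shift hβE hβA (Ψ.isCore _),
      doublyLinear_shift (I.corr.1 β hβE) hXβ (Φ.isCore _)] at e1
    have e3 := doublyLinear_der_hat I.corr hY I.homA (hdC (Φ.apply ε)) hβE hβA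
      (g := D.bE.pairing l ε) (fun m => rfl) m
    have e4 := hE.2.2 ε l hl m
    have e5 : β ((dC (Φ.apply ε) - Φ.apply (dE ε)).1 m) =
        β ((dC (Φ.apply ε)).1 m) - l (dE ε m) := hβE.sec_sub _ _ m
    refine e1.trans ?_
    rw [e5, e3, e4]
    show Δ.symbol.deriv l (ε m) - X.deriv β (Φ.toFun (ε m)) =
      Y.deriv (D.bE.pairing l ε) m - X.deriv β (Φ.toFun (ε m)) - (_ - _)
    ring
  · refine VBundle.SecAlong.ext_fibreLinear fun φ hφ m => ?_
    have e1 := AnchorMap.field_der I.corr I.anchor (D.hat χ) φ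
    rw [← hdC, coreAnchor_spec _ hφ, coreAnchor_spec _ hφ, coreAnchor_spec _ (hE.1 φ hφ),
      VBundle.deriv_pull hY] at e1
    have e2 := congrArg (fun g : SmoothFun VE E => g (D.bE.zero m)) e1
    have e3 : D.bE.pairing φ (D.coreAnchor (dC χ)) (D.bE.proj (D.bE.zero m)) =
      Y.deriv (D.bE.pairing φ (D.coreAnchor χ)) (D.bE.proj (D.bE.zero m)) -
        D.bE.pairing (Δ.symbol.deriv φ) (D.coreAnchor χ) (D.bE.proj (D.bE.zero m)) := e2
    rw [D.bE.proj_zero] at e3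
    exact e3.trans (hE.2.2 (D.coreAnchor χ) φ hφ m).symm
  · refine VBundle.SecAlong.ext_fibreLinear fun φ hφ m => ?_
    have hp : ∀ {φ : SmoothFun VE E}, D.bE.IsFibreLinear φ → ∀ ε,
        D.bE.pairing φ (dE ε) = Y.deriv (D.bE.pairing φ ε) - D.bE.pairing (Δ.symbol.deriv φ) ε :=
      fun {φ} hφ ε => ContMDiffMap.ext fun m => hE.2.2 ε φ hφ m
    have hZ := field_deriv_lin s hφ
    have e1 : D.bE.pairing φ (dE (D.sideRep s ε)) - D.bE.pairing φ (D.sideRep s (dE ε)) =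
        D.bE.pairing φ (D.sideRep (dA s) ε) := by
      have e2 : D.bE.pairing ((D.lieW.field (dA s).1).deriv φ) ε =
          D.bE.pairing (Δ.symbol.deriv ((D.lieW.field s.1).deriv φ)) ε -
            D.bE.pairing ((D.lieW.field s.1).deriv (Δ.symbol.deriv φ)) ε := by
        rw [hdA, AnchorMap.field_der I.corr I.anchor]
        rfl
      rw [hp hφ, pairing_sideRep s ε hφ, pairing_sideRep s ε (hE.1 φ hφ), pairing_sideRep s _ hφ,
        pairing_sideRep _ ε hφ, hp hφ, hp hZ, e2, I.fatAnchor_der hY (hdA s), VField.deriv_sub,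
        VField.deriv_sub]
      abel
    rw [hφ.sec_sub]
    exact congrArg (fun g : SmoothFun VM M => g m) e1
  · refine hat_injective ?_
    rw [hat_sub, hdC, hat_coreRep, hat_coreRep, hat_coreRep, hdC, hdA, I.bracket]
    abel

end IsInfinitesimal

end VBAlgebroid

/-! ### From the infinitesimal conditions to the flow -/

namespace VBAlgebroid

variable {VW : Type*} [NormedAddCommGroup VW] [NormedSpace ℝ VW] [FiniteDimensional ℝ VW]
  {W : Type*} [TopologicalSpace W] [ChartedSpace VW W] [IsManifold 𝓘(ℝ, VW) ∞ W] [T2Space W]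
  {VE : Type*} [NormedAddCommGroup VE] [NormedSpace ℝ VE] [FiniteDimensional ℝ VE]
  {E : Type*} [TopologicalSpace E] [ChartedSpace VE E] [IsManifold 𝓘(ℝ, VE) ∞ E] [T2Space E]
  {VA : Type*} [NormedAddCommGroup VA] [NormedSpace ℝ VA] [FiniteDimensional ℝ VA]
  {A : Type*} [TopologicalSpace A] [ChartedSpace VA A] [IsManifold 𝓘(ℝ, VA) ∞ A] [T2Space A]
  {VM : Type*} [NormedAddCommGroup VM] [NormedSpace ℝ VM] [FiniteDimensional ℝ VM]
  {M : Type*} [TopologicalSpace M] [ChartedSpace VM M] [IsManifold 𝓘(ℝ, VM) ∞ M] [T2Space M]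
  {D : VBAlgebroid VW W VE E VA A VM M} {X : VField VW W} {Δ : Der VE E D.overE.Sec}

open DoubleVB

lemma fatProj_eq {s : D.LinSec} {a : D.bA.Sec} (h : D.IsLinearOver s.1 a) : D.fatProj s = a :=
  (D.fatProj_spec s).unique h

lemma fatProj_add (s t : D.LinSec) : D.fatProj (s + t) = D.fatProj s + D.fatProj t :=
  fatProj_eq ((D.fatProj_spec s).add (D.fatProj_spec t))

lemma fatProj_smul (f : SmoothFun VM M) (s : D.LinSec) : D.fatProj (f • s) = f • D.fatProj s :=
  fatProj_eq ((D.fatProj_spec s).smul f)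

lemma fatProj_bracket (s t : D.LinSec) :
    D.fatProj (D.fatBracket s t) = D.lieA.bracket (D.fatProj s) (D.fatProj t) :=
  fatProj_eq (D.bracket_lin_lin _ _ _ _ (D.fatProj_spec s) (D.fatProj_spec t))

/-- Sections of `A` are locally projections of linear sections. -/
lemma tensorial_eq_zero_of_fatProj {T : D.bA.Sec → ℝ} {m : M}
    (hmul : ∀ (f : SmoothFun VM M) a, T (f • a) = f m * T a) (h : ∀ s, T (D.fatProj s) = 0)
    (a : D.bA.Sec) : T a = 0 := by
  obtain ⟨r, h1, h2⟩ := D.exists_linSec m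
  obtain ⟨s, hs⟩ := h2 a
  have e := hmul r a
  rw [h1.self_of_nhds, one_mul, ← fatProj_eq hs, h] at e
  exact e.symm

/-- A derivation of `W → E` that is compatible with the anchor is a derivation of the bracket if this
holds on linear sections and on core sections. -/
lemma bracket_of_generators (hC : D.overE.Corresponds X Δ)
    (hA : ∀ f, X.deriv (D.lieW.dualFun f) = D.lieW.dualFun (Δ.symbol.deriv f))
    (hll : ∀ s t : D.LinSec, D.lieW.defect Δ s.1 t.1 = 0)
    (hlc : ∀ (s : D.LinSec) χ, D.lieW.defect Δ s.1 (D.hat χ) = 0)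
    (hcc : ∀ χ χ', D.lieW.defect Δ (D.hat χ) (D.hat χ') = 0) (s t : D.overE.Sec) :
    Δ (D.lieW.bracket s t) = D.lieW.bracket (Δ s) t + D.lieW.bracket s (Δ t) := by
  have key : ∀ s, (∀ t : D.LinSec, D.lieW.defect Δ s t.1 = 0) →
      (∀ χ, D.lieW.defect Δ s (D.hat χ) = 0) → ∀ t, D.lieW.defect Δ s t = 0 := by
    intro s h1 h2 t
    refine VBundle.SecAlong.ext_fibreLinear fun φ hφ e => ?_
    rw [hφ.sec_zero]
    refine D.tensorial_eq_zero (e := e) (T := fun t => φ (D.lieW.defect Δ s t e)) (fun t t' => ?_)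
      (fun f t => ?_) (fun t => ?_) (fun χ => ?_) t
    · rw [LieAlgebroid.defect_add, hφ.sec_add]
    · rw [LieAlgebroid.defect_smul hC hA, hφ.sec_smul]
    · rw [h1, hφ.sec_zero]
    · rw [h2, hφ.sec_zero]
  have k1 : ∀ (s : D.LinSec) t, D.lieW.defect Δ t s.1 = 0 := fun s t => by
    rw [LieAlgebroid.defect_swap, key s.1 (hll s) (hlc s), neg_zero]
  have k2 : ∀ χ t, D.lieW.defect Δ t (D.hat χ) = 0 := fun χ t => by
    rw [LieAlgebroid.defect_swap, key (D.hat χ) (fun t => k1 t _) (hcc χ), neg_zero]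
  exact sub_eq_zero.1 (key s (fun t => k1 t s) (fun χ => k2 χ s) t)

namespace IsInfinitesimal

variable (I : D.IsInfinitesimal X Δ)
include I

/-- The flow of a vector field that satisfies the infinitesimal conditions preserves the structure. -/
theorem isInfAut : D.IsInfAut X := by
  have hs := symbol_isHomogeneous I.corr I.homA
  obtain ⟨ΔW, hW⟩ := I.homA.exists_der
  have hYh : D.bA.IsHomogeneous ΔW.symbol := fun r =>
    VBundle.related_base hW.2.1 (D.overE.contMDiff_smul r) (D.bA.contMDiff_smul r)
      (fun w => D.projA_smulE r w) (I.corr.isHomogeneous r)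
  obtain ⟨δ, hδ⟩ := hYh.exists_der
  set Y := δ.symbol with hYdef
  -- the projections of `X` to `M` through `E` and through `A` agree
  have hY : ∀ e, mfderiv 𝓘(ℝ, VE) 𝓘(ℝ, VM) D.bE.proj e (Δ.symbol e) = Y (D.bE.proj e) := by
    obtain ⟨Y', hY'⟩ := hs.exists_base
    have : Y' = Y := VField.ext_deriv fun f => ContMDiffMap.ext fun m => by
      have e1 : D.overE.pull (D.bE.pull f) = D.overA.pull (D.bA.pull f) :=
        ContMDiffMap.ext fun w => congrArg f (D.bA_projA w).symm
      have e2 := congrArg (fun g => X.deriv g (D.overE.zero (D.bE.zero m))) e1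
      rw [VBundle.deriv_pull I.corr.2.1, VBundle.deriv_pull hW.2.1, VBundle.deriv_pull hY',
        VBundle.deriv_pull hδ.2.1] at e2
      have e3 : Y'.deriv f (D.bE.proj (D.overE.proj (D.overE.zero (D.bE.zero m)))) =
        Y.deriv f (D.bA.proj (D.overA.proj (D.overE.zero (D.bE.zero m)))) := e2
      rwa [D.bA_projA, D.overE.proj_zero, D.bE.proj_zero] at e3
    rwa [this] at hY'
  let dA : D.LinSec → D.LinSec := fun s => ⟨Δ s.1, der_linSec I.corr I.homA s⟩
  have hπ : ∀ s, δ (D.fatProj s) = D.fatProj (dA s) := by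
    intro s
    refine VBundle.SecAlong.ext_fibreLinear fun a ha m => ?_
    have e1 := I.corr.2.2 s.1 _ (isFibreLinear_pullA ha) (D.bE.zero m)
    have e2 : D.overE.pairing (D.overA.pull a) s.1 = D.bE.pull (D.bA.pairing a (D.fatProj s)) :=
      ContMDiffMap.ext fun e => by
        rw [VBundle.pairing_apply, VBundle.pull_apply, projA_linSec]
        rfl
    have e3 : Δ s.1 (D.bE.zero m) = (dA s).1 (D.bE.zero m) := rfl
    rw [e2, VBundle.deriv_pull hY, VBundle.deriv_pull hW.2.1, VBundle.pull_apply, VBundle.pull_apply,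
      VBundle.pull_apply, projA_linSec, e3, projA_linSec, D.bE.proj_zero] at e1
    rw [e1, hδ.2.2 _ a ha]
  have hA : ∀ f, ΔW.symbol.deriv (D.lieA.dualFun f) = D.lieA.dualFun (Y.deriv f) := by
    intro f
    ext v
    obtain ⟨a, ha⟩ := D.bA.exists_sec_eq v
    have l1 := hδ.1 _ (D.lieA.dualFun_lin f)
    have l2 := D.lieA.dualFun_lin (Y.deriv f)
    have e1 := tensorial_eq_zero_of_fatProj (D := D) (m := D.bA.proj v)
      (T := fun a => ΔW.symbol.deriv (D.lieA.dualFun f) (a (D.bA.proj v)) -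
        D.lieA.dualFun (Y.deriv f) (a (D.bA.proj v)))
      (fun f a => by rw [l1.sec_smul, l2.sec_smul]; ring) (fun s => ?_) a
    · rw [ha] at e1
      exact sub_eq_zero.1 e1
    · rw [hδ.deriv_eq (D.lieA.dualFun_lin f), hπ]
      have e2 := I.fatAnchor_der hY (s := s) (s' := dA s) rfl f
      unfold fatAnchor at e2
      rw [D.lieA.field_deriv, D.lieA.field_deriv, D.lieA.field_deriv] at e2
      have e3 := congrArg (fun g : SmoothFun VM M => g (D.bA.proj v)) e2
      have e4 : D.lieA.dualFun f (D.fatProj (dA s) (D.bA.proj v)) =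
        Y.deriv (D.bA.pairing (D.lieA.dualFun f) (D.fatProj s)) (D.bA.proj v) -
          D.lieA.dualFun (Y.deriv f) (D.fatProj s (D.bA.proj v)) := e3
      rw [e4]
      ring
  have hdef : ∀ s t, D.lieA.defect δ (D.fatProj s) (D.fatProj t) = 0 := by
    intro s t
    have e1 : dA (D.fatBracket s t) = D.fatBracket (dA s) t + D.fatBracket s (dA t) :=
      Subtype.ext (I.bracket s.1 t.1)
    unfold LieAlgebroid.defect
    rw [← fatProj_bracket, hπ, hπ, hπ, ← fatProj_bracket, ← fatProj_bracket, e1, fatProj_add, sub_self]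
  have hdef' : ∀ a b, D.lieA.defect δ a b = 0 := by
    have key : ∀ a, (∀ s, D.lieA.defect δ a (D.fatProj s) = 0) → ∀ b, D.lieA.defect δ a b = 0 := by
      intro a h b
      refine VBundle.SecAlong.ext_fibreLinear fun φ hφ m => ?_
      rw [hφ.sec_zero]
      exact tensorial_eq_zero_of_fatProj (D := D) (m := m)
        (T := fun b => φ (D.lieA.defect δ a b m))
        (fun f b => by rw [LieAlgebroid.defect_smul hδ hA, hφ.sec_smul])
        (fun s => by rw [h, hφ.sec_zero]) b
    intro a b
    refine key a (fun s => ?_) b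
    rw [LieAlgebroid.defect_swap, key _ (hdef s), neg_zero]
  intro t
  have hsetE : {e | Δ.symbol.Defined t e} = D.bE.proj ⁻¹' {m | Y.Defined t m} :=
    Set.ext fun e => hs.defined_iff hY
  have hsetA : {a | ΔW.symbol.Defined t a} = D.bA.proj ⁻¹' {m | Y.Defined t m} :=
    Set.ext fun a => hYh.defined_iff hδ.2.1
  have hdom : ∀ w, X.Defined t w ↔ Y.Defined t (D.base w) := fun w =>
    I.corr.defined_iff.trans (hs.defined_iff hY)
  refine ⟨{m | Y.Defined t m}, X.flow t, Δ.symbol.flow t, ΔW.symbol.flow t, Y.flow t,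
    Y.isOpen_defined t, hdom, fun w hw => ((hdom w).2 hw).flowsTo, ?_, ?_, ?_, ?_⟩
  · rw [← hsetE]
    exact D.lieW.isMorphismOn_flow I.corr I.anchor I.bracket t
  · exact D.lieA.isMorphismOn_flow hδ hA (fun a b => sub_eq_zero.1 (hdef' a b)) t
  · rw [← hsetA]
    exact I.homA.isMorphismOn_flow hW.2.1 t
  · exact hs.isMorphismOn_flow hY t

end IsInfinitesimal

end VBAlgebroid

/-! ### Reconstruction of a linear vector field from its action on generators -/

/-- A vector field on a vector bundle is the commutator of two others if it acts as such on pulled back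
and on fibrewise linear functions. -/
lemma VBundle.commutator_ext {VV : Type*} [NormedAddCommGroup VV] [NormedSpace ℝ VV]
    {V : Type*} [TopologicalSpace V] [ChartedSpace VV V] [IsManifold 𝓘(ℝ, VV) ∞ V]
    {VN : Type*} [NormedAddCommGroup VN] [NormedSpace ℝ VN]
    {N : Type*} [TopologicalSpace N] [ChartedSpace VN N] [IsManifold 𝓘(ℝ, VN) ∞ N]
    [FiniteDimensional ℝ VV] [T2Space V] [FiniteDimensional ℝ VN] [T2Space N]
    (B : VBundle VV V VN N) {X Y Z : VField VV V}
    (hp : ∀ g, Z.deriv (B.pull g) = X.deriv (Y.deriv (B.pull g)) - Y.deriv (X.deriv (B.pull g)))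
    (hl : ∀ φ, B.IsFibreLinear φ → Z.deriv φ = X.deriv (Y.deriv φ) - Y.deriv (X.deriv φ))
    (f : SmoothFun VV V) : Z.deriv f = X.deriv (Y.deriv f) - Y.deriv (X.deriv f) := by
  ext v
  obtain ⟨u, hu⟩ := X.exists_commutator Y v
  have e : Z v = u := by
    refine B.tangent_ext (_root_.tangent_ext fun g => ?_) fun φ hφ => ?_
    · rw [← dirDeriv_comp (g.mdifferentiableAt _) (B.mdifferentiableAt_proj v),
        ← dirDeriv_comp (g.mdifferentiableAt _) (B.mdifferentiableAt_proj v)]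
      exact (congrArg (fun k : SmoothFun VV V => k v) (hp g)).trans (hu (B.pull g)).symm
    · exact (congrArg (fun k : SmoothFun VV V => k v) (hl φ hφ)).trans (hu φ).symm
  rw [VField.deriv_apply, e, hu]
  rfl

namespace VBAlgebroid

variable {VW : Type*} [NormedAddCommGroup VW] [NormedSpace ℝ VW] [FiniteDimensional ℝ VW]
  {W : Type*} [TopologicalSpace W] [ChartedSpace VW W] [IsManifold 𝓘(ℝ, VW) ∞ W] [T2Space W]
  {VE : Type*} [NormedAddCommGroup VE] [NormedSpace ℝ VE] [FiniteDimensional ℝ VE]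
  {E : Type*} [TopologicalSpace E] [ChartedSpace VE E] [IsManifold 𝓘(ℝ, VE) ∞ E] [T2Space E]
  {VA : Type*} [NormedAddCommGroup VA] [NormedSpace ℝ VA] [FiniteDimensional ℝ VA]
  {A : Type*} [TopologicalSpace A] [ChartedSpace VA A] [IsManifold 𝓘(ℝ, VA) ∞ A] [T2Space A]
  {VM : Type*} [NormedAddCommGroup VM] [NormedSpace ℝ VM] [FiniteDimensional ℝ VM]
  {M : Type*} [TopologicalSpace M] [ChartedSpace VM M] [IsManifold 𝓘(ℝ, VM) ∞ M] [T2Space M]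
  {D : VBAlgebroid VW W VE E VA A VM M}

open DoubleVB

/-- The linear section `l χ̂` for a fibrewise linear function `l` on `E`. -/
lemma exists_smul_hat {l : SmoothFun VE E} (hl : D.bE.IsFibreLinear l) (χ : D.CoreSec) :
    ∃ Φ : D.HomEC, Φ.toLin.1 = l • D.hat χ ∧ ∀ ε, Φ.apply ε = D.bE.pairing l ε • χ := by
  have hs : l • D.hat χ ∈ D.LinSec := isLinearOver_of_homogeneous fun r e => by
    show D.overE.smul (l _) (D.hat χ _) = D.overA.smul r (D.overE.smul (l e) (D.hat χ e))
    rw [← D.smul_comm, ← smul_hat, hl.2, D.overE.smul_smul', mul_comm]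
  obtain ⟨Φ, hΦ⟩ := exists_homEC (s := ⟨_, hs⟩) fun e => by
    show D.overA.proj (D.overE.smul (l e) (D.hat χ e)) = _
    rw [D.projA_smulE, projA_hat, D.bA.smul_zero']
  have hΦ' : Φ.toLin.1 = l • D.hat χ := congrArg Subtype.val hΦ
  refine ⟨Φ, hΦ', fun ε => coreSec_ext fun β hE hA m => ?_⟩
  have e1 : β (Φ.toLin.1 (ε m)) = β (Φ.toFun (ε m)) := doublyLinear_shift hE hA (Φ.isCore _)
  rw [hΦ', hE.sec_smul, doublyLinear_hat hE hA, ε.proj_eq] at e1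
  exact e1.symm.trans (hE.sec_smul (D.bE.pairing l ε) χ.1 m).symm

namespace Triple

variable (T : D.Triple) {XE : VField VE E}

/-- The action of `δ_Â` on the linear section `l χ̂`. -/
lemma dA_smul_hat (hE : D.bE.Corresponds XE T.dE) {l : SmoothFun VE E} (hl : D.bE.IsFibreLinear l)
    (χ : D.CoreSec) {Φ : D.HomEC} (h : ∀ ε, Φ.apply ε = D.bE.pairing l ε • χ) :
    (T.dA Φ.toLin).1 = XE.deriv l • D.hat χ + l • D.hat (T.dC χ) := by
  obtain ⟨Ψ, h1, h2⟩ := T.hom Φ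
  rw [h1]
  refine VBundle.SecAlong.ext fun e => ?_
  obtain ⟨ε, hε⟩ := D.bE.exists_sec_eq e
  have e1 : Ψ.toLin.1 e = D.hat (Ψ.apply ε) e := by
    show D.overA.add (D.overE.zero e) (Ψ.toFun e) =
      D.overA.add (D.overE.zero e) (Ψ.toFun (ε (D.bE.proj e)))
    rw [hε]
  have e2 := hE.2.2 ε l hl (D.bE.proj e)
  rw [hε] at e2
  rw [e1, h2, h, h, T.dC.leibniz, ← T.symbol_C, hat_sub, hat_add, hat_smul, hat_smul, hat_smul]
  refine D.overE.ext_fibreLinear (by rw [VBundle.SecAlong.proj_eq, VBundle.SecAlong.proj_eq])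
    fun φ hφ => ?_
  have e3 : D.pullE (D.bE.pairing l ε) e = l e := congrArg l hε
  have e4 : D.pullE (D.bE.pairing l (T.dE ε)) e =
    T.dE.symbol.deriv (D.bE.pairing l ε) (D.bE.proj e) - XE.deriv l e := e2
  have e5 : D.pullE (T.dE.symbol.deriv (D.bE.pairing l ε)) e =
    T.dE.symbol.deriv (D.bE.pairing l ε) (D.bE.proj e) := rfl
  rw [hφ.sec_sub, hφ.sec_add, hφ.sec_add, hφ.sec_smul, hφ.sec_smul, hφ.sec_smul, hφ.sec_smul,
    hφ.sec_smul, e3, e4, e5]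
  ring

/-- The derivation of `W → E` reconstructed over an open set of `M` by means of local generators. -/
lemma exists_local_der (hE : D.bE.Corresponds XE T.dE) (m₀ : M) :
    ∃ (ρ : SmoothFun VM M) (L : D.overE.Sec → D.overE.Sec), (∀ᶠ m in 𝓝 m₀, ρ m = 1) ∧
      (∀ t t', L (t + t') = L t + L t') ∧
      (∀ f t, L (f • t) = (XE.deriv f * D.pullE ρ) • t + f • L t) ∧
      (∀ s : D.LinSec, L s.1 = (T.dA (ρ • s)).1) ∧ ∀ χ, L (D.hat χ) = D.hat (T.dC (ρ • χ)) := by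
  have hY := hE.2.1
  obtain ⟨n, k, ρ, a, s, β, χ, h0, ha, hβE, hβA, h⟩ := D.exists_generators m₀
  have hpa : ∀ i, D.overE.IsFibreLinear (D.overA.pull (a i)) := fun i => isFibreLinear_pullA (ha i)
  let L : D.overE.Sec → D.overE.Sec := fun t =>
    ∑ i, (XE.deriv (D.overE.pairing (D.overA.pull (a i)) t) • (s i).1 +
      D.overE.pairing (D.overA.pull (a i)) t • (T.dA (s i)).1) +
    ∑ j, (XE.deriv (D.overE.pairing (β j) t) • D.hat (χ j) +
      D.overE.pairing (β j) t • D.hat (T.dC (χ j)))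
  refine ⟨ρ, L, h0, fun t t' => ?_, fun f t => ?_, fun u => ?_, fun η => ?_⟩
  · simp only [L, (hpa _).pairing_add, (hβE _).pairing_add, VField.deriv_add, add_smul,
      Finset.sum_add_distrib]
    abel
  · have e1 := congrArg (fun x => XE.deriv f • x) (h t)
    simp only [smul_add, Finset.smul_sum, smul_smul] at e1
    simp only [L, (hpa _).pairing_smul, (hβE _).pairing_smul, VField.deriv_mul, add_smul, smul_add,
      Finset.smul_sum, Finset.sum_add_distrib, smul_smul]
    rw [← e1]
    abel
  · -- the expansion of `ρ u` in the module of linear sections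
    choose Φ hΦ hΦa using fun j => exists_smul_hat (D := D) (l := D.overE.pairing (β j) u.1)
      (D.bE.isFibreLinear_of_homogeneous fun r e => by
        rw [VBundle.pairing_apply, VBundle.pairing_apply, linSec_smul, (hβA j).2]) (χ j)
    have e1 : ∀ i, D.overE.pairing (D.overA.pull (a i)) u.1 =
        D.pullE (D.bA.pairing (a i) (D.fatProj u)) := fun i => ContMDiffMap.ext fun e => by
      rw [VBundle.pairing_apply, VBundle.pull_apply, projA_linSec]
      rfl
    have e2 : ρ • u = ∑ i, D.bA.pairing (a i) (D.fatProj u) • s i + ∑ j, (Φ j).toLin := by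
      refine Subtype.ext ((h u.1).symm.trans ?_)
      rw [AddSubgroup.coe_add, AddSubgroup.val_finsetSum, AddSubgroup.val_finsetSum]
      congr 1
      · exact Finset.sum_congr rfl fun i _ => by rw [e1]; rfl
      · exact Finset.sum_congr rfl fun j _ => (hΦ j).symm
    rw [e2, T.dA.map_add, T.dA.map_sum, T.dA.map_sum, AddSubgroup.coe_add, AddSubgroup.val_finsetSum,
      AddSubgroup.val_finsetSum]
    show _ + _ = _
    congr 1
    · refine Finset.sum_congr rfl fun i _ => ?_
      have e3 : XE.deriv (D.pullE (D.bA.pairing (a i) (D.fatProj u))) =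
          D.pullE (T.dE.symbol.deriv (D.bA.pairing (a i) (D.fatProj u))) := VBundle.deriv_pull hY _
      rw [T.dA.leibniz, T.symbol_E, e1, e3]
      rfl
    · refine Finset.sum_congr rfl fun j _ => ?_
      exact (T.dA_smul_hat hE (D.bE.isFibreLinear_of_homogeneous fun r e => by
        rw [VBundle.pairing_apply, VBundle.pairing_apply, linSec_smul, (hβA j).2]) (χ j)
        (hΦa j)).symm
  · let g : Fin k → SmoothFun VM M := fun j =>
      ⟨fun m => β j (η.1 m), (β j).contMDiff.comp η.1.contMDiff⟩
    have e1 : ∀ i, D.overE.pairing (D.overA.pull (a i)) (D.hat η) = 0 := fun i =>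
      ContMDiffMap.ext fun e => by
        rw [VBundle.pairing_apply, VBundle.pull_apply, projA_hat, (ha i).apply_zero]
        rfl
    have e2 : ∀ j, D.overE.pairing (β j) (D.hat η) = D.pullE (g j) := fun j =>
      ContMDiffMap.ext fun e => doublyLinear_hat (hβE j) (hβA j) η e
    have e3 : ρ • η = ∑ j, g j • χ j := hat_injective (by
      rw [hat_smul, ← h, hat_sum]
      simp only [e1, e2, zero_smul, Finset.sum_const_zero, zero_add, hat_smul])
    have e4 : ∀ j, XE.deriv (D.pullE (g j)) = D.pullE (T.dE.symbol.deriv (g j)) := fun j =>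
      VBundle.deriv_pull hY _
    rw [e3, T.dC.map_sum, hat_sum]
    simp only [L, e1, e2, e4, VField.deriv_zero, zero_smul, add_zero, Finset.sum_const_zero, zero_add,
      T.dC.leibniz, ← T.symbol_C, hat_add, hat_smul]

/-- The derivation of `W → E` with given action on linear sections and on core sections. -/
lemma exists_der (hE : D.bE.Corresponds XE T.dE) : ∃ Δ : Der VE E D.overE.Sec, Δ.symbol = XE ∧
    (∀ s : D.LinSec, Δ s.1 = (T.dA s).1) ∧ ∀ χ, Δ (D.hat χ) = D.hat (T.dC χ) := by
  choose ρ L h0 hadd hmul hlin hcore using T.exists_local_der hE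
  -- locality of the action on generators
  have hl : ∀ {m₀ e}, (∀ᶠ m in 𝓝 (D.bE.proj e), ρ m₀ m = 1) → ∀ φ, D.overE.IsFibreLinear φ →
      ∀ s : D.LinSec, φ (L m₀ s.1 e) = φ ((T.dA s).1 e) := by
    intro m₀ e he φ hφ s
    have e1 : T.dA.symbol.deriv (ρ m₀) (D.bE.proj e) = 0 := by
      rw [VField.deriv_congr (g := algebraMap ℝ (SmoothFun VM M) 1) _ he, VField.deriv_const]
      rfl
    have e2 : (T.dA (ρ m₀ • s)).1 =
        D.pullE (T.dA.symbol.deriv (ρ m₀)) • s.1 + D.pullE (ρ m₀) • (T.dA s).1 :=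
      congrArg Subtype.val (T.dA.leibniz (ρ m₀) s)
    rw [hlin, e2, hφ.sec_add, hφ.sec_smul, hφ.sec_smul]
    show T.dA.symbol.deriv (ρ m₀) (D.bE.proj e) * _ + ρ m₀ (D.bE.proj e) * _ = _
    rw [e1, he.self_of_nhds, zero_mul, zero_add, one_mul]
  have hc : ∀ {m₀ e}, (∀ᶠ m in 𝓝 (D.bE.proj e), ρ m₀ m = 1) → ∀ φ, D.overE.IsFibreLinear φ →
      ∀ χ, φ (L m₀ (D.hat χ) e) = φ (D.hat (T.dC χ) e) := by
    intro m₀ e he φ hφ χ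
    have e1 : T.dC.symbol.deriv (ρ m₀) (D.bE.proj e) = 0 := by
      rw [VField.deriv_congr (g := algebraMap ℝ (SmoothFun VM M) 1) _ he, VField.deriv_const]
      rfl
    rw [hcore, T.dC.leibniz, hat_add, hat_smul, hat_smul, hφ.sec_add, hφ.sec_smul, hφ.sec_smul]
    show T.dC.symbol.deriv (ρ m₀) (D.bE.proj e) * _ + ρ m₀ (D.bE.proj e) * _ = _
    rw [e1, he.self_of_nhds, zero_mul, zero_add, one_mul]
  have hm : ∀ {m₀ e}, (∀ᶠ m in 𝓝 (D.bE.proj e), ρ m₀ m = 1) → ∀ φ, D.overE.IsFibreLinear φ →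
      ∀ f t, φ (L m₀ (f • t) e) = XE.deriv f e * φ (t e) + f e * φ (L m₀ t e) := by
    intro m₀ e he φ hφ f t
    rw [hmul, hφ.sec_add, hφ.sec_smul, hφ.sec_smul]
    show XE.deriv f e * ρ m₀ (D.bE.proj e) * _ + _ = _
    rw [he.self_of_nhds, mul_one]
  have huniq : ∀ {m₀ m₁ e}, (∀ᶠ m in 𝓝 (D.bE.proj e), ρ m₀ m = 1) →
      (∀ᶠ m in 𝓝 (D.bE.proj e), ρ m₁ m = 1) → ∀ t, L m₀ t e = L m₁ t e := by
    intro m₀ m₁ e he he' t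
    refine D.overE.ext_fibreLinear (by rw [VBundle.SecAlong.proj_eq, VBundle.SecAlong.proj_eq])
      fun φ hφ => sub_eq_zero.1 ?_
    exact D.tensorial_eq_zero (e := e) (T := fun t => φ (L m₀ t e) - φ (L m₁ t e))
      (fun t t' => by rw [hadd, hadd, hφ.sec_add, hφ.sec_add]; ring)
      (fun f t => by rw [hm he φ hφ, hm he' φ hφ]; ring)
      (fun s => by rw [hl he φ hφ, hl he' φ hφ, sub_self])
      (fun χ => by rw [hc he φ hφ, hc he' φ hφ, sub_self]) t
  let G : D.overE.Sec → D.overE.Sec := fun t =>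
    ⟨fun e => L (D.bE.proj e) t e, fun e₀ => by
      refine ((L (D.bE.proj e₀) t).contMDiff e₀).congr_of_eventuallyEq ?_
      filter_upwards [D.bE.contMDiff_proj.continuous.continuousAt.eventually
        (h0 (D.bE.proj e₀)).eventually_nhds] with e he
      exact huniq (h0 _) he t, fun e => (L (D.bE.proj e) t).proj_apply e⟩
  have hG : ∀ t e, G t e = L (D.bE.proj e) t e := fun _ _ => rfl
  have hleib : ∀ f t, G (f • t) = XE.deriv f • t + f • G t := fun f t =>
    VBundle.SecAlong.ext_fibreLinear fun φ hφ e => by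
      rw [hG, hm (h0 _) φ hφ, hφ.sec_add, hφ.sec_smul, hφ.sec_smul, hG]
  refine ⟨⟨G, XE, fun t t' => VBundle.SecAlong.ext_fibreLinear fun φ hφ e => ?_, fun r t => ?_, hleib⟩,
    rfl, fun s => VBundle.SecAlong.ext_fibreLinear fun φ hφ e => hl (h0 _) φ hφ s,
    fun χ => VBundle.SecAlong.ext_fibreLinear fun φ hφ e => hc (h0 _) φ hφ χ⟩
  · rw [hG, hadd, hφ.sec_add, hφ.sec_add, hG, hG]
  · rw [hleib, VField.deriv_const, zero_smul, zero_add]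

end Triple

end VBAlgebroid

namespace VBAlgebroid

variable {VW : Type*} [NormedAddCommGroup VW] [NormedSpace ℝ VW] [FiniteDimensional ℝ VW]
  {W : Type*} [TopologicalSpace W] [ChartedSpace VW W] [IsManifold 𝓘(ℝ, VW) ∞ W] [T2Space W]
  {VE : Type*} [NormedAddCommGroup VE] [NormedSpace ℝ VE] [FiniteDimensional ℝ VE]
  {E : Type*} [TopologicalSpace E] [ChartedSpace VE E] [IsManifold 𝓘(ℝ, VE) ∞ E] [T2Space E]
  {VA : Type*} [NormedAddCommGroup VA] [NormedSpace ℝ VA] [FiniteDimensional ℝ VA]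
  {A : Type*} [TopologicalSpace A] [ChartedSpace VA A] [IsManifold 𝓘(ℝ, VA) ∞ A] [T2Space A]
  {VM : Type*} [NormedAddCommGroup VM] [NormedSpace ℝ VM] [FiniteDimensional ℝ VM]
  {M : Type*} [TopologicalSpace M] [ChartedSpace VM M] [IsManifold 𝓘(ℝ, VM) ∞ M] [T2Space M]
  {D : VBAlgebroid VW W VE E VA A VM M}

open DoubleVB

/-! #### The fat algebroid -/

lemma fatAnchor_add (s t : D.LinSec) (f : SmoothFun VM M) :
    (D.fatAnchor (s + t)).deriv f = (D.fatAnchor s).deriv f + (D.fatAnchor t).deriv f := by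
  unfold fatAnchor
  rw [D.lieA.field_deriv, D.lieA.field_deriv, D.lieA.field_deriv, fatProj_add,
    (D.lieA.dualFun_lin f).pairing_add]

lemma fatAnchor_smul (g : SmoothFun VM M) (s : D.LinSec) (f : SmoothFun VM M) :
    (D.fatAnchor (g • s)).deriv f = g * (D.fatAnchor s).deriv f := by
  unfold fatAnchor
  rw [D.lieA.field_deriv, D.lieA.field_deriv, fatProj_smul, (D.lieA.dualFun_lin f).pairing_smul]

lemma fatBracket_add (s t t' : D.LinSec) :
    D.fatBracket s (t + t') = D.fatBracket s t + D.fatBracket s t' :=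
  Subtype.ext (D.lieW.bracket_add_right s.1 t.1 t'.1)

lemma fatBracket_smul (s : D.LinSec) (g : SmoothFun VM M) (t : D.LinSec) :
    D.fatBracket s (g • t) = (D.fatAnchor s).deriv g • t + g • D.fatBracket s t :=
  Subtype.ext ((D.lieW.leibniz s.1 (D.pullE g) t.1).trans (by
    have e : (D.lieW.field s.1).deriv (D.pullE g) = D.pullE ((D.fatAnchor s).deriv g) :=
      field_deriv_pull s g
    rw [e]
    rfl))

namespace Triple

variable (T : D.Triple) {XE : VField VE E}

/-- The anchor of the fat algebroid intertwines `δ_Â` with the commutator with its symbol. -/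
lemma fatAnchor_der (s : D.LinSec) (f : SmoothFun VM M) : (D.fatAnchor (T.dA s)).deriv f =
    T.dA.symbol.deriv ((D.fatAnchor s).deriv f) - (D.fatAnchor s).deriv (T.dA.symbol.deriv f) := by
  set Y := T.dA.symbol
  let P : D.LinSec → SmoothFun VM M := fun s => (D.fatAnchor (T.dA s)).deriv f -
    (Y.deriv ((D.fatAnchor s).deriv f) - (D.fatAnchor s).deriv (Y.deriv f))
  -- the Leibniz rule for `[s, f t]`
  have h1 : ∀ s t : D.LinSec, P s • t = 0 := by
    intro s t
    have e := T.bracket s (f • t)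
    rw [fatBracket_smul, T.dA.map_add, T.dA.leibniz, T.dA.leibniz, T.dA.leibniz, fatBracket_add,
      fatBracket_smul, fatBracket_smul, fatBracket_smul, T.bracket, smul_add] at e
    simp only [P, sub_smul]
    rw [← sub_eq_zero] at e
    rw [← neg_eq_zero, ← e]
    abel
  have h2 : ∀ g s, P (g • s) = g * P s := by
    intro g s
    simp only [P]
    rw [T.dA.leibniz, fatAnchor_add, fatAnchor_smul, fatAnchor_smul, fatAnchor_smul, fatAnchor_smul,
      VField.deriv_mul]
    ring
  -- `P` is linear over functions, hence `0 = P (P s • s) = (P s)²`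
  have h3 : P s * P s = 0 := by
    rw [← h2, h1, ← zero_smul (SmoothFun VM M) (0 : D.LinSec), h2, zero_mul]
  refine sub_eq_zero.1 (ContMDiffMap.ext fun m => ?_)
  exact mul_self_eq_zero.1 (congrArg (fun g : SmoothFun VM M => g m) h3)

variable {X : VField VW W} {Δ : Der VE E D.overE.Sec}

/-- The linear vector field on `W` reconstructed from a triple preserves the structure. -/
lemma isInfinitesimal (hX : D.overE.Corresponds X Δ) (hE : D.bE.Corresponds Δ.symbol T.dE)
    (hl : ∀ s : D.LinSec, Δ s.1 = (T.dA s).1) (hc : ∀ χ, Δ (D.hat χ) = D.hat (T.dC χ)) :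
    D.IsInfinitesimal X Δ := by
  have hY := hE.2.1
  have hpair : ∀ {φ : SmoothFun VE E}, D.bE.IsFibreLinear φ → ∀ ε, D.bE.pairing φ (T.dE ε) =
      T.dE.symbol.deriv (D.bE.pairing φ ε) - D.bE.pairing (Δ.symbol.deriv φ) ε :=
    fun {φ} hφ ε => ContMDiffMap.ext fun m => hE.2.2 ε φ hφ m
  have hlin : ∀ (s : D.LinSec) f, (D.lieW.field (Δ s.1)).deriv f =
      Δ.symbol.deriv ((D.lieW.field s.1).deriv f) - (D.lieW.field s.1).deriv (Δ.symbol.deriv f) := by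
    intro s
    refine D.bE.commutator_ext (fun g => ?_) fun φ hφ => ?_
    · rw [hl, field_deriv_pull, field_deriv_pull, VBundle.deriv_pull hY, VBundle.deriv_pull hY,
        field_deriv_pull, T.fatAnchor_der, T.symbol_E]
      rfl
    · have hZ := field_deriv_lin s hφ
      ext e
      obtain ⟨ε, hε⟩ := D.bE.exists_sec_eq e
      have e1 : D.bE.pairing φ (T.dE (D.sideRep s ε)) - D.bE.pairing φ (D.sideRep s (T.dE ε)) =
          D.bE.pairing φ (D.sideRep (T.dA s) ε) := by
        rw [← T.side]
        exact ContMDiffMap.ext fun m => (hφ.sec_sub _ _ m).symm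
      rw [hpair hφ, pairing_sideRep s ε hφ, pairing_sideRep s ε (hE.1 φ hφ), pairing_sideRep s _ hφ,
        pairing_sideRep _ ε hφ, hpair hφ, hpair hZ, T.fatAnchor_der, T.symbol_E, VField.deriv_sub,
        VField.deriv_sub] at e1
      have e2 : D.bE.pairing ((D.lieW.field (T.dA s).1).deriv φ) ε =
          D.bE.pairing (Δ.symbol.deriv ((D.lieW.field s.1).deriv φ)) ε -
            D.bE.pairing ((D.lieW.field s.1).deriv (Δ.symbol.deriv φ)) ε := by
        linear_combination e1
      have e3 := congrArg (fun g : SmoothFun VM M => g (D.bE.proj e)) e2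
      have e4 : (D.lieW.field (T.dA s).1).deriv φ (ε (D.bE.proj e)) =
        Δ.symbol.deriv ((D.lieW.field s.1).deriv φ) (ε (D.bE.proj e)) -
          (D.lieW.field s.1).deriv (Δ.symbol.deriv φ) (ε (D.bE.proj e)) := e3
      rw [hε] at e4
      rw [hl, e4]
      rfl
  have hcore : ∀ χ f, (D.lieW.field (Δ (D.hat χ))).deriv f =
      Δ.symbol.deriv ((D.lieW.field (D.hat χ)).deriv f) -
        (D.lieW.field (D.hat χ)).deriv (Δ.symbol.deriv f) := by
    intro χ
    refine D.bE.commutator_ext (fun g => ?_) fun φ hφ => ?_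
    · rw [hc, field_hat_deriv_pull, field_hat_deriv_pull, VBundle.deriv_pull hY, field_hat_deriv_pull,
        VField.deriv_zero, sub_zero]
    · rw [hc, coreAnchor_spec _ hφ, coreAnchor_spec _ hφ, coreAnchor_spec _ (hE.1 φ hφ),
        VBundle.deriv_pull hY, T.core_anchor, hpair hφ]
      rfl
  have hA : ∀ f, X.deriv (D.lieW.dualFun f) = D.lieW.dualFun (Δ.symbol.deriv f) := by
    intro f
    have key : ∀ t : D.overE.Sec, (D.lieW.field (Δ t)).deriv f =
        Δ.symbol.deriv ((D.lieW.field t).deriv f) - (D.lieW.field t).deriv (Δ.symbol.deriv f) →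
        ∀ e, X.deriv (D.lieW.dualFun f) (t e) = D.lieW.dualFun (Δ.symbol.deriv f) (t e) := by
      intro t h e
      have e1 := congrArg (fun g : SmoothFun VE E => g e) h
      rw [D.lieW.field_deriv, D.lieW.field_deriv, D.lieW.field_deriv] at e1
      have e2 : D.lieW.dualFun f (Δ t e) = Δ.symbol.deriv (D.overE.pairing (D.lieW.dualFun f) t) e -
        D.lieW.dualFun (Δ.symbol.deriv f) (t e) := e1
      rw [hX.deriv_eq (D.lieW.dualFun_lin f), e2]
      ring
    exact ext_generators (hX.1 _ (D.lieW.dualFun_lin f)) (D.lieW.dualFun_lin _)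
      (fun s => key s.1 (hlin s f)) fun χ => key _ (hcore χ f)
  refine ⟨hX, isHomogeneous_of_der hX hE.isHomogeneous (fun s => hl s ▸ (T.dA s).2)
    fun χ => ⟨_, (hc χ).symm⟩, hA, bracket_of_generators hX hA (fun s t => ?_) (fun s χ => ?_)
    fun χ χ' => ?_⟩
  · have e := congrArg Subtype.val (T.bracket s t)
    rw [← hl] at e
    unfold LieAlgebroid.defect
    rw [hl s, hl t]
    exact sub_eq_zero.2 e
  · unfold LieAlgebroid.defect
    rw [hl, hc, ← hat_coreRep, ← hat_coreRep, ← hat_coreRep, hc, ← T.core, hat_sub]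
    abel
  · unfold LieAlgebroid.defect
    rw [hc, hc, D.bracket_core_core, D.bracket_core_core, D.bracket_core_core, add_zero, sub_zero,
      Δ.map_zero]

end Triple

end VBAlgebroid

namespace VBAlgebroid

variable {VW : Type*} [NormedAddCommGroup VW] [NormedSpace ℝ VW] [FiniteDimensional ℝ VW]
  {W : Type*} [TopologicalSpace W] [ChartedSpace VW W] [IsManifold 𝓘(ℝ, VW) ∞ W] [T2Space W]
  {VE : Type*} [NormedAddCommGroup VE] [NormedSpace ℝ VE] [FiniteDimensional ℝ VE]
  {E : Type*} [TopologicalSpace E] [ChartedSpace VE E] [IsManifold 𝓘(ℝ, VE) ∞ E] [T2Space E]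
  {VA : Type*} [NormedAddCommGroup VA] [NormedSpace ℝ VA] [FiniteDimensional ℝ VA]
  {A : Type*} [TopologicalSpace A] [ChartedSpace VA A] [IsManifold 𝓘(ℝ, VA) ∞ A] [T2Space A]
  {VM : Type*} [NormedAddCommGroup VM] [NormedSpace ℝ VM] [FiniteDimensional ℝ VM]
  {M : Type*} [TopologicalSpace M] [ChartedSpace VM M] [IsManifold 𝓘(ℝ, VM) ∞ M] [T2Space M]
  {D : VBAlgebroid VW W VE E VA A VM M}

open DoubleVB

/-! ### The correspondences -/

/-- A triple is induced by at most one vector field: a derivation of `W → E` is determined by its symbol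
and its action on linear sections and on core sections. -/
lemma IsTripleOf.field_unique {X X' : VField VW W} {T : D.Triple} (h : D.IsTripleOf X T)
    (h' : D.IsTripleOf X' T) : X = X' := by
  obtain ⟨Δ, hX, hl, hE, hc⟩ := h
  obtain ⟨Δ', hX', hl', hE', hc'⟩ := h'
  have hs : Δ.symbol = Δ'.symbol := hE.field_unique hE'
  have hΔ : Δ = Δ' := by
    refine Der.ext' (fun t => VBundle.SecAlong.ext_fibreLinear fun φ hφ e => sub_eq_zero.1 ?_) hs
    exact D.tensorial_eq_zero (e := e) (T := fun t => φ (Δ t e) - φ (Δ' t e))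
      (fun t t' => by rw [Δ.map_add, Δ'.map_add, hφ.sec_add, hφ.sec_add]; ring)
      (fun f t => by
        rw [Δ.leibniz, Δ'.leibniz, hs, hφ.sec_add, hφ.sec_add, hφ.sec_smul, hφ.sec_smul, hφ.sec_smul]
        ring)
      (fun s => by rw [hl, hl', sub_self]) (fun χ => by rw [hc, hc', sub_self]) t
  subst hΔ
  exact hX.field_unique hX'

/-- A vector field induces at most one triple. -/
lemma IsTripleOf.unique {X : VField VW W} {T T' : D.Triple} (h : D.IsTripleOf X T)
    (h' : D.IsTripleOf X T') : T = T' := by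
  obtain ⟨Δ, hX, hl, hE, hc⟩ := h
  obtain ⟨Δ', hX', hl', hE', hc'⟩ := h'
  obtain rfl := hX.der_unique hX'
  have eE : T.dE = T'.dE := hE.der_unique hE'
  have eA : T.dA = T'.dA := Der.ext' (fun s => Subtype.ext ((hl s).symm.trans (hl' s)))
    (by rw [T.symbol_E, T'.symbol_E, eE])
  have eC : T.dC = T'.dC := Der.ext' (fun χ => hat_injective ((hc χ).symm.trans (hc' χ)))
    (by rw [← T.symbol_C, ← T'.symbol_C, eE])
  cases T; cases T'
  congr

/-- Every triple is induced by an infinitesimal automorphism. -/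
lemma Triple.exists_isInfAut (T : D.Triple) : ∃ X, D.IsInfAut X ∧ D.IsTripleOf X T := by
  obtain ⟨XE, hE⟩ := D.bE.exists_corresponds T.dE
  obtain ⟨Δ, rfl, hl, hc⟩ := T.exists_der hE
  obtain ⟨X, hX⟩ := D.overE.exists_corresponds Δ
  exact ⟨X, (T.isInfinitesimal hX hE hl hc).isInfAut, Δ, hX, hl, hE, hc⟩

/-- Infinitesimal automorphisms correspond to IM derivations. -/
lemma exists_equiv_IMDer (D : VBAlgebroid VW W VE E VA A VM M) :
    ∃ Φ : D.InfAut ≃ D.IMDer, ∀ X, D.overA.Corresponds X.1 (Φ X).1 := by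
  have h : ∀ X : D.InfAut, ∃ Δ : D.IMDer, D.overA.Corresponds X.1 Δ.1 := fun X => by
    obtain ⟨_, I⟩ := X.2.exists_isInfinitesimal
    obtain ⟨Δ, hΔ⟩ := I.homA.exists_der
    exact ⟨⟨Δ, X.1, hΔ, X.2⟩, hΔ⟩
  choose F hF using h
  refine ⟨Equiv.ofBijective F ⟨fun X X' e => Subtype.ext ?_, fun Δ => ?_⟩, hF⟩
  · exact (hF X).field_unique (e ▸ hF X')
  · obtain ⟨X, hX, hX'⟩ := Δ.2
    exact ⟨⟨X, hX'⟩, Subtype.ext ((hF ⟨X, hX'⟩).der_unique hX)⟩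

/-- Infinitesimal automorphisms correspond to triples. -/
lemma exists_equiv_triple (D : VBAlgebroid VW W VE E VA A VM M) :
    ∃ Ψ : D.InfAut ≃ D.Triple, ∀ X, D.IsTripleOf X.1 (Ψ X) := by
  have h : ∀ X : D.InfAut, ∃ T : D.Triple, D.IsTripleOf X.1 T := fun X => by
    obtain ⟨_, I⟩ := X.2.exists_isInfinitesimal
    exact I.exists_isTripleOf
  choose F hF using h
  refine ⟨Equiv.ofBijective F ⟨fun X X' e => Subtype.ext ?_, fun T => ?_⟩, hF⟩
  · exact (hF X).field_unique (e ▸ hF X')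
  · obtain ⟨X, hX, hT⟩ := T.exists_isInfAut
    exact ⟨⟨X, hX⟩, (hF ⟨X, hX⟩).unique hT⟩

end VBAlgebroid

end

theorem mainTheorem1
    {VW : Type*} [NormedAddCommGroup VW] [NormedSpace ℝ VW] [FiniteDimensional ℝ VW]
    {W : Type*} [TopologicalSpace W] [ChartedSpace VW W] [IsManifold 𝓘(ℝ, VW) ∞ W]
    [T2Space W] [SecondCountableTopology W]
    {VE : Type*} [NormedAddCommGroup VE] [NormedSpace ℝ VE] [FiniteDimensional ℝ VE]
    {E : Type*} [TopologicalSpace E] [ChartedSpace VE E] [IsManifold 𝓘(ℝ, VE) ∞ E]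
    [T2Space E] [SecondCountableTopology E]
    {VA : Type*} [NormedAddCommGroup VA] [NormedSpace ℝ VA] [FiniteDimensional ℝ VA]
    {A : Type*} [TopologicalSpace A] [ChartedSpace VA A] [IsManifold 𝓘(ℝ, VA) ∞ A]
    [T2Space A] [SecondCountableTopology A]
    {VM : Type*} [NormedAddCommGroup VM] [NormedSpace ℝ VM] [FiniteDimensional ℝ VM]
    {M : Type*} [TopologicalSpace M] [ChartedSpace VM M] [IsManifold 𝓘(ℝ, VM) ∞ M]
    [T2Space M] [SecondCountableTopology M]
    (D : VBAlgebroid VW W VE E VA A VM M) :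
    ∃ (Φ : D.InfAut ≃ D.IMDer) (Ψ : D.InfAut ≃ D.Triple),
      (∀ X, D.overA.Corresponds X.1 (Φ X).1) ∧ ∀ X, D.IsTripleOf X.1 (Ψ X) := by
  obtain ⟨Φ, hΦ⟩ := D.exists_equiv_IMDer
  obtain ⟨Ψ, hΨ⟩ := D.exists_equiv_triple
  exact ⟨Φ, Ψ, hΦ, hΨ⟩
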